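/- Let $d\in\mathbb N$, $0<\alpha<\min(2,d)$, and let $\Omega\subset\mathbb R^d$ be an open set containing $0$. Put $$\mathcal E(f,g)=\frac{\mathcal A(d,\alpha)}{2}\iint\frac{(f(x)-f(y))(g(x)-g(y))}{|x-y|^{d+\alpha}}\,dx\,dy,\qquad \mathcal A(d,\alpha)=\frac{\alpha\,\Gamma(\frac{d+\alpha}{2})}{2^{1-\alpha}\pi^{d/2}\Gamma(1-\frac{\alpha}{2})},$$ on $W^{\alpha/2,2}(\mathbb R^d)=\{f\in L^2(\mathbb R^d):\mathcal E(f,f)<\infty\}$. Let $\mathcal E_\Omega$ be the restriction of $\mathcal E$ to $W_0^{\alpha/2,2}(\Omega)=\{f\in W^{\alpha/2,2}(\mathbb R^d): f=0 \text{ quasi-everywhere on }\Omega^c\}$, regarded as a form in the real space $L^2(\Omega)$. Let $L_0^\Omega$ be its associated operator and let $p_t^{L_0^\Omega}(x,y)$ be the heat kernel of $e^{-tL_0^\Omega}$, that is, its (jointly measurable, nonnegative, symmetric) integral kernel. Let $$0<c\le c^*:=\frac{2^\alpha\,\Gamma(\frac{d+\alpha}{4})^2}{\Gamma(\frac{d-\alpha}{4})^2},\qquad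 V_c(x)=\frac{c}{|x|^\alpha}.$$ The form $\mathcal E_\Omega-V_c$, i.e. $f\mapsto\mathcal E_\Omega(f,f)-\int_\Omega f^2V_c\,dx$ on $W_0^{\alpha/2,2}(\Omega)$, is closable in $L^2(\Omega)$. Let $L_{V_c}^\Omega$ be the operator associated with its closure, and for $k\in\mathbb N$ let $H_k$ be the operator associated with the form $\mathcal E_\Omega-(V_c\wedge k)$ on $W_0^{\alpha/2,2}(\Omega)$. Each of $-L_0^\Omega$, $-L_{V_c}^\Omega$, $-H_k$ generates a strongly continuous semigroup on $L^2(\Omega)$, and $e^{-tL_0^\Omega}$ has a heat kernel. For $0\le u_0\in L^2(\Omega)$, the minimal nonnegative solution of the heat equation $$-\frac{\partial u}{\partial t}=L_0^\Omega u-V_cu,\qquad u(0)=u_0,$$ is by definition the limit $u=\lim_{k\to\infty}u_k$ of the increasing sequence $u_k(t)=e^{-tH_k}u_0$ (for every $t\ge0$, a.e. in $\Omega$). Then: 1. the sequence $(u_k(t))_k$ is increasing a.e. in $\Omega$ and the minimal nonnegative solution is the semigroup solution: $0\le u(t)=\lim_k u_k(t)=e^{-tL_{V_c}^\Omega}u_0$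 a.e. in $\Omega$, for every $t\ge 0$; 2. $u(t)\in D(L_{V_c}^\Omega)$ for every $t>0$, and $u\in C([0,\infty),L^2(\Omega))\cap C^1((0,\infty),L^2(\Omega))$; 3. $u$ satisfies Duhamel's formula: for every $t>0$ and a.e. $x\in\Omega$, $$u(t,x)=e^{-tL_0^\Omega}u_0(x)+\int_0^t\int_\Omega p_{t-s}^{L_0^\Omega}(x,y)\,u(s,y)\,V_c(y)\,dy\,ds,$$ where the integrals converge. -/

import Mathlib

open MeasureTheory Filter Topology Set

noncomputable section

/-! ## Symmetric forms on a real Hilbert space, their operators and semigroups -/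

section Abstract

variable {H : Type*} [NormedAddCommGroup H] [InnerProductSpace ℝ H]

/-- A form `q(f, g)` on `H`, given by its domain and its values; only the values on
`dom × dom` are meaningful. -/
structure HForm (H : Type*) where
  dom : Set H
  val : H → H → ℝ

/-- `s` is a sequence in `D(q)` that converges to `f` in `H` and is Cauchy for `q`. -/
def HForm.Approximates (q : HForm H) (s : ℕ → H) (f : H) : Prop :=
  (∀ n, s n ∈ q.dom) ∧ Tendsto s atTop (𝓝 f) ∧
    Tendsto (fun m : ℕ × ℕ => q.val (s m.1 - s m.2) (s m.1 - s m.2)) atTop (𝓝 0)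

/-- Closability: `f_n → 0` in `H` and `f_n` Cauchy for `q` imply `q[f_n] → 0`. -/
def HForm.IsClosable (q : HForm H) : Prop :=
  ∀ s : ℕ → H, q.Approximates s 0 → Tendsto (fun n => q.val (s n) (s n)) atTop (𝓝 0)

/-- The closure of a closable form: its domain consists of the limits of approximating
sequences, and its values are the limits of `q(f_n, g_n)` along approximating sequences
(for a closable form the limit exists and does not depend on the sequences).
A closed form is its own closure. -/
def HForm.closure (q : HForm H) : HForm H where
  dom := {f | ∃ s, q.Approximates s f}
  val f g := Classical.epsilon fun a : ℝ =>
    ∃ s r, q.Approximates s f ∧ q.Approximates r g ∧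
      Tendsto (fun n => q.val (s n) (r n)) atTop (𝓝 a)

/-- The graph of the operator `L` associated with `q` (first representation theorem):
`f ∈ D(L)` and `L f = g` iff `f ∈ D(q)` and `q(f, v) = ⟨g, v⟩` for all `v ∈ D(q)`. -/
def HForm.opGraph (q : HForm H) (f g : H) : Prop :=
  f ∈ q.dom ∧ ∀ v ∈ q.dom, q.val f v = inner ℝ g v

/-- The domain of the operator associated with `q`. -/
def HForm.opDom (q : HForm H) : Set H := {f | ∃ g, q.opGraph f g}

/-- `T_t = e^{-tL}`, `t ≥ 0`, for the operator `L` with the given graph: `T` is a strongly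
continuous semigroup of bounded operators whose generator is exactly `-L`. -/
structure IsSemigroupOf (T : ℝ → H →L[ℝ] H) (graph : H → H → Prop) : Prop where
  zero : T 0 = ContinuousLinearMap.id ℝ H
  add : ∀ s t : ℝ, 0 ≤ s → 0 ≤ t → T (s + t) = (T s).comp (T t)
  continuousOn : ∀ f : H, ContinuousOn (fun t => T t f) (Ici 0)
  generator : ∀ f g : H,
    graph f g ↔ Tendsto (fun t : ℝ => t⁻¹ • (f - T t f)) (𝓝[>] 0) (𝓝 g)

/-- The semigroup `e^{-tL}` (`t ≥ 0`) of the operator `L` associated with `q`. A strongly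
continuous semigroup is determined on `[0, ∞)` by its generator, so there is at most one. -/
def HForm.semigroup (q : HForm H) : ℝ → H →L[ℝ] H :=
  Classical.epsilon fun T => IsSemigroupOf T q.opGraph

end Abstract

/-! ## The fractional Sobolev space, capacity, and the Dirichlet form on an open set -/

section Fractional

/-- The space `ℝ^d`. -/
abbrev Rd (d : ℕ) : Type := EuclideanSpace ℝ (Fin d)

/-- The normalizing constant
`𝒜(d, α) = α Γ((d+α)/2) / (2^{1-α} π^{d/2} Γ(1-α/2))`. -/
def fracConst (d : ℕ) (α : ℝ) : ℝ :=
  α * Real.Gamma ((d + α) / 2) /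
    (2 ^ (1 - α) * Real.pi ^ ((d : ℝ) / 2) * Real.Gamma (1 - α / 2))

/-- The critical constant `c^* = 2^α Γ((d+α)/4)² / Γ((d-α)/4)²`. -/
def hardyConst (d : ℕ) (α : ℝ) : ℝ :=
  2 ^ α * Real.Gamma ((d + α) / 4) ^ 2 / Real.Gamma ((d - α) / 4) ^ 2

variable {d : ℕ}

/-- The quadratic form
`ℰ[f] = (𝒜(d, α)/2) ∬ (f(x)-f(y))² / |x-y|^{d+α} dx dy ∈ [0, ∞]`. -/
def fracEnergy (α : ℝ) (f : Rd d → ℝ) : ENNReal :=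
  ENNReal.ofReal (fracConst d α / 2) *
    ∫⁻ z : Rd d × Rd d,
      ENNReal.ofReal ((f z.1 - f z.2) ^ 2 / ‖z.1 - z.2‖ ^ ((d : ℝ) + α))

/-- The bilinear form
`ℰ(f, g) = (𝒜(d, α)/2) ∬ (f(x)-f(y)) (g(x)-g(y)) / |x-y|^{d+α} dx dy`. -/
def fracForm (α : ℝ) (f g : Rd d → ℝ) : ℝ :=
  fracConst d α / 2 *
    ∫ z : Rd d × Rd d,
      (f z.1 - f z.2) * (g z.1 - g z.2) / ‖z.1 - z.2‖ ^ ((d : ℝ) + α)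

/-- `f ∈ W^{α/2,2}(ℝ^d)`. -/
def MemFracSobolev (α : ℝ) (f : Rd d → ℝ) : Prop :=
  MemLp f 2 volume ∧ fracEnergy α f < ⊤

/-- The capacity of `A`: the infimum of `ℰ[f] + ‖f‖²_{L²}` over the `f ∈ W^{α/2,2}(ℝ^d)`
with `f ≥ 1` a.e. on some open neighbourhood of `A`. -/
def fracCapacity (α : ℝ) (A : Set (Rd d)) : ENNReal :=
  ⨅ (f : Rd d → ℝ) (_ : MemFracSobolev α f)
    (_ : ∃ O : Set (Rd d), IsOpen O ∧ A ⊆ O ∧ ∀ᵐ x ∂volume.restrict O, 1 ≤ f x),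
    fracEnergy α f + ∫⁻ x, ENNReal.ofReal (f x ^ 2)

/-- Quasi-continuity: continuous off open sets of arbitrarily small capacity. -/
def QuasiContinuous (α : ℝ) (f : Rd d → ℝ) : Prop :=
  ∀ ε : ENNReal, 0 < ε →
    ∃ G : Set (Rd d), IsOpen G ∧ fracCapacity α G < ε ∧ ContinuousOn f Gᶜ

/-- `f ∈ W_0^{α/2,2}(Ω)`: `f ∈ W^{α/2,2}(ℝ^d)` and `f = 0` quasi-everywhere on `Ωᶜ`, where,
as always for quasi-everywhere statements, `f` is taken in a quasi-continuous version. -/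
def MemFracSobolevZero (α : ℝ) (Ω : Set (Rd d)) (f : Rd d → ℝ) : Prop :=
  MemFracSobolev α f ∧
    ∃ f' : Rd d → ℝ, f' =ᵐ[volume] f ∧ QuasiContinuous α f' ∧
      fracCapacity α {x | x ∉ Ω ∧ f' x ≠ 0} = 0

/-- The real Hilbert space `L²(Ω)`. -/
abbrev L2 (Ω : Set (Rd d)) : Type := Lp ℝ 2 (volume.restrict Ω)

/-- The extension by zero to `ℝ^d` of an element of `L²(Ω)`. -/
def zeroExt (Ω : Set (Rd d)) (f : L2 Ω) : Rd d → ℝ := Ω.indicator f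

/-- The form `ℰ_Ω - W` on `W_0^{α/2,2}(Ω) ⊆ L²(Ω)`:
`(f, g) ↦ ℰ(f, g) - ∫_Ω f g W dx`. -/
def perturbedForm (α : ℝ) (Ω : Set (Rd d)) (W : Rd d → ℝ) : HForm (L2 Ω) where
  dom := {f | MemFracSobolevZero α Ω (zeroExt Ω f)}
  val f g := fracForm α (zeroExt Ω f) (zeroExt Ω g) - ∫ x in Ω, f x * g x * W x

/-- The form `ℰ_Ω`, whose operator is `L_0^Ω`, the Dirichlet fractional Laplacian on `Ω`. -/
def dirichletForm (α : ℝ) (Ω : Set (Rd d)) : HForm (L2 Ω) :=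
  perturbedForm α Ω (fun _ => 0)

/-- The Hardy potential `V_c(x) = c / |x|^α`. -/
def hardyPotential (α c : ℝ) (x : Rd d) : ℝ := c / ‖x‖ ^ α

/-- The form `ℰ_Ω - V_c` on `W_0^{α/2,2}(Ω)`, before taking the closure. -/
def hardyForm (α : ℝ) (Ω : Set (Rd d)) (c : ℝ) : HForm (L2 Ω) :=
  perturbedForm α Ω (hardyPotential α c)

/-- The closed form `ℰ_Ω^{V_c}`, whose operator is `L_{V_c}^Ω`. The closure is
needed only for `c = c^*`: for `0 < c < c^*` the form `ℰ_Ω - V_c` is already closed. -/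
def closedHardyForm (α : ℝ) (Ω : Set (Rd d)) (c : ℝ) : HForm (L2 Ω) :=
  (hardyForm α Ω c).closure

/-- The form `ℰ_Ω - (V_c ∧ k)` on `W_0^{α/2,2}(Ω)`. -/
def truncatedForm (α : ℝ) (Ω : Set (Rd d)) (c : ℝ) (k : ℕ) : HForm (L2 Ω) :=
  perturbedForm α Ω (fun x => min (hardyPotential α c x) k)

/-- The semigroup solution `u_k(t)` of the heat equation with potential `V_c ∧ k`
and initial value `u₀`. -/
def truncatedSolution (α : ℝ) (Ω : Set (Rd d)) (c : ℝ) (u₀ : L2 Ω) (k : ℕ) (t : ℝ) : L2 Ω :=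
  (truncatedForm α Ω c k).semigroup t u₀

/-- `u` is the minimal nonnegative solution of `-∂u/∂t = L_0^Ω u - V_c u`, `u(0) = u₀`:
`u(t) ≥ 0` is the a.e. limit of the increasing sequence `u_k(t)`, for every `t ≥ 0`. -/
def IsMinimalSolution (α : ℝ) (Ω : Set (Rd d)) (c : ℝ) (u₀ : L2 Ω) (u : ℝ → L2 Ω) : Prop :=
  ∀ t : ℝ, 0 ≤ t → ∀ᵐ x ∂volume.restrict Ω,
    0 ≤ u t x ∧ Monotone (fun k => truncatedSolution α Ω c u₀ k t x) ∧
      Tendsto (fun k => truncatedSolution α Ω c u₀ k t x) atTop (𝓝 (u t x))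

/-- `p` is a heat kernel of the semigroup `T` on `L²(Ω)`: a measurable, nonnegative,
symmetric kernel with `T_t f = ∫_Ω p_t(·, y) f(y) dy` a.e., for all `t > 0`, `f ∈ L²(Ω)`. -/
structure IsHeatKernel (Ω : Set (Rd d)) (T : ℝ → L2 Ω →L[ℝ] L2 Ω)
    (p : ℝ → Rd d → Rd d → ℝ) : Prop where
  measurable : Measurable fun z : ℝ × Rd d × Rd d => p z.1 z.2.1 z.2.2
  nonneg : ∀ t : ℝ, 0 < t → ∀ x ∈ Ω, ∀ y ∈ Ω, 0 ≤ p t x y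
  symm : ∀ t : ℝ, 0 < t → ∀ x ∈ Ω, ∀ y ∈ Ω, p t x y = p t y x
  repr : ∀ t : ℝ, 0 < t → ∀ f : L2 Ω, ∀ᵐ x ∂volume.restrict Ω,
    IntegrableOn (fun y => p t x y * f y) Ω ∧ T t f x = ∫ y in Ω, p t x y * f y

/-- Duhamel's formula
`u(t,x) = e^{-tL_0^Ω} u₀(x) + ∫_0^t ∫_Ω p_{t-s}(x,y) u(s,y) V(y) dy ds`
for all `t > 0` and a.e. `x ∈ Ω`, with convergent integrals. -/
def DuhamelFormula (α : ℝ) (Ω : Set (Rd d)) (V : Rd d → ℝ) (p : ℝ → Rd d → Rd d → ℝ)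
    (u₀ : L2 Ω) (u : ℝ → L2 Ω) : Prop :=
  ∀ t : ℝ, 0 < t → ∀ᵐ x ∂volume.restrict Ω,
    (∀ᵐ s ∂volume.restrict (Ioo 0 t),
      IntegrableOn (fun y => p (t - s) x y * u s y * V y) Ω) ∧
    IntervalIntegrable (fun s => ∫ y in Ω, p (t - s) x y * u s y * V y) volume 0 t ∧
    u t x = (dirichletForm α Ω).semigroup t u₀ x +
      ∫ s in (0 : ℝ)..t, ∫ y in Ω, p (t - s) x y * u s y * V y

end Fractional

end

/-! Everything rests on the ground state representation. With `h(x)` proportional to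
`|x|^{-(d-α)/2}`, `fracEnergy_eq_groundEnergy_add` writes `ℰ[f]` as `∫ f² c*/|x|^α` plus a weighted
energy of `f/h`. Hardy's inequality follows at once, and for `c = θ c*` the form `ℰ - V_c` is
`(1-θ)ℰ` plus `θ` times the ground energy. Both summands are lower semicontinuous under a.e.
convergence by Fatou's lemma, so the form is closable even for `θ = 1` (`hardyForm_isClosable`).

The forms with potential `V_c ∧ k` are closed, share one domain and decrease on it to `ℰ_Ω - V_c`.
The resolvent minimises `q[v] + ‖v‖² - 2⟨f, v⟩`, and a comparison of minima gives strong resolvent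
convergence to the resolvent of the closure (`FormSpace.tendsto_resolvent`). A functional calculus
for `B = (1 + L)⁻¹`, a symmetric operator between 0 and 1, carries this over to the semigroups
(`tendsto_expSg_apply`) and also yields their regularity in time.

The semigroups preserve positivity because monotone normal contractions of `u` are good test
functions for the energy. Integrating the `s`-derivative of `⟨e^{-(t-s)L} g, e^{-sL'} f⟩` compares
two potentials (`ofReal_inner_expSg_sub`). Hence `u_k` increases with `k`, and `L²` convergence
becomes a.e. convergence of the whole sequence.

The same identity with zero potential on one side is Duhamel's formula for `V_c ∧ k`, tested against
`g`. Monotone convergence replaces `V_c ∧ k` by `V_c`, and Tonelli's theorem with the heat kernel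
removes `g`. A heat kernel exists because a Nash-type inequality makes `S = e^{-(t/2)L_0}` bounded
from `L²` to `L^∞`; the kernel of `e^{-tL_0} = S S` is then `∑ (S e_n)(x) (S e_n)(y)` for an
orthonormal basis `e_n`. -/

noncomputable section

/-! ### Continuous functional calculus of a symmetric operator between 0 and 1, by polynomial
approximation. -/

section FunctionalCalculus

open Polynomial

variable {H : Type*} [NormedAddCommGroup H] [InnerProductSpace ℝ H]

/-- Symmetric operators `B` on a real Hilbert space with `0 ≤ B ≤ 1`. -/
structure IsPosContraction (B : H →L[ℝ] H) : Prop where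
  symm : ∀ x y, inner ℝ (B x) y = inner ℝ x (B y)
  nonneg : ∀ x, 0 ≤ inner ℝ (B x) x
  le : ∀ x, inner ℝ (B x) x ≤ ‖x‖ ^ 2

/-- In an orthonormal eigenbasis `p(T)` is diagonal with entries `p(λ)`, and the two form bounds put
every eigenvalue `λ` in `[0, 1]`. -/
theorem LinearMap.IsSymmetric.norm_aeval_apply_le {W : Type*} [NormedAddCommGroup W]
    [InnerProductSpace ℝ W] [FiniteDimensional ℝ W] {T : W →ₗ[ℝ] W} (hT : T.IsSymmetric)
    (h0 : ∀ x, 0 ≤ inner ℝ (T x) x) (h1 : ∀ x, inner ℝ (T x) x ≤ ‖x‖ ^ 2) {p : ℝ[X]} {M : ℝ}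
    (hM : ∀ x ∈ Icc (0 : ℝ) 1, |p.eval x| ≤ M) (w : W) :
    ‖aeval T p w‖ ≤ M * ‖w‖ := by
  have hM0 : 0 ≤ M := (abs_nonneg _).trans (hM 0 ⟨le_rfl, zero_le_one⟩)
  set b := hT.eigenvectorBasis rfl
  set ev := hT.eigenvalues rfl
  have hTb : ∀ i, T (b i) = ev i • b i := fun i => hT.apply_eigenvectorBasis rfl i
  have hev : ∀ i, ev i ∈ Icc (0 : ℝ) 1 := by
    intro i
    have e : inner ℝ (T (b i)) (b i) = ev i := by
      rw [hTb, real_inner_smul_left, real_inner_self_eq_norm_sq, b.norm_eq_one]; simp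
    exact ⟨e ▸ h0 (b i), by have := h1 (b i); rw [e, b.norm_eq_one] at this; simpa using this⟩
  have hp : ∀ i, aeval T p (b i) = p.eval (ev i) • b i := by
    intro i
    have : Module.End.HasEigenvector T (ev i) (b i) :=
      ⟨Module.End.mem_eigenspace_iff.2 (hTb i), b.orthonormal.ne_zero i⟩
    exact Module.End.aeval_apply_of_hasEigenvector this
  have hw : aeval T p w = ∑ i, (p.eval (ev i) * inner ℝ (b i) w) • b i := by
    conv_lhs => rw [← b.sum_repr' w]
    rw [map_sum]
    refine Finset.sum_congr rfl fun i _ => ?_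
    rw [map_smul, hp, smul_smul, mul_comm]
  have hsq : ‖aeval T p w‖ ^ 2 ≤ (M * ‖w‖) ^ 2 := by
    have e1 : ∀ i, inner ℝ (b i) (aeval T p w) = p.eval (ev i) * inner ℝ (b i) w := by
      intro i
      rw [hw, b.orthonormal.inner_right_fintype]
    rw [← b.sum_sq_norm_inner_right (aeval T p w), mul_pow, ← b.sum_sq_norm_inner_right w,
      Finset.mul_sum]
    refine Finset.sum_le_sum fun i _ => ?_
    rw [e1, norm_mul, mul_pow]
    refine mul_le_mul_of_nonneg_right ?_ (sq_nonneg _)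
    rw [Real.norm_eq_abs, sq_abs, ← sq_abs]
    exact pow_le_pow_left₀ (abs_nonneg _) (hM _ (hev i)) 2
  exact le_of_sq_le_sq hsq (by positivity)

/-- Reduction to finite dimension. For fixed `v` and `n = deg p`, compress `B` to the span `W` of
`v, Bv, ..., Bⁿv`. The compression `T` is again symmetric between 0 and 1, and `T^i v = B^i v` for
`i ≤ n` because projecting onto `W` does nothing to these vectors. So `p(B) v = p(T) v`. -/
theorem IsPosContraction.norm_aeval_le {B : H →L[ℝ] H} (hB : IsPosContraction B) {p : ℝ[X]}
    {M : ℝ} (hM : ∀ x ∈ Icc (0 : ℝ) 1, |p.eval x| ≤ M) : ‖aeval B p‖ ≤ M := by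
  have hM0 : 0 ≤ M := (abs_nonneg _).trans (hM 0 ⟨le_rfl, zero_le_one⟩)
  refine ContinuousLinearMap.opNorm_le_bound _ hM0 fun v => ?_
  set n := p.natDegree
  set W : Submodule ℝ H := Submodule.span ℝ (range fun i : Fin (n + 1) => (B ^ (i : ℕ)) v)
  have hfd : FiniteDimensional ℝ W := FiniteDimensional.span_of_finite ℝ (finite_range _)
  have hmem : ∀ i ≤ n, (B ^ i) v ∈ W := fun i hi =>
    Submodule.subset_span ⟨⟨i, Nat.lt_succ_of_le hi⟩, rfl⟩
  set T : W →ₗ[ℝ] W := (W.orthogonalProjectionOnto.toLinearMap ∘ₗ B.toLinearMap) ∘ₗ W.subtype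
  have hTi : ∀ x y : W, inner ℝ (T x) y = inner ℝ (B x) (y : H) := by
    intro x y
    simp only [T, LinearMap.comp_apply, ContinuousLinearMap.coe_coe, Submodule.subtype_apply]
    exact Submodule.inner_orthogonalProjectionOnto_eq_of_mem_right y (B x)
  have hTs : T.IsSymmetric := by
    intro x y
    rw [hTi, real_inner_comm (T y) x, hTi, hB.symm, real_inner_comm]
  have hv : v ∈ W := by simpa using hmem 0 (Nat.zero_le _)
  have hpow : ∀ i ≤ n, ((T ^ i) ⟨v, hv⟩ : H) = (B ^ i) v := by
    intro i
    induction i with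
    | zero => intro _; simp
    | succ k ih =>
      intro hk
      rw [pow_succ', pow_succ', Module.End.mul_apply, mul_apply_eq_comp,
        ← ih (by omega)]
      simp only [T, LinearMap.comp_apply, ContinuousLinearMap.coe_coe, Submodule.subtype_apply]
      change ((W.orthogonalProjectionOnto (B ((T ^ k) ⟨v, hv⟩ : W)) : W) : H) = _
      rw [Submodule.coe_orthogonalProjectionOnto_apply, Submodule.starProjection_eq_self_iff.2]
      rw [ih (by omega), ← mul_apply_eq_comp, ← pow_succ']
      exact hmem _ hk
  have hae : (aeval T p ⟨v, hv⟩ : H) = aeval B p v := by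
    rw [aeval_eq_sum_range, aeval_eq_sum_range]
    simp only [LinearMap.sum_apply, LinearMap.smul_apply, sum_apply,
      smul_apply, Submodule.coe_sum, Submodule.coe_smul]
    refine Finset.sum_congr rfl fun i hi => ?_
    rw [hpow i (by simpa [Nat.lt_succ_iff] using hi)]
  have := hTs.norm_aeval_apply_le (fun x => by rw [hTi]; exact hB.nonneg _)
    (fun x => by rw [hTi]; exact hB.le _) hM ⟨v, hv⟩
  rw [← hae]
  exact this

/-- A polynomial within `1 / (n + 1)` of `f` on `[0, 1]`. -/
def approxPoly (f : ℝ → ℝ) (n : ℕ) : ℝ[X] :=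
  Classical.epsilon fun p => ∀ x ∈ Icc (0 : ℝ) 1, |p.eval x - f x| < 1 / ((n : ℝ) + 1)

theorem approxPoly_spec {f : ℝ → ℝ} (hf : ContinuousOn f (Icc 0 1)) (n : ℕ) :
    ∀ x ∈ Icc (0 : ℝ) 1, |(approxPoly f n).eval x - f x| < 1 / ((n : ℝ) + 1) :=
  Classical.epsilon_spec
    (p := fun p : ℝ[X] => ∀ x ∈ Icc (0 : ℝ) 1, |p.eval x - f x| < 1 / ((n : ℝ) + 1))
    (exists_polynomial_near_of_continuousOn 0 1 f hf _ (by positivity))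

/-- The functional calculus `f(B)` for `f` continuous on `[0, 1]` and `0 ≤ B ≤ 1`. -/
def fc (B : H →L[ℝ] H) (f : ℝ → ℝ) : H →L[ℝ] H :=
  limUnder atTop fun n => aeval B (approxPoly f n)

variable [CompleteSpace H] {B : H →L[ℝ] H} {f g : ℝ → ℝ}

theorem IsPosContraction.tendsto_fc (hB : IsPosContraction B) (hf : ContinuousOn f (Icc 0 1)) :
    Tendsto (fun n => aeval B (approxPoly f n)) atTop (𝓝 (fc B f)) := by
  refine CauchySeq.tendsto_limUnder ?_
  refine cauchySeq_of_le_tendsto_0 (fun n : ℕ => 2 * (1 / ((n : ℝ) + 1))) (fun m n N hm hn => ?_) ?_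
  · rw [dist_eq_norm, ← map_sub]
    refine hB.norm_aeval_le fun x hx => ?_
    have h1 := approxPoly_spec hf m x hx
    have h2 := approxPoly_spec hf n x hx
    have hm' : 1 / ((m : ℝ) + 1) ≤ 1 / ((N : ℝ) + 1) := by gcongr
    have hn' : 1 / ((n : ℝ) + 1) ≤ 1 / ((N : ℝ) + 1) := by gcongr
    rw [eval_sub]
    rw [abs_lt] at h1 h2
    rw [abs_le]
    constructor <;> linarith [h1.1, h1.2, h2.1, h2.2]
  · simpa using (tendsto_one_div_add_atTop_nhds_zero_nat (𝕜 := ℝ)).const_mul 2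

theorem IsPosContraction.norm_aeval_sub_fc_le (hB : IsPosContraction B)
    (hf : ContinuousOn f (Icc 0 1)) {p : ℝ[X]} {ε : ℝ}
    (hp : ∀ x ∈ Icc (0 : ℝ) 1, |p.eval x - f x| ≤ ε) : ‖aeval B p - fc B f‖ ≤ ε := by
  have h1 : Tendsto (fun n => ‖aeval B p - aeval B (approxPoly f n)‖) atTop
      (𝓝 ‖aeval B p - fc B f‖) := (tendsto_const_nhds.sub (hB.tendsto_fc hf)).norm
  have h2 : Tendsto (fun n : ℕ => ε + 1 / ((n : ℝ) + 1)) atTop (𝓝 (ε + 0)) :=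
    tendsto_const_nhds.add tendsto_one_div_add_atTop_nhds_zero_nat
  rw [add_zero] at h2
  refine le_of_tendsto_of_tendsto' h1 h2 fun n => ?_
  rw [← map_sub]
  refine hB.norm_aeval_le fun x hx => ?_
  have h1 := approxPoly_spec hf n x hx
  have h2 := hp x hx
  rw [eval_sub]
  rw [abs_lt] at h1
  rw [abs_le] at h2 ⊢
  constructor <;> linarith [h1.1, h1.2, h2.1, h2.2]

theorem IsPosContraction.exists_aeval_near (hB : IsPosContraction B)
    (hf : ContinuousOn f (Icc 0 1)) {ε : ℝ} (hε : 0 < ε) :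
    ∃ p : ℝ[X], (∀ x ∈ Icc (0 : ℝ) 1, |p.eval x - f x| ≤ ε) ∧ ‖aeval B p - fc B f‖ ≤ ε := by
  obtain ⟨p, hp⟩ := exists_polynomial_near_of_continuousOn 0 1 f hf ε hε
  exact ⟨p, fun x hx => (hp x hx).le, hB.norm_aeval_sub_fc_le hf fun x hx => (hp x hx).le⟩

theorem IsPosContraction.fc_eq_aeval (hB : IsPosContraction B) {p : ℝ[X]}
    (h : ∀ x ∈ Icc (0 : ℝ) 1, f x = p.eval x) : fc B f = aeval B p := by
  have hf : ContinuousOn f (Icc 0 1) := p.continuous.continuousOn.congr h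
  have := hB.norm_aeval_sub_fc_le hf (p := p) (ε := 0) fun x hx => by simp [h x hx]
  exact (sub_eq_zero.1 (norm_le_zero_iff.1 this)).symm

theorem IsPosContraction.norm_fc_le (hB : IsPosContraction B) (hf : ContinuousOn f (Icc 0 1))
    {M : ℝ} (hM : ∀ x ∈ Icc (0 : ℝ) 1, |f x| ≤ M) : ‖fc B f‖ ≤ M := by
  have : ‖aeval B (0 : ℝ[X]) - fc B f‖ ≤ M :=
    hB.norm_aeval_sub_fc_le hf fun x hx => by simpa using hM x hx
  simpa using this

theorem IsPosContraction.fc_add (hB : IsPosContraction B) (hf : ContinuousOn f (Icc 0 1))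
    (hg : ContinuousOn g (Icc 0 1)) : fc B (fun x => f x + g x) = fc B f + fc B g := by
  refine eq_of_forall_dist_le fun ε hε => ?_
  obtain ⟨p, hp, hp'⟩ := hB.exists_aeval_near hf (ε := ε / 4) (by positivity)
  obtain ⟨q, hq, hq'⟩ := hB.exists_aeval_near hg (ε := ε / 4) (by positivity)
  have h := hB.norm_aeval_sub_fc_le (hf.add hg) (p := p + q) (ε := ε / 2) fun x hx => by
    have h1 := hp x hx
    have h2 := hq x hx
    rw [eval_add]
    rw [abs_le] at *
    simp only [Pi.add_apply]
    constructor <;> linarith [h1.1, h1.2, h2.1, h2.2]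
  rw [dist_eq_norm]
  have e : fc B (fun x => f x + g x) - (fc B f + fc B g) =
      -(aeval B (p + q) - fc B (f + g)) + (aeval B p - fc B f) + (aeval B q - fc B g) := by
    rw [map_add]; change fc B (f + g) - _ = _; abel
  rw [e]
  calc _ ≤ ‖-(aeval B (p + q) - fc B (f + g))‖ + ‖aeval B p - fc B f‖ + ‖aeval B q - fc B g‖ :=
        norm_add₃_le
    _ ≤ ε / 2 + ε / 4 + ε / 4 := by rw [norm_neg]; gcongr
    _ = ε := by ring

theorem IsPosContraction.fc_const_mul (hB : IsPosContraction B) (hf : ContinuousOn f (Icc 0 1))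
    (r : ℝ) : fc B (fun x => r * f x) = r • fc B f := by
  have h := (hB.tendsto_fc hf).const_smul r
  refine tendsto_nhds_unique (tendsto_iff_norm_sub_tendsto_zero.2 ?_) h
  refine squeeze_zero (fun _ => norm_nonneg _) (g := fun n : ℕ => |r| * (1 / ((n : ℝ) + 1)))
    (fun n => ?_) ?_
  · rw [← map_smul]
    refine hB.norm_aeval_sub_fc_le (continuousOn_const.mul hf) fun x hx => ?_
    rw [eval_smul, smul_eq_mul]
    change |r * _ - r * f x| ≤ _
    rw [← mul_sub, abs_mul]
    gcongr
    exact (approxPoly_spec hf n x hx).le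
  · simpa using (tendsto_one_div_add_atTop_nhds_zero_nat (𝕜 := ℝ)).const_mul |r|

theorem IsPosContraction.fc_sub (hB : IsPosContraction B) (hf : ContinuousOn f (Icc 0 1))
    (hg : ContinuousOn g (Icc 0 1)) : fc B (fun x => f x - g x) = fc B f - fc B g := by
  have hg' : ContinuousOn (fun x => (-1) * g x) (Icc 0 1) := continuousOn_const.mul hg
  have h := hB.fc_add hf hg'
  rw [hB.fc_const_mul hg] at h
  simpa [sub_eq_add_neg] using h

theorem IsPosContraction.fc_mul (hB : IsPosContraction B) (hf : ContinuousOn f (Icc 0 1))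
    (hg : ContinuousOn g (Icc 0 1)) : fc B (fun x => f x * g x) = fc B f * fc B g := by
  obtain ⟨K, hK⟩ := isCompact_Icc.exists_bound_of_continuousOn hf
  obtain ⟨L, hL⟩ := isCompact_Icc.exists_bound_of_continuousOn hg
  simp only [Real.norm_eq_abs] at hK hL
  have hK0 : 0 ≤ K := (abs_nonneg _).trans (hK 0 ⟨le_rfl, zero_le_one⟩)
  have hL0 : 0 ≤ L := (abs_nonneg _).trans (hL 0 ⟨le_rfl, zero_le_one⟩)
  have h := (hB.tendsto_fc hf).mul (hB.tendsto_fc hg)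
  refine tendsto_nhds_unique (tendsto_iff_norm_sub_tendsto_zero.2 ?_) h
  refine squeeze_zero (fun _ => norm_nonneg _)
    (g := fun n : ℕ => (L + 1 + K) * (1 / ((n : ℝ) + 1))) (fun n => ?_) ?_
  · rw [← map_mul]
    refine hB.norm_aeval_sub_fc_le (hf.mul hg) fun x hx => ?_
    have h1 := (approxPoly_spec hf n x hx).le
    have h2 := (approxPoly_spec hg n x hx).le
    have h3 := hK x hx
    have h4 := hL x hx
    have h5 : 1 / ((n : ℝ) + 1) ≤ 1 := by
      rw [div_le_one (by positivity)]; linarith [n.cast_nonneg (α := ℝ)]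
    rw [eval_mul]
    set a := (approxPoly f n).eval x
    set b := (approxPoly g n).eval x
    have hb : |b| ≤ L + 1 := by
      rw [abs_le] at h2 h4 ⊢
      constructor <;> linarith [h2.1, h2.2, h4.1, h4.2]
    calc |a * b - f x * g x| = |(a - f x) * b + f x * (b - g x)| := by ring_nf
      _ ≤ |a - f x| * |b| + |f x| * |b - g x| := by
        rw [← abs_mul, ← abs_mul]; exact abs_add_le _ _
      _ ≤ 1 / ((n : ℝ) + 1) * (L + 1) + K * (1 / ((n : ℝ) + 1)) := by gcongr
      _ = _ := by ring
  · simpa using (tendsto_one_div_add_atTop_nhds_zero_nat (𝕜 := ℝ)).const_mul (L + 1 + K)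

theorem IsPosContraction.fc_id (hB : IsPosContraction B) : fc B (fun x => x) = B := by
  rw [hB.fc_eq_aeval (p := X) (fun x _ => by simp), aeval_X]

-- The predicate from which `approxPoly` chooses sees `f` only on `[0, 1]`, so equal restrictions
-- give literally the same polynomials and no continuity is needed.
omit [CompleteSpace H] in
theorem fc_congr (h : ∀ x ∈ Icc (0 : ℝ) 1, f x = g x) : fc B f = fc B g := by
  have : approxPoly f = approxPoly g := by
    funext n
    unfold approxPoly
    congr 1
    funext p
    exact propext (forall₂_congr fun x hx => by rw [h x hx])
  rw [fc, fc, this]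

omit [CompleteSpace H] in
theorem IsPosContraction.inner_aeval (hB : IsPosContraction B) (p : ℝ[X]) (x y : H) :
    inner ℝ (aeval B p x) y = inner ℝ x (aeval B p y) := by
  have hpow : ∀ n : ℕ, ∀ x y, inner ℝ ((B ^ n) x) y = inner ℝ x ((B ^ n) y) := by
    intro n
    induction n with
    | zero => simp
    | succ k ih =>
      intro x y
      rw [pow_succ, mul_apply_eq_comp, ih, hB.symm, ← mul_apply_eq_comp,
        ← pow_succ', pow_succ]
  simp only [aeval_eq_sum_range, sum_apply, smul_apply,
    sum_inner, inner_sum, real_inner_smul_left, real_inner_smul_right, hpow]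

theorem IsPosContraction.inner_fc (hB : IsPosContraction B) (hf : ContinuousOn f (Icc 0 1))
    (x y : H) : inner ℝ (fc B f x) y = inner ℝ x (fc B f y) := by
  have h := hB.tendsto_fc hf
  have hx : ∀ z : H, Tendsto (fun n => aeval B (approxPoly f n) z) atTop (𝓝 (fc B f z)) := fun z =>
    ((ContinuousLinearMap.apply ℝ H z).continuous.tendsto _).comp h
  refine tendsto_nhds_unique ((hx x).inner tendsto_const_nhds) ?_
  simp only [hB.inner_aeval]
  exact tendsto_const_nhds.inner (hx y)

/-- Strong convergence of `B n` to `B` implies strong convergence of `f(B n)` to `f(B)`. -/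
theorem tendsto_fc_apply {ι : Type*} {l : Filter ι} {Bn : ι → H →L[ℝ] H}
    (hBn : ∀ n, IsPosContraction (Bn n)) (hB : IsPosContraction B)
    (hlim : ∀ v, Tendsto (fun n => Bn n v) l (𝓝 (B v))) (hf : ContinuousOn f (Icc 0 1)) (v : H) :
    Tendsto (fun n => fc (Bn n) f v) l (𝓝 (fc B f v)) := by
  have hnorm : ∀ n, ‖Bn n‖ ≤ 1 := by
    intro n
    have := (hBn n).norm_aeval_le (p := X) (M := 1) fun x hx => by
      rw [eval_X, abs_le]; constructor <;> linarith [hx.1, hx.2]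
    simpa using this
  have hpow : ∀ k : ℕ, ∀ v, Tendsto (fun n => (Bn n ^ k) v) l (𝓝 ((B ^ k) v)) := by
    intro k
    induction k with
    | zero => intro v; simpa using tendsto_const_nhds
    | succ k ih =>
      intro v
      simp only [pow_succ', mul_apply_eq_comp]
      have h1 := hlim ((B ^ k) v)
      have h2 : Tendsto (fun n => Bn n ((Bn n ^ k) v - (B ^ k) v)) l (𝓝 0) := by
        refine squeeze_zero_norm (fun n => ?_)
          (tendsto_iff_norm_sub_tendsto_zero.1 (ih v))
        exact ((Bn n).le_opNorm _).trans (mul_le_of_le_one_left (norm_nonneg _) (hnorm n))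
      simpa using h2.add h1
  have hpoly : ∀ p : ℝ[X], Tendsto (fun n => aeval (Bn n) p v) l (𝓝 (aeval B p v)) := by
    intro p
    simp only [aeval_eq_sum_range, sum_apply, smul_apply]
    exact tendsto_finsetSum _ fun i _ => (hpow i v).const_smul _
  rw [Metric.tendsto_nhds]
  intro ε hε
  obtain ⟨δ, hδ, hδ'⟩ : ∃ δ > 0, δ * ‖v‖ ≤ ε / 4 := by
    refine ⟨ε / (4 * (‖v‖ + 1)), by positivity, ?_⟩
    rw [div_mul_eq_mul_div, div_le_iff₀ (by positivity)]
    nlinarith [norm_nonneg v]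
  -- One polynomial serves `B` and all the `Bn n` at once: its error bound depends only on its
  -- values on `[0, 1]`.
  obtain ⟨p, hp⟩ := exists_polynomial_near_of_continuousOn 0 1 f hf δ hδ
  have hp' : ∀ x ∈ Icc (0 : ℝ) 1, |p.eval x - f x| ≤ δ := fun x hx => (hp x hx).le
  filter_upwards [(Metric.tendsto_nhds.1 (hpoly p)) (ε / 2) (by positivity)] with n hn
  have h1 : ‖(aeval (Bn n) p - fc (Bn n) f) v‖ ≤ ε / 4 :=
    (ContinuousLinearMap.le_of_opNorm_le _ ((hBn n).norm_aeval_sub_fc_le hf hp') v).trans hδ'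
  have h2 : ‖(aeval B p - fc B f) v‖ ≤ ε / 4 :=
    (ContinuousLinearMap.le_of_opNorm_le _ (hB.norm_aeval_sub_fc_le hf hp') v).trans hδ'
  rw [dist_eq_norm] at hn ⊢
  have e : fc (Bn n) f v - fc B f v = -((aeval (Bn n) p - fc (Bn n) f) v) +
      (aeval (Bn n) p v - aeval B p v) + (aeval B p - fc B f) v := by
    simp only [sub_apply]; abel
  rw [e]
  calc _ ≤ ‖-((aeval (Bn n) p - fc (Bn n) f) v)‖ + ‖aeval (Bn n) p v - aeval B p v‖
        + ‖(aeval B p - fc B f) v‖ := norm_add₃_le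
    _ < ε / 4 + ε / 2 + ε / 4 := by rw [norm_neg]; linarith
    _ = ε := by ring

end FunctionalCalculus

end

noncomputable section

/-! ### Functions of an unbounded operator `L ≥ 0` through its resolvent `B = (1 + L)⁻¹`. -/

section SpectralFunctions

variable {H : Type*} [NormedAddCommGroup H] [InnerProductSpace ℝ H]

/-- Pointwise convergence of a bounded family of operators follows from convergence on a
dense set. -/
theorem tendsto_apply_of_dense {ι : Type*} {l : Filter ι} {F : ι → H →L[ℝ] H} {G : H →L[ℝ] H}
    {S : Set H} (hS : Dense S) {C : ℝ} (hF : ∀ᶠ i in l, ‖F i‖ ≤ C)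
    (h : ∀ x ∈ S, Tendsto (fun i => F i x) l (𝓝 (G x))) (x : H) :
    Tendsto (fun i => F i x) l (𝓝 (G x)) := by
  rw [Metric.tendsto_nhds]
  intro ε hε
  set K := max C ‖G‖
  have hGK : ‖G‖ ≤ K := le_max_right _ _
  have hK0 : 0 ≤ K := (norm_nonneg G).trans hGK
  obtain ⟨y, hy, hyS⟩ := Metric.dense_iff.1 hS x (ε / (4 * (K + 1))) (by positivity)
  rw [Metric.mem_ball, dist_eq_norm] at hy
  have hKy : K * ‖y - x‖ ≤ ε / 4 := by
    have : K * ‖y - x‖ ≤ (K + 1) * (ε / (4 * (K + 1))) := by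
      gcongr
      linarith
    refine this.trans (le_of_eq ?_)
    field_simp
  filter_upwards [hF, (Metric.tendsto_nhds.1 (h y hyS)) (ε / 2) (by positivity)] with i hi hyi
  rw [dist_eq_norm] at hyi ⊢
  have e : F i x - G x = -(F i (y - x)) + (F i y - G y) + G (y - x) := by
    simp only [map_sub]; abel
  have h1 : ‖F i (y - x)‖ ≤ K * ‖y - x‖ :=
    ContinuousLinearMap.le_of_opNorm_le _ (hi.trans (le_max_left _ _)) _
  have h2 : ‖G (y - x)‖ ≤ K * ‖y - x‖ := ContinuousLinearMap.le_of_opNorm_le _ hGK _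
  rw [e]
  calc _ ≤ ‖-(F i (y - x))‖ + ‖F i y - G y‖ + ‖G (y - x)‖ := norm_add₃_le
    _ < ε / 4 + ε / 2 + ε / 4 := by rw [norm_neg]; linarith
    _ = ε := by ring

/-- Continuous functions on `[0, ∞)` that vanish at infinity. -/
structure IsC0 (G : ℝ → ℝ) : Prop where
  cont : ContinuousOn G (Ici 0)
  lim : Tendsto G atTop (𝓝 0)

/-- `G(1/x - 1)`, as a function of `x ∈ (0, 1]`. -/
def pullInv (G : ℝ → ℝ) (x : ℝ) : ℝ := if x ≤ 0 then 0 else G (x⁻¹ - 1)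

/-- The map `l ↦ 1/(1+l)` carries `[0, ∞)` onto `(0, 1]`, and vanishing at infinity becomes
continuity at the added endpoint 0. -/
theorem IsC0.continuousOn_pullInv {G : ℝ → ℝ} (hG : IsC0 G) :
    ContinuousOn (pullInv G) (Icc 0 1) := by
  intro x hx
  rcases hx.1.eq_or_lt with rfl | hx0
  · have h1 : Tendsto (fun x : ℝ => G (x⁻¹ - 1)) (𝓝[>] 0) (𝓝 0) :=
      hG.lim.comp (tendsto_atTop_add_const_right _ (-1) tendsto_inv_nhdsGT_zero)
    have h2 : Tendsto (pullInv G) (𝓝[>] 0) (𝓝 0) := by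
      refine h1.congr' ?_
      filter_upwards [self_mem_nhdsWithin] with x hx
      rw [pullInv, if_neg (not_le.2 hx)]
    have h0 : pullInv G 0 = 0 := by simp [pullInv]
    have h3 : ContinuousWithinAt (pullInv G) (Ioi 0) 0 := by
      rw [ContinuousWithinAt, h0]; exact h2
    exact (continuousWithinAt_Ioi_iff_Ici.1 h3).mono fun y hy => hy.1
  · have h1 : ContinuousWithinAt (fun x : ℝ => G (x⁻¹ - 1)) (Icc 0 1 ∩ Ioi 0) x := by
      refine ContinuousWithinAt.comp (t := Ici 0) (g := G) (f := fun x : ℝ => x⁻¹ - 1)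
        (hG.cont _ ?_) ?_ ?_
      · exact sub_nonneg.2 ((one_le_inv₀ hx0).2 hx.2)
      · exact ((continuousAt_inv₀ hx0.ne').sub continuousAt_const).continuousWithinAt
      · exact fun y hy => sub_nonneg.2 ((one_le_inv₀ hy.2).2 hy.1.2)
    have h2 : ContinuousWithinAt (pullInv G) (Icc 0 1 ∩ Ioi 0) x :=
      h1.congr (fun y hy => if_neg (not_le.2 hy.2)) (if_neg (not_le.2 hx0))
    exact h2.mono_of_mem_nhdsWithin (inter_mem self_mem_nhdsWithin
      (mem_nhdsWithin_of_mem_nhds (Ioi_mem_nhds hx0)))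

/-- The bounded operator `G(L)`, where `B = (1 + L)⁻¹`. -/
def opFun (B : H →L[ℝ] H) (G : ℝ → ℝ) : H →L[ℝ] H := fc B (pullInv G)

theorem isC0_inv : IsC0 fun l => (1 + l)⁻¹ where
  cont := by
    refine ContinuousOn.inv₀ (by fun_prop) fun l hl => ?_
    have : (0 : ℝ) ≤ l := hl
    positivity
  lim := tendsto_inv_atTop_zero.comp (tendsto_atTop_add_const_left _ _ tendsto_id)

theorem isC0_resolvent {ε : ℝ} (hε : 0 < ε) : IsC0 fun l => (1 + ε * l)⁻¹ where
  cont := by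
    refine ContinuousOn.inv₀ (by fun_prop) fun l hl => ?_
    have : (0 : ℝ) ≤ l := hl
    positivity
  lim := tendsto_inv_atTop_zero.comp
    (tendsto_atTop_add_const_left _ _ (tendsto_id.const_mul_atTop hε))

theorem isC0_exp {t : ℝ} (ht : 0 < t) : IsC0 fun l => Real.exp (-(t * l)) where
  cont := by fun_prop
  lim := Real.tendsto_exp_atBot.comp (tendsto_neg_atTop_atBot.comp (tendsto_id.const_mul_atTop ht))

theorem isC0_mul_exp {t : ℝ} (ht : 0 < t) : IsC0 fun l => l * Real.exp (-(t * l)) where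
  cont := by fun_prop
  lim := by
    have := (Real.tendsto_pow_mul_exp_neg_atTop_nhds_zero 1).comp (tendsto_id.const_mul_atTop ht)
    have h2 := this.const_mul t⁻¹
    rw [mul_zero] at h2
    refine h2.congr fun l => ?_
    simp only [Function.comp, id, pow_one]
    field_simp

theorem IsC0.bounded {G : ℝ → ℝ} (hG : IsC0 G) : ∃ M, ∀ l, 0 ≤ l → |G l| ≤ M := by
  obtain ⟨N, hN⟩ := (Metric.tendsto_atTop.1 hG.lim) 1 one_pos
  obtain ⟨M, hM⟩ := isCompact_Icc.exists_bound_of_continuousOn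
    (hG.cont.mono (fun x hx => hx.1 : Icc 0 N ⊆ Ici 0))
  refine ⟨max M 1, fun l hl => ?_⟩
  rcases le_total l N with h | h
  · exact (hM l ⟨hl, h⟩).trans (le_max_left _ _)
  · have := hN l h
    rw [dist_zero_right] at this
    exact this.le.trans (le_max_right _ _)

theorem IsC0.of_bounded_mul {F G : ℝ → ℝ} (hG : IsC0 G) (hF : ContinuousOn F (Ici 0)) {M : ℝ}
    (hM : ∀ l, 0 ≤ l → |F l| ≤ M) : IsC0 fun l => F l * G l where
  cont := hF.mul hG.cont
  lim := by
    refine squeeze_zero_norm' (a := fun l => M * |G l|) ?_ ?_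
    · filter_upwards [eventually_ge_atTop 0] with l hl
      rw [norm_mul]
      exact mul_le_mul_of_nonneg_right (hM l hl) (abs_nonneg _)
    · simpa using hG.lim.abs.const_mul M

theorem IsC0.mul {F G : ℝ → ℝ} (hF : IsC0 F) (hG : IsC0 G) : IsC0 fun l => F l * G l := by
  obtain ⟨M, hM⟩ := hF.bounded
  exact hG.of_bounded_mul hF.cont hM

theorem IsC0.sub {F G : ℝ → ℝ} (hF : IsC0 F) (hG : IsC0 G) : IsC0 fun l => F l - G l :=
  ⟨hF.cont.sub hG.cont, by simpa using hF.lim.sub hG.lim⟩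

theorem IsC0.const_mul {F : ℝ → ℝ} (hF : IsC0 F) (r : ℝ) : IsC0 fun l => r * F l :=
  ⟨continuousOn_const.mul hF.cont, by simpa using hF.lim.const_mul r⟩

theorem isC0_pow {F : ℝ → ℝ} (hF : IsC0 F) (n : ℕ) : IsC0 fun l => F l ^ (n + 1) := by
  induction n with
  | zero => simpa using hF
  | succ k ih => simpa only [pow_succ _ (k + 1)] using ih.mul hF

theorem isC0_exp_mul_inv {t : ℝ} (ht : 0 ≤ t) : IsC0 fun l => Real.exp (-(t * l)) * (1 + l)⁻¹ :=
  isC0_inv.of_bounded_mul (M := 1) (by fun_prop) fun l hl => by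
    rw [abs_of_pos (Real.exp_pos _), Real.exp_le_one_iff]
    nlinarith [mul_nonneg ht hl]

section

variable [CompleteSpace H] {B : H →L[ℝ] H} {F G : ℝ → ℝ}

theorem IsPosContraction.opFun_norm_le (hB : IsPosContraction B) (hG : IsC0 G) {M : ℝ}
    (hM : ∀ l, 0 ≤ l → |G l| ≤ M) : ‖opFun B G‖ ≤ M := by
  have hM0 : 0 ≤ M := (abs_nonneg _).trans (hM 0 le_rfl)
  refine hB.norm_fc_le hG.continuousOn_pullInv fun x hx => ?_
  rw [pullInv]
  split_ifs with h
  · simpa using hM0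
  · exact hM _ (sub_nonneg.2 ((one_le_inv₀ (not_le.1 h)).2 hx.2))

omit [CompleteSpace H] in
theorem opFun_congr (h : ∀ l, 0 ≤ l → F l = G l) : opFun B F = opFun B G := by
  refine fc_congr fun x hx => ?_
  rw [pullInv, pullInv]
  split_ifs with h0
  · rfl
  · exact h _ (sub_nonneg.2 ((one_le_inv₀ (not_le.1 h0)).2 hx.2))

theorem IsPosContraction.opFun_mul (hB : IsPosContraction B) (hF : IsC0 F) (hG : IsC0 G) :
    opFun B (fun l => F l * G l) = opFun B F * opFun B G := by
  rw [opFun, opFun, opFun, ← hB.fc_mul hF.continuousOn_pullInv hG.continuousOn_pullInv]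
  refine fc_congr fun x _ => ?_
  simp only [pullInv]
  split_ifs <;> simp

theorem IsPosContraction.opFun_sub (hB : IsPosContraction B) (hF : IsC0 F) (hG : IsC0 G) :
    opFun B (fun l => F l - G l) = opFun B F - opFun B G := by
  rw [opFun, opFun, opFun, ← hB.fc_sub hF.continuousOn_pullInv hG.continuousOn_pullInv]
  refine fc_congr fun x _ => ?_
  simp only [pullInv]
  split_ifs <;> simp

theorem IsPosContraction.opFun_const_mul (hB : IsPosContraction B) (hF : IsC0 F) (r : ℝ) :
    opFun B (fun l => r * F l) = r • opFun B F := by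
  rw [opFun, opFun, ← hB.fc_const_mul hF.continuousOn_pullInv]
  refine fc_congr fun x _ => ?_
  simp only [pullInv]
  split_ifs <;> simp

theorem IsPosContraction.opFun_inv (hB : IsPosContraction B) :
    opFun B (fun l => (1 + l)⁻¹) = B := by
  conv_rhs => rw [← hB.fc_id]
  refine fc_congr fun x hx => ?_
  rw [pullInv]
  split_ifs with h
  · exact le_antisymm hx.1 h
  · simp

theorem IsPosContraction.opFun_pow (hB : IsPosContraction B) (hF : IsC0 F) (n : ℕ) :
    opFun B (fun l => F l ^ (n + 1)) = opFun B F ^ (n + 1) := by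
  induction n with
  | zero => simp
  | succ k ih =>
    simp only [pow_succ _ (k + 1)]
    rw [hB.opFun_mul (isC0_pow hF k) hF, ih]

theorem IsPosContraction.inner_opFun (hB : IsPosContraction B) (hF : IsC0 F) (x y : H) :
    inner ℝ (opFun B F x) y = inner ℝ x (opFun B F y) :=
  hB.inner_fc hF.continuousOn_pullInv x y

end

/-! ### Scalar estimates -/

theorem abs_exp_neg_sub_le {s t l : ℝ} (hs : 0 ≤ s) (ht : 0 ≤ t) (hl : 0 ≤ l) :
    |Real.exp (-(s * l)) - Real.exp (-(t * l))| ≤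
      |s - t| * (l * Real.exp (-(min s t * l))) := by
  wlog h : s ≤ t generalizing s t
  · rw [abs_sub_comm, abs_sub_comm s, min_comm]
    exact this ht hs (le_of_not_ge h)
  have e : Real.exp (-(t * l)) = Real.exp (-(s * l)) * Real.exp (-((t - s) * l)) := by
    rw [← Real.exp_add]; ring_nf
  have h1 : 1 - Real.exp (-((t - s) * l)) ≤ (t - s) * l := by
    linarith [Real.add_one_le_exp (-((t - s) * l))]
  have h2 : Real.exp (-((t - s) * l)) ≤ 1 := by
    rw [Real.exp_le_one_iff]; nlinarith [mul_nonneg (sub_nonneg.2 h) hl]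
  rw [min_eq_left h, abs_sub_comm s t, abs_of_nonneg (sub_nonneg.2 h), e,
    show Real.exp (-(s * l)) - Real.exp (-(s * l)) * Real.exp (-((t - s) * l)) =
      Real.exp (-(s * l)) * (1 - Real.exp (-((t - s) * l))) by ring,
    abs_of_nonneg (mul_nonneg (Real.exp_pos _).le (by linarith))]
  nlinarith [Real.exp_pos (-(s * l))]

theorem mul_exp_neg_le {t l : ℝ} (ht : 0 < t) : l * Real.exp (-(t * l)) ≤ 1 / t := by
  have h1 : t * l ≤ Real.exp (t * l) := by linarith [Real.add_one_le_exp (t * l)]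
  rw [le_div_iff₀ ht, Real.exp_neg, mul_right_comm, ← div_eq_mul_inv,
    div_le_one (Real.exp_pos _), mul_comm l t]
  exact h1

theorem sq_mul_exp_neg_le {t l : ℝ} (ht : 0 < t) (hl : 0 ≤ l) :
    l ^ 2 * Real.exp (-(t * l)) ≤ 4 / t ^ 2 := by
  have h := mul_exp_neg_le (l := l) (half_pos ht)
  have e : l ^ 2 * Real.exp (-(t * l)) = (l * Real.exp (-(t / 2 * l))) ^ 2 := by
    rw [mul_pow, ← Real.exp_nat_mul]; congr 2; push_cast; ring
  rw [e]
  calc _ ≤ (1 / (t / 2)) ^ 2 := pow_le_pow_left₀ (by positivity) h 2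
    _ = 4 / t ^ 2 := by field_simp; norm_num

/-- The first-order Taylor estimate for `e^{-y}` on `[0, ∞)`. -/
theorem abs_exp_neg_taylor {a b : ℝ} (ha : 0 ≤ a) (hb : 0 ≤ b) :
    |Real.exp (-b) - Real.exp (-a) + (b - a) * Real.exp (-a)| ≤ (b - a) ^ 2 := by
  have e : Real.exp (-b) - Real.exp (-a) + (b - a) * Real.exp (-a) =
      Real.exp (-a) * (Real.exp (-(b - a)) - 1 + (b - a)) := by
    have : Real.exp (-b) = Real.exp (-a) * Real.exp (-(b - a)) := by
      rw [← Real.exp_add]; ring_nf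
    rw [this]; ring
  have h0 : 0 ≤ Real.exp (-(b - a)) - 1 + (b - a) := by
    linarith [Real.add_one_le_exp (-(b - a))]
  have hea : Real.exp (-a) ≤ 1 := by rw [Real.exp_le_one_iff]; linarith
  have hea0 := Real.exp_pos (-a)
  rw [e, abs_of_nonneg (mul_nonneg hea0.le h0)]
  rcases le_total a b with h | h
  · have h1 : Real.exp (-(b - a)) ≤ 1 - (b - a) + (b - a) ^ 2 := by
      have h2 : 1 + (b - a) ≤ Real.exp (b - a) := by linarith [Real.add_one_le_exp (b - a)]
      rw [Real.exp_neg, inv_le_comm₀ (Real.exp_pos _)]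
      · refine le_trans ?_ h2
        rw [inv_le_comm₀ _ (by linarith)]
        · rw [inv_eq_one_div, div_le_iff₀ (by linarith)]
          nlinarith [pow_nonneg (sub_nonneg.2 h) 3]
        · nlinarith [sq_nonneg (b - a - 1)]
      · nlinarith [sq_nonneg (b - a - 1)]
    nlinarith
  · have e2 : Real.exp (-a) * (Real.exp (-(b - a)) - 1 + (b - a)) =
        Real.exp (-b) * (1 - (1 + (a - b)) * Real.exp (-(a - b))) := by
      have h1 : Real.exp (-a) = Real.exp (-b) * Real.exp (-(a - b)) := by
        rw [← Real.exp_add]; ring_nf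
      have h2 : Real.exp (-a) * Real.exp (-(b - a)) = Real.exp (-b) := by
        rw [← Real.exp_add]; ring_nf
      rw [mul_add, mul_sub, h2, h1]; ring
    have h3 : 1 - (a - b) ≤ Real.exp (-(a - b)) := by linarith [Real.add_one_le_exp (-(a - b))]
    have hb1 : Real.exp (-b) ≤ 1 := by rw [Real.exp_le_one_iff]; linarith
    have h4 : 1 - (1 + (a - b)) * Real.exp (-(a - b)) ≤ (a - b) ^ 2 := by nlinarith
    rw [e2]
    have hb0 := Real.exp_pos (-b)
    nlinarith [sq_nonneg (a - b)]

/-- A bound uniform in `l`: the remainder of order `l² (s-t)²` is absorbed by a factor `e^{-(t/2)l}`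
split off both exponentials, which is why `s` must stay above `t/2`. It gives differentiability of
the semigroup in operator norm. -/
theorem abs_exp_mul_taylor {s t l : ℝ} (ht : 0 < t) (hs : t / 2 ≤ s) (hl : 0 ≤ l) :
    |Real.exp (-(s * l)) - Real.exp (-(t * l)) + (s - t) * (l * Real.exp (-(t * l)))| ≤
      16 / t ^ 2 * (s - t) ^ 2 := by
  have h := abs_exp_neg_taylor (a := t / 2 * l) (b := (s - t / 2) * l) (by positivity)
    (mul_nonneg (by linarith) hl)
  have e : Real.exp (-(s * l)) - Real.exp (-(t * l)) + (s - t) * (l * Real.exp (-(t * l))) =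
      Real.exp (-(t / 2 * l)) * (Real.exp (-((s - t / 2) * l)) - Real.exp (-(t / 2 * l)) +
        ((s - t / 2) * l - t / 2 * l) * Real.exp (-(t / 2 * l))) := by
    have h1 : Real.exp (-(s * l)) = Real.exp (-(t / 2 * l)) * Real.exp (-((s - t / 2) * l)) := by
      rw [← Real.exp_add]; ring_nf
    have h2 : Real.exp (-(t * l)) = Real.exp (-(t / 2 * l)) * Real.exp (-(t / 2 * l)) := by
      rw [← Real.exp_add]; ring_nf
    rw [h1, h2]; ring
  have h3 := sq_mul_exp_neg_le (l := l) (half_pos ht) hl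
  rw [e, abs_mul, abs_of_pos (Real.exp_pos _)]
  calc _ ≤ Real.exp (-(t / 2 * l)) * ((s - t / 2) * l - t / 2 * l) ^ 2 := by gcongr
    _ = (l ^ 2 * Real.exp (-(t / 2 * l))) * (s - t) ^ 2 := by ring
    _ ≤ 4 / (t / 2) ^ 2 * (s - t) ^ 2 := by gcongr
    _ = _ := by field_simp; ring

theorem abs_mul_exp_neg_sub_le {s t l : ℝ} (ht : 0 < t) (hs : t / 2 ≤ s) (hl : 0 ≤ l) :
    |l * Real.exp (-(s * l)) - l * Real.exp (-(t * l))| ≤ 16 / t ^ 2 * |s - t| := by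
  have h := abs_exp_neg_sub_le (s := s) (t := t) (l := l) (by linarith) ht.le hl
  have h3 := sq_mul_exp_neg_le (l := l) (half_pos ht) hl
  have hm : Real.exp (-(min s t * l)) ≤ Real.exp (-(t / 2 * l)) := by
    gcongr
    exact le_min hs (by linarith)
  rw [← mul_sub, abs_mul, abs_of_nonneg hl]
  calc _ ≤ l * (|s - t| * (l * Real.exp (-(min s t * l)))) := by gcongr
    _ ≤ l * (|s - t| * (l * Real.exp (-(t / 2 * l)))) := by gcongr
    _ = (l ^ 2 * Real.exp (-(t / 2 * l))) * |s - t| := by ring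
    _ ≤ 4 / (t / 2) ^ 2 * |s - t| := by gcongr
    _ = _ := by field_simp; ring

theorem abs_inv_one_add_sub_exp_le {y : ℝ} (hy : 0 ≤ y) :
    |(1 + y)⁻¹ - Real.exp (-y)| ≤ y ^ 2 := by
  have h1 : Real.exp (-y) ≤ (1 + y)⁻¹ := by
    rw [Real.exp_neg]
    exact inv_anti₀ (by positivity) (by linarith [Real.add_one_le_exp y])
  have h2 : 1 - y ≤ Real.exp (-y) := by linarith [Real.add_one_le_exp (-y)]
  have h3 : (1 + y)⁻¹ ≤ 1 - y + y ^ 2 := by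
    rw [inv_eq_one_div, div_le_iff₀ (by positivity)]
    nlinarith [pow_nonneg hy 3]
  rw [abs_of_nonneg (by linarith)]
  linarith

theorem abs_pow_sub_pow_le_mul {a b : ℝ} (ha : |a| ≤ 1) (hb : |b| ≤ 1) (n : ℕ) :
    |a ^ n - b ^ n| ≤ n * |a - b| := by
  induction n with
  | zero => simp
  | succ k ih =>
    have hak : |a ^ k| ≤ 1 := by rw [abs_pow]; exact pow_le_one₀ (abs_nonneg _) ha
    calc |a ^ (k + 1) - b ^ (k + 1)| = |a ^ k * (a - b) + (a ^ k - b ^ k) * b| := by ring_nf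
      _ ≤ |a ^ k| * |a - b| + |a ^ k - b ^ k| * |b| := by
        rw [← abs_mul, ← abs_mul]; exact abs_add_le _ _
      _ ≤ 1 * |a - b| + (k * |a - b|) * 1 := by gcongr
      _ = _ := by push_cast; ring

end SpectralFunctions

/-! ### The semigroup of a nonnegative self-adjoint operator, its generator and its uniqueness. -/

section Semigroup

variable {H : Type*} [NormedAddCommGroup H] [InnerProductSpace ℝ H]

/-- `B = (1 + L)⁻¹` for the nonnegative self-adjoint operator `L` with the given graph. -/
structure IsResolventOf (B : H →L[ℝ] H) (graph : H → H → Prop) : Prop where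
  pos : IsPosContraction B
  dense : DenseRange B
  graph_iff : ∀ f g, graph f g ↔ f = B (f + g)

/-- The semigroup `e^{-tL}`, where `B = (1 + L)⁻¹`. -/
def expSg (B : H →L[ℝ] H) (t : ℝ) : H →L[ℝ] H :=
  if t ≤ 0 then 1 else opFun B fun l => Real.exp (-(t * l))

/-- The operator `L e^{-tL}`, where `B = (1 + L)⁻¹`. -/
def genExpSg (B : H →L[ℝ] H) (t : ℝ) : H →L[ℝ] H := opFun B fun l => l * Real.exp (-(t * l))

theorem expSg_of_pos (B : H →L[ℝ] H) {t : ℝ} (ht : 0 < t) :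
    expSg B t = opFun B fun l => Real.exp (-(t * l)) := if_neg (not_le.2 ht)

theorem expSg_zero (B : H →L[ℝ] H) : expSg B 0 = 1 := if_pos le_rfl

variable [CompleteSpace H] {B : H →L[ℝ] H}

theorem IsPosContraction.norm_expSg_le (hB : IsPosContraction B) (t : ℝ) : ‖expSg B t‖ ≤ 1 := by
  rcases le_or_gt t 0 with h | h
  · rw [expSg, if_pos h]
    exact ContinuousLinearMap.norm_id_le
  · rw [expSg_of_pos B h]
    refine hB.opFun_norm_le (isC0_exp h) fun l hl => ?_
    rw [abs_of_pos (Real.exp_pos _), Real.exp_le_one_iff]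
    nlinarith [mul_nonneg h.le hl]

theorem IsPosContraction.norm_expSg_apply_le (hB : IsPosContraction B) (t : ℝ) (f : H) :
    ‖expSg B t f‖ ≤ ‖f‖ := by
  simpa using ContinuousLinearMap.le_of_opNorm_le _ (hB.norm_expSg_le t) f

theorem IsPosContraction.inner_expSg (hB : IsPosContraction B) (t : ℝ) (x y : H) :
    inner ℝ (expSg B t x) y = inner ℝ x (expSg B t y) := by
  rcases le_or_gt t 0 with h | h
  · simp [expSg, if_pos h]
  · rw [expSg_of_pos B h]
    exact hB.inner_opFun (isC0_exp h) x y

theorem IsPosContraction.expSg_add (hB : IsPosContraction B) {s t : ℝ} (hs : 0 ≤ s) (ht : 0 ≤ t) :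
    expSg B (s + t) = expSg B s * expSg B t := by
  rcases hs.eq_or_lt with rfl | hs
  · rw [zero_add, expSg_zero, one_mul]
  rcases ht.eq_or_lt with rfl | ht
  · rw [add_zero, expSg_zero, mul_one]
  rw [expSg_of_pos B hs, expSg_of_pos B ht, expSg_of_pos B (add_pos hs ht),
    ← hB.opFun_mul (isC0_exp hs) (isC0_exp ht)]
  refine opFun_congr fun l _ => ?_
  rw [← Real.exp_add]; ring_nf

theorem IsPosContraction.expSg_mul_self (hB : IsPosContraction B) {t : ℝ} (ht : 0 ≤ t) :
    expSg B t * B = opFun B fun l => Real.exp (-(t * l)) * (1 + l)⁻¹ := by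
  rcases ht.eq_or_lt with rfl | ht
  · rw [expSg_zero, one_mul]
    conv_lhs => rw [← hB.opFun_inv]
    exact opFun_congr fun l _ => by simp
  · rw [hB.opFun_mul (isC0_exp ht) isC0_inv, hB.opFun_inv, expSg_of_pos B ht]

/-- On the range of `B` the semigroup is Lipschitz up to `t = 0`, because `l/(1+l) ≤ 1`. As this
range is dense and the semigroup contracts, strong continuity follows. -/
theorem IsPosContraction.norm_expSg_mul_sub_le (hB : IsPosContraction B) {s t : ℝ} (hs : 0 ≤ s)
    (ht : 0 ≤ t) : ‖expSg B s * B - expSg B t * B‖ ≤ |s - t| := by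
  rw [hB.expSg_mul_self hs, hB.expSg_mul_self ht,
    ← hB.opFun_sub (isC0_exp_mul_inv hs) (isC0_exp_mul_inv ht)]
  refine hB.opFun_norm_le ((isC0_exp_mul_inv hs).sub (isC0_exp_mul_inv ht)) fun l hl => ?_
  have h := abs_exp_neg_sub_le hs ht hl
  have hm : Real.exp (-(min s t * l)) ≤ 1 := by
    rw [Real.exp_le_one_iff]
    nlinarith [mul_nonneg (le_min hs ht) hl]
  rw [← sub_mul, abs_mul, abs_of_nonneg (a := (1 + l)⁻¹) (by positivity), ← div_eq_mul_inv,
    div_le_iff₀ (by positivity)]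
  calc _ ≤ |s - t| * (l * Real.exp (-(min s t * l))) := h
    _ ≤ |s - t| * (l * 1) := by gcongr
    _ ≤ _ := by gcongr; linarith

theorem IsResolventOf.continuousOn_expSg {graph : H → H → Prop} (h : IsResolventOf B graph)
    (f : H) : ContinuousOn (fun t => expSg B t f) (Ici 0) := by
  intro t ht
  refine tendsto_apply_of_dense h.dense (C := 1)
    (Eventually.of_forall fun s => h.pos.norm_expSg_le s) ?_ f
  rintro _ ⟨x, rfl⟩
  rw [tendsto_iff_norm_sub_tendsto_zero]
  have h1 : Tendsto (fun s : ℝ => |s - t| * ‖x‖) (𝓝[Ici 0] t) (𝓝 0) := by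
    have : Tendsto (fun s : ℝ => |s - t| * ‖x‖) (𝓝 t) (𝓝 (|t - t| * ‖x‖)) := by
      apply Continuous.tendsto; fun_prop
    simpa using this.mono_left nhdsWithin_le_nhds
  refine squeeze_zero' (Eventually.of_forall fun _ => norm_nonneg _) ?_ h1
  filter_upwards [self_mem_nhdsWithin] with s hs
  exact ContinuousLinearMap.le_of_opNorm_le _ (h.pos.norm_expSg_mul_sub_le hs ht) x

/-- The quotients composed with `B` are the functions `t⁻¹(1 - e^{-tl})/(1+l)`, bounded by 1, so
convergence need only be checked on the dense range of `B`. There a second factor `1/(1+l)` makes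
the error at most `t`. -/
theorem IsResolventOf.tendsto_generator {graph : H → H → Prop} (h : IsResolventOf B graph)
    (w : H) : Tendsto (fun t : ℝ => t⁻¹ • (B w - expSg B t (B w))) (𝓝[>] 0) (𝓝 (w - B w)) := by
  have hB := h.pos
  have key : ∀ t : ℝ, 0 < t → IsC0 fun l => t⁻¹ * ((1 - Real.exp (-(t * l))) * (1 + l)⁻¹) := by
    intro t ht
    refine (isC0_inv.of_bounded_mul (M := 1) (by fun_prop) fun l hl => ?_).const_mul _
    have h1 : Real.exp (-(t * l)) ≤ 1 := by
      rw [Real.exp_le_one_iff]; nlinarith [mul_nonneg ht.le hl]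
    rw [abs_of_nonneg (by linarith)]
    linarith [Real.exp_pos (-(t * l))]
  have eq : ∀ t : ℝ, 0 < t → t⁻¹ • (B - expSg B t * B) =
      opFun B fun l => t⁻¹ * ((1 - Real.exp (-(t * l))) * (1 + l)⁻¹) := by
    intro t ht
    rw [hB.expSg_mul_self ht.le]
    conv_lhs => rw [← hB.opFun_inv]
    rw [hB.opFun_inv]
    nth_rw 1 [← hB.opFun_inv]
    rw [← hB.opFun_sub isC0_inv (isC0_exp_mul_inv ht.le), ← hB.opFun_const_mul
      (isC0_inv.sub (isC0_exp_mul_inv ht.le))]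
    exact opFun_congr fun l _ => by ring
  have main := tendsto_apply_of_dense (l := 𝓝[>] (0 : ℝ))
    (F := fun t => t⁻¹ • (B - expSg B t * B)) (G := 1 - B) h.dense (C := 1) ?_ ?_ w
  · simpa using main
  · filter_upwards [self_mem_nhdsWithin] with t ht
    rw [eq t ht]
    refine hB.opFun_norm_le (key t ht) fun l hl => ?_
    have ht' : (0 : ℝ) < t := ht
    have h1 : Real.exp (-(t * l)) ≤ 1 := by
      rw [Real.exp_le_one_iff]; nlinarith [mul_nonneg ht'.le hl]
    have h2 : 1 - Real.exp (-(t * l)) ≤ t * l := by linarith [Real.add_one_le_exp (-(t * l))]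
    have h3 : 0 ≤ 1 - Real.exp (-(t * l)) := by linarith
    rw [abs_of_nonneg (by positivity), ← div_eq_inv_mul, div_le_one ht', ← div_eq_mul_inv,
      div_le_iff₀ (by positivity)]
    nlinarith
  · rintro _ ⟨x, rfl⟩
    have hlim : Tendsto (fun t : ℝ => t * ‖x‖) (𝓝[>] 0) (𝓝 0) := by
      have : Tendsto (fun t : ℝ => t * ‖x‖) (𝓝 0) (𝓝 (0 * ‖x‖)) := by
        apply Continuous.tendsto; fun_prop
      simpa using this.mono_left nhdsWithin_le_nhds
    rw [tendsto_iff_norm_sub_tendsto_zero]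
    refine squeeze_zero' (Eventually.of_forall fun _ => norm_nonneg _) ?_ hlim
    filter_upwards [self_mem_nhdsWithin] with t ht
    have ht' : (0 : ℝ) < t := ht
    have e2 : (1 - B) * B = opFun B fun l => l * (1 + l)⁻¹ * (1 + l)⁻¹ := by
      have : (1 - B) * B = B - B * B := by rw [sub_mul, one_mul]
      rw [this]
      nth_rw 1 2 3 [← hB.opFun_inv]
      rw [← hB.opFun_mul isC0_inv isC0_inv, ← hB.opFun_sub isC0_inv (isC0_inv.mul isC0_inv)]
      refine opFun_congr fun l hl => ?_
      field_simp
      ring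
    have hc2 : IsC0 fun l => l * (1 + l)⁻¹ * (1 + l)⁻¹ := by
      refine isC0_inv.of_bounded_mul (M := 1) ?_ fun l hl => ?_
      · exact continuousOn_id.mul isC0_inv.cont
      · rw [abs_of_nonneg (by positivity), ← div_eq_mul_inv, div_le_one (by positivity)]
        linarith
    have e3 : (t⁻¹ • (B - expSg B t * B)) * B - (1 - B) * B = opFun B fun l =>
        (t⁻¹ * ((1 - Real.exp (-(t * l))) * (1 + l)⁻¹)) * (1 + l)⁻¹ -
          l * (1 + l)⁻¹ * (1 + l)⁻¹ := by
      rw [eq t ht, e2]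
      nth_rw 2 [← hB.opFun_inv]
      rw [← hB.opFun_mul (key t ht) isC0_inv, ← hB.opFun_sub ((key t ht).mul isC0_inv) hc2]
    have e4 : ‖(t⁻¹ • (B - expSg B t * B)) * B - (1 - B) * B‖ ≤ t := by
      rw [e3]
      refine hB.opFun_norm_le (((key t ht).mul isC0_inv).sub hc2) fun l hl => ?_
      have h1 := abs_exp_neg_taylor (a := 0) (b := t * l) le_rfl (by positivity)
      simp only [neg_zero, Real.exp_zero, sub_zero, mul_one] at h1
      have e5 : (t⁻¹ * ((1 - Real.exp (-(t * l))) * (1 + l)⁻¹)) * (1 + l)⁻¹ -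
          l * (1 + l)⁻¹ * (1 + l)⁻¹ =
          -((Real.exp (-(t * l)) - 1 + t * l) * (t⁻¹ * (1 + l)⁻¹ ^ 2)) := by
        field_simp; ring
      rw [e5, abs_neg, abs_mul, abs_of_nonneg (a := t⁻¹ * (1 + l)⁻¹ ^ 2) (by positivity)]
      calc _ ≤ (t * l) ^ 2 * (t⁻¹ * (1 + l)⁻¹ ^ 2) := by gcongr
        _ = t * (l * (1 + l)⁻¹) ^ 2 := by field_simp
        _ ≤ t * 1 ^ 2 := by
          gcongr
          rw [← div_eq_mul_inv, div_le_one (by positivity)]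
          linarith
        _ = t := by ring
    exact ContinuousLinearMap.le_of_opNorm_le _ e4 x

theorem IsResolventOf.isSemigroupOf {graph : H → H → Prop} (h : IsResolventOf B graph) :
    IsSemigroupOf (expSg B) graph where
  zero := expSg_zero B
  add s t hs ht := h.pos.expSg_add hs ht
  continuousOn f := h.continuousOn_expSg f
  generator f g := by
    constructor
    · intro hfg
      rw [h.graph_iff] at hfg
      have := h.tendsto_generator (f + g)
      rw [← hfg] at this
      simpa using this
    · intro hlim
      rw [h.graph_iff]
      -- `B` commutes with the semigroup. Applied to the difference quotients it gives the limit `B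
      -- g` by continuity and `f - B f` by `tendsto_generator`, that is, `f = B (f + g)`.
      have h1 := (B.continuous.tendsto g).comp hlim
      have h2 := h.tendsto_generator f
      have h3 : ∀ t : ℝ, B (expSg B t f) = expSg B t (B f) := by
        intro t
        rcases le_or_gt t 0 with ht | ht
        · simp [expSg, if_pos ht]
        · have e1 := h.pos.opFun_mul (isC0_exp ht) isC0_inv
          have e2 := h.pos.opFun_mul isC0_inv (isC0_exp ht)
          rw [h.pos.opFun_inv, ← expSg_of_pos B ht] at e1 e2
          rw [← mul_apply_eq_comp, ← mul_apply_eq_comp, ← e1, ← e2]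
          exact congrArg (fun A : H →L[ℝ] H => A f) (opFun_congr fun l _ => mul_comm _ _)
      have h4 : B g = f - B f := by
        refine tendsto_nhds_unique h1 (h2.congr fun t => ?_)
        simp only [Function.comp, map_smul, map_sub, h3]
      rw [map_add, h4]
      abel

/-- Smoothing: `e^{-tl} = (1+l)⁻¹ (e^{-tl} + l e^{-tl})`, and `l e^{-tl}` vanishes at infinity for
`t > 0`. -/
theorem IsResolventOf.graph_expSg {graph : H → H → Prop} (h : IsResolventOf B graph) {t : ℝ}
    (ht : 0 < t) (f : H) : graph (expSg B t f) (genExpSg B t f) := by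
  have e : expSg B t = B * (expSg B t + genExpSg B t) := by
    have e1 : (opFun B fun l => Real.exp (-(t * l))) -
        (opFun B fun l => (1 + l)⁻¹) * (opFun B fun l => Real.exp (-(t * l))) =
        (opFun B fun l => (1 + l)⁻¹) * opFun B fun l => l * Real.exp (-(t * l)) := by
      rw [← h.pos.opFun_mul isC0_inv (isC0_exp ht), ← h.pos.opFun_mul isC0_inv (isC0_mul_exp ht),
        ← h.pos.opFun_sub (isC0_exp ht) (isC0_inv.mul (isC0_exp ht))]
      refine opFun_congr fun l hl => ?_
      field_simp
      ring
    rw [h.pos.opFun_inv] at e1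
    rw [mul_add, expSg_of_pos B ht, genExpSg, ← e1]
    abel
  rw [h.graph_iff]
  exact congrArg (fun A : H →L[ℝ] H => A f) e

theorem IsPosContraction.norm_genExpSg_le (hB : IsPosContraction B) {t : ℝ} (ht : 0 < t) :
    ‖genExpSg B t‖ ≤ 1 / t := by
  refine hB.opFun_norm_le (isC0_mul_exp ht) fun l hl => ?_
  rw [abs_of_nonneg (by positivity)]
  exact mul_exp_neg_le ht

theorem IsPosContraction.norm_expSg_sub_le (hB : IsPosContraction B) {s t : ℝ} (hs : 0 < s)
    (ht : 0 < t) : ‖expSg B s - expSg B t‖ ≤ |s - t| / min s t := by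
  rw [expSg_of_pos B hs, expSg_of_pos B ht, ← hB.opFun_sub (isC0_exp hs) (isC0_exp ht)]
  refine hB.opFun_norm_le ((isC0_exp hs).sub (isC0_exp ht)) fun l hl => ?_
  refine (abs_exp_neg_sub_le hs.le ht.le hl).trans ?_
  rw [div_eq_mul_one_div]
  gcongr
  exact mul_exp_neg_le (lt_min hs ht)

theorem IsPosContraction.hasDerivAt_expSg (hB : IsPosContraction B) {t : ℝ} (ht : 0 < t) :
    HasDerivAt (expSg B) (-genExpSg B t) t := by
  rw [hasDerivAt_iff_isLittleO]
  refine Asymptotics.IsBigO.trans_isLittleO (g := fun s : ℝ => (s - t) ^ 2) ?_ ?_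
  · refine Asymptotics.IsBigO.of_bound (16 / t ^ 2) ?_
    filter_upwards [Ioi_mem_nhds (half_lt_self ht)] with s hs
    have hs0 : 0 < s := (half_pos ht).trans hs
    have e : expSg B s - expSg B t - (s - t) • -genExpSg B t = opFun B fun l =>
        Real.exp (-(s * l)) - Real.exp (-(t * l)) - (t - s) * (l * Real.exp (-(t * l))) := by
      rw [hB.opFun_sub ((isC0_exp hs0).sub (isC0_exp ht)) ((isC0_mul_exp ht).const_mul _),
        hB.opFun_sub (isC0_exp hs0) (isC0_exp ht), hB.opFun_const_mul (isC0_mul_exp ht),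
        expSg_of_pos B hs0, expSg_of_pos B ht, genExpSg, smul_neg, ← neg_smul, neg_sub]
    rw [e, Real.norm_of_nonneg (sq_nonneg _)]
    refine hB.opFun_norm_le (((isC0_exp hs0).sub (isC0_exp ht)).sub
      ((isC0_mul_exp ht).const_mul _)) fun l hl => ?_
    have := abs_exp_mul_taylor ht (le_of_lt hs) hl
    convert this using 2
    ring
  · have : (fun s : ℝ => (s - t) ^ 2) = fun s => (s - t) * (s - t) := by funext s; ring
    rw [this]
    refine Asymptotics.IsLittleO.of_bound fun c hc => ?_
    filter_upwards [Metric.ball_mem_nhds t hc] with s hs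
    rw [norm_mul]
    gcongr
    rw [Metric.mem_ball, dist_eq_norm] at hs
    exact hs.le

theorem IsPosContraction.continuousOn_genExpSg (hB : IsPosContraction B) :
    ContinuousOn (genExpSg B) (Ioi 0) := by
  intro t ht
  have ht' : (0 : ℝ) < t := ht
  refine ContinuousAt.continuousWithinAt ?_
  rw [ContinuousAt, tendsto_iff_norm_sub_tendsto_zero]
  have hlim : Tendsto (fun s : ℝ => 16 / t ^ 2 * |s - t|) (𝓝 t) (𝓝 0) := by
    have : Tendsto (fun s : ℝ => 16 / t ^ 2 * |s - t|) (𝓝 t) (𝓝 (16 / t ^ 2 * |t - t|)) := by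
      apply Continuous.tendsto; fun_prop
    simpa using this
  refine squeeze_zero' (Eventually.of_forall fun _ => norm_nonneg _) ?_ hlim
  filter_upwards [Ioi_mem_nhds (half_lt_self ht')] with s hs
  have hs0 : 0 < s := (half_pos ht').trans hs
  rw [genExpSg, genExpSg, ← hB.opFun_sub (isC0_mul_exp hs0) (isC0_mul_exp ht')]
  exact hB.opFun_norm_le ((isC0_mul_exp hs0).sub (isC0_mul_exp ht'))
    fun l hl => abs_mul_exp_neg_sub_le ht' (le_of_lt hs) hl

theorem IsPosContraction.hasDerivAt_expSg_apply (hB : IsPosContraction B) {t : ℝ} (ht : 0 < t)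
    (f : H) : HasDerivAt (fun t => expSg B t f) (-genExpSg B t f) t := by
  simpa using (hB.hasDerivAt_expSg ht).clm_apply (hasDerivAt_const t f)

theorem IsPosContraction.contDiffOn_expSg_apply (hB : IsPosContraction B) (f : H) :
    ContDiffOn ℝ 1 (fun t => expSg B t f) (Ioi 0) := by
  have h1 : ContDiffOn ℝ (0 + 1) (fun t => expSg B t f) (Ioi 0) := by
    rw [contDiffOn_succ_iff_deriv_of_isOpen isOpen_Ioi]
    refine ⟨fun t ht => (hB.hasDerivAt_expSg_apply ht f).differentiableAt.differentiableWithinAt,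
      by simp, ?_⟩
    rw [contDiffOn_zero]
    have h2 : ContinuousOn (fun t => -genExpSg B t f) (Ioi 0) :=
      (hB.continuousOn_genExpSg.clm_apply continuousOn_const).neg
    exact h2.congr fun t ht => (hB.hasDerivAt_expSg_apply ht f).deriv
  simpa using h1

/-- The resolvent `(1 + ε L)⁻¹`. -/
def resolventSg (B : H →L[ℝ] H) (ε : ℝ) : H →L[ℝ] H := opFun B fun l => (1 + ε * l)⁻¹

theorem IsResolventOf.graph_resolventSg {graph : H → H → Prop} (h : IsResolventOf B graph) {ε : ℝ}
    (hε : 0 < ε) (f : H) : graph (resolventSg B ε f) (ε⁻¹ • (f - resolventSg B ε f)) := by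
  have hB := h.pos
  have hR := isC0_resolvent hε
  have e : resolventSg B ε = B * resolventSg B ε + ε⁻¹ • (B - B * resolventSg B ε) := by
    have e1 : (opFun B fun l => (1 + ε * l)⁻¹) -
        (opFun B fun l => (1 + l)⁻¹) * (opFun B fun l => (1 + ε * l)⁻¹) =
        ε⁻¹ • ((opFun B fun l => (1 + l)⁻¹) -
          (opFun B fun l => (1 + l)⁻¹) * opFun B fun l => (1 + ε * l)⁻¹) := by
      rw [← hB.opFun_mul isC0_inv hR,
        ← hB.opFun_sub isC0_inv (isC0_inv.mul hR), ← hB.opFun_sub hR (isC0_inv.mul hR),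
        ← hB.opFun_const_mul (isC0_inv.sub (isC0_inv.mul hR))]
      refine opFun_congr fun l hl => ?_
      field_simp
      ring
    rw [hB.opFun_inv] at e1
    rw [resolventSg, ← e1]
    abel
  rw [h.graph_iff]
  have := congrArg (fun A : H →L[ℝ] H => A f) e
  simpa using this

theorem IsPosContraction.norm_resolventSg_le (hB : IsPosContraction B) {ε : ℝ} (hε : 0 < ε) :
    ‖resolventSg B ε‖ ≤ 1 := by
  refine hB.opFun_norm_le (isC0_resolvent hε) fun l hl => ?_
  rw [abs_of_nonneg (by positivity)]
  exact inv_le_one_of_one_le₀ (by nlinarith [mul_nonneg hε.le hl])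

/-- The exponential formula `e^{-tL} f = lim (1 + (t/n) L)^{-n} f`. -/
theorem IsResolventOf.tendsto_resolventSg_pow {graph : H → H → Prop} (h : IsResolventOf B graph)
    {t : ℝ} (ht : 0 < t) (f : H) :
    Tendsto (fun n : ℕ => (resolventSg B (t / ((n : ℝ) + 1)) ^ (n + 1)) f) atTop
      (𝓝 (expSg B t f)) := by
  have hB := h.pos
  have hε : ∀ n : ℕ, 0 < t / ((n : ℝ) + 1) := fun n => by positivity
  -- Two factors of `B` are needed: the `n + 1` steps cost at most `(n+1)(εl)²` with `ε = t/(n+1)`,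
  -- and `l²/(1+l)² ≤ 1` leaves `t²/(n+1)`.
  have hdense : Dense (range (B * B)) := by
    have : range (B * B) = B '' range B := by rw [← range_comp]; rfl
    rw [this]
    exact h.dense.dense_image B.continuous h.dense
  refine tendsto_apply_of_dense (F := fun n : ℕ => resolventSg B (t / ((n : ℝ) + 1)) ^ (n + 1))
    hdense (C := 1) (Eventually.of_forall fun n => ?_) ?_ f
  · exact (norm_pow_le' _ n.succ_pos).trans
      (pow_le_one₀ (norm_nonneg _) (hB.norm_resolventSg_le (hε n)))
  rintro _ ⟨x, rfl⟩
  have hlim : Tendsto (fun n : ℕ => t ^ 2 * (1 / ((n : ℝ) + 1)) * ‖x‖) atTop (𝓝 0) := by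
    simpa using ((tendsto_one_div_add_atTop_nhds_zero_nat (𝕜 := ℝ)).const_mul (t ^ 2)).mul_const ‖x‖
  rw [tendsto_iff_norm_sub_tendsto_zero]
  refine squeeze_zero (fun _ => norm_nonneg _) (fun n => ?_) hlim
  set ε := t / ((n : ℝ) + 1) with hεdef
  have hc1 := isC0_pow (isC0_resolvent (hε n)) n
  have hBB := isC0_inv.mul isC0_inv
  have e : resolventSg B ε ^ (n + 1) * (B * B) - expSg B t * (B * B) = opFun B fun l =>
      (1 + ε * l)⁻¹ ^ (n + 1) * ((1 + l)⁻¹ * (1 + l)⁻¹) -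
        Real.exp (-(t * l)) * ((1 + l)⁻¹ * (1 + l)⁻¹) := by
    rw [hB.opFun_sub (hc1.mul hBB) ((isC0_exp ht).mul hBB), hB.opFun_mul hc1 hBB,
      hB.opFun_mul (isC0_exp ht) hBB, hB.opFun_mul isC0_inv isC0_inv,
      hB.opFun_pow (isC0_resolvent (hε n)), hB.opFun_inv, expSg_of_pos B ht, resolventSg]
  have key : ‖resolventSg B ε ^ (n + 1) * (B * B) - expSg B t * (B * B)‖ ≤
      t ^ 2 * (1 / ((n : ℝ) + 1)) := by
    rw [e]
    refine hB.opFun_norm_le ((hc1.mul hBB).sub ((isC0_exp ht).mul hBB)) fun l hl => ?_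
    have hεl : 0 ≤ ε * l := mul_nonneg (hε n).le hl
    have h1 : Real.exp (-(t * l)) = Real.exp (-(ε * l)) ^ (n + 1) := by
      rw [← Real.exp_nat_mul]; congr 1; rw [hεdef]; push_cast; field_simp
    have h2 : |(1 + ε * l)⁻¹ ^ (n + 1) - Real.exp (-(ε * l)) ^ (n + 1)| ≤
        ((n + 1 : ℕ) : ℝ) * (ε * l) ^ 2 := by
      refine (abs_pow_sub_pow_le_mul ?_ ?_ _).trans ?_
      · rw [abs_of_nonneg (by positivity)]
        exact inv_le_one_of_one_le₀ (by linarith)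
      · rw [abs_of_pos (Real.exp_pos _), Real.exp_le_one_iff]; linarith
      · gcongr
        exact abs_inv_one_add_sub_exp_le hεl
    have h3 : l * (1 + l)⁻¹ ≤ 1 := by
      rw [← div_eq_mul_inv, div_le_one (by positivity)]
      linarith
    rw [← sub_mul, h1, abs_mul, abs_of_nonneg (a := (1 + l)⁻¹ * (1 + l)⁻¹) (by positivity)]
    calc _ ≤ ((n + 1 : ℕ) : ℝ) * (ε * l) ^ 2 * ((1 + l)⁻¹ * (1 + l)⁻¹) := by gcongr
      _ = t ^ 2 * (1 / ((n : ℝ) + 1)) * (l * (1 + l)⁻¹) ^ 2 := by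
        rw [hεdef]; push_cast; field_simp
      _ ≤ t ^ 2 * (1 / ((n : ℝ) + 1)) * 1 ^ 2 := by gcongr
      _ = _ := by ring
  have := ContinuousLinearMap.le_of_opNorm_le _ key x
  simpa using this

/-- Strong resolvent convergence implies strong convergence of the semigroups. -/
theorem tendsto_expSg_apply {Bn : ℕ → H →L[ℝ] H} (hBn : ∀ n, IsPosContraction (Bn n))
    (hB : IsPosContraction B) (hlim : ∀ v, Tendsto (fun n => Bn n v) atTop (𝓝 (B v)))
    (t : ℝ) (f : H) : Tendsto (fun n => expSg (Bn n) t f) atTop (𝓝 (expSg B t f)) := by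
  rcases le_or_gt t 0 with h | h
  · simp only [expSg, if_pos h]
    exact tendsto_const_nhds
  · simp only [expSg_of_pos _ h]
    exact tendsto_fc_apply hBn hB hlim (isC0_exp h).continuousOn_pullInv f

/-- A strongly continuous semigroup is determined by its generator. -/
theorem IsResolventOf.eq_expSg {graph : H → H → Prop} (h : IsResolventOf B graph)
    {T : ℝ → H →L[ℝ] H} (hT : IsSemigroupOf T graph) {t : ℝ} (ht : 0 ≤ t) : T t = expSg B t := by
  have hS := h.isSemigroupOf
  have hB := h.pos
  -- `(S (t - s)) (T s f)` is constant in `s` for `f` in the domain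
  have key : ∀ f g, graph f g → T t f = expSg B t f := by
    intro f g hfg
    set w : ℝ → H := fun s => expSg B (t - s) (T s f) with hw
    have hTc := hT.continuousOn f
    have hcont : ContinuousOn w (Icc 0 t) := by
      intro s hs
      rw [ContinuousWithinAt, tendsto_iff_norm_sub_tendsto_zero]
      have h1 : Tendsto (fun r => ‖T r f - T s f‖) (𝓝[Icc 0 t] s) (𝓝 0) :=
        tendsto_iff_norm_sub_tendsto_zero.1
          ((hTc s hs.1).mono_left (nhdsWithin_mono _ fun r hr => hr.1))
      have h2 : Tendsto (fun r => ‖expSg B (t - r) (T s f) - expSg B (t - s) (T s f)‖)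
          (𝓝[Icc 0 t] s) (𝓝 0) := by
        refine tendsto_iff_norm_sub_tendsto_zero.1 ?_
        refine Tendsto.comp (h.continuousOn_expSg (T s f) (t - s) (sub_nonneg.2 hs.2)) ?_
        refine tendsto_nhdsWithin_of_tendsto_nhds_of_eventually_within _ ?_ ?_
        · have : Tendsto (fun r : ℝ => t - r) (𝓝 s) (𝓝 (t - s)) := by
            apply Continuous.tendsto; fun_prop
          exact this.mono_left nhdsWithin_le_nhds
        · filter_upwards [self_mem_nhdsWithin] with r hr
          exact sub_nonneg.2 hr.2
      refine squeeze_zero (fun _ => norm_nonneg _) (fun r => ?_) (by simpa using h1.add h2)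
      calc ‖w r - w s‖ = ‖expSg B (t - r) (T r f - T s f) +
            (expSg B (t - r) (T s f) - expSg B (t - s) (T s f))‖ := by
            simp only [hw, map_sub]; congr 1; abel
        _ ≤ _ := (norm_add_le _ _).trans (by gcongr; exact hB.norm_expSg_apply_le _ _)
    -- For `r > s`, `w r - w s` is `expSg B (t - r)` applied to the difference of the two semigroups
    -- at time `r - s` on `T s f`. The outer operator contracts, and the inner difference is `o(r -
    -- s)` since both generators agree at `T s f`.
    have hderiv : ∀ s ∈ Ico 0 t, HasDerivWithinAt w 0 (Ici s) s := by
      intro s hs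
      have hgs : graph (T s f) (T s g) := by
        rw [hT.generator]
        have := ((T s).continuous.tendsto g).comp ((hT.generator f g).1 hfg)
        refine this.congr' ?_
        filter_upwards [self_mem_nhdsWithin] with r hr
        have hr' : (0 : ℝ) < r := hr
        have e : T r (T s f) = T s (T r f) := by
          rw [← ContinuousLinearMap.comp_apply, ← ContinuousLinearMap.comp_apply,
            ← hT.add r s hr'.le hs.1, ← hT.add s r hs.1 hr'.le, add_comm]
        simp only [Function.comp, map_smul, map_sub, e]
      have h1 := (hT.generator _ _).1 hgs
      have h2 := (hS.generator _ _).1 hgs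
      have h3 : Tendsto (fun r : ℝ => r⁻¹ • (T r (T s f) - expSg B r (T s f))) (𝓝[>] 0)
          (𝓝 0) := by
        have := h2.sub h1
        rw [sub_self] at this
        refine this.congr fun r => ?_
        rw [← smul_sub]; congr 1; abel
      rw [← hasDerivWithinAt_Ioi_iff_Ici, hasDerivWithinAt_iff_tendsto_slope' (by simp)]
      have h4 : Tendsto (fun r : ℝ => r - s) (𝓝[>] s) (𝓝[>] 0) := by
        refine tendsto_nhdsWithin_of_tendsto_nhds_of_eventually_within _ ?_ ?_
        · have : Tendsto (fun r : ℝ => r - s) (𝓝 s) (𝓝 (s - s)) := by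
            apply Continuous.tendsto; fun_prop
          rw [sub_self] at this
          exact this.mono_left nhdsWithin_le_nhds
        · filter_upwards [self_mem_nhdsWithin] with r hr
          exact sub_pos.2 (show s < r from hr)
      rw [tendsto_zero_iff_norm_tendsto_zero]
      refine squeeze_zero' (Eventually.of_forall fun _ => norm_nonneg _) ?_
        (tendsto_zero_iff_norm_tendsto_zero.1 (h3.comp h4))
      filter_upwards [Ioo_mem_nhdsGT hs.2] with r hr
      have e1 : w r - w s =
          expSg B (t - r) (T (r - s) (T s f) - expSg B (r - s) (T s f)) := by
        have e2 : T r f = T (r - s) (T s f) := by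
          rw [← ContinuousLinearMap.comp_apply, ← hT.add _ _ (sub_nonneg.2 hr.1.le) hs.1,
            sub_add_cancel]
        have e3 : expSg B (t - s) = expSg B (t - r) * expSg B (r - s) := by
          rw [← hB.expSg_add (sub_nonneg.2 hr.2.le) (sub_nonneg.2 hr.1.le)]; ring_nf
        simp only [hw, map_sub, e2, e3, mul_apply_eq_comp]
      rw [slope_def_module, e1]
      simp only [Function.comp, norm_smul]
      gcongr
      exact hB.norm_expSg_apply_le _ _
    have := constant_of_has_deriv_right_zero hcont hderiv t ⟨ht, le_rfl⟩
    simpa [hw, expSg_zero, hT.zero] using this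
  refine ContinuousLinearMap.ext fun f => ?_
  refine congrFun (Continuous.ext_on h.dense (T t).continuous (expSg B t).continuous ?_) f
  rintro _ ⟨x, rfl⟩
  exact key (B x) (x - B x) ((h.graph_iff _ _).2 (by simp))

theorem HForm.isSemigroupOf_semigroup {q : HForm H} (h : IsResolventOf B q.opGraph) :
    IsSemigroupOf q.semigroup q.opGraph :=
  Classical.epsilon_spec (p := fun T => IsSemigroupOf T q.opGraph) ⟨_, h.isSemigroupOf⟩

/-- Uniqueness makes the choice in `HForm.semigroup` irrelevant for `t ≥ 0`; from here on only
`expSg` needs to be studied. -/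
theorem HForm.semigroup_eq_expSg {q : HForm H} (h : IsResolventOf B q.opGraph) {t : ℝ}
    (ht : 0 ≤ t) : q.semigroup t = expSg B t :=
  h.eq_expSg (HForm.isSemigroupOf_semigroup h) ht

end Semigroup

end

noncomputable section

/-! ### Closable forms: completion of the form domain, representation theorem, monotone convergence.
-/

section Forms

variable {H : Type*} [NormedAddCommGroup H] [InnerProductSpace ℝ H]

/-- Nonnegative symmetric bilinear forms, defined on a linear subspace. -/
structure HForm.IsNonneg (q : HForm H) : Prop where
  zero_mem : 0 ∈ q.dom
  add_mem : ∀ f ∈ q.dom, ∀ g ∈ q.dom, f + g ∈ q.dom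
  smul_mem : ∀ r : ℝ, ∀ f ∈ q.dom, r • f ∈ q.dom
  add_left : ∀ f ∈ q.dom, ∀ g ∈ q.dom, ∀ h ∈ q.dom, q.val (f + g) h = q.val f h + q.val g h
  smul_left : ∀ r : ℝ, ∀ f ∈ q.dom, ∀ g ∈ q.dom, q.val (r • f) g = r * q.val f g
  symm : ∀ f ∈ q.dom, ∀ g ∈ q.dom, q.val f g = q.val g f
  nonneg : ∀ f ∈ q.dom, 0 ≤ q.val f f

/-- The domain of a form as a subspace. -/
def HForm.IsNonneg.submodule {q : HForm H} (hq : q.IsNonneg) : Submodule ℝ H where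
  carrier := q.dom
  add_mem' := fun {f g} hf hg => hq.add_mem f hf g hg
  zero_mem' := hq.zero_mem
  smul_mem' := fun r f hf => hq.smul_mem r f hf

/-- The domain of a form, to be normed by the form norm. -/
def FormSpace {q : HForm H} (hq : q.IsNonneg) : Type _ := hq.submodule

variable {q : HForm H} (hq : q.IsNonneg)

instance : AddCommGroup (FormSpace hq) := inferInstanceAs (AddCommGroup hq.submodule)

instance : Module ℝ (FormSpace hq) := inferInstanceAs (Module ℝ hq.submodule)

/-- The inclusion of the form domain. -/
def FormSpace.incl : FormSpace hq →ₗ[ℝ] H := hq.submodule.subtype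

theorem FormSpace.incl_mem (x : FormSpace hq) : FormSpace.incl hq x ∈ q.dom := x.2

theorem FormSpace.incl_injective : Function.Injective (FormSpace.incl hq) :=
  Subtype.val_injective

/-- An element of the domain as an element of the normed space. -/
def FormSpace.mk {f : H} (hf : f ∈ q.dom) : FormSpace hq := (⟨f, hf⟩ : hq.submodule)

theorem FormSpace.incl_mk {f : H} (hf : f ∈ q.dom) : incl hq (mk hq hf) = f := rfl

/-- The inner product `q(f, g) + ⟨f, g⟩` on the form domain. -/
@[reducible] def FormSpace.core : InnerProductSpace.Core ℝ (FormSpace hq) where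
  inner x y := q.val (incl hq x) (incl hq y) + inner ℝ (incl hq x) (incl hq y)
  conj_inner_symm x y := by
    simp only [conj_trivial]
    rw [hq.symm _ (incl_mem hq y) _ (incl_mem hq x), real_inner_comm]
  re_inner_nonneg x := by
    simp only [RCLike.re_to_real]
    exact add_nonneg (hq.nonneg _ (incl_mem hq x)) real_inner_self_nonneg
  add_left x y z := by
    simp only [map_add]
    rw [hq.add_left _ (incl_mem hq x) _ (incl_mem hq y) _ (incl_mem hq z), inner_add_left]
    ring
  smul_left x y r := by
    simp only [map_smul, conj_trivial]
    rw [hq.smul_left _ _ (incl_mem hq x) _ (incl_mem hq y), real_inner_smul_left]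
    ring
  definite x hx := by
    have h1 := hq.nonneg _ (incl_mem hq x)
    have h2 : inner ℝ (incl hq x) (incl hq x) = 0 :=
      le_antisymm (by linarith) real_inner_self_nonneg
    exact incl_injective hq (by rw [inner_self_eq_zero.1 h2, map_zero])

instance : NormedAddCommGroup (FormSpace hq) := (FormSpace.core hq).toNormedAddCommGroup

instance : InnerProductSpace ℝ (FormSpace hq) := InnerProductSpace.ofCore (FormSpace.core hq).toCore

theorem FormSpace.inner_def (x y : FormSpace hq) :
    inner ℝ x y = q.val (incl hq x) (incl hq y) + inner ℝ (incl hq x) (incl hq y) := rfl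

theorem FormSpace.norm_sq (x : FormSpace hq) :
    ‖x‖ ^ 2 = q.val (incl hq x) (incl hq x) + ‖incl hq x‖ ^ 2 := by
  rw [← real_inner_self_eq_norm_sq, ← real_inner_self_eq_norm_sq, inner_def]

theorem FormSpace.norm_incl_le (x : FormSpace hq) : ‖incl hq x‖ ≤ ‖x‖ := by
  refine le_of_sq_le_sq ?_ (norm_nonneg _)
  rw [norm_sq]
  linarith [hq.nonneg _ (incl_mem hq x)]

/-- The inclusion of the form domain as a bounded operator. -/
def FormSpace.inclL : FormSpace hq →L[ℝ] H :=
  (incl hq).mkContinuous 1 fun x => by simpa using norm_incl_le hq x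

variable [CompleteSpace H]

/-- The completion of the form domain. -/
abbrev FormSpace.Compl := UniformSpace.Completion (FormSpace hq)

/-- The extension of the inclusion to the completion of the form domain. -/
def FormSpace.embed : Compl hq →L[ℝ] H :=
  (inclL hq).extend (UniformSpace.Completion.toComplL (𝕜 := ℝ) (E := FormSpace hq))

theorem FormSpace.embed_coe (x : FormSpace hq) : embed hq (x : Compl hq) = incl hq x :=
  ContinuousLinearMap.extend_eq _ UniformSpace.Completion.denseRange_coe
    (UniformSpace.Completion.isUniformInducing_coe _) x

theorem FormSpace.norm_embed_le (u : Compl hq) : ‖embed hq u‖ ≤ ‖u‖ := by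
  induction u using UniformSpace.Completion.induction_on with
  | hp => exact isClosed_le (by fun_prop) (by fun_prop)
  | ih x => rw [embed_coe, UniformSpace.Completion.norm_coe]; exact norm_incl_le hq x

omit [CompleteSpace H] in
theorem FormSpace.exists_seq (u : Compl hq) :
    ∃ s : ℕ → FormSpace hq, Tendsto (fun n => (s n : Compl hq)) atTop (𝓝 u) := by
  have := UniformSpace.Completion.denseRange_coe (α := FormSpace hq) u
  obtain ⟨x, hx, hlim⟩ := mem_closure_iff_seq_limit.1 this
  choose s hs using hx
  exact ⟨s, by simpa only [hs] using hlim⟩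

theorem FormSpace.approximates_of_tendsto {s : ℕ → FormSpace hq} {u : Compl hq}
    (h : Tendsto (fun n => (s n : Compl hq)) atTop (𝓝 u)) :
    q.Approximates (fun n => incl hq (s n)) (embed hq u) := by
  refine ⟨fun n => incl_mem hq _, ?_, ?_⟩
  · have := ((embed hq).continuous.tendsto u).comp h
    simpa only [Function.comp_def, embed_coe] using this
  · have h1 : Tendsto (fun m : ℕ × ℕ => ((s m.1 : Compl hq) - s m.2)) atTop (𝓝 (u - u)) := by
      rw [← prod_atTop_atTop_eq]
      exact (h.comp tendsto_fst).sub (h.comp tendsto_snd)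
    have h2 : Tendsto (fun m : ℕ × ℕ => ‖s m.1 - s m.2‖ ^ 2) atTop (𝓝 0) := by
      have := (h1.norm).pow 2
      simpa [← UniformSpace.Completion.coe_sub, UniformSpace.Completion.norm_coe] using this
    refine squeeze_zero (fun m => ?_) (fun m => ?_) h2
    · rw [← map_sub]; exact hq.nonneg _ (incl_mem hq _)
    · rw [norm_sq, map_sub]; exact le_add_of_nonneg_right (sq_nonneg _)

/-- A sequence that converges in `H` and is Cauchy for `q` is Cauchy for the form norm, hence
defines a point of the completion lying over `f`. -/
theorem FormSpace.exists_tendsto_of_approximates {s : ℕ → H} {f : H} (h : q.Approximates s f) :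
    ∃ u : Compl hq, embed hq u = f ∧
      Tendsto (fun n => ((FormSpace.mk hq (h.1 n)) : Compl hq)) atTop (𝓝 u) := by
  obtain ⟨hs, hlim, hc⟩ := h
  set x : ℕ → FormSpace hq := fun n => mk hq (hs n)
  have hx : ∀ n, incl hq (x n) = s n := fun n => rfl
  have hcs : CauchySeq fun n => (x n : Compl hq) := by
    rw [cauchySeq_iff_tendsto_dist_atTop_0]
    have h1 : Tendsto (fun m : ℕ × ℕ => s m.1 - s m.2) atTop (𝓝 (f - f)) := by
      rw [← prod_atTop_atTop_eq]
      exact (hlim.comp tendsto_fst).sub (hlim.comp tendsto_snd)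
    have h2 := hc.add (h1.norm.pow 2)
    rw [sub_self, norm_zero, zero_pow two_ne_zero, add_zero] at h2
    have h3 := h2.sqrt
    rw [Real.sqrt_zero] at h3
    refine h3.congr fun m => ?_
    rw [dist_eq_norm, ← UniformSpace.Completion.coe_sub, UniformSpace.Completion.norm_coe,
      ← hx, ← hx, ← map_sub, ← norm_sq, Real.sqrt_sq (norm_nonneg _)]
  obtain ⟨u, hu⟩ := cauchySeq_tendsto_of_complete hcs
  refine ⟨u, ?_, hu⟩
  have h1 := ((embed hq).continuous.tendsto u).comp hu
  simp only [Function.comp_def, embed_coe, hx] at h1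
  exact tendsto_nhds_unique h1 hlim

/-- This is what closability means: a point `u` over 0 is the limit of a form-Cauchy sequence
tending to 0 in `H`, whose form norms tend both to `‖u‖` and to 0. -/
theorem FormSpace.embed_injective (hcl : q.IsClosable) : Function.Injective (embed hq) := by
  rw [injective_iff_map_eq_zero]
  intro u hu
  obtain ⟨s, hs⟩ := exists_seq hq u
  have h1 := approximates_of_tendsto hq hs
  rw [hu] at h1
  have h2 := (hcl _ h1).add (h1.2.1.norm.pow 2)
  rw [norm_zero, zero_pow two_ne_zero, add_zero] at h2
  have h3 := (hs.norm).pow 2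
  simp only [UniformSpace.Completion.norm_coe, norm_sq] at h3
  have := tendsto_nhds_unique h3 h2
  simpa using this

theorem FormSpace.mem_closure_dom {f : H} : f ∈ q.closure.dom ↔ ∃ u, embed hq u = f := by
  constructor
  · rintro ⟨s, hs⟩
    obtain ⟨u, hu, -⟩ := exists_tendsto_of_approximates hq hs
    exact ⟨u, hu⟩
  · rintro ⟨u, rfl⟩
    obtain ⟨s, hs⟩ := exists_seq hq u
    exact ⟨_, approximates_of_tendsto hq hs⟩

/-- By injectivity of `embed`, every approximating sequence of `embed hq u` converges to the same
`u` in the completion. So all admissible pairs of sequences have one common limit, and the value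
chosen in `HForm.closure` must be that limit. -/
theorem FormSpace.closure_val (hcl : q.IsClosable) (u v : Compl hq) :
    q.closure.val (embed hq u) (embed hq v) = inner ℝ u v - inner ℝ (embed hq u) (embed hq v) := by
  have key : ∀ s r : ℕ → FormSpace hq, Tendsto (fun n => (s n : Compl hq)) atTop (𝓝 u) →
      Tendsto (fun n => (r n : Compl hq)) atTop (𝓝 v) →
      Tendsto (fun n => q.val (incl hq (s n)) (incl hq (r n))) atTop
        (𝓝 (inner ℝ u v - inner ℝ (embed hq u) (embed hq v))) := by
    intro s r hs hr
    have h1 := (hs.inner (𝕜 := ℝ) hr).sub ((((embed hq).continuous.tendsto u).comp hs).inner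
      (((embed hq).continuous.tendsto v).comp hr))
    refine h1.congr fun n => ?_
    simp only [Function.comp, embed_coe]
    have : inner ℝ (s n : Compl hq) (r n : Compl hq) = inner ℝ (s n) (r n) :=
      UniformSpace.Completion.inner_coe (𝕜 := ℝ) _ _
    rw [this, inner_def]
    ring
  have hex : ∃ a : ℝ, ∃ s r, q.Approximates s (embed hq u) ∧ q.Approximates r (embed hq v) ∧
      Tendsto (fun n => q.val (s n) (r n)) atTop (𝓝 a) := by
    obtain ⟨s, hs⟩ := exists_seq hq u
    obtain ⟨r, hr⟩ := exists_seq hq v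
    exact ⟨_, _, _, approximates_of_tendsto hq hs, approximates_of_tendsto hq hr, key s r hs hr⟩
  obtain ⟨s, r, hs, hr, hlim⟩ := Classical.epsilon_spec hex
  obtain ⟨u', hu', hsu⟩ := exists_tendsto_of_approximates hq hs
  obtain ⟨v', hv', hrv⟩ := exists_tendsto_of_approximates hq hr
  rw [embed_injective hq hcl hu'] at hsu
  rw [embed_injective hq hcl hv'] at hrv
  exact tendsto_nhds_unique hlim (key _ _ hsu hrv)

open ContinuousLinearMap in
/-- The resolvent `(1 + L)⁻¹` of the operator of the closure of `q`. -/
def FormSpace.resolvent : H →L[ℝ] H := (embed hq).comp (adjoint (embed hq))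

/-- Write `J` for the embedding of the completion. By definition of the adjoint, `u = J* f` solves
`⟨u, w⟩ = ⟨f, J w⟩` for all `w`, so `(1 + L)⁻¹ = J J*`. Symmetry and positivity are visible from
this form, and `‖J‖ ≤ 1` gives the upper bound. A vector orthogonal to the range is killed by `J
J*`, hence by `J*` as `J` is injective, hence is orthogonal to the dense form domain. -/
theorem FormSpace.isResolventOf (hcl : q.IsClosable) (hd : Dense q.dom) :
    IsResolventOf (resolvent hq) q.closure.opGraph := by
  have hinner : ∀ x y, inner ℝ (resolvent hq x) y =
      inner ℝ (ContinuousLinearMap.adjoint (embed hq) x) (ContinuousLinearMap.adjoint (embed hq) y) := by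
    intro x y
    rw [ContinuousLinearMap.adjoint_inner_right]
    rfl
  have hinj := embed_injective hq hcl
  have hnorm : ‖ContinuousLinearMap.adjoint (embed hq)‖ ≤ 1 := by
    rw [LinearIsometryEquiv.norm_map]
    exact ContinuousLinearMap.opNorm_le_bound _ zero_le_one fun u => by
      simpa using norm_embed_le hq u
  refine ⟨⟨fun x y => ?_, fun x => ?_, fun x => ?_⟩, ?_, fun f g => ?_⟩
  · rw [hinner, real_inner_comm, ← hinner, real_inner_comm]
  · rw [hinner]; exact real_inner_self_nonneg
  · rw [hinner, real_inner_self_eq_norm_sq]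
    gcongr
    simpa using ContinuousLinearMap.le_of_opNorm_le _ hnorm x
  · have : (LinearMap.range (resolvent hq).toLinearMap).topologicalClosure = ⊤ := by
      rw [Submodule.topologicalClosure_eq_top_iff, Submodule.eq_bot_iff]
      intro y hy
      have h1 : resolvent hq y = 0 := by
        rw [← inner_self_eq_zero (𝕜 := ℝ)]
        have h2 := (Submodule.mem_orthogonal _ _).1 hy (resolvent hq (resolvent hq y)) ⟨_, rfl⟩
        rw [hinner, real_inner_comm, ← hinner] at h2
        exact h2
      have h2 : ContinuousLinearMap.adjoint (embed hq) y = 0 := hinj (by rw [map_zero]; exact h1)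
      have h3 : ∀ v ∈ q.dom, inner ℝ v y = 0 := by
        intro v hv
        have e : embed hq ((FormSpace.mk hq hv) : Compl hq) = v := embed_coe hq _
        rw [← e, ← ContinuousLinearMap.adjoint_inner_right, h2, inner_zero_right]
      have h4 : Continuous fun v : H => inner ℝ v y := by fun_prop
      have h5 := congrFun (Continuous.ext_on hd h4 (continuous_const (y := (0 : ℝ))) h3) y
      exact inner_self_eq_zero.1 h5
    rw [Submodule.eq_top_iff'] at this
    intro y
    exact this y
  · constructor
    · rintro ⟨hf, h⟩
      obtain ⟨u, rfl⟩ := (mem_closure_dom hq).1 hf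
      have : u = ContinuousLinearMap.adjoint (embed hq) (embed hq u + g) := by
        refine ext_inner_right ℝ fun w => ?_
        have h1 := h _ ((mem_closure_dom hq).2 ⟨w, rfl⟩)
        rw [closure_val hq hcl] at h1
        rw [ContinuousLinearMap.adjoint_inner_left, inner_add_left]
        linarith
      exact congrArg (embed hq) this
    · intro hf
      set u := ContinuousLinearMap.adjoint (embed hq) (f + g) with hu
      have hfu : embed hq u = f := hf.symm
      refine ⟨(mem_closure_dom hq).2 ⟨u, hfu⟩, fun v hv => ?_⟩
      obtain ⟨w, rfl⟩ := (mem_closure_dom hq).1 hv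
      have h1 : inner ℝ u w = inner ℝ (f + g) (embed hq w) := by
        rw [hu, ContinuousLinearMap.adjoint_inner_left]
      rw [← hfu, closure_val hq hcl, h1, hfu, inner_add_left]
      ring

/-- Completing the square. The functional `q[v] + ‖v‖² - 2⟨f, v⟩` has infimum `-⟨f, B f⟩`, and the
right side is the excess of `v` over it. -/
theorem FormSpace.norm_sub_resolvent_sq (v : FormSpace hq) (f : H) :
    ‖(v : Compl hq) - ContinuousLinearMap.adjoint (embed hq) f‖ ^ 2 =
      q.val (incl hq v) (incl hq v) + ‖incl hq v‖ ^ 2 - 2 * inner ℝ f (incl hq v) +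
        inner ℝ f (resolvent hq f) := by
  rw [norm_sub_sq_real, UniformSpace.Completion.norm_coe, norm_sq,
    ContinuousLinearMap.adjoint_inner_right, embed_coe,
    ← real_inner_self_eq_norm_sq (ContinuousLinearMap.adjoint (embed hq) f),
    ContinuousLinearMap.adjoint_inner_left, real_inner_comm f]
  rfl

theorem FormSpace.norm_sub_resolvent_sq_le {v : H} (hv : v ∈ q.dom) (f : H) :
    ‖v - resolvent hq f‖ ^ 2 ≤
      q.val v v + ‖v‖ ^ 2 - 2 * inner ℝ f v + inner ℝ f (resolvent hq f) := by
  have h := norm_sub_resolvent_sq hq (FormSpace.mk hq hv) f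
  have e : embed hq (((FormSpace.mk hq hv) : Compl hq) -
      ContinuousLinearMap.adjoint (embed hq) f) = v - resolvent hq f := by
    rw [map_sub, embed_coe]; rfl
  refine le_trans ?_ h.le
  rw [← e]
  gcongr
  exact norm_embed_le hq _

theorem FormSpace.exists_near_resolvent (f : H) {ε : ℝ} (hε : 0 < ε) :
    ∃ v ∈ q.dom, q.val v v + ‖v‖ ^ 2 - 2 * inner ℝ f v + inner ℝ f (resolvent hq f) < ε := by
  obtain ⟨s, hs⟩ := exists_seq hq (ContinuousLinearMap.adjoint (embed hq) f)
  have h1 := (tendsto_iff_norm_sub_tendsto_zero.1 hs).pow 2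
  rw [zero_pow two_ne_zero] at h1
  obtain ⟨n, hn⟩ := (h1.eventually (gt_mem_nhds hε)).exists
  rw [norm_sub_resolvent_sq] at hn
  exact ⟨incl hq (s n), incl_mem hq _, hn⟩

/-- Closed forms. -/
def HForm.IsClosed (q : HForm H) : Prop :=
  ∀ s f, q.Approximates s f →
    f ∈ q.dom ∧ Tendsto (fun n => q.val (s n - f) (s n - f)) atTop (𝓝 0)

omit [InnerProductSpace ℝ H] [CompleteSpace H] in
theorem HForm.IsClosed.isClosable (h : q.IsClosed) : q.IsClosable := fun s hs => by
  simpa using (h s 0 hs).2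

omit [CompleteSpace H] in
theorem HForm.IsNonneg.val_zero (hq : q.IsNonneg) : q.val 0 0 = 0 := by
  simpa using hq.smul_left 0 0 hq.zero_mem 0 hq.zero_mem

theorem HForm.IsNonneg.closure_val_eq (hq : q.IsNonneg) (hcl : q.IsClosable) {f g : H}
    (hf : f ∈ q.dom) (hg : g ∈ q.dom) : q.closure.val f g = q.val f g := by
  have h := FormSpace.closure_val hq hcl ((FormSpace.mk hq hf) : FormSpace.Compl hq)
    ((FormSpace.mk hq hg) : FormSpace.Compl hq)
  rw [FormSpace.embed_coe, FormSpace.embed_coe] at h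
  have h2 : inner ℝ ((FormSpace.mk hq hf) : FormSpace.Compl hq)
    ((FormSpace.mk hq hg) : FormSpace.Compl hq) =
      inner ℝ (FormSpace.mk hq hf) (FormSpace.mk hq hg) :=
    UniformSpace.Completion.inner_coe _ _
  rw [h2, FormSpace.inner_def] at h
  rw [FormSpace.incl_mk, FormSpace.incl_mk] at h
  linarith

theorem HForm.IsNonneg.isResolventOf_of_isClosed (hq : q.IsNonneg) (hc : q.IsClosed)
    (hd : Dense q.dom) : IsResolventOf (FormSpace.resolvent hq) q.opGraph := by
  have h := FormSpace.isResolventOf hq hc.isClosable hd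
  have hdom : q.closure.dom = q.dom := by
    ext f
    constructor
    · rintro ⟨s, hs⟩
      exact (hc s f hs).1
    · intro hf
      refine ⟨fun _ => f, fun _ => hf, tendsto_const_nhds, ?_⟩
      simp only [sub_self, hq.val_zero]
      exact tendsto_const_nhds
  have hg : q.closure.opGraph = q.opGraph := by
    ext f g
    unfold HForm.opGraph
    rw [hdom]
    refine and_congr_right fun hf => forall₂_congr fun v hv => ?_
    rw [hq.closure_val_eq hc.isClosable hf hv]
  rwa [hg] at h

/-- Monotone convergence from above of forms implies strong resolvent convergence to the
closure of the limit. -/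
theorem FormSpace.tendsto_resolvent {qn : ℕ → HForm H} (hqn : ∀ n, (qn n).IsNonneg)
    (hcn : ∀ n, (qn n).IsClosed) (hdn : ∀ n, Dense (qn n).dom)
    (hdom : ∀ n, (qn n).dom = q.dom) (hle : ∀ n, ∀ v ∈ q.dom, q.val v v ≤ (qn n).val v v)
    (hlim : ∀ v ∈ q.dom, Tendsto (fun n => (qn n).val v v) atTop (𝓝 (q.val v v))) (f : H) :
    Tendsto (fun n => resolvent (hqn n) f) atTop (𝓝 (resolvent hq f)) := by
  set u := resolvent hq f
  -- The excess of `w = resolvent (hqn n) f` for `q` controls the left side. Since `q ≤ qn n` and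
  -- `w` minimises the functional of `qn n`, it is at most the excess computed with `qn n` at an
  -- arbitrary `v`.
  have key : ∀ n, ∀ v ∈ q.dom, ‖resolvent (hqn n) f - u‖ ^ 2 ≤
      (qn n).val v v + ‖v‖ ^ 2 - 2 * inner ℝ f v + inner ℝ f u := by
    intro n v hv
    set w := resolvent (hqn n) f
    have hr := (hqn n).isResolventOf_of_isClosed (hcn n) (hdn n)
    have hg : (qn n).opGraph w (f - w) := (hr.graph_iff _ _).2 (by simp [w])
    have hw : w ∈ q.dom := hdom n ▸ hg.1
    have h1 := hg.2 w hg.1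
    have h2 := norm_sub_resolvent_sq_le hq hw f
    have h3 := hle n w hw
    have h4 := norm_sub_resolvent_sq_le (hqn n) (v := v) (by rw [hdom]; exact hv) f
    have h5 := sq_nonneg ‖v - resolvent (hqn n) f‖
    rw [inner_sub_left, real_inner_self_eq_norm_sq] at h1
    change _ ≤ _ - _ + inner ℝ f w at h4
    linarith
  rw [tendsto_iff_norm_sub_tendsto_zero]
  suffices h : Tendsto (fun n => ‖resolvent (hqn n) f - u‖ ^ 2) atTop (𝓝 0) by
    have := h.sqrt
    simpa [Real.sqrt_sq (norm_nonneg _)] using this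
  rw [Metric.tendsto_nhds]
  intro ε hε
  -- The minimiser `u` may belong only to the domain of the closure, where `qn n` is not available;
  -- a near-minimiser in `q.dom` takes its place.
  obtain ⟨v, hv, hvε⟩ := exists_near_resolvent hq f hε
  have h1 := (((hlim v hv).add_const (‖v‖ ^ 2)).sub_const (2 * inner ℝ f v)).add_const (inner ℝ f u)
  filter_upwards [h1.eventually (gt_mem_nhds hvε)] with n hn
  rw [dist_zero_right, Real.norm_of_nonneg (sq_nonneg _)]
  exact (key n v hv).trans_lt hn

end Forms

end

noncomputable section

/-! ### The fractional energy: bilinearity, contractions, Fatou, a Nash-type inequality and test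
functions. -/

section FractionalEnergy

variable {d : ℕ} {α : ℝ}

theorem fracConst_pos (hα : 0 < α) (hα2 : α < 2) : 0 < fracConst d α := by
  have h1 : 0 < Real.Gamma (((d : ℝ) + α) / 2) := Real.Gamma_pos_of_pos (by positivity)
  have h2 : 0 < Real.Gamma (1 - α / 2) := Real.Gamma_pos_of_pos (by linarith)
  have := Real.pi_pos
  unfold fracConst
  positivity

/-- The weighted difference quotient `(f(x) - f(y)) / |x - y|^{(d+α)/2}`. -/
def diffQuot (α : ℝ) (f : Rd d → ℝ) (z : Rd d × Rd d) : ℝ :=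
  (f z.1 - f z.2) / ‖z.1 - z.2‖ ^ (((d : ℝ) + α) / 2)

theorem mul_div_rpow_eq {a b r p : ℝ} (hr : 0 ≤ r) :
    a * b / r ^ p = a / r ^ (p / 2) * (b / r ^ (p / 2)) := by
  rw [div_mul_div_comm, ← sq, ← Real.rpow_natCast, ← Real.rpow_mul hr]
  norm_num

theorem diffQuot_mul (f g : Rd d → ℝ) (z : Rd d × Rd d) :
    diffQuot α f z * diffQuot α g z =
      (f z.1 - f z.2) * (g z.1 - g z.2) / ‖z.1 - z.2‖ ^ ((d : ℝ) + α) :=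
  (mul_div_rpow_eq (norm_nonneg _)).symm

theorem diffQuot_sq (f : Rd d → ℝ) (z : Rd d × Rd d) :
    diffQuot α f z ^ 2 = (f z.1 - f z.2) ^ 2 / ‖z.1 - z.2‖ ^ ((d : ℝ) + α) := by
  rw [sq, diffQuot_mul, ← sq]

theorem fracEnergy_eq (α : ℝ) (f : Rd d → ℝ) : fracEnergy α f =
    ENNReal.ofReal (fracConst d α / 2) * ∫⁻ z, ENNReal.ofReal (diffQuot α f z ^ 2) := by
  simp only [fracEnergy, diffQuot_sq]

theorem fracForm_eq (α : ℝ) (f g : Rd d → ℝ) : fracForm α f g =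
    fracConst d α / 2 * ∫ z, diffQuot α f z * diffQuot α g z := by
  simp only [fracForm, diffQuot_mul]

theorem ae_comp_fst {p : Rd d → Prop} (h : ∀ᵐ x, p x) : ∀ᵐ z : Rd d × Rd d, p z.1 :=
  Measure.quasiMeasurePreserving_fst.ae h

theorem ae_comp_snd {p : Rd d → Prop} (h : ∀ᵐ x, p x) : ∀ᵐ z : Rd d × Rd d, p z.2 :=
  Measure.quasiMeasurePreserving_snd.ae h

theorem diffQuot_ae_eq {f g : Rd d → ℝ} (h : f =ᵐ[volume] g) :
    diffQuot α f =ᵐ[volume] diffQuot α g := by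
  filter_upwards [ae_comp_fst h, ae_comp_snd h] with z h1 h2
  rw [diffQuot, diffQuot, h1, h2]

theorem aestronglyMeasurable_diffQuot {f : Rd d → ℝ} (hf : AEStronglyMeasurable f volume) :
    AEStronglyMeasurable (diffQuot α f) volume := by
  have h1 : AEStronglyMeasurable (fun z : Rd d × Rd d => f z.1 - f z.2)
      (volume : Measure (Rd d × Rd d)) := hf.comp_fst.sub hf.comp_snd
  have h2 : Measurable fun z : Rd d × Rd d => ‖z.1 - z.2‖ ^ (((d : ℝ) + α) / 2) := by fun_prop
  exact (h1.aemeasurable.div h2.aemeasurable).aestronglyMeasurable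

theorem fracEnergy_congr {f g : Rd d → ℝ} (h : f =ᵐ[volume] g) :
    fracEnergy α f = fracEnergy α g := by
  rw [fracEnergy_eq, fracEnergy_eq]
  congr 1
  refine lintegral_congr_ae ?_
  filter_upwards [diffQuot_ae_eq (α := α) h] with z hz
  rw [hz]

theorem fracForm_congr {f f' g g' : Rd d → ℝ} (h : f =ᵐ[volume] f') (h' : g =ᵐ[volume] g') :
    fracForm α f g = fracForm α f' g' := by
  rw [fracForm_eq, fracForm_eq]
  congr 1
  refine integral_congr_ae ?_
  filter_upwards [diffQuot_ae_eq (α := α) h, diffQuot_ae_eq (α := α) h'] with z hz hz'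
  rw [hz, hz']

theorem memLp_two_iff_lintegral_sq {X : Type*} [MeasurableSpace X] {μ : Measure X} {f : X → ℝ}
    (hf : AEStronglyMeasurable f μ) :
    MemLp f 2 μ ↔ ∫⁻ x, ENNReal.ofReal (f x ^ 2) ∂μ < ⊤ := by
  rw [memLp_two_iff_integrable_sq hf, Integrable, hasFiniteIntegral_iff_ofReal
    (Eventually.of_forall fun x => sq_nonneg _)]
  exact and_iff_right (hf.pow 2)

theorem memFracSobolev_iff (hα : 0 < α) (hα2 : α < 2) {f : Rd d → ℝ} :
    MemFracSobolev α f ↔ MemLp f 2 volume ∧ MemLp (diffQuot α f) 2 volume := by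
  refine and_congr_right fun hf => ?_
  rw [memLp_two_iff_lintegral_sq (aestronglyMeasurable_diffQuot hf.1), fracEnergy_eq]
  have h0 : ENNReal.ofReal (fracConst d α / 2) ≠ 0 := by
    have := fracConst_pos (d := d) hα hα2
    simpa using this
  constructor
  · exact fun h => ENNReal.lt_top_of_mul_ne_top_right h.ne h0
  · exact fun h => ENNReal.mul_lt_top ENNReal.ofReal_lt_top h

theorem MemFracSobolev.congr {f g : Rd d → ℝ} (hf : MemFracSobolev α f) (h : f =ᵐ[volume] g) :
    MemFracSobolev α g :=
  ⟨hf.1.ae_eq h, by rw [← fracEnergy_congr h]; exact hf.2⟩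

theorem diffQuot_add (f g : Rd d → ℝ) : diffQuot α (f + g) = diffQuot α f + diffQuot α g := by
  funext z
  simp only [diffQuot, Pi.add_apply]
  ring

theorem diffQuot_smul (r : ℝ) (f : Rd d → ℝ) : diffQuot α (r • f) = r • diffQuot α f := by
  funext z
  simp only [diffQuot, Pi.smul_apply, smul_eq_mul]
  ring

section

variable (hα : 0 < α) (hα2 : α < 2)
include hα hα2

theorem MemFracSobolev.add {f g : Rd d → ℝ} (hf : MemFracSobolev α f) (hg : MemFracSobolev α g) :
    MemFracSobolev α (f + g) := by
  rw [memFracSobolev_iff hα hα2] at *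
  exact ⟨hf.1.add hg.1, by rw [diffQuot_add]; exact hf.2.add hg.2⟩

theorem MemFracSobolev.smul {f : Rd d → ℝ} (hf : MemFracSobolev α f) (r : ℝ) :
    MemFracSobolev α (r • f) := by
  rw [memFracSobolev_iff hα hα2] at *
  exact ⟨hf.1.const_smul r, by rw [diffQuot_smul]; exact hf.2.const_smul r⟩

theorem MemFracSobolev.integrable_mul {f g : Rd d → ℝ} (hf : MemFracSobolev α f)
    (hg : MemFracSobolev α g) : Integrable (fun z => diffQuot α f z * diffQuot α g z) volume := by
  rw [memFracSobolev_iff hα hα2] at *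
  exact hf.2.integrable_mul hg.2

theorem fracForm_add_left {f g h : Rd d → ℝ} (hf : MemFracSobolev α f) (hg : MemFracSobolev α g)
    (hh : MemFracSobolev α h) : fracForm α (f + g) h = fracForm α f h + fracForm α g h := by
  rw [fracForm_eq, fracForm_eq, fracForm_eq, ← mul_add,
    ← integral_add (hf.integrable_mul hα hα2 hh) (hg.integrable_mul hα hα2 hh)]
  congr 2
  funext z
  rw [diffQuot_add, Pi.add_apply, add_mul]

theorem ofReal_fracForm_self {f : Rd d → ℝ} (hf : MemFracSobolev α f) :
    ENNReal.ofReal (fracForm α f f) = fracEnergy α f := by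
  have h0 := fracConst_pos (d := d) hα hα2
  rw [fracForm_eq, fracEnergy_eq, ENNReal.ofReal_mul (by positivity),
    ofReal_integral_eq_lintegral_ofReal (hf.integrable_mul hα hα2 hf)
      (Eventually.of_forall fun z => mul_self_nonneg _)]
  simp only [sq]

theorem fracForm_self_nonneg (f : Rd d → ℝ) : 0 ≤ fracForm α f f := by
  have h0 := fracConst_pos (d := d) hα hα2
  rw [fracForm_eq]
  exact mul_nonneg (by positivity) (integral_nonneg fun z => mul_self_nonneg _)

end

theorem fracForm_comm (f g : Rd d → ℝ) : fracForm α f g = fracForm α g f := by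
  simp only [fracForm_eq, mul_comm]

theorem fracForm_smul_left (r : ℝ) (f g : Rd d → ℝ) :
    fracForm α (r • f) g = r * fracForm α f g := by
  have h : ∀ z, diffQuot α (r • f) z * diffQuot α g z = r * (diffQuot α f z * diffQuot α g z) := by
    intro z
    rw [diffQuot_smul, Pi.smul_apply, smul_eq_mul, mul_assoc]
  rw [fracForm_eq, fracForm_eq]
  simp only [h]
  rw [integral_const_mul]
  ring

/-! ### Normal contractions -/

/-- Normal contractions of the line. -/
structure IsNormalContraction (φ : ℝ → ℝ) : Prop where
  zero : φ 0 = 0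
  le : ∀ a b, |φ a - φ b| ≤ |a - b|

theorem IsNormalContraction.continuous {φ : ℝ → ℝ} (hφ : IsNormalContraction φ) :
    Continuous φ :=
  (LipschitzWith.of_dist_le_mul (K := 1) fun a b => by
    simpa [Real.dist_eq] using hφ.le a b).continuous

theorem IsNormalContraction.abs_le {φ : ℝ → ℝ} (hφ : IsNormalContraction φ) (a : ℝ) :
    |φ a| ≤ |a| := by
  simpa [hφ.zero] using hφ.le a 0

theorem IsNormalContraction.diffQuot_sq_le {φ : ℝ → ℝ} (hφ : IsNormalContraction φ)
    (f : Rd d → ℝ) (z : Rd d × Rd d) :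
    diffQuot α (fun x => φ (f x)) z ^ 2 ≤ diffQuot α f z ^ 2 := by
  rw [diffQuot_sq, diffQuot_sq]
  have := sq_le_sq.2 (hφ.le (f z.1) (f z.2))
  gcongr

theorem IsNormalContraction.fracEnergy_le {φ : ℝ → ℝ} (hφ : IsNormalContraction φ)
    (f : Rd d → ℝ) : fracEnergy α (fun x => φ (f x)) ≤ fracEnergy α f := by
  rw [fracEnergy_eq, fracEnergy_eq]
  exact mul_le_mul_right (lintegral_mono fun z =>
    ENNReal.ofReal_le_ofReal (hφ.diffQuot_sq_le f z)) _

theorem IsNormalContraction.memLp {X : Type*} [MeasurableSpace X] {μ : Measure X} {φ : ℝ → ℝ}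
    (hφ : IsNormalContraction φ) {f : X → ℝ} (hf : MemLp f 2 μ) : MemLp (fun x => φ (f x)) 2 μ :=
  hf.of_le (hφ.continuous.comp_aestronglyMeasurable hf.1)
    (Eventually.of_forall fun x => hφ.abs_le (f x))

theorem IsNormalContraction.memFracSobolev {φ : ℝ → ℝ} (hφ : IsNormalContraction φ)
    {f : Rd d → ℝ} (hf : MemFracSobolev α f) : MemFracSobolev α (fun x => φ (f x)) :=
  ⟨hφ.memLp hf.1, (hφ.fracEnergy_le f).trans_lt hf.2⟩

/-- Pointwise, `(φ a - φ b)² ≤ (a - b)(φ a - φ b)` for `φ` increasing and 1-Lipschitz. This is what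
makes `φ(u)` a good test function in the equation for `u`. -/
theorem fracForm_contraction_le (hα : 0 < α) (hα2 : α < 2) {φ : ℝ → ℝ}
    (hφ : IsNormalContraction φ) (hmono : Monotone φ) {f : Rd d → ℝ} (hf : MemFracSobolev α f) :
    fracForm α (fun x => φ (f x)) (fun x => φ (f x)) ≤ fracForm α f (fun x => φ (f x)) := by
  have h0 := fracConst_pos (d := d) hα hα2
  have hφf := hφ.memFracSobolev hf
  rw [fracForm_eq, fracForm_eq]
  refine mul_le_mul_of_nonneg_left ?_ (by positivity)
  refine integral_mono (hφf.integrable_mul hα hα2 hφf) (hf.integrable_mul hα hα2 hφf) fun z => ?_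
  change diffQuot α _ z * diffQuot α _ z ≤ diffQuot α f z * diffQuot α _ z
  rw [diffQuot_mul, diffQuot_mul]
  gcongr ?_ / _
  have h1 := hφ.le (f z.1) (f z.2)
  rcases le_total (f z.1) (f z.2) with h | h
  · have h2 := hmono h
    rw [abs_of_nonpos (sub_nonpos.2 h2), abs_of_nonpos (sub_nonpos.2 h)] at h1
    nlinarith
  · have h2 := hmono h
    rw [abs_of_nonneg (sub_nonneg.2 h2), abs_of_nonneg (sub_nonneg.2 h)] at h1
    nlinarith

/-! ### Lower semicontinuity -/

theorem lintegral_ofReal_sq_le_liminf {X : Type*} [MeasurableSpace X] {μ : Measure X}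
    {f : ℕ → X → ℝ} {g : X → ℝ} (hf : ∀ n, AEStronglyMeasurable (f n) μ)
    (hlim : ∀ᵐ x ∂μ, Tendsto (fun n => f n x) atTop (𝓝 (g x))) :
    ∫⁻ x, ENNReal.ofReal (g x ^ 2) ∂μ ≤
      liminf (fun n => ∫⁻ x, ENNReal.ofReal (f n x ^ 2) ∂μ) atTop := by
  calc _ = ∫⁻ x, liminf (fun n => ENNReal.ofReal (f n x ^ 2)) atTop ∂μ := by
        refine lintegral_congr_ae ?_
        filter_upwards [hlim] with x hx
        exact ((ENNReal.continuous_ofReal.tendsto _).comp (hx.pow 2)).liminf_eq.symm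
    _ ≤ _ := lintegral_liminf_le' fun n => ((hf n).aemeasurable.pow_const 2).ennreal_ofReal

theorem fracEnergy_le_liminf {f : ℕ → Rd d → ℝ} {g : Rd d → ℝ}
    (hf : ∀ n, AEStronglyMeasurable (f n) volume)
    (hlim : ∀ᵐ x, Tendsto (fun n => f n x) atTop (𝓝 (g x))) :
    fracEnergy α g ≤ liminf (fun n => fracEnergy α (f n)) atTop := by
  simp only [fracEnergy_eq]
  have h1 : ∀ᵐ z : Rd d × Rd d, Tendsto (fun n => diffQuot α (f n) z) atTop
      (𝓝 (diffQuot α g z)) := by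
    filter_upwards [ae_comp_fst hlim, ae_comp_snd hlim] with z h1 h2
    exact (h1.sub h2).div_const _
  have h2 := lintegral_ofReal_sq_le_liminf (fun n => aestronglyMeasurable_diffQuot (hf n)) h1
  refine (mul_le_mul_right h2 _).trans (le_of_eq ?_)
  rw [ENNReal.liminf_const_mul_of_ne_top ENNReal.ofReal_ne_top]

/-! ### A Nash-type inequality -/

/-- Integrate `f(x)² + f(y)² = (f(x)-f(y))² + 2 f(x) f(y)` over `|x - y| < r`. The left side gives
`2 |B_r| ‖f‖²`, the squared difference costs `r^{d+α}` against the singular kernel, and the product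
is at most the square of the `L¹` norm. -/
theorem lintegral_sq_le_nash (hα : 0 < α) {f : Rd d → ℝ} (hf : AEStronglyMeasurable f volume)
    {r : ℝ} (hr : 0 < r) :
    2 * (volume (Metric.ball (0 : Rd d) r) * ∫⁻ x, ENNReal.ofReal (f x ^ 2)) ≤
      ENNReal.ofReal (r ^ ((d : ℝ) + α)) * (∫⁻ z, ENNReal.ofReal (diffQuot α f z ^ 2)) +
        2 * (∫⁻ x, ENNReal.ofReal |f x|) ^ 2 := by
  set S : Set (Rd d × Rd d) := {z | dist z.1 z.2 < r}
  have hS : MeasurableSet S := measurableSet_lt (by fun_prop) measurable_const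
  have hSx : ∀ x : Rd d, Prod.mk x ⁻¹' S = Metric.ball x r := fun x => by
    ext y; simp [S, dist_comm]
  have hfm : AEMeasurable (fun x => ENNReal.ofReal (f x ^ 2)) volume :=
    (hf.aemeasurable.pow_const 2).ennreal_ofReal
  have h1 : ∫⁻ z in S, ENNReal.ofReal (f z.1 ^ 2) =
      volume (Metric.ball (0 : Rd d) r) * ∫⁻ x, ENNReal.ofReal (f x ^ 2) := by
    rw [← lintegral_indicator hS, Measure.volume_eq_prod, lintegral_prod _
      ((hfm.comp_fst).indicator hS), ← lintegral_const_mul'' _ hfm]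
    refine lintegral_congr fun x => ?_
    have : (fun y => S.indicator (fun z : Rd d × Rd d => ENNReal.ofReal (f z.1 ^ 2)) (x, y)) =
        (Metric.ball x r).indicator fun _ => ENNReal.ofReal (f x ^ 2) := by
      funext y
      rw [← hSx]
      rfl
    rw [this, lintegral_indicator_const measurableSet_ball, mul_comm, Measure.addHaar_ball_center]
  have h2 : ∫⁻ z in S, ENNReal.ofReal (f z.2 ^ 2) = ∫⁻ z in S, ENNReal.ofReal (f z.1 ^ 2) := by
    rw [← lintegral_indicator hS, ← lintegral_indicator hS, Measure.volume_eq_prod,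
      ← lintegral_prod_swap]
    refine lintegral_congr fun z => ?_
    simp only [indicator, S, mem_ofPred_eq, Prod.fst_swap, Prod.snd_swap, dist_comm]
  have h3 : ∫⁻ z in S, ENNReal.ofReal (|f z.1| * |f z.2|) ≤ (∫⁻ x, ENNReal.ofReal |f x|) ^ 2 := by
    refine (setLIntegral_le_lintegral _ _).trans (le_of_eq ?_)
    simp only [ENNReal.ofReal_mul (abs_nonneg _)]
    have hm : AEMeasurable (fun x => ENNReal.ofReal |f x|) volume :=
      hf.norm.aemeasurable.ennreal_ofReal
    rw [Measure.volume_eq_prod, lintegral_prod_mul hm hm, sq]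
  have hdm : AEMeasurable (fun z => ENNReal.ofReal (diffQuot α f z ^ 2)) volume :=
    ((aestronglyMeasurable_diffQuot hf).aemeasurable.pow_const 2).ennreal_ofReal
  have h4 : ∀ z ∈ S, ENNReal.ofReal (f z.1 ^ 2) + ENNReal.ofReal (f z.2 ^ 2) ≤
      ENNReal.ofReal (r ^ ((d : ℝ) + α)) * ENNReal.ofReal (diffQuot α f z ^ 2) +
        2 * ENNReal.ofReal (|f z.1| * |f z.2|) := by
    intro z hz
    have hz' : ‖z.1 - z.2‖ < r := by rw [← dist_eq_norm]; exact hz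
    have e2 : (2 : ENNReal) = ENNReal.ofReal 2 := by simp
    rw [e2, ← ENNReal.ofReal_mul (by positivity), ← ENNReal.ofReal_mul (by positivity),
      ← ENNReal.ofReal_add (by positivity) (by positivity),
      ← ENNReal.ofReal_add (by positivity) (by positivity)]
    refine ENNReal.ofReal_le_ofReal ?_
    have h5 : (f z.1 - f z.2) ^ 2 ≤ r ^ ((d : ℝ) + α) * diffQuot α f z ^ 2 := by
      rw [diffQuot_sq]
      rcases (norm_nonneg (z.1 - z.2)).eq_or_lt with h | h
      · have : z.1 = z.2 := sub_eq_zero.1 (norm_eq_zero.1 h.symm)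
        simp [this]
      · rw [mul_div_assoc', le_div_iff₀ (by positivity), mul_comm]
        gcongr
    have h6 : f z.1 * f z.2 ≤ |f z.1| * |f z.2| := by rw [← abs_mul]; exact le_abs_self _
    nlinarith
  calc 2 * (volume (Metric.ball (0 : Rd d) r) * ∫⁻ x, ENNReal.ofReal (f x ^ 2))
      = ∫⁻ z in S, (ENNReal.ofReal (f z.1 ^ 2) + ENNReal.ofReal (f z.2 ^ 2)) := by
        have hm : AEMeasurable (fun z : Rd d × Rd d => ENNReal.ofReal (f z.1 ^ 2))
            (volume.restrict S) := (hfm.comp_fst (ν := volume)).restrict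
        rw [lintegral_add_left' hm, h2, h1, two_mul]
    _ ≤ ∫⁻ z in S, (ENNReal.ofReal (r ^ ((d : ℝ) + α)) * ENNReal.ofReal (diffQuot α f z ^ 2) +
        2 * ENNReal.ofReal (|f z.1| * |f z.2|)) := setLIntegral_mono' hS h4
    _ = ENNReal.ofReal (r ^ ((d : ℝ) + α)) * (∫⁻ z in S, ENNReal.ofReal (diffQuot α f z ^ 2)) +
        2 * ∫⁻ z in S, ENNReal.ofReal (|f z.1| * |f z.2|) := by
        rw [lintegral_add_left' ((hdm.const_mul _).restrict (s := S)),
          lintegral_const_mul'' _ (hdm.restrict (s := S)),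
          lintegral_const_mul' _ _ (by simp)]
    _ ≤ _ := by
        gcongr
        exact Measure.restrict_le_self

/-! ### Test functions -/

/-- In polar coordinates the integrand is `r^{1-α}` near 0, where `α < 2` is needed, and `r^{-1-α}`
at infinity, where `α > 0` is. -/
theorem integrable_min_one_sq_div (hα : 0 < α) (hα2 : α < 2) (hd : 0 < d) :
    Integrable (fun z : Rd d => min 1 (‖z‖ ^ 2) / ‖z‖ ^ ((d : ℝ) + α)) volume := by
  have : Nontrivial (Rd d) := by
    have : Nonempty (Fin d) := ⟨⟨0, hd⟩⟩
    infer_instance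
  rw [integrable_fun_norm_addHaar volume (f := fun r => min 1 (r ^ 2) / r ^ ((d : ℝ) + α)),
    finrank_euclideanSpace_fin]
  have e : ∀ r ∈ Ioi (0 : ℝ), r ^ (d - 1) • (min 1 (r ^ 2) / r ^ ((d : ℝ) + α)) =
      min 1 (r ^ 2) * r ^ (-1 - α) := by
    intro r hr
    have hr' : 0 < r := hr
    have h1 : r ^ (d - 1) = r ^ ((d : ℝ) - 1) := by
      rw [← Real.rpow_natCast, Nat.cast_sub (by omega)]; simp
    rw [smul_eq_mul, h1, div_eq_mul_inv, ← Real.rpow_neg hr'.le, mul_left_comm,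
      ← Real.rpow_add hr']
    congr 2
    ring
  rw [integrableOn_congr_fun e measurableSet_Ioi, ← Ioc_union_Ioi_eq_Ioi zero_le_one]
  refine IntegrableOn.union ?_ ?_
  · have h1 : IntegrableOn (fun r : ℝ => r ^ (1 - α)) (Ioc 0 1) := by
      rw [← intervalIntegrable_iff_integrableOn_Ioc_of_le zero_le_one]
      exact intervalIntegral.intervalIntegrable_rpow' (by linarith)
    refine h1.congr_fun (fun r hr => ?_) measurableSet_Ioc
    have h2 : r ^ 2 ≤ 1 := pow_le_one₀ hr.1.le hr.2
    rw [min_eq_right h2, ← Real.rpow_natCast, ← Real.rpow_add hr.1]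
    norm_num
    ring_nf
  · have h1 : IntegrableOn (fun r : ℝ => r ^ (-1 - α)) (Ioi 1) :=
      integrableOn_Ioi_rpow_of_lt (by linarith) one_pos
    refine h1.congr_fun (fun r hr => ?_) measurableSet_Ioi
    have h2 : 1 ≤ r ^ 2 := one_le_pow₀ (le_of_lt hr)
    rw [min_eq_left h2, one_mul]

/-- The Lipschitz bound handles small `|x - y|`, the sup bound large `|x - y|`; together they give
`K * min 1 |x - y|²`. The difference vanishes unless one of the two points lies in the support, and
integrating over the other point yields a translate of the integrable kernel. -/
theorem memFracSobolev_of_contDiff (hα : 0 < α) (hα2 : α < 2) (hd : 0 < d) {f : Rd d → ℝ}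
    (hf : ContDiff ℝ 1 f) (hs : HasCompactSupport f) : MemFracSobolev α f := by
  refine ⟨hf.continuous.memLp_of_hasCompactSupport hs, ?_⟩
  rw [fracEnergy_eq]
  refine ENNReal.mul_lt_top ENNReal.ofReal_lt_top ?_
  obtain ⟨L, hL⟩ := hf.lipschitzWith_of_hasCompactSupport hs one_ne_zero
  obtain ⟨M, hM⟩ := hs.exists_bound_of_continuous hf.continuous
  have hM0 : 0 ≤ M := (norm_nonneg _).trans (hM 0)
  set m : Rd d → ℝ := fun z => min 1 (‖z‖ ^ 2) / ‖z‖ ^ ((d : ℝ) + α)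
  set K : ℝ := (L : ℝ) ^ 2 + 4 * M ^ 2
  have hm := integrable_min_one_sq_div (d := d) hα hα2 hd
  have hm0 : ∀ z, 0 ≤ m z := fun z => by positivity
  have hmm : Measurable m := by fun_prop
  have hI : ∫⁻ z, ENNReal.ofReal (m z) < ⊤ := by
    rw [← hasFiniteIntegral_iff_ofReal (Eventually.of_forall hm0)]
    exact hm.2
  set T := tsupport f
  have hT : MeasurableSet T := (isClosed_tsupport f).measurableSet
  have hTf : ∀ x, x ∉ T → f x = 0 := fun x hx => image_eq_zero_of_notMem_tsupport hx
  set F : Rd d × Rd d → ENNReal := fun z =>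
    T.indicator (fun _ => 1) z.1 * (ENNReal.ofReal K * ENNReal.ofReal (m (z.1 - z.2)))
  have hF : Measurable F := by
    refine Measurable.mul ((measurable_const.indicator hT).comp measurable_fst) ?_
    exact ((hmm.comp (measurable_fst.sub measurable_snd)).ennreal_ofReal).const_mul _
  have key : ∀ z, ENNReal.ofReal (diffQuot α f z ^ 2) ≤ F z + F z.swap := by
    intro z
    by_cases hz : z.1 ∈ T ∨ z.2 ∈ T
    · have h1 : diffQuot α f z ^ 2 ≤ K * m (z.1 - z.2) := by
        rw [diffQuot_sq, mul_div_assoc']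
        gcongr
        have h2 : |f z.1 - f z.2| ≤ L * ‖z.1 - z.2‖ := by
          have := hL.dist_le_mul z.1 z.2
          rwa [Real.dist_eq, dist_eq_norm] at this
        have h3 : |f z.1 - f z.2| ≤ 2 * M := by
          have h4 := hM z.1
          have h5 := hM z.2
          rw [Real.norm_eq_abs] at h4 h5
          linarith [abs_sub (f z.1) (f z.2)]
        rcases min_choice 1 (‖z.1 - z.2‖ ^ 2) with h | h
        · rw [h, ← sq_abs, mul_one]
          nlinarith [abs_nonneg (f z.1 - f z.2), sq_nonneg (L : ℝ)]
        · rw [h, ← sq_abs]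
          have h6 := pow_le_pow_left₀ (abs_nonneg _) h2 2
          rw [mul_pow] at h6
          nlinarith [mul_nonneg (sq_nonneg M) (sq_nonneg ‖z.1 - z.2‖)]
      have h2 : ENNReal.ofReal (diffQuot α f z ^ 2) ≤
          ENNReal.ofReal K * ENNReal.ofReal (m (z.1 - z.2)) := by
        rw [← ENNReal.ofReal_mul (by positivity)]
        exact ENNReal.ofReal_le_ofReal h1
      have h3 : m (z.2 - z.1) = m (z.1 - z.2) := by simp only [m, norm_sub_rev]
      rcases hz with hz | hz
      · refine h2.trans (le_add_right ?_)
        simp [F, hz]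
      · refine h2.trans (le_add_left ?_)
        simp [F, hz, h3]
    · push Not at hz
      simp [diffQuot, hTf _ hz.1, hTf _ hz.2]
  have hFI : ∫⁻ z, F z < ⊤ := by
    rw [Measure.volume_eq_prod, lintegral_prod _ hF.aemeasurable]
    have : ∀ x, ∫⁻ y, F (x, y) =
        T.indicator (fun _ => ENNReal.ofReal K * ∫⁻ z, ENNReal.ofReal (m z)) x := by
      intro x
      have hmx : Measurable fun y => ENNReal.ofReal (m (x - y)) :=
        (hmm.comp (measurable_const.sub measurable_id)).ennreal_ofReal
      simp only [F]
      rw [lintegral_const_mul _ (hmx.const_mul _), lintegral_const_mul _ hmx,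
        lintegral_sub_left_eq_self (fun z => ENNReal.ofReal (m z)) x]
      by_cases hx : x ∈ T <;> simp [hx]
    simp only [this]
    rw [lintegral_indicator_const hT]
    exact ENNReal.mul_lt_top (ENNReal.mul_lt_top ENNReal.ofReal_lt_top hI)
      hs.measure_lt_top
  have hFI2 : ∫⁻ z : Rd d × Rd d, F z.swap = ∫⁻ z, F z := by
    rw [Measure.volume_eq_prod, lintegral_prod_swap]
  refine (lintegral_mono key).trans_lt ?_
  rw [lintegral_add_left hF, hFI2]
  exact ENNReal.add_lt_top.2 ⟨hFI, hFI⟩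

end FractionalEnergy

end

noncomputable section

/-! ### Capacity, quasi-continuity and completeness of `W_0(Ω)`. -/

section Capacity

variable {d : ℕ} {α : ℝ}

/-- The squared Sobolev norm `ℰ[f] + ‖f‖²`. -/
def sobolevSq (α : ℝ) (f : Rd d → ℝ) : ENNReal :=
  fracEnergy α f + ∫⁻ x, ENNReal.ofReal (f x ^ 2)

theorem sobolevSq_lt_top {f : Rd d → ℝ} (hf : MemFracSobolev α f) : sobolevSq α f < ⊤ :=
  ENNReal.add_lt_top.2 ⟨hf.2, (memLp_two_iff_lintegral_sq hf.1.1).1 hf.1⟩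

theorem memFracSobolev_of_sobolevSq {f : Rd d → ℝ} (hf : AEStronglyMeasurable f volume)
    (h : sobolevSq α f < ⊤) : MemFracSobolev α f :=
  ⟨(memLp_two_iff_lintegral_sq hf).2 (ENNReal.add_lt_top.1 h).2, (ENNReal.add_lt_top.1 h).1⟩

theorem sobolevSq_congr {f g : Rd d → ℝ} (h : f =ᵐ[volume] g) :
    sobolevSq α f = sobolevSq α g := by
  rw [sobolevSq, sobolevSq, fracEnergy_congr h]
  congr 1
  refine lintegral_congr_ae ?_
  filter_upwards [h] with x hx
  rw [hx]

theorem sobolevSq_smul (r : ℝ) (f : Rd d → ℝ) :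
    sobolevSq α (r • f) = ENNReal.ofReal (r ^ 2) * sobolevSq α f := by
  rw [sobolevSq, sobolevSq, mul_add, fracEnergy_eq, fracEnergy_eq, diffQuot_smul]
  simp only [Pi.smul_apply, smul_eq_mul, mul_pow, ENNReal.ofReal_mul (sq_nonneg r)]
  rw [lintegral_const_mul' _ _ ENNReal.ofReal_ne_top,
    lintegral_const_mul' _ _ ENNReal.ofReal_ne_top]
  ring

theorem IsNormalContraction.sobolevSq_le {φ : ℝ → ℝ} (hφ : IsNormalContraction φ)
    (f : Rd d → ℝ) : sobolevSq α (fun x => φ (f x)) ≤ sobolevSq α f :=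
  add_le_add (hφ.fracEnergy_le f) (lintegral_mono fun _ =>
    ENNReal.ofReal_le_ofReal (sq_le_sq.2 (hφ.abs_le _)))

theorem isNormalContraction_abs : IsNormalContraction fun x => |x| :=
  ⟨abs_zero, fun a b => abs_abs_sub_abs_le a b⟩

theorem isNormalContraction_clamp : IsNormalContraction fun x => max 0 (min 1 x) where
  zero := by simp
  le a b := by
    have h1 := abs_max_sub_max_le_max 0 (min 1 a) 0 (min 1 b)
    have h2 := abs_min_sub_min_le_max 1 a 1 b
    simp only [sub_self, abs_zero, abs_nonneg, sup_of_le_right] at h1 h2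
    exact h1.trans h2

/-- `|sup a - sup b|² ≤ sup |a_n - b_n|²`, which is at most the sum. Applied to the difference
quotients it bounds the energy of a countable supremum, and so gives subadditivity of the capacity.
-/
theorem ofReal_sq_iSup_sub_le {a b : ℕ → ℝ} (ha : ∀ n, a n ∈ Icc (0 : ℝ) 1)
    (hb : ∀ n, b n ∈ Icc (0 : ℝ) 1) :
    ENNReal.ofReal (((⨆ n, a n) - ⨆ n, b n) ^ 2) ≤ ∑' n, ENNReal.ofReal ((a n - b n) ^ 2) := by
  set S := ∑' n, ENNReal.ofReal ((a n - b n) ^ 2)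
  by_cases hS : S = ⊤
  · rw [hS]; exact le_top
  have h1 : ∀ n, |a n - b n| ≤ √S.toReal := by
    intro n
    refine Real.abs_le_sqrt ?_
    rw [← ENNReal.ofReal_le_iff_le_toReal hS]
    exact ENNReal.le_tsum n
  have hba : BddAbove (range a) := ⟨1, by rintro _ ⟨n, rfl⟩; exact (ha n).2⟩
  have hbb : BddAbove (range b) := ⟨1, by rintro _ ⟨n, rfl⟩; exact (hb n).2⟩
  have h2 : (⨆ n, a n) ≤ (⨆ n, b n) + √S.toReal := by
    refine ciSup_le fun n => ?_
    have := le_ciSup hbb n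
    linarith [(abs_le.1 (h1 n)).2]
  have h3 : (⨆ n, b n) ≤ (⨆ n, a n) + √S.toReal := by
    refine ciSup_le fun n => ?_
    have := le_ciSup hba n
    linarith [(abs_le.1 (h1 n)).1]
  rw [ENNReal.ofReal_le_iff_le_toReal hS, ← sq_abs, ← Real.sq_sqrt (ENNReal.toReal_nonneg (a := S))]
  refine pow_le_pow_left₀ (abs_nonneg _) (abs_le.2 ⟨?_, ?_⟩) 2 <;> linarith

theorem sobolevSq_iSup_le {f : ℕ → Rd d → ℝ} (hf : ∀ n, AEStronglyMeasurable (f n) volume)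
    (h01 : ∀ n x, f n x ∈ Icc (0 : ℝ) 1) :
    sobolevSq α (fun x => ⨆ n, f n x) ≤ ∑' n, sobolevSq α (f n) := by
  simp only [sobolevSq]
  rw [ENNReal.tsum_add]
  gcongr
  · simp only [fracEnergy_eq]
    rw [ENNReal.tsum_mul_left, ← lintegral_tsum fun n =>
      ((aestronglyMeasurable_diffQuot (hf n)).aemeasurable.pow_const 2).ennreal_ofReal]
    refine mul_le_mul_right (lintegral_mono fun z => ?_) _
    have h := ofReal_sq_iSup_sub_le (fun n => h01 n z.1) (fun n => h01 n z.2)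
    have hr : 0 ≤ ‖z.1 - z.2‖ ^ ((d : ℝ) + α) := by positivity
    simp only [diffQuot_sq, div_eq_mul_inv, ENNReal.ofReal_mul (sq_nonneg _)]
    rw [ENNReal.tsum_mul_right]
    gcongr
  · rw [← lintegral_tsum fun n => ((hf n).aemeasurable.pow_const 2).ennreal_ofReal]
    refine lintegral_mono fun x => ?_
    have h := ofReal_sq_iSup_sub_le (fun n => h01 n x) (b := fun _ => 0) (fun n => by simp)
    simpa using h

theorem sobolevSq_max_le {f g : Rd d → ℝ} (hf : AEStronglyMeasurable f volume) :
    sobolevSq α (fun x => max (f x) (g x)) ≤ sobolevSq α f + sobolevSq α g := by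
  have key : ∀ a b a' b' : ℝ, (max a b - max a' b') ^ 2 ≤ (a - a') ^ 2 + (b - b') ^ 2 := by
    intro a b a' b'
    have h := abs_max_sub_max_le_max a b a' b'
    rw [← sq_abs]
    refine (pow_le_pow_left₀ (abs_nonneg _) h 2).trans ?_
    rcases max_choice |a - a'| |b - b'| with h | h <;> rw [h, sq_abs] <;>
      nlinarith [sq_nonneg (a - a'), sq_nonneg (b - b')]
  simp only [sobolevSq]
  rw [add_add_add_comm]
  gcongr
  · simp only [fracEnergy_eq]
    rw [← mul_add, ← lintegral_add_left'
      ((aestronglyMeasurable_diffQuot hf).aemeasurable.pow_const 2).ennreal_ofReal]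
    refine mul_le_mul_right (lintegral_mono fun z => ?_) _
    rw [← ENNReal.ofReal_add (sq_nonneg _) (sq_nonneg _)]
    refine ENNReal.ofReal_le_ofReal ?_
    rw [diffQuot_sq, diffQuot_sq, diffQuot_sq, ← add_div]
    gcongr
    exact key _ _ _ _
  · rw [← lintegral_add_left' (hf.aemeasurable.pow_const 2).ennreal_ofReal]
    refine lintegral_mono fun x => ?_
    rw [← ENNReal.ofReal_add (sq_nonneg _) (sq_nonneg _)]
    refine ENNReal.ofReal_le_ofReal ?_
    have := key (f x) (g x) 0 0
    simpa using this

/-! ### Capacity -/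

theorem fracCapacity_le {A O : Set (Rd d)} {f : Rd d → ℝ} (hf : MemFracSobolev α f)
    (hO : IsOpen O) (hAO : A ⊆ O) (h1 : ∀ᵐ x ∂volume.restrict O, 1 ≤ f x) :
    fracCapacity α A ≤ sobolevSq α f :=
  iInf_le_of_le f (iInf_le_of_le hf (iInf_le _ ⟨O, hO, hAO, h1⟩))

/-- Clamping is a normal contraction and does not disturb `1 ≤ f`. Competitors with values in `[0,
1]` have everywhere finite countable suprema. -/
theorem exists_of_fracCapacity_lt {A : Set (Rd d)} {c : ENNReal} (h : fracCapacity α A < c) :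
    ∃ f : Rd d → ℝ, MemFracSobolev α f ∧ (∀ x, f x ∈ Icc (0 : ℝ) 1) ∧ sobolevSq α f < c ∧
      ∃ O : Set (Rd d), IsOpen O ∧ A ⊆ O ∧ ∀ᵐ x ∂volume.restrict O, 1 ≤ f x := by
  simp only [fracCapacity, iInf_lt_iff] at h
  obtain ⟨f, hf, ⟨O, hO, hAO, h1⟩, hc⟩ := h
  have hφ := isNormalContraction_clamp
  refine ⟨fun x => max 0 (min 1 (f x)), hφ.memFracSobolev hf, fun x => ⟨le_max_left _ _, by simp⟩,
    (hφ.sobolevSq_le f).trans_lt hc, O, hO, hAO, ?_⟩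
  filter_upwards [h1] with x hx
  simp [hx]

theorem fracCapacity_mono {A B : Set (Rd d)} (h : A ⊆ B) :
    fracCapacity α A ≤ fracCapacity α B := by
  refine le_of_forall_gt fun c hc => ?_
  obtain ⟨f, hf, -, hfc, O, hO, hBO, h1⟩ := exists_of_fracCapacity_lt hc
  exact (fracCapacity_le hf hO (h.trans hBO) h1).trans_lt hfc

theorem fracCapacity_empty : fracCapacity α (∅ : Set (Rd d)) = 0 := by
  have h0 : sobolevSq α (0 : Rd d → ℝ) = 0 := by simp [sobolevSq, fracEnergy_eq, diffQuot]
  have hm : MemFracSobolev α (0 : Rd d → ℝ) :=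
    memFracSobolev_of_sobolevSq aestronglyMeasurable_const (by rw [h0]; exact ENNReal.zero_lt_top)
  refine le_antisymm ?_ zero_le
  rw [← h0]
  exact fracCapacity_le hm isOpen_empty subset_rfl (by simp)

/-- The supremum of nearly optimal competitors for the `A n` competes for the union, with energy at
most the sum of their energies. -/
theorem fracCapacity_iUnion_le (A : ℕ → Set (Rd d)) :
    fracCapacity α (⋃ n, A n) ≤ ∑' n, fracCapacity α (A n) := by
  by_cases hT : ∑' n, fracCapacity α (A n) = ⊤
  · rw [hT]; exact le_top
  refine ENNReal.le_of_forall_pos_le_add fun ε hε _ => ?_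
  obtain ⟨δ, hδ, hδε⟩ := ENNReal.exists_pos_sum_of_countable' (ENNReal.coe_pos.2 hε).ne' ℕ
  have hne : ∀ n, fracCapacity α (A n) ≠ ⊤ := fun n => ENNReal.ne_top_of_tsum_ne_top hT n
  have hlt : ∀ n, fracCapacity α (A n) < fracCapacity α (A n) + δ n := fun n =>
    ENNReal.lt_add_right (hne n) (hδ n).ne'
  choose f hf h01 hfc O hO hAO h1 using fun n => exists_of_fracCapacity_lt (hlt n)
  have hsum : ∑' n, sobolevSq α (f n) ≤ ∑' n, fracCapacity α (A n) + ε := by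
    calc _ ≤ ∑' n, (fracCapacity α (A n) + δ n) := ENNReal.tsum_le_tsum fun n => (hfc n).le
      _ = ∑' n, fracCapacity α (A n) + ∑' n, δ n := ENNReal.tsum_add
      _ ≤ _ := by gcongr
  have hle := (sobolevSq_iSup_le (α := α) (fun n => (hf n).1.1) h01).trans hsum
  have hmeas : AEStronglyMeasurable (fun x => ⨆ n, f n x) volume :=
    (AEMeasurable.iSup fun n => (hf n).1.1.aemeasurable).aestronglyMeasurable
  have hmem : MemFracSobolev α fun x => ⨆ n, f n x :=
    memFracSobolev_of_sobolevSq hmeas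
      (hle.trans_lt (ENNReal.add_lt_top.2 ⟨lt_top_iff_ne_top.2 hT, ENNReal.coe_lt_top⟩))
  refine (fracCapacity_le hmem (isOpen_iUnion hO) (iUnion_mono hAO) ?_).trans hle
  rw [ae_restrict_iff' (isOpen_iUnion hO).measurableSet]
  have h1' : ∀ n, ∀ᵐ x, x ∈ O n → 1 ≤ f n x := fun n =>
    (ae_restrict_iff' (hO n).measurableSet).1 (h1 n)
  filter_upwards [ae_all_iff.2 h1'] with x hx hxO
  obtain ⟨n, hn⟩ := mem_iUnion.1 hxO
  exact (hx n hn).trans (le_ciSup (f := fun n => f n x)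
    ⟨1, by rintro _ ⟨k, rfl⟩; exact (h01 k x).2⟩ n)

theorem fracCapacity_union_le (A B : Set (Rd d)) :
    fracCapacity α (A ∪ B) ≤ fracCapacity α A + fracCapacity α B := by
  set s : ℕ → Set (Rd d) := fun n => if n = 0 then A else if n = 1 then B else ∅
  have h := fracCapacity_iUnion_le (α := α) s
  have hU : A ∪ B ⊆ ⋃ n, s n := by
    rintro x (hx | hx)
    · exact mem_iUnion.2 ⟨0, by simpa [s] using hx⟩
    · exact mem_iUnion.2 ⟨1, by simpa [s] using hx⟩
  refine (fracCapacity_mono hU).trans (h.trans (le_of_eq ?_))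
  rw [tsum_eq_sum (s := Finset.range 2)]
  · simp [Finset.sum_range_succ, s]
  · intro n hn
    have h2 : 1 < n := by simpa using hn
    have : s n = ∅ := by simp only [s]; rw [if_neg (by omega), if_neg (by omega)]
    rw [this, fracCapacity_empty]

/-! ### Quasi-continuity -/

theorem Continuous.quasiContinuous {f : Rd d → ℝ} (hf : Continuous f) : QuasiContinuous α f :=
  fun ε hε => ⟨∅, isOpen_empty, by rwa [fracCapacity_empty], hf.continuousOn⟩

theorem QuasiContinuous.comp {f : Rd d → ℝ} (hf : QuasiContinuous α f) {φ : ℝ → ℝ}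
    (hφ : Continuous φ) : QuasiContinuous α fun x => φ (f x) := by
  intro ε hε
  obtain ⟨G, hG, hc, hcont⟩ := hf ε hε
  exact ⟨G, hG, hc, hφ.comp_continuousOn hcont⟩

theorem QuasiContinuous.add {f g : Rd d → ℝ} (hf : QuasiContinuous α f)
    (hg : QuasiContinuous α g) : QuasiContinuous α (f + g) := by
  intro ε hε
  have hε2 : 0 < ε / 2 := ENNReal.half_pos hε.ne'
  obtain ⟨G, hG, hc, hcont⟩ := hf _ hε2
  obtain ⟨G', hG', hc', hcont'⟩ := hg _ hε2
  refine ⟨G ∪ G', hG.union hG', ?_, ?_⟩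
  · calc _ ≤ fracCapacity α G + fracCapacity α G' := fracCapacity_union_le _ _
      _ < ε / 2 + ε / 2 := ENNReal.add_lt_add hc hc'
      _ = ε := ENNReal.add_halves ε
  · exact (hcont.mono (compl_subset_compl.2 subset_union_left)).add
      (hcont'.mono (compl_subset_compl.2 subset_union_right))

/-- The weak capacitary inequality for quasi-continuous functions. -/
theorem QuasiContinuous.exists_superlevel {f : Rd d → ℝ} (hq : QuasiContinuous α f)
    (hf : MemFracSobolev α f) {l : ℝ} (hl : 0 < l) {δ : ENNReal} (hδ : 0 < δ) :
    ∃ U : Set (Rd d), IsOpen U ∧ {x | l < |f x|} ⊆ U ∧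
      fracCapacity α U ≤ ENNReal.ofReal (l⁻¹ ^ 2) * sobolevSq α f + δ := by
  obtain ⟨G, hG, hGc, hcont⟩ := hq δ hδ
  obtain ⟨w, hw, -, hwc, O, hO, hGO, hw1⟩ := exists_of_fracCapacity_lt hGc
  -- The set `{|f| > l}` is open only relative to `Gᶜ`, but its union with the open set `G` is open.
  -- On this union the maximum of `|f| / l` and the competitor `w` of `G` is at least 1.
  obtain ⟨u, hu, hueq⟩ := continuousOn_iff'.1 hcont.abs (Ioi l) isOpen_Ioi
  have hU : {x | l < |f x|} ∪ G = u ∪ G := by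
    ext x
    by_cases hx : x ∈ G
    · simp [hx]
    · have : x ∈ (fun x => |f x|) ⁻¹' Ioi l ∩ Gᶜ ↔ x ∈ u ∩ Gᶜ := by rw [hueq]
      simpa [hx] using this
  have hUo : IsOpen ({x | l < |f x|} ∪ G) := by rw [hU]; exact hu.union hG
  refine ⟨_, hUo, subset_union_left, ?_⟩
  set a : Rd d → ℝ := l⁻¹ • fun x => |f x| with ha
  have hfabs := isNormalContraction_abs.memFracSobolev hf
  have ham : AEStronglyMeasurable a volume := hfabs.1.1.const_smul _
  have hle : sobolevSq α (fun x => max (a x) (w x)) ≤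
      ENNReal.ofReal (l⁻¹ ^ 2) * sobolevSq α f + δ := by
    refine (sobolevSq_max_le ham).trans (add_le_add ?_ hwc.le)
    rw [ha, sobolevSq_smul]
    exact mul_le_mul_right (isNormalContraction_abs.sobolevSq_le f) _
  have hmem : MemFracSobolev α fun x => max (a x) (w x) := by
    refine memFracSobolev_of_sobolevSq ?_ ((sobolevSq_max_le ham).trans_lt ?_)
    · exact (ham.aemeasurable.max hw.1.1.aemeasurable).aestronglyMeasurable
    · rw [ha, sobolevSq_smul]
      exact ENNReal.add_lt_top.2 ⟨ENNReal.mul_lt_top ENNReal.ofReal_lt_top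
        (sobolevSq_lt_top hfabs), sobolevSq_lt_top hw⟩
  refine (fracCapacity_le hmem hUo subset_rfl ?_).trans hle
  rw [ae_restrict_iff' hUo.measurableSet]
  filter_upwards [(ae_restrict_iff' hO.measurableSet).1 hw1] with x hx hxU
  rcases hxU with h | h
  · refine le_max_of_le_left ?_
    have h' : l < |f x| := h
    simp only [ha, Pi.smul_apply, smul_eq_mul]
    rw [← inv_mul_cancel₀ hl.ne']
    gcongr
  · exact le_max_of_le_right (hx (hGO h))

/-- The pointwise limit, where it exists. -/
def pointwiseLim (f : ℕ → Rd d → ℝ) (x : Rd d) : ℝ :=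
  open Classical in if h : ∃ l, Tendsto (fun n => f n x) atTop (𝓝 l) then h.choose else 0

theorem pointwiseLim_eq {f : ℕ → Rd d → ℝ} {x : Rd d} {l : ℝ}
    (h : Tendsto (fun n => f n x) atTop (𝓝 l)) : pointwiseLim f x = l := by
  have hex : ∃ l, Tendsto (fun n => f n x) atTop (𝓝 l) := ⟨l, h⟩
  rw [pointwiseLim, dif_pos hex]
  exact tendsto_nhds_unique hex.choose_spec h

theorem pointwiseLim_eq_zero {f : ℕ → Rd d → ℝ} {x : Rd d} (h : ∀ n, f n x = 0) :
    pointwiseLim f x = 0 :=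
  pointwiseLim_eq (by simp [h])

/-- Off a tail of the sets `U n` the increments are at most `2^{-n}`, so the convergence is uniform
there; off the sets `G n` every `f n` is continuous. Both exceptional sets have small capacity. -/
theorem quasiContinuous_pointwiseLim {f : ℕ → Rd d → ℝ} (hq : ∀ n, QuasiContinuous α (f n))
    {U : ℕ → Set (Rd d)} (hU : ∀ n, IsOpen (U n))
    (hfU : ∀ n, {x | (1 / 2 : ℝ) ^ n < |f (n + 1) x - f n x|} ⊆ U n)
    (hsum : ∑' n, fracCapacity α (U n) ≠ ⊤) : QuasiContinuous α (pointwiseLim f) := by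
  intro ε hε
  have hε2 : 0 < ε / 2 := ENNReal.half_pos hε.ne'
  obtain ⟨δ, hδ, hδε⟩ := ENNReal.exists_pos_sum_of_countable' hε2.ne' ℕ
  choose G hG hGc hcont using fun n => hq n (δ n) (hδ n)
  have htail := ENNReal.tendsto_sum_nat_add (fun n => fracCapacity α (U n)) hsum
  obtain ⟨m, hm⟩ := (htail.eventually (gt_mem_nhds hε2)).exists
  refine ⟨(⋃ n, U (n + m)) ∪ ⋃ n, G n,
    (isOpen_iUnion fun n => hU _).union (isOpen_iUnion hG), ?_, ?_⟩
  · calc _ ≤ fracCapacity α (⋃ n, U (n + m)) + fracCapacity α (⋃ n, G n) :=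
          fracCapacity_union_le _ _
      _ ≤ ∑' n, fracCapacity α (U (n + m)) + ∑' n, fracCapacity α (G n) :=
          add_le_add (fracCapacity_iUnion_le _) (fracCapacity_iUnion_le _)
      _ ≤ ∑' n, fracCapacity α (U (n + m)) + ∑' n, δ n := by
          gcongr with n
          exact (hGc n).le
      _ < ε / 2 + ε / 2 := ENNReal.add_lt_add hm hδε
      _ = ε := ENNReal.add_halves ε
  · set S := ((⋃ n, U (n + m)) ∪ ⋃ n, G n)ᶜ
    have hS1 : ∀ x ∈ S, ∀ n, x ∉ U (n + m) := fun x hx n hn =>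
      hx (Or.inl (mem_iUnion.2 ⟨n, hn⟩))
    have hSG : ∀ n, S ⊆ (G n)ᶜ := fun n x hx hn => hx (Or.inr (mem_iUnion.2 ⟨n, hn⟩))
    have hgeo : ∀ x ∈ S, ∀ n, dist (f (n + m) x) (f (n + 1 + m) x) ≤
        2 * (1 / 2 : ℝ) ^ m / 2 / 2 ^ n := by
      intro x hx n
      have h1 : |f (n + m + 1) x - f (n + m) x| ≤ (1 / 2 : ℝ) ^ (n + m) := by
        by_contra hcon
        exact hS1 x hx n (hfU (n + m) (not_le.1 hcon))
      rw [dist_comm, Real.dist_eq, show n + 1 + m = n + m + 1 by ring]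
      refine h1.trans (le_of_eq ?_)
      rw [pow_add, one_div, inv_pow]
      field_simp
    have hlim : ∀ x ∈ S, Tendsto (fun n => f (n + m) x) atTop (𝓝 (pointwiseLim f x)) := by
      intro x hx
      obtain ⟨l, hl⟩ := cauchySeq_tendsto_of_complete (cauchySeq_of_le_geometric_two (hgeo x hx))
      have hl' : Tendsto (fun n => f n x) atTop (𝓝 l) :=
        (tendsto_add_atTop_iff_nat (f := fun n => f n x) m).1 hl
      rwa [pointwiseLim_eq hl']
    have hunif : TendstoUniformlyOn (fun n => f (n + m)) (pointwiseLim f) atTop S := by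
      rw [Metric.tendstoUniformlyOn_iff]
      intro η hη
      have h0 : Tendsto (fun n : ℕ => 2 * (1 / 2 : ℝ) ^ m / 2 ^ n) atTop (𝓝 0) := by
        have := (tendsto_pow_atTop_nhds_zero_of_lt_one (r := (1 / 2 : ℝ)) (by norm_num)
          (by norm_num)).const_mul (2 * (1 / 2 : ℝ) ^ m)
        rw [mul_zero] at this
        refine this.congr fun n => ?_
        rw [one_div, inv_pow, inv_pow, div_eq_mul_inv]
      filter_upwards [h0.eventually (gt_mem_nhds hη)] with n hn x hx
      rw [dist_comm]
      exact (dist_le_of_le_geometric_two_of_tendsto (hgeo x hx) (hlim x hx) n).trans_lt hn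
    exact hunif.continuousOn (Frequently.of_forall fun n => (hcont (n + m)).mono (hSG _))

/-- Allows Fatou's lemma for two functionals of which only the sum is controlled. -/
theorem liminf_add_liminf_le {u v : ℕ → ENNReal} {c : ENNReal}
    (h : ∀ᶠ n in atTop, u n + v n ≤ c) : liminf u atTop + liminf v atTop ≤ c := by
  obtain ⟨N, hN⟩ := eventually_atTop.1 h
  have hmono : ∀ w : ℕ → ENNReal, Monotone fun n => ⨅ i, w (i + n) := by
    intro w m n hmn
    refine le_iInf fun i => ?_
    have := iInf_le (fun i => w (i + m)) (i + (n - m))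
    rwa [add_assoc, Nat.sub_add_cancel hmn] at this
  rw [liminf_eq_iSup_iInf_of_nat', liminf_eq_iSup_iInf_of_nat',
    ENNReal.iSup_add_iSup_of_monotone (hmono u) (hmono v)]
  refine iSup_le fun n => (add_le_add (iInf_le _ N) (iInf_le _ N)).trans (hN _ ?_)
  omega

/-! ### The space `W_0(Ω)` -/

variable {Ω : Set (Rd d)}

theorem MemFracSobolevZero.congr {f g : Rd d → ℝ} (hf : MemFracSobolevZero α Ω f)
    (h : f =ᵐ[volume] g) : MemFracSobolevZero α Ω g := by
  obtain ⟨h1, f', h2, h3, h4⟩ := hf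
  exact ⟨h1.congr h, f', h2.trans h, h3, h4⟩

theorem MemFracSobolevZero.comp {f : Rd d → ℝ} (hf : MemFracSobolevZero α Ω f) {φ : ℝ → ℝ}
    (hφ : IsNormalContraction φ) : MemFracSobolevZero α Ω fun x => φ (f x) := by
  obtain ⟨h1, f', h2, h3, h4⟩ := hf
  refine ⟨hφ.memFracSobolev h1, fun x => φ (f' x), ?_, h3.comp hφ.continuous, ?_⟩
  · filter_upwards [h2] with x hx
    rw [hx]
  · refine le_antisymm (le_trans (fracCapacity_mono ?_) h4.le) zero_le
    rintro x ⟨hx1, hx2⟩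
    exact ⟨hx1, fun h => hx2 (show φ (f' x) = 0 by rw [h, hφ.zero])⟩

theorem memFracSobolevZero_of_contDiff (hα : 0 < α) (hα2 : α < 2) (hd : 0 < d) {f : Rd d → ℝ}
    (hf : ContDiff ℝ 1 f) (hs : HasCompactSupport f) (hΩ : tsupport f ⊆ Ω) :
    MemFracSobolevZero α Ω f := by
  refine ⟨memFracSobolev_of_contDiff hα hα2 hd hf hs, f, EventuallyEq.rfl,
    hf.continuous.quasiContinuous, ?_⟩
  have : {x | x ∉ Ω ∧ f x ≠ 0} = ∅ := by
    refine eq_empty_of_forall_notMem fun x hx => hx.2 ?_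
    exact image_eq_zero_of_notMem_tsupport fun h => hx.1 (hΩ h)
  rw [this, fracCapacity_empty]

/-- The capacitary inequality at level `2^{-n}` costs a factor `4^n`, so increments of size `8^{-n}`
leave exceptional sets of capacity at most `4^n 8^{-n} + 2^{-n} = 2 * 2^{-n}`, which is summable.
The limit of the quasi-continuous versions vanishes outside `Ω` wherever all of them do, and the
sets where one of them fails to vanish form a countable union of null sets for the capacity. -/
theorem MemFracSobolevZero.of_sobolevSq_sub_le {f : ℕ → Rd d → ℝ} {g : Rd d → ℝ}
    (hα : 0 < α) (hα2 : α < 2) (hf : ∀ n, MemFracSobolevZero α Ω (f n))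
    (hg : MemFracSobolev α g)
    (hc : ∀ n, sobolevSq α (f (n + 1) - f n) ≤ ENNReal.ofReal ((1 / 8 : ℝ) ^ n))
    (hlim : ∀ᵐ x, Tendsto (fun n => f n x) atTop (𝓝 (g x))) : MemFracSobolevZero α Ω g := by
  choose hf1 f' hf' hq hz using hf
  have hmem : ∀ n, MemFracSobolev α (f' n) := fun n => (hf1 n).congr (hf' n).symm
  have hmemd : ∀ n, MemFracSobolev α (f' (n + 1) - f' n) := by
    intro n
    have := (hmem (n + 1)).add hα hα2 ((hmem n).smul hα hα2 (-1))
    rwa [neg_one_smul, ← sub_eq_add_neg] at this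
  have hqd : ∀ n, QuasiContinuous α (f' (n + 1) - f' n) := by
    intro n
    rw [sub_eq_add_neg]
    exact (hq (n + 1)).add ((hq n).comp continuous_neg)
  have hsd : ∀ n, sobolevSq α (f' (n + 1) - f' n) ≤ ENNReal.ofReal ((1 / 8 : ℝ) ^ n) := by
    intro n
    rw [sobolevSq_congr ((hf' (n + 1)).sub (hf' n))]
    exact hc n
  choose U hUo hfU hUc using fun n : ℕ => (hqd n).exists_superlevel (hmemd n)
    (l := (1 / 2 : ℝ) ^ n) (by positivity) (δ := ENNReal.ofReal ((1 / 2 : ℝ) ^ n)) (by simp)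
  have hUle : ∀ n, fracCapacity α (U n) ≤ ENNReal.ofReal (2 * (1 / 2 : ℝ) ^ n) := by
    intro n
    refine (hUc n).trans ?_
    calc _ ≤ ENNReal.ofReal (((1 / 2 : ℝ) ^ n)⁻¹ ^ 2) * ENNReal.ofReal ((1 / 8 : ℝ) ^ n) +
          ENNReal.ofReal ((1 / 2 : ℝ) ^ n) := by gcongr; exact hsd n
      _ = ENNReal.ofReal (2 * (1 / 2 : ℝ) ^ n) := by
        rw [← ENNReal.ofReal_mul (by positivity),
          ← ENNReal.ofReal_add (by positivity) (by positivity)]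
        congr 1
        have : ((1 / 2 : ℝ) ^ n)⁻¹ ^ 2 * (1 / 8 : ℝ) ^ n = (1 / 2 : ℝ) ^ n := by
          rw [← inv_pow, ← pow_mul, mul_comm n 2, pow_mul, ← mul_pow]
          norm_num
        rw [this]; ring
  have hsum : ∑' n, fracCapacity α (U n) ≠ ⊤ := by
    have hs : Summable fun n : ℕ => 2 * (1 / 2 : ℝ) ^ n :=
      (summable_geometric_of_lt_one (by norm_num) (by norm_num)).mul_left 2
    refine ne_top_of_le_ne_top ?_ (ENNReal.tsum_le_tsum hUle)
    rw [← ENNReal.ofReal_tsum_of_nonneg (fun n => by positivity) hs]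
    exact ENNReal.ofReal_ne_top
  refine ⟨hg, pointwiseLim f', ?_, quasiContinuous_pointwiseLim hq hUo hfU hsum, ?_⟩
  · filter_upwards [hlim, ae_all_iff.2 hf'] with x hx hfx
    refine pointwiseLim_eq ?_
    simpa only [hfx] using hx
  · have hsub : {x | x ∉ Ω ∧ pointwiseLim f' x ≠ 0} ⊆ ⋃ n, {x | x ∉ Ω ∧ f' n x ≠ 0} := by
      rintro x ⟨hx1, hx2⟩
      by_contra hcon
      refine hx2 (pointwiseLim_eq_zero fun n => ?_)
      by_contra hn
      exact hcon (mem_iUnion.2 ⟨n, hx1, hn⟩)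
    refine le_antisymm ((fracCapacity_mono hsub).trans ((fracCapacity_iUnion_le _).trans ?_))
      zero_le
    simp [hz]

section

variable (hα : 0 < α) (hα2 : α < 2)
include hα hα2

theorem MemFracSobolevZero.add {f g : Rd d → ℝ} (hf : MemFracSobolevZero α Ω f)
    (hg : MemFracSobolevZero α Ω g) : MemFracSobolevZero α Ω (f + g) := by
  obtain ⟨h1, f', h2, h3, h4⟩ := hf
  obtain ⟨k1, g', k2, k3, k4⟩ := hg
  refine ⟨h1.add hα hα2 k1, f' + g', h2.add k2, h3.add k3, ?_⟩
  have hsub : {x | x ∉ Ω ∧ (f' + g') x ≠ 0} ⊆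
      {x | x ∉ Ω ∧ f' x ≠ 0} ∪ {x | x ∉ Ω ∧ g' x ≠ 0} := by
    rintro x ⟨hx1, hx2⟩
    by_contra hcon
    simp only [mem_union, mem_ofPred_eq, not_or, not_and, not_not] at hcon
    exact hx2 (by rw [Pi.add_apply, hcon.1 hx1, hcon.2 hx1, add_zero])
  refine le_antisymm ((fracCapacity_mono hsub).trans ((fracCapacity_union_le _ _).trans ?_)) zero_le
  rw [h4, k4, add_zero]

theorem MemFracSobolevZero.smul {f : Rd d → ℝ} (hf : MemFracSobolevZero α Ω f) (r : ℝ) :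
    MemFracSobolevZero α Ω (r • f) := by
  obtain ⟨h1, f', h2, h3, h4⟩ := hf
  refine ⟨h1.smul hα hα2 r, r • f', h2.const_smul r,
    h3.comp (continuous_const.mul continuous_id), ?_⟩
  refine le_antisymm ((fracCapacity_mono ?_).trans h4.le) zero_le
  rintro x ⟨hx1, hx2⟩
  exact ⟨hx1, fun h => hx2 (by rw [Pi.smul_apply, h, smul_zero])⟩

/-- `W_0(Ω)` is complete. -/
theorem MemFracSobolevZero.of_cauchy {f : ℕ → Rd d → ℝ} {g : Rd d → ℝ}
    (hf : ∀ n, MemFracSobolevZero α Ω (f n))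
    (hc : ∀ ε : ENNReal, 0 < ε → ∃ N, ∀ m ≥ N, ∀ n ≥ N, sobolevSq α (f m - f n) ≤ ε)
    (hlim : ∀ᵐ x, Tendsto (fun n => f n x) atTop (𝓝 (g x))) :
    MemFracSobolevZero α Ω g ∧ Tendsto (fun n => sobolevSq α (f n - g)) atTop (𝓝 0) := by
  have hfm : ∀ n, AEStronglyMeasurable (f n) volume := fun n => (hf n).1.1.1
  -- Fatou's lemma in the second index of the Cauchy condition.
  have hle : ∀ ε : ENNReal, 0 < ε → ∃ N, ∀ n ≥ N, sobolevSq α (f n - g) ≤ ε := by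
    intro ε hε
    obtain ⟨N, hN⟩ := hc ε hε
    refine ⟨N, fun n hn => ?_⟩
    have hl : ∀ᵐ x, Tendsto (fun m => (f n - f m) x) atTop (𝓝 ((f n - g) x)) := by
      filter_upwards [hlim] with x hx
      exact tendsto_const_nhds.sub hx
    have hm : ∀ m, AEStronglyMeasurable (f n - f m) volume := fun m => (hfm n).sub (hfm m)
    have h1 := fracEnergy_le_liminf (α := α) hm hl
    have h2 := lintegral_ofReal_sq_le_liminf hm hl
    refine (add_le_add h1 h2).trans (liminf_add_liminf_le ?_)
    filter_upwards [eventually_ge_atTop N] with m hm using hN n hn m hm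
  have hgm : AEStronglyMeasurable g volume :=
    aestronglyMeasurable_of_tendsto_ae atTop hfm hlim
  have hg : MemFracSobolev α g := by
    obtain ⟨N, hN⟩ := hle 1 one_pos
    have h1 : MemFracSobolev α (f N - g) :=
      memFracSobolev_of_sobolevSq ((hfm N).sub hgm) ((hN N le_rfl).trans_lt ENNReal.one_lt_top)
    have h2 := (hf N).1.add hα hα2 (h1.smul hα hα2 (-1))
    rwa [neg_one_smul, neg_sub, add_sub_cancel] at h2
  refine ⟨?_, ?_⟩
  · obtain ⟨φ, hφ, hφc⟩ := extraction_forall_of_eventually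
      (P := fun n N => ∀ m ≥ N, sobolevSq α (f m - f N) ≤ ENNReal.ofReal ((1 / 8 : ℝ) ^ n))
      (fun n => by
        obtain ⟨N, hN⟩ := hc (ENNReal.ofReal ((1 / 8 : ℝ) ^ n)) (by simp)
        filter_upwards [eventually_ge_atTop N] with k hk m hm
        exact hN m (hk.trans hm) k hk)
    refine MemFracSobolevZero.of_sobolevSq_sub_le hα hα2 (fun n => hf (φ n)) hg
      (fun n => hφc n _ (hφ.monotone n.le_succ)) ?_
    filter_upwards [hlim] with x hx
    exact hx.comp hφ.tendsto_atTop
  · rw [ENNReal.tendsto_nhds_zero]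
    intro ε hε
    obtain ⟨N, hN⟩ := hle ε hε
    exact eventually_atTop.2 ⟨N, hN⟩

end

end Capacity

end

noncomputable section

/-! ### Gauss kernels and Riesz kernels as integrals of Gauss kernels over time. -/

section HeatKernelIntegrals

theorem lintegral_rpow_mul_exp_neg_mul {b c : ℝ} (hb : 0 < b) (hc : 0 < c) :
    ∫⁻ u in Ioi (0 : ℝ), ENNReal.ofReal (u ^ (b - 1) * Real.exp (-(c * u))) =
      ENNReal.ofReal (Real.Gamma b * c ^ (-b)) := by
  have h := Real.integral_rpow_mul_exp_neg_mul_Ioi hb hc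
  have hpos : 0 < (1 / c) ^ b * Real.Gamma b := by
    have := Real.Gamma_pos_of_pos hb
    positivity
  have hint : IntegrableOn (fun u : ℝ => u ^ (b - 1) * Real.exp (-(c * u))) (Ioi 0) := by
    by_contra hcon
    rw [integral_undef hcon] at h
    exact hpos.ne h
  rw [← ofReal_integral_eq_lintegral_ofReal hint, h]
  · rw [one_div, Real.inv_rpow hc.le, Real.rpow_neg hc.le, mul_comm]
  · filter_upwards [ae_restrict_mem measurableSet_Ioi] with u hu
    have : (0 : ℝ) < u := hu
    positivity

theorem lintegral_rpow_mul_exp_neg_div {b c : ℝ} (hb : 0 < b) (hc : 0 < c) :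
    ∫⁻ s in Ioi (0 : ℝ), ENNReal.ofReal (s ^ (-b - 1) * Real.exp (-(c / s))) =
      ENNReal.ofReal (Real.Gamma b * c ^ (-b)) := by
  rw [← lintegral_rpow_mul_exp_neg_mul hb hc]
  have himg : (fun u : ℝ => u⁻¹) '' Ioi 0 = Ioi 0 := by
    ext s
    constructor
    · rintro ⟨u, hu, rfl⟩
      exact inv_pos.2 (show (0 : ℝ) < u from hu)
    · intro hs
      exact ⟨s⁻¹, inv_pos.2 (show (0 : ℝ) < s from hs), inv_inv s⟩
  nth_rw 1 [← himg]
  rw [lintegral_image_eq_lintegral_abs_deriv_mul measurableSet_Ioi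
    (f' := fun u => -(u ^ 2)⁻¹) (fun u hu => (hasDerivAt_inv (ne_of_gt hu)).hasDerivWithinAt)
    inv_injective.injOn]
  refine setLIntegral_congr_fun measurableSet_Ioi fun u hu => ?_
  have hu' : (0 : ℝ) < u := hu
  rw [← ENNReal.ofReal_mul (abs_nonneg _), abs_neg, abs_of_pos (by positivity)]
  congr 1
  rw [Real.inv_rpow hu'.le, ← Real.rpow_neg hu'.le, ← Real.rpow_natCast, ← Real.rpow_neg hu'.le,
    ← mul_assoc, ← Real.rpow_add hu', div_inv_eq_mul]
  congr 2
  push_cast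
  ring

variable {d : ℕ}

/-- The Gauss-Weierstrass kernel. -/
def gaussKernel (t : ℝ) (x : Rd d) : ℝ :=
  (4 * Real.pi * t) ^ (-(d : ℝ) / 2) * Real.exp (-(‖x‖ ^ 2 / (4 * t)))

theorem gaussKernel_pos {t : ℝ} (ht : 0 < t) (x : Rd d) : 0 < gaussKernel t x := by
  have := Real.pi_pos
  unfold gaussKernel
  positivity

theorem measurable_gaussKernel : Measurable fun z : ℝ × Rd d => gaussKernel z.1 z.2 := by
  unfold gaussKernel
  fun_prop

theorem gaussKernel_neg (t : ℝ) (x : Rd d) : gaussKernel t (-x) = gaussKernel t x := by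
  simp [gaussKernel]

theorem lintegral_gaussKernel {t : ℝ} (ht : 0 < t) :
    ∫⁻ x : Rd d, ENNReal.ofReal (gaussKernel t x) = 1 := by
  have hpi := Real.pi_pos
  have h := GaussianFourier.integral_rexp_neg_mul_sq_norm (V := Rd d) (b := 1 / (4 * t))
    (by positivity)
  have hint : Integrable (fun x : Rd d => Real.exp (-(1 / (4 * t)) * ‖x‖ ^ 2)) := by
    by_contra hcon
    rw [integral_undef hcon] at h
    have : 0 < (Real.pi / (1 / (4 * t))) ^ ((Module.finrank ℝ (Rd d) : ℝ) / 2) := by positivity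
    exact this.ne h
  have e : ∀ x : Rd d, gaussKernel t x =
      (4 * Real.pi * t) ^ (-(d : ℝ) / 2) * Real.exp (-(1 / (4 * t)) * ‖x‖ ^ 2) := by
    intro x
    rw [gaussKernel]
    congr 2
    ring
  simp only [e]
  rw [← ofReal_integral_eq_lintegral_ofReal (hint.const_mul _)
    (Eventually.of_forall fun x => by positivity), integral_const_mul, h,
    finrank_euclideanSpace_fin, ← ENNReal.ofReal_one]
  congr 1
  rw [show Real.pi / (1 / (4 * t)) = 4 * Real.pi * t by field_simp,
    ← Real.rpow_add (by positivity), neg_div, neg_add_cancel, Real.rpow_zero]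

/-- Completing the square in `y`. Integration over `y` then gives the semigroup property, since the
second factor on the right has mass 1. -/
theorem gaussKernel_mul {s t : ℝ} (hs : 0 < s) (ht : 0 < t) (x y : Rd d) :
    gaussKernel t (x - y) * gaussKernel s y =
      gaussKernel (s + t) x * gaussKernel (s * t / (s + t)) (y - (s / (s + t)) • x) := by
  have hpi := Real.pi_pos
  have e1 : ‖x - y‖ ^ 2 / (4 * t) + ‖y‖ ^ 2 / (4 * s) =
      ‖x‖ ^ 2 / (4 * (s + t)) + ‖y - (s / (s + t)) • x‖ ^ 2 / (4 * (s * t / (s + t))) := by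
    rw [norm_sub_sq_real, norm_sub_sq_real, norm_smul, mul_pow, Real.norm_eq_abs, sq_abs,
      real_inner_smul_right, real_inner_comm x y]
    have : s + t ≠ 0 := by positivity
    field_simp
    ring
  have e2 : (4 * Real.pi * t) * (4 * Real.pi * s) =
      (4 * Real.pi * (s + t)) * (4 * Real.pi * (s * t / (s + t))) := by
    field_simp
  have e3 : (4 * Real.pi * t) ^ (-(d : ℝ) / 2) * (4 * Real.pi * s) ^ (-(d : ℝ) / 2) =
      (4 * Real.pi * (s + t)) ^ (-(d : ℝ) / 2) *
        (4 * Real.pi * (s * t / (s + t))) ^ (-(d : ℝ) / 2) := by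
    rw [← Real.mul_rpow (by positivity) (by positivity), e2,
      Real.mul_rpow (by positivity) (by positivity)]
  calc gaussKernel t (x - y) * gaussKernel s y
      = ((4 * Real.pi * t) ^ (-(d : ℝ) / 2) * (4 * Real.pi * s) ^ (-(d : ℝ) / 2)) *
          Real.exp (-(‖x - y‖ ^ 2 / (4 * t) + ‖y‖ ^ 2 / (4 * s))) := by
        rw [gaussKernel, gaussKernel, neg_add, Real.exp_add]
        ring
    _ = _ := by
        rw [e3, e1, gaussKernel, gaussKernel, neg_add, Real.exp_add]
        ring

theorem lintegral_gaussKernel_mul {s t : ℝ} (hs : 0 < s) (ht : 0 < t) (x : Rd d) :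
    ∫⁻ y : Rd d, ENNReal.ofReal (gaussKernel t (x - y) * gaussKernel s y) =
      ENNReal.ofReal (gaussKernel (s + t) x) := by
  simp only [gaussKernel_mul hs ht]
  have hst : 0 < s + t := by positivity
  simp only [ENNReal.ofReal_mul (gaussKernel_pos hst x).le]
  rw [lintegral_const_mul' _ _ ENNReal.ofReal_ne_top,
    lintegral_sub_right_eq_self (fun y : Rd d => ENNReal.ofReal (gaussKernel (s * t / (s + t)) y)),
    lintegral_gaussKernel (by positivity), mul_one]

/-- The function `∫_0^∞ s^{d/2-q-1} g_s(x) ds`, a multiple of `|x|^{-2q}`. -/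
def rieszKernel (q : ℝ) (x : Rd d) : ℝ :=
  (4 * Real.pi) ^ (-(d : ℝ) / 2) * (Real.Gamma q * (‖x‖ ^ 2 / 4) ^ (-q))

theorem rieszKernel_pos {q : ℝ} (hq : 0 < q) {x : Rd d} (hx : x ≠ 0) : 0 < rieszKernel q x := by
  have h1 := Real.pi_pos
  have h2 := Real.Gamma_pos_of_pos hq
  have h3 : 0 < ‖x‖ := norm_pos_iff.2 hx
  unfold rieszKernel
  positivity

theorem rieszKernel_nonneg {q : ℝ} (hq : 0 < q) (x : Rd d) : 0 ≤ rieszKernel q x := by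
  have h1 := Real.pi_pos
  have h2 := Real.Gamma_pos_of_pos hq
  unfold rieszKernel
  positivity

theorem measurable_rieszKernel (q : ℝ) : Measurable (rieszKernel q : Rd d → ℝ) := by
  unfold rieszKernel
  fun_prop

theorem rpow_mul_gaussKernel {s : ℝ} (hs : 0 < s) (p : ℝ) (x : Rd d) :
    s ^ p * gaussKernel s x = (4 * Real.pi) ^ (-(d : ℝ) / 2) *
      (s ^ (-((d : ℝ) / 2 - p - 1) - 1) * Real.exp (-(‖x‖ ^ 2 / 4 / s))) := by
  have hpi := Real.pi_pos
  rw [gaussKernel, Real.mul_rpow (by positivity) hs.le, div_div]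
  have : s ^ (-((d : ℝ) / 2 - p - 1) - 1) = s ^ p * s ^ (-(d : ℝ) / 2) := by
    rw [← Real.rpow_add hs]; congr 1; ring
  rw [this]
  ring

theorem lintegral_rpow_mul_gaussKernel {p : ℝ} (hp : p + 1 < (d : ℝ) / 2) {x : Rd d}
    (hx : x ≠ 0) : ∫⁻ s in Ioi (0 : ℝ), ENNReal.ofReal (s ^ p * gaussKernel s x) =
      ENNReal.ofReal (rieszKernel ((d : ℝ) / 2 - p - 1) x) := by
  have hpi := Real.pi_pos
  have hx' : 0 < ‖x‖ := norm_pos_iff.2 hx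
  have e : ∀ s ∈ Ioi (0 : ℝ), ENNReal.ofReal (s ^ p * gaussKernel s x) =
      ENNReal.ofReal ((4 * Real.pi) ^ (-(d : ℝ) / 2)) * ENNReal.ofReal
        (s ^ (-((d : ℝ) / 2 - p - 1) - 1) * Real.exp (-(‖x‖ ^ 2 / 4 / s))) := by
    intro s hs
    rw [rpow_mul_gaussKernel hs, ENNReal.ofReal_mul (by positivity)]
  rw [setLIntegral_congr_fun measurableSet_Ioi e, lintegral_const_mul' _ _ ENNReal.ofReal_ne_top,
    lintegral_rpow_mul_exp_neg_div (by linarith) (by positivity), rieszKernel,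
    ← ENNReal.ofReal_mul (by positivity)]

end HeatKernelIntegrals

/-! ### Truncated beta integrals and their divergent part. -/

section BetaIntegrals

variable {a b : ℝ}

/-- The truncated integral `∫_r^1 t^{-1-a} (1-t)^{b-1} dt`. -/
def truncBeta (a b r : ℝ) : ENNReal :=
  ∫⁻ t in Ioo r 1, ENNReal.ofReal (t ^ (-1 - a) * (1 - t) ^ (b - 1))

/-- The truncated beta integral `∫_r^1 t^{-a} (1-t)^{b-1} dt`. -/
def truncBeta' (a b r : ℝ) : ENNReal :=
  ∫⁻ t in Ioo r 1, ENNReal.ofReal (t ^ (-a) * (1 - t) ^ (b - 1))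

theorem truncBeta'_zero (ha : a < 1) (hb : 0 < b) :
    truncBeta' a b 0 = ENNReal.ofReal (ProbabilityTheory.beta (1 - a) b) := by
  have hpos := ProbabilityTheory.beta_pos (sub_pos.2 ha) hb
  have h := ProbabilityTheory.lintegral_betaPDF_eq_one (sub_pos.2 ha) hb
  rw [ProbabilityTheory.lintegral_betaPDF] at h
  have e : ∀ t ∈ Ioo (0 : ℝ) 1, ENNReal.ofReal (1 / ProbabilityTheory.beta (1 - a) b *
      t ^ (1 - a - 1) * (1 - t) ^ (b - 1)) =
      ENNReal.ofReal (1 / ProbabilityTheory.beta (1 - a) b) *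
        ENNReal.ofReal (t ^ (-a) * (1 - t) ^ (b - 1)) := by
    intro t _
    rw [← ENNReal.ofReal_mul (by positivity), mul_assoc]
    congr 4
    ring
  rw [setLIntegral_congr_fun measurableSet_Ioo e,
    lintegral_const_mul' _ _ ENNReal.ofReal_ne_top] at h
  change _ * truncBeta' a b 0 = 1 at h
  calc truncBeta' a b 0 = ENNReal.ofReal (ProbabilityTheory.beta (1 - a) b) *
        (ENNReal.ofReal (1 / ProbabilityTheory.beta (1 - a) b) * truncBeta' a b 0) := by
        rw [← mul_assoc, ← ENNReal.ofReal_mul hpos.le, mul_one_div_cancel hpos.ne',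
          ENNReal.ofReal_one, one_mul]
    _ = _ := by rw [h, mul_one]

theorem truncBeta'_le (ha : a < 1) (hb : 0 < b) {r : ℝ} (hr : 0 ≤ r) :
    truncBeta' a b r ≤ ENNReal.ofReal (ProbabilityTheory.beta (1 - a) b) := by
  rw [← truncBeta'_zero ha hb]
  exact lintegral_mono_set (Ioo_subset_Ioo_left hr)

/-- The left side is the integral over `(r, 1)` of the derivative of `-t^{-a} (1-t)^b`, whose value
at 1 is 0. -/
theorem truncBeta_add (ha : 0 < a) (hb : a < b) {r : ℝ} (hr : 0 < r) (hr1 : r < 1) :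
    ENNReal.ofReal a * truncBeta a b r + ENNReal.ofReal (b - a) * truncBeta' a b r =
      ENNReal.ofReal (r ^ (-a) * (1 - r) ^ b) := by
  have hb0 : 0 < b := ha.trans hb
  set F : ℝ → ℝ := fun t => -(t ^ (-a) * (1 - t) ^ b)
  set F' : ℝ → ℝ := fun t =>
    a * (t ^ (-1 - a) * (1 - t) ^ (b - 1)) + (b - a) * (t ^ (-a) * (1 - t) ^ (b - 1))
  have hF'0 : ∀ t ∈ Ioo r 1, 0 ≤ F' t := by
    intro t ht
    have h1 : 0 < t := hr.trans ht.1
    have h2 : 0 < 1 - t := sub_pos.2 ht.2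
    have h3 : 0 < b - a := sub_pos.2 hb
    positivity
  have hcont : ContinuousOn F (Icc r 1) := by
    refine ContinuousOn.neg (ContinuousOn.mul ?_ ?_)
    · exact continuousOn_id.rpow_const fun t ht => Or.inl (hr.trans_le ht.1).ne'
    · exact (continuousOn_const.sub continuousOn_id).rpow_const fun t _ => Or.inr hb0.le
  have hderiv : ∀ t ∈ Ioo r 1, HasDerivAt F (F' t) t := by
    intro t ht
    have h1 : 0 < t := hr.trans ht.1
    have h2 : 0 < 1 - t := sub_pos.2 ht.2
    have d1 : HasDerivAt (fun t : ℝ => t ^ (-a)) (-a * t ^ (-a - 1)) t :=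
      Real.hasDerivAt_rpow_const (Or.inl h1.ne')
    have d2 : HasDerivAt (fun t : ℝ => (1 - t) ^ b) (-1 * b * (1 - t) ^ (b - 1)) t :=
      ((hasDerivAt_id t).const_sub 1).rpow_const (Or.inl h2.ne')
    refine (d1.mul d2).neg.congr_deriv ?_
    have e1 : (1 - t) ^ b = (1 - t) ^ (b - 1) * (1 - t) := by
      rw [← Real.rpow_add_one h2.ne']; ring_nf
    have e2 : t ^ (-a) = t ^ (-1 - a) * t := by
      rw [← Real.rpow_add_one h1.ne']; ring_nf
    have e3 : t ^ (-a - 1) = t ^ (-1 - a) := by ring_nf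
    simp only [F']
    rw [e3, e1, e2]
    ring
  have hint : IntervalIntegrable F' volume r 1 := by
    rw [intervalIntegrable_iff_integrableOn_Ioc_of_le hr1.le]
    exact intervalIntegral.integrableOn_deriv_of_nonneg hcont hderiv hF'0
  have hI := intervalIntegral.integral_eq_sub_of_hasDerivAt_of_le hr1.le hcont hderiv hint
  have hF1 : F 1 - F r = r ^ (-a) * (1 - r) ^ b := by
    simp [F, Real.zero_rpow hb0.ne']
  rw [intervalIntegral.integral_of_le hr1.le, integral_Ioc_eq_integral_Ioo, hF1] at hI
  rw [← hI, ofReal_integral_eq_lintegral_ofReal]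
  · rw [truncBeta, truncBeta', ← lintegral_const_mul' _ _ ENNReal.ofReal_ne_top,
      ← lintegral_const_mul' _ _ ENNReal.ofReal_ne_top, ← lintegral_add_left (by fun_prop)]
    refine setLIntegral_congr_fun measurableSet_Ioo fun t ht => ?_
    have h1 : 0 < t := hr.trans ht.1
    have h2 : 0 < 1 - t := sub_pos.2 ht.2
    have h3 : 0 < b - a := sub_pos.2 hb
    rw [ENNReal.ofReal_add (by positivity) (by positivity), ENNReal.ofReal_mul ha.le,
      ENNReal.ofReal_mul h3.le]
  · rw [intervalIntegrable_iff_integrableOn_Ioc_of_le hr1.le] at hint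
    exact hint.mono_set Ioo_subset_Ioc_self
  · exact (ae_restrict_iff' measurableSet_Ioo).2 (Eventually.of_forall hF'0)

/-- `r^{-a}/a - ∫_r^1 t^{-1-a} (1-t)^{b-1} dt`, written as a sum of nonnegative terms. -/
def betaDefect (a b r : ℝ) : ENNReal :=
  if r < 1 then ENNReal.ofReal (r ^ (-a) * (1 - (1 - r) ^ b) / a) +
    ENNReal.ofReal ((b - a) / a) * truncBeta' a b r
  else ENNReal.ofReal (r ^ (-a) / a)

/-- Both `truncBeta` and `r^{-a}/a` blow up as `r → 0`, while `betaDefect` stays bounded. Stating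
their difference as a sum keeps all terms in `[0, ∞]` without subtraction. -/
theorem truncBeta_add_betaDefect (ha : 0 < a) (hb : a < b) {r : ℝ} (hr : 0 < r) :
    truncBeta a b r + betaDefect a b r = ENNReal.ofReal (r ^ (-a) / a) := by
  have hb0 : 0 < b := ha.trans hb
  by_cases hr1 : r < 1
  · have h := truncBeta_add ha hb hr hr1
    have h2 : 0 < 1 - r := sub_pos.2 hr1
    have h3 : (1 - r) ^ b ≤ 1 := Real.rpow_le_one h2.le (by linarith) hb0.le
    have h4 : 0 ≤ r ^ (-a) * (1 - (1 - r) ^ b) / a := by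
      have := sub_nonneg.2 h3
      positivity
    have e1 : truncBeta a b r =
        ENNReal.ofReal a⁻¹ * (ENNReal.ofReal a * truncBeta a b r) := by
      rw [← mul_assoc, ← ENNReal.ofReal_mul (by positivity), inv_mul_cancel₀ ha.ne',
        ENNReal.ofReal_one, one_mul]
    have e2 : ENNReal.ofReal ((b - a) / a) * truncBeta' a b r =
        ENNReal.ofReal a⁻¹ * (ENNReal.ofReal (b - a) * truncBeta' a b r) := by
      rw [← mul_assoc, ← ENNReal.ofReal_mul (by positivity), div_eq_inv_mul]
    rw [betaDefect, if_pos hr1, add_left_comm, e1, e2, ← mul_add, h,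
      ← ENNReal.ofReal_mul (by positivity), ← ENNReal.ofReal_add h4 (by positivity)]
    congr 1
    field_simp
    ring
  · rw [betaDefect, if_neg hr1, truncBeta, Ioo_eq_empty hr1]
    simp

theorem one_sub_one_sub_rpow_le (hb : 0 < b) {r : ℝ} (hr : 0 ≤ r) (hr1 : r ≤ 1) :
    1 - (1 - r) ^ b ≤ max 1 b * r := by
  have h1 : 0 ≤ 1 - r := sub_nonneg.2 hr1
  rcases le_total b 1 with h | h
  · have h2 : 1 - r ≤ (1 - r) ^ b := by
      conv_lhs => rw [← Real.rpow_one (1 - r)]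
      exact Real.rpow_le_rpow_of_exponent_ge' h1 (by linarith) hb.le h
    rw [max_eq_left h]
    linarith
  · have h2 := one_add_mul_self_le_rpow_one_add (s := -r) (by linarith) h
    rw [max_eq_right h]
    rw [← sub_eq_add_neg] at h2
    linarith

theorem betaDefect_lt_one_le (ha : 0 < a) (hb : a < b) {r : ℝ} (hr : 0 < r)
    (hr1 : r < 1) : r ^ (-a) * (1 - (1 - r) ^ b) / a ≤ max 1 b / a * r ^ (1 - a) := by
  have h := one_sub_one_sub_rpow_le (ha.trans hb) hr.le hr1.le
  have e : r ^ (1 - a) = r ^ (-a) * r := by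
    rw [← Real.rpow_add_one hr.ne']; ring_nf
  rw [e, div_mul_eq_mul_div]
  gcongr ?_ / _
  calc _ ≤ r ^ (-a) * (max 1 b * r) := by gcongr
    _ = _ := by ring

theorem betaDefect_le (ha : 0 < a) (ha1 : a < 1) (hb : a < b) {r : ℝ} (hr : 0 < r) :
    betaDefect a b r ≤ ENNReal.ofReal (max 1 b / a) +
      ENNReal.ofReal ((b - a) / a) * ENNReal.ofReal (ProbabilityTheory.beta (1 - a) b) := by
  have hb0 : 0 < b := ha.trans hb
  rw [betaDefect]
  split_ifs with h
  · refine add_le_add (ENNReal.ofReal_le_ofReal ((betaDefect_lt_one_le ha hb hr h).trans ?_))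
      (mul_le_mul_right (truncBeta'_le ha1 hb0 hr.le) _)
    exact mul_le_of_le_one_right (by positivity) (Real.rpow_le_one hr.le h.le (by linarith))
  · refine le_add_right (ENNReal.ofReal_le_ofReal ?_)
    gcongr
    exact (Real.rpow_le_one_of_one_le_of_nonpos (not_lt.1 h) (by linarith)).trans (le_max_left _ _)

/-- The limit is the number from which the Hardy constant arises in `beta_const`. The boundary term
is `O(r^{1-a})` and disappears because `a < 1`. -/
theorem tendsto_betaDefect (ha : 0 < a) (ha1 : a < 1) (hb : a < b) {r : ℕ → ℝ}
    (hr : ∀ n, 0 < r n) (hanti : Antitone r) (hlim : Tendsto r atTop (𝓝 0)) :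
    Tendsto (fun n => betaDefect a b (r n)) atTop
      (𝓝 (ENNReal.ofReal ((b - a) / a * ProbabilityTheory.beta (1 - a) b))) := by
  have hb0 : 0 < b := ha.trans hb
  have hba : 0 < b - a := sub_pos.2 hb
  have h1 : ∀ᶠ n in atTop, r n < 1 := hlim.eventually (gt_mem_nhds one_pos)
  have h2 : Tendsto (fun n => ENNReal.ofReal (r n ^ (-a) * (1 - (1 - r n) ^ b) / a)) atTop
      (𝓝 0) := by
    have h3 : Tendsto (fun n => max 1 b / a * r n ^ (1 - a)) atTop (𝓝 0) := by
      have := (hlim.rpow_const (p := 1 - a) (Or.inr (by linarith))).const_mul (max 1 b / a)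
      rwa [Real.zero_rpow (by linarith), mul_zero] at this
    rw [← ENNReal.ofReal_zero]
    refine (ENNReal.continuous_ofReal.tendsto 0).comp ?_
    refine squeeze_zero' ?_ ?_ h3
    · filter_upwards [h1] with n hn
      have h2 : 0 < 1 - r n := sub_pos.2 hn
      have h3 : (1 - r n) ^ b ≤ 1 := Real.rpow_le_one h2.le (by linarith [hr n]) hb0.le
      have := sub_nonneg.2 h3
      have := hr n
      positivity
    · filter_upwards [h1] with n hn using betaDefect_lt_one_le ha hb (hr n) hn
  have h3 : Tendsto (fun n => truncBeta' a b (r n)) atTop (𝓝 (truncBeta' a b 0)) := by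
    set G : ℝ → ENNReal := fun t => ENNReal.ofReal (t ^ (-a) * (1 - t) ^ (b - 1))
    have hG : Measurable G := by fun_prop
    simp only [truncBeta', ← lintegral_indicator measurableSet_Ioo]
    refine lintegral_tendsto_of_tendsto_of_monotone
      (fun n => (hG.indicator measurableSet_Ioo).aemeasurable) ?_ ?_
    · refine Eventually.of_forall fun t m n hmn => ?_
      exact indicator_le_indicator_of_subset (Ioo_subset_Ioo_left (hanti hmn))
        (fun _ => zero_le) t
    · refine Eventually.of_forall fun t => ?_
      by_cases ht : t ∈ Ioo (0 : ℝ) 1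
      · refine tendsto_const_nhds.congr' ?_
        filter_upwards [hlim.eventually (gt_mem_nhds ht.1)] with n hn
        rw [indicator_of_mem ht, indicator_of_mem (show t ∈ Ioo (r n) 1 from ⟨hn, ht.2⟩)]
      · refine tendsto_const_nhds.congr fun n => ?_
        rw [indicator_of_notMem ht, indicator_of_notMem]
        exact fun h => ht ⟨(hr n).trans h.1, h.2⟩
  have h4 := h2.add (ENNReal.Tendsto.const_mul (a := ENNReal.ofReal ((b - a) / a)) h3
    (Or.inr ENNReal.ofReal_ne_top))
  rw [zero_add, truncBeta'_zero ha1 hb0, ← ENNReal.ofReal_mul (by positivity)] at h4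
  refine h4.congr' ?_
  filter_upwards [h1] with n hn
  rw [betaDefect, if_pos hn]

end BetaIntegrals

end

noncomputable section

/-! ### Ground state representation for kernels of finite mass. -/

section GroundState

variable {d : ℕ}

/-- The ground state representation for a kernel `k` of finite mass. -/
theorem lintegral_kernel_sq_sub_eq {k : Rd d → ENNReal} (hk : Measurable k)
    (hke : ∀ x, k (-x) = k x) (hK : ∫⁻ z, k z ≠ ⊤) {h : Rd d → ℝ} (hh : Measurable h)
    (hpos : ∀ᵐ x, 0 < h x) {D : Rd d → ENNReal}
    (hkh : ∀ᵐ x, (∫⁻ y, k (x - y) * ENNReal.ofReal (h y)) + D x =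
      (∫⁻ z, k z) * ENNReal.ofReal (h x)) {f : Rd d → ℝ} (hf : MemLp f 2 volume) :
    ∫⁻ z : Rd d × Rd d, k (z.1 - z.2) * ENNReal.ofReal ((f z.1 - f z.2) ^ 2) =
      (∫⁻ z : Rd d × Rd d, k (z.1 - z.2) *
        ENNReal.ofReal (h z.1 * h z.2 * (f z.1 / h z.1 - f z.2 / h z.2) ^ 2)) +
      2 * ∫⁻ x, ENNReal.ofReal (f x ^ 2 / h x) * D x := by
  have hfm : AEMeasurable f volume := hf.1.aemeasurable
  have hf1 : AEMeasurable (fun z : Rd d × Rd d => f z.1) volume :=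
    hfm.comp_quasiMeasurePreserving Measure.quasiMeasurePreserving_fst
  have hf2 : AEMeasurable (fun z : Rd d × Rd d => f z.2) volume :=
    hfm.comp_quasiMeasurePreserving Measure.quasiMeasurePreserving_snd
  have hk2 : Measurable fun z : Rd d × Rd d => k (z.1 - z.2) := by fun_prop
  have hh1 : Measurable fun z : Rd d × Rd d => h z.1 := by fun_prop
  have hh2 : Measurable fun z : Rd d × Rd d => h z.2 := by fun_prop
  have hfin : ∫⁻ x, ENNReal.ofReal (f x ^ 2) ≠ ⊤ := ((memLp_two_iff_lintegral_sq hf.1).1 hf).ne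
  set K := ∫⁻ z, k z
  set A : ENNReal := ∫⁻ x, ENNReal.ofReal (f x ^ 2 / h x) *
    ∫⁻ y, k (x - y) * ENNReal.ofReal (h y)
  have hconvm : Measurable fun x => ∫⁻ y, k (x - y) * ENNReal.ofReal (h y) := by
    exact Measurable.lintegral_prod_right' (f := fun z : Rd d × Rd d =>
      k (z.1 - z.2) * ENNReal.ofReal (h z.2)) (by fun_prop)
  have swap : ∀ G : Rd d × Rd d → ENNReal, ∫⁻ z, G z = ∫⁻ z : Rd d × Rd d, G z.swap := fun G =>
    ((Measure.measurePreserving_swap (μ := (volume : Measure (Rd d)))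
      (ν := (volume : Measure (Rd d)))).lintegral_comp_emb
      MeasurableEquiv.prodComm.measurableEmbedding G).symm
  have hk_symm : ∀ x y, k (x - y) = k (y - x) := fun x y => by rw [← hke, neg_sub]
  have a1 : ∫⁻ z : Rd d × Rd d, k (z.1 - z.2) * ENNReal.ofReal (f z.1 ^ 2 / h z.1 * h z.2) =
      A := by
    rw [Measure.volume_eq_prod, lintegral_prod _ (by
      exact hk2.aemeasurable.mul (((hf1.pow_const 2).div hh1.aemeasurable).mul
        hh2.aemeasurable).ennreal_ofReal)]
    refine lintegral_congr_ae ?_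
    filter_upwards [hpos] with x hx
    rw [← lintegral_const_mul' _ _ ENNReal.ofReal_ne_top]
    refine lintegral_congr fun y => ?_
    rw [ENNReal.ofReal_mul (by positivity)]
    ring
  have a2 : ∫⁻ z : Rd d × Rd d, k (z.1 - z.2) * ENNReal.ofReal (f z.2 ^ 2 / h z.2 * h z.1) =
      A := by
    rw [swap, ← a1]
    exact lintegral_congr fun z => by simp only [Prod.fst_swap, Prod.snd_swap, hk_symm z.2]
  have b1 : ∫⁻ z : Rd d × Rd d, k (z.1 - z.2) * ENNReal.ofReal (f z.1 ^ 2) =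
      K * ∫⁻ x, ENNReal.ofReal (f x ^ 2) := by
    rw [Measure.volume_eq_prod, lintegral_prod _ (by
      exact hk2.aemeasurable.mul (hf1.pow_const 2).ennreal_ofReal),
      ← lintegral_const_mul' _ _ hK]
    refine lintegral_congr fun x => ?_
    dsimp only
    rw [lintegral_mul_const' _ _ ENNReal.ofReal_ne_top]
    congr 1
    exact lintegral_sub_left_eq_self k x
  have b2 : ∫⁻ z : Rd d × Rd d, k (z.1 - z.2) * ENNReal.ofReal (f z.2 ^ 2) =
      K * ∫⁻ x, ENNReal.ofReal (f x ^ 2) := by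
    rw [swap, ← b1]
    exact lintegral_congr fun z => by simp only [Prod.fst_swap, Prod.snd_swap, hk_symm z.2]
  have hAR : A + ∫⁻ x, ENNReal.ofReal (f x ^ 2 / h x) * D x =
      K * ∫⁻ x, ENNReal.ofReal (f x ^ 2) := by
    have m : AEMeasurable (fun x => ENNReal.ofReal (f x ^ 2 / h x) *
        ∫⁻ y, k (x - y) * ENNReal.ofReal (h y)) volume :=
      ((hfm.pow_const 2).div hh.aemeasurable).ennreal_ofReal.mul hconvm.aemeasurable
    rw [← lintegral_add_left' m, ← lintegral_const_mul' _ _ hK]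
    refine lintegral_congr_ae ?_
    filter_upwards [hpos, hkh] with x hx hx2
    rw [← mul_add, hx2, mul_left_comm, ← ENNReal.ofReal_mul (by positivity),
      div_mul_cancel₀ _ hx.ne']
  have hA : A ≠ ⊤ := by
    refine ne_top_of_le_ne_top (ENNReal.mul_ne_top hK hfin) (hAR ▸ le_self_add)
  -- The integrated form of `(f₁-f₂)² + f₁² h₂/h₁ + f₂² h₁/h₂ = h₁h₂ (f₁/h₁ - f₂/h₂)² + f₁² + f₂²`.
  -- The two middle terms integrate to `A` each, and `A` can be cancelled because the finite mass of
  -- `k` makes it finite.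
  have key : (∫⁻ z : Rd d × Rd d, k (z.1 - z.2) * ENNReal.ofReal ((f z.1 - f z.2) ^ 2)) +
        (A + A) =
      (∫⁻ z : Rd d × Rd d, k (z.1 - z.2) *
        ENNReal.ofReal (h z.1 * h z.2 * (f z.1 / h z.1 - f z.2 / h z.2) ^ 2)) +
      (K * (∫⁻ x, ENNReal.ofReal (f x ^ 2)) + K * ∫⁻ x, ENNReal.ofReal (f x ^ 2)) := by
    nth_rw 1 [← a1, ← a2]
    rw [← b1]
    nth_rw 2 [b1]
    have m1 : AEMeasurable (fun z : Rd d × Rd d =>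
        k (z.1 - z.2) * ENNReal.ofReal (f z.2 ^ 2 / h z.2 * h z.1)) volume :=
      hk2.aemeasurable.mul (((hf2.pow_const 2).div
        hh2.aemeasurable).mul hh1.aemeasurable).ennreal_ofReal
    have m2 : AEMeasurable (fun z : Rd d × Rd d =>
        k (z.1 - z.2) * ENNReal.ofReal (f z.2 ^ 2)) volume :=
      hk2.aemeasurable.mul (hf2.pow_const 2).ennreal_ofReal
    have m3 : AEMeasurable (fun z : Rd d × Rd d =>
        k (z.1 - z.2) * ENNReal.ofReal ((f z.1 - f z.2) ^ 2)) volume :=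
      hk2.aemeasurable.mul ((hf1.sub hf2).pow_const 2).ennreal_ofReal
    have m4 : AEMeasurable (fun z : Rd d × Rd d => k (z.1 - z.2) *
        ENNReal.ofReal (h z.1 * h z.2 * (f z.1 / h z.1 - f z.2 / h z.2) ^ 2)) volume :=
      hk2.aemeasurable.mul ((hh1.aemeasurable.mul hh2.aemeasurable).mul
        (((hf1.div hh1.aemeasurable).sub (hf2.div hh2.aemeasurable)).pow_const 2)).ennreal_ofReal
    rw [← b2, ← lintegral_add_right' _ m1, ← lintegral_add_right' _ m2,
      ← lintegral_add_left' m3, ← lintegral_add_left' m4]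
    refine lintegral_congr_ae ?_
    filter_upwards [ae_comp_fst hpos, ae_comp_snd hpos] with z h1 h2
    rw [← mul_add, ← mul_add, ← mul_add, ← mul_add,
      ← ENNReal.ofReal_add (by positivity) (by positivity),
      ← ENNReal.ofReal_add (by positivity) (by positivity),
      ← ENNReal.ofReal_add (by positivity) (by positivity),
      ← ENNReal.ofReal_add (by positivity) (by positivity)]
    congr 2
    field_simp
    ring
  rw [← hAR] at key
  exact (ENNReal.add_left_inj (ENNReal.add_ne_top.2 ⟨hA, hA⟩)).1 (key.trans (by ring))

end GroundState

/-! ### The kernel cut off at small times, acting on a Riesz kernel. -/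

section TruncatedKernel

variable {d : ℕ} {a b : ℝ}

theorem lintegral_Ioi_rpow (ha : 0 < a) {δ : ℝ} (hδ : 0 < δ) :
    ∫⁻ t in Ioi δ, ENNReal.ofReal (t ^ (-1 - a)) = ENNReal.ofReal (δ ^ (-a) / a) := by
  rw [← ofReal_integral_eq_lintegral_ofReal
    (integrableOn_Ioi_rpow_of_lt (by linarith) hδ), integral_Ioi_rpow_of_lt (by linarith) hδ]
  · congr 1
    rw [show -1 - a + 1 = -a by ring, neg_div_neg_eq]
  · filter_upwards [ae_restrict_mem measurableSet_Ioi] with t ht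
    have : 0 < t := hδ.trans ht
    positivity

/-- The truncation `∫_δ^∞ t^{-1-a} g_t(z) dt` of the kernel `|z|^{-d-2a}`. -/
def truncKernel (a δ : ℝ) (z : Rd d) : ENNReal :=
  ∫⁻ t in Ioi δ, ENNReal.ofReal (t ^ (-1 - a) * gaussKernel t z)

theorem measurable_rpow_mul_gaussKernel (p : ℝ) :
    Measurable fun z : ℝ × Rd d => ENNReal.ofReal (z.1 ^ p * gaussKernel z.1 z.2) :=
  ((measurable_fst.pow_const p).mul measurable_gaussKernel).ennreal_ofReal

theorem measurable_truncKernel (a δ : ℝ) : Measurable (truncKernel a δ : Rd d → ENNReal) := by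
  exact Measurable.lintegral_prod_left' (μ := volume.restrict (Ioi δ))
    (measurable_rpow_mul_gaussKernel (d := d) (-1 - a))

theorem truncKernel_neg (δ : ℝ) (z : Rd d) : truncKernel a δ (-z) = truncKernel a δ z := by
  simp only [truncKernel, gaussKernel_neg]

theorem lintegral_truncKernel (ha : 0 < a) {δ : ℝ} (hδ : 0 < δ) :
    ∫⁻ z : Rd d, truncKernel a δ z = ENNReal.ofReal (δ ^ (-a) / a) := by
  simp only [truncKernel]
  rw [lintegral_lintegral_swap
    (f := fun (z : Rd d) (t : ℝ) => ENNReal.ofReal (t ^ (-1 - a) * gaussKernel t z))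
    ((measurable_rpow_mul_gaussKernel (d := d) (-1 - a)).comp measurable_swap).aemeasurable,
    ← lintegral_Ioi_rpow ha hδ]
  refine setLIntegral_congr_fun measurableSet_Ioi fun t ht => ?_
  have ht' : 0 < t := hδ.trans ht
  simp only [ENNReal.ofReal_mul (Real.rpow_nonneg ht'.le _)]
  rw [lintegral_const_mul' _ _ ENNReal.ofReal_ne_top, lintegral_gaussKernel ht', mul_one]

theorem tendsto_truncKernel {δ : ℕ → ℝ} (hpos : ∀ n, 0 < δ n) (hanti : Antitone δ)
    (hlim : Tendsto δ atTop (𝓝 0)) (z : Rd d) :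
    Monotone (fun n => truncKernel a (δ n) z) ∧
      Tendsto (fun n => truncKernel a (δ n) z) atTop (𝓝 (truncKernel a 0 z)) := by
  have hm : Measurable fun t : ℝ => ENNReal.ofReal (t ^ (-1 - a) * gaussKernel t z) :=
    (measurable_rpow_mul_gaussKernel (d := d) (-1 - a)).comp measurable_prodMk_right
  refine ⟨fun m n hmn => lintegral_mono_set (Ioi_subset_Ioi (hanti hmn)), ?_⟩
  simp only [truncKernel, ← lintegral_indicator measurableSet_Ioi]
  refine lintegral_tendsto_of_tendsto_of_monotone
    (fun n => (hm.indicator measurableSet_Ioi).aemeasurable) ?_ ?_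
  · exact Eventually.of_forall fun t m n hmn =>
      indicator_le_indicator_of_subset (Ioi_subset_Ioi (hanti hmn)) (fun _ => zero_le) t
  · refine Eventually.of_forall fun t => ?_
    by_cases ht : t ∈ Ioi (0 : ℝ)
    · refine tendsto_const_nhds.congr' ?_
      filter_upwards [hlim.eventually (gt_mem_nhds ht)] with n hn
      rw [indicator_of_mem ht, indicator_of_mem (show t ∈ Ioi (δ n) from hn)]
    · refine tendsto_const_nhds.congr fun n => ?_
      rw [indicator_of_notMem ht, indicator_of_notMem]
      exact fun h => ht ((hpos n).trans h)

theorem lintegral_Ioo_rpow_mul_sub_rpow {δ u : ℝ} (hδ : 0 < δ) (hu : 0 < u) :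
    ∫⁻ t in Ioo δ u, ENNReal.ofReal (t ^ (-1 - a) * (u - t) ^ (b - 1)) =
      ENNReal.ofReal (u ^ (b - 1 - a)) * truncBeta a b (δ / u) := by
  have himg : (fun τ => u * τ) '' Ioo (δ / u) 1 = Ioo δ u := by
    rw [image_mul_left_Ioo hu, mul_one, mul_div_cancel₀ _ hu.ne']
  rw [← himg, lintegral_image_eq_lintegral_abs_deriv_mul measurableSet_Ioo (f' := fun _ => u)
    (fun τ _ => by simpa using ((hasDerivAt_id τ).const_mul u).hasDerivWithinAt)
    (mul_right_injective₀ hu.ne').injOn, truncBeta,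
    ← lintegral_const_mul' _ _ ENNReal.ofReal_ne_top]
  refine setLIntegral_congr_fun measurableSet_Ioo fun τ hτ => ?_
  have h1 : 0 < τ := (div_pos hδ hu).trans hτ.1
  have h2 : 0 < 1 - τ := sub_pos.2 hτ.2
  rw [abs_of_pos hu, ← ENNReal.ofReal_mul hu.le, ← ENNReal.ofReal_mul (by positivity)]
  congr 1
  rw [show u - u * τ = u * (1 - τ) by ring, Real.mul_rpow hu.le h1.le, Real.mul_rpow hu.le h2.le,
    show b - 1 - a = 1 + (-1 - a) + (b - 1) by ring, Real.rpow_add hu, Real.rpow_add hu,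
    Real.rpow_one]
  ring

/-- Both factors are time integrals of Gauss kernels, at times `t > δ` and `s > 0`. The `y`-integral
merges them into the kernel at time `u = s + t`; for fixed `u` the remaining `t`-integral over `(δ,
u)` is a truncated beta integral after scaling by `u`. -/
theorem lintegral_truncKernel_mul_rieszKernel {δ : ℝ} (hδ : 0 < δ) (hd : 0 < d) {q : ℝ}
    (hq : 0 < q) (hbq : q = (d : ℝ) / 2 - b) (x : Rd d) :
    ∫⁻ y, truncKernel a δ (x - y) * ENNReal.ofReal (rieszKernel q y) =
      ∫⁻ u in Ioi (0 : ℝ), ENNReal.ofReal (u ^ (b - 1 - a) * gaussKernel u x) *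
        truncBeta a b (δ / u) := by
  have : Nontrivial (Rd d) := by
    have : Nonempty (Fin d) := ⟨⟨0, hd⟩⟩
    infer_instance
  have hne : ∀ᵐ y : Rd d, y ≠ 0 := (measure_eq_zero_iff_ae_notMem.1 (measure_singleton 0))
  set T : ℝ → ENNReal := fun t => ENNReal.ofReal (t ^ (-1 - a))
  set S : ℝ → ENNReal := fun s => ENNReal.ofReal (s ^ (b - 1))
  have hT : Measurable T := by fun_prop
  have hS : Measurable S := by fun_prop
  have hg : Measurable fun z : ℝ × Rd d => ENNReal.ofReal (gaussKernel z.1 z.2) :=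
    measurable_gaussKernel.ennreal_ofReal
  have hgx : ∀ x : Rd d, Measurable fun t : ℝ => ENNReal.ofReal (gaussKernel t x) := fun x =>
    hg.comp measurable_prodMk_right
  calc ∫⁻ y, truncKernel a δ (x - y) * ENNReal.ofReal (rieszKernel q y)
      = ∫⁻ y, ∫⁻ t in Ioi δ, ∫⁻ s in Ioi (0 : ℝ),
          T t * S s * ENNReal.ofReal (gaussKernel t (x - y) * gaussKernel s y) := by
        refine lintegral_congr_ae ?_
        filter_upwards [hne] with y hy
        have e := lintegral_rpow_mul_gaussKernel (p := b - 1) (by linarith) hy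
        rw [show (d : ℝ) / 2 - (b - 1) - 1 = q by linarith] at e
        rw [← e, truncKernel, ← lintegral_mul_const' _ _ (by rw [e]; exact ENNReal.ofReal_ne_top)]
        refine setLIntegral_congr_fun measurableSet_Ioi fun t ht => ?_
        have ht' : 0 < t := hδ.trans ht
        rw [← lintegral_const_mul' _ _ ENNReal.ofReal_ne_top]
        refine setLIntegral_congr_fun measurableSet_Ioi fun s hs => ?_
        have hs' : (0 : ℝ) < s := hs
        have h1 := gaussKernel_pos ht' (x - y)
        simp only [T, S]
        rw [← ENNReal.ofReal_mul (by positivity), ← ENNReal.ofReal_mul (by positivity),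
          ← ENNReal.ofReal_mul (by positivity)]
        congr 1
        ring
    _ = ∫⁻ t in Ioi δ, ∫⁻ s in Ioi (0 : ℝ), ∫⁻ y,
          T t * S s * ENNReal.ofReal (gaussKernel t (x - y) * gaussKernel s y) := by
        have hm : Measurable fun z : (Rd d × ℝ) × ℝ =>
            T z.1.2 * S z.2 * ENNReal.ofReal (gaussKernel z.1.2 (x - z.1.1) *
              gaussKernel z.2 z.1.1) := by
          have h1 : Measurable fun z : (Rd d × ℝ) × ℝ => gaussKernel z.1.2 (x - z.1.1) :=
            measurable_gaussKernel.comp (f := fun z : (Rd d × ℝ) × ℝ => (z.1.2, x - z.1.1))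
              (by fun_prop)
          have h2 : Measurable fun z : (Rd d × ℝ) × ℝ => gaussKernel z.2 z.1.1 :=
            measurable_gaussKernel.comp (f := fun z : (Rd d × ℝ) × ℝ => (z.2, z.1.1))
              (by fun_prop)
          fun_prop
        rw [lintegral_lintegral_swap (f := fun y t => ∫⁻ s in Ioi (0 : ℝ),
          T t * S s * ENNReal.ofReal (gaussKernel t (x - y) * gaussKernel s y))
          (hm.lintegral_prod_right' (ν := volume.restrict (Ioi (0 : ℝ)))).aemeasurable]
        refine lintegral_congr fun t => ?_
        exact lintegral_lintegral_swap (f := fun y s =>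
          T t * S s * ENNReal.ofReal (gaussKernel t (x - y) * gaussKernel s y))
          (hm.comp (f := fun z : Rd d × ℝ => ((z.1, t), z.2)) (by fun_prop)).aemeasurable
    _ = ∫⁻ t in Ioi δ, ∫⁻ u in Ioi t, T t * S (u - t) * ENNReal.ofReal (gaussKernel u x) := by
        refine setLIntegral_congr_fun measurableSet_Ioi fun t ht => ?_
        have ht' : 0 < t := hδ.trans ht
        have e : ∀ s ∈ Ioi (0 : ℝ), ∫⁻ y, T t * S s *
            ENNReal.ofReal (gaussKernel t (x - y) * gaussKernel s y) =
            T t * S s * ENNReal.ofReal (gaussKernel (s + t) x) := by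
          intro s hs
          rw [lintegral_const_mul' _ _ (ENNReal.mul_ne_top ENNReal.ofReal_ne_top
            ENNReal.ofReal_ne_top), lintegral_gaussKernel_mul hs ht']
        rw [setLIntegral_congr_fun measurableSet_Ioi e]
        have h1 := (measurePreserving_sub_right (volume : Measure ℝ) t).setLIntegral_comp_preimage_emb
          (measurableEmbedding_subRight t)
          (fun s => T t * S s * ENNReal.ofReal (gaussKernel (s + t) x)) (Ioi 0)
        rw [preimage_sub_const_Ioi, zero_add] at h1
        rw [← h1]
        simp only [sub_add_cancel]
    _ = ∫⁻ u in Ioi (0 : ℝ), ∫⁻ t in Ioo δ u,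
          T t * S (u - t) * ENNReal.ofReal (gaussKernel u x) := by
        simp only [← lintegral_indicator measurableSet_Ioi, ← lintegral_indicator measurableSet_Ioo]
        have e1 : ∀ t u : ℝ, (Ioi δ).indicator (fun t => (Ioi t).indicator (fun u =>
            T t * S (u - t) * ENNReal.ofReal (gaussKernel u x)) u) t =
            {z : ℝ × ℝ | δ < z.1 ∧ z.1 < z.2}.indicator (fun z =>
              T z.1 * S (z.2 - z.1) * ENNReal.ofReal (gaussKernel z.2 x)) (t, u) := by
          intro t u
          by_cases h1 : δ < t <;> by_cases h2 : t < u <;> simp [indicator, h1, h2]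
        have e2 : ∀ t u : ℝ, (Ioi (0 : ℝ)).indicator (fun u => (Ioo δ u).indicator (fun t =>
            T t * S (u - t) * ENNReal.ofReal (gaussKernel u x)) t) u =
            {z : ℝ × ℝ | δ < z.1 ∧ z.1 < z.2}.indicator (fun z =>
              T z.1 * S (z.2 - z.1) * ENNReal.ofReal (gaussKernel z.2 x)) (t, u) := by
          intro t u
          by_cases h1 : δ < t <;> by_cases h2 : t < u
          · have : 0 < u := hδ.trans (h1.trans h2)
            simp [indicator, h1, h2, this]
          all_goals simp [indicator, h1, h2]
        have hm : Measurable ({z : ℝ × ℝ | δ < z.1 ∧ z.1 < z.2}.indicator (fun z =>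
              T z.1 * S (z.2 - z.1) * ENNReal.ofReal (gaussKernel z.2 x))) := by
          refine Measurable.indicator ?_ ((measurableSet_lt measurable_const measurable_fst).inter
            (measurableSet_lt measurable_fst measurable_snd))
          have h2 : Measurable fun z : ℝ × ℝ => ENNReal.ofReal (gaussKernel z.2 x) :=
            (hgx x).comp measurable_snd
          have h3 : Measurable fun z : ℝ × ℝ => S (z.2 - z.1) :=
            hS.comp (measurable_snd.sub measurable_fst)
          exact ((hT.comp measurable_fst).mul h3).mul h2
        have s1 : ∀ t : ℝ, (Ioi δ).indicator (fun t => ∫⁻ u, (Ioi t).indicator (fun u =>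
            T t * S (u - t) * ENNReal.ofReal (gaussKernel u x)) u) t =
            ∫⁻ u, (Ioi δ).indicator (fun t => (Ioi t).indicator (fun u =>
            T t * S (u - t) * ENNReal.ofReal (gaussKernel u x)) u) t := by
          intro t
          by_cases h1 : t ∈ Ioi δ
          · simp only [indicator_of_mem h1]
          · simp only [indicator_of_notMem h1, lintegral_zero]
        have s2 : ∀ u : ℝ, (Ioi (0 : ℝ)).indicator (fun u => ∫⁻ t, (Ioo δ u).indicator (fun t =>
            T t * S (u - t) * ENNReal.ofReal (gaussKernel u x)) t) u =
            ∫⁻ t, (Ioi (0 : ℝ)).indicator (fun u => (Ioo δ u).indicator (fun t =>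
            T t * S (u - t) * ENNReal.ofReal (gaussKernel u x)) t) u := by
          intro u
          by_cases h1 : u ∈ Ioi (0 : ℝ)
          · simp only [indicator_of_mem h1]
          · simp only [indicator_of_notMem h1, lintegral_zero]
        simp only [s1, s2, e1, e2]
        exact lintegral_lintegral_swap (f := fun t u => {z : ℝ × ℝ | δ < z.1 ∧ z.1 < z.2}.indicator
          (fun z => T z.1 * S (z.2 - z.1) * ENNReal.ofReal (gaussKernel z.2 x)) (t, u))
          hm.aemeasurable
    _ = _ := by
        refine setLIntegral_congr_fun measurableSet_Ioi fun u hu => ?_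
        have hu' : (0 : ℝ) < u := hu
        rw [lintegral_mul_const' _ _ ENNReal.ofReal_ne_top,
          ENNReal.ofReal_mul (by positivity), mul_right_comm,
          ← lintegral_Ioo_rpow_mul_sub_rpow hδ hu']
        congr 1
        refine setLIntegral_congr_fun measurableSet_Ioo fun t ht => ?_
        have : 0 < t := hδ.trans ht.1
        simp only [T, S]
        rw [← ENNReal.ofReal_mul (by positivity)]

theorem antitone_truncBeta : Antitone (truncBeta a b) := fun _ _ h =>
  lintegral_mono_set (Ioo_subset_Ioo_left h)

theorem measurable_betaDefect : Measurable (betaDefect a b) := by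
  have h : Measurable (truncBeta' a b) := Antitone.measurable fun _ _ h =>
    lintegral_mono_set (Ioo_subset_Ioo_left h)
  unfold betaDefect
  refine Measurable.ite measurableSet_Iio ?_ ?_
  · exact Measurable.add (by fun_prop) (h.const_mul _)
  · fun_prop

/-- The defect of the truncated kernel on the function `∫_0^∞ u^{b-1} g_u du`. -/
def kernelDefect (a b δ : ℝ) (x : Rd d) : ENNReal :=
  ∫⁻ u in Ioi (0 : ℝ), ENNReal.ofReal (u ^ (b - 1 - a) * gaussKernel u x) *
    betaDefect a b (δ / u)

theorem measurable_kernelDefect (δ : ℝ) :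
    Measurable (kernelDefect a b δ : Rd d → ENNReal) := by
  refine Measurable.lintegral_prod_left' (μ := volume.restrict (Ioi (0 : ℝ)))
    (f := fun z : ℝ × Rd d => ENNReal.ofReal (z.1 ^ (b - 1 - a) * gaussKernel z.1 z.2) *
      betaDefect a b (δ / z.1)) ?_
  exact (measurable_rpow_mul_gaussKernel _).mul
    (measurable_betaDefect.comp (measurable_const.div measurable_fst))

/-- Under the integral over `u` this is `truncBeta_add_betaDefect` with `r = δ / u`. -/
theorem lintegral_truncKernel_mul_add_kernelDefect {δ : ℝ} (hδ : 0 < δ) (hd : 0 < d) {q : ℝ}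
    (ha : 0 < a) (hab : a < b) (hq : 0 < q) (hbq : q = (d : ℝ) / 2 - b) {x : Rd d} (hx : x ≠ 0) :
    (∫⁻ y, truncKernel a δ (x - y) * ENNReal.ofReal (rieszKernel q y)) + kernelDefect a b δ x =
      (∫⁻ z : Rd d, truncKernel a δ z) * ENNReal.ofReal (rieszKernel q x) := by
  have e := lintegral_rpow_mul_gaussKernel (p := b - 1) (by linarith) hx
  rw [show (d : ℝ) / 2 - (b - 1) - 1 = q by linarith] at e
  have hm : Measurable fun u : ℝ => ENNReal.ofReal (u ^ (b - 1 - a) * gaussKernel u x) :=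
    (measurable_rpow_mul_gaussKernel (d := d) _).comp measurable_prodMk_right
  have hm2 : Measurable fun u : ℝ => ENNReal.ofReal (u ^ (b - 1 - a) * gaussKernel u x) *
      truncBeta a b (δ / u) :=
    hm.mul (antitone_truncBeta.measurable.comp (measurable_const.div measurable_id))
  rw [lintegral_truncKernel_mul_rieszKernel hδ hd hq hbq, kernelDefect, lintegral_truncKernel ha hδ,
    ← e, ← lintegral_const_mul' _ _ ENNReal.ofReal_ne_top, ← lintegral_add_left hm2]
  refine setLIntegral_congr_fun measurableSet_Ioi fun u hu => ?_
  have hu' : (0 : ℝ) < u := hu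
  have hg := gaussKernel_pos hu' x
  rw [← mul_add, truncBeta_add_betaDefect ha hab (div_pos hδ hu'),
    ← ENNReal.ofReal_mul (by positivity), ← ENNReal.ofReal_mul (by positivity)]
  congr 1
  rw [Real.div_rpow hδ.le hu'.le, show b - 1 - a = b - 1 + -a by ring, Real.rpow_add hu']
  have : u ^ (-a) ≠ 0 := (Real.rpow_pos_of_pos hu' _).ne'
  field_simp

/-- Uniform in `δ`, so that it can serve as a dominating function when `δ → 0`. -/
theorem kernelDefect_le (ha : 0 < a) (ha1 : a < 1) (hab : a < b) {δ : ℝ} (hδ : 0 < δ)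
    (hbd : b - a < (d : ℝ) / 2) {x : Rd d} (hx : x ≠ 0) : kernelDefect a b δ x ≤
      ENNReal.ofReal (rieszKernel ((d : ℝ) / 2 - (b - a)) x) *
        (ENNReal.ofReal (max 1 b / a) +
          ENNReal.ofReal ((b - a) / a) * ENNReal.ofReal (ProbabilityTheory.beta (1 - a) b)) := by
  have e := lintegral_rpow_mul_gaussKernel (p := b - 1 - a) (by linarith) hx
  rw [show (d : ℝ) / 2 - (b - 1 - a) - 1 = (d : ℝ) / 2 - (b - a) by ring] at e
  rw [← e, ← lintegral_mul_const' _ _ (by finiteness)]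
  refine setLIntegral_mono' measurableSet_Ioi fun u hu => ?_
  exact mul_le_mul_right (betaDefect_le ha ha1 hab (div_pos hδ hu)) _

theorem tendsto_kernelDefect (ha : 0 < a) (ha1 : a < 1) (hab : a < b) {δ : ℕ → ℝ}
    (hpos : ∀ n, 0 < δ n) (hanti : Antitone δ) (hlim : Tendsto δ atTop (𝓝 0))
    (hbd : b - a < (d : ℝ) / 2) {x : Rd d} (hx : x ≠ 0) :
    Tendsto (fun n => kernelDefect a b (δ n) x) atTop
      (𝓝 (ENNReal.ofReal (rieszKernel ((d : ℝ) / 2 - (b - a)) x) *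
        ENNReal.ofReal ((b - a) / a * ProbabilityTheory.beta (1 - a) b))) := by
  have e := lintegral_rpow_mul_gaussKernel (p := b - 1 - a) (by linarith) hx
  rw [show (d : ℝ) / 2 - (b - 1 - a) - 1 = (d : ℝ) / 2 - (b - a) by ring] at e
  have hm : Measurable fun u : ℝ => ENNReal.ofReal (u ^ (b - 1 - a) * gaussKernel u x) :=
    (measurable_rpow_mul_gaussKernel (d := d) _).comp measurable_prodMk_right
  rw [← e, ← lintegral_mul_const' _ _ ENNReal.ofReal_ne_top]
  refine tendsto_lintegral_of_dominated_convergence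
    (fun u => ENNReal.ofReal (u ^ (b - 1 - a) * gaussKernel u x) *
      (ENNReal.ofReal (max 1 b / a) +
        ENNReal.ofReal ((b - a) / a) * ENNReal.ofReal (ProbabilityTheory.beta (1 - a) b)))
    (fun n => hm.mul (measurable_betaDefect.comp (measurable_const.div measurable_id))) ?_ ?_ ?_
  · intro n
    filter_upwards [ae_restrict_mem measurableSet_Ioi] with u hu
    exact mul_le_mul_right (betaDefect_le ha ha1 hab (div_pos (hpos n) hu)) _
  · rw [lintegral_mul_const' _ _ (by finiteness), e]
    finiteness
  · filter_upwards [ae_restrict_mem measurableSet_Ioi] with u hu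
    have hu' : (0 : ℝ) < u := hu
    refine ENNReal.Tendsto.const_mul (tendsto_betaDefect ha ha1 hab
      (fun n => div_pos (hpos n) hu') (fun m n h => div_le_div_of_nonneg_right (hanti h) hu'.le) ?_)
      (Or.inr ENNReal.ofReal_ne_top)
    simpa using hlim.div_const u

end TruncatedKernel

end

noncomputable section

/-! ### Ground state representation of the fractional energy, with the sharp Hardy constant. -/

section Hardy

variable {d : ℕ} {α : ℝ}

theorem rieszKernel_eq (q : ℝ) (x : Rd d) : rieszKernel q x =
    (4 * Real.pi) ^ (-(d : ℝ) / 2) * Real.Gamma q * 4 ^ q * ‖x‖ ^ (-(2 * q)) := by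
  rw [rieszKernel, Real.div_rpow (by positivity) (by norm_num), ← Real.rpow_natCast,
    ← Real.rpow_mul (norm_nonneg _), Real.rpow_neg (by norm_num : (0 : ℝ) ≤ 4), div_inv_eq_mul]
  push_cast
  rw [mul_neg]
  ring

theorem four_rpow (q : ℝ) : (4 : ℝ) ^ q = 2 ^ (2 * q) := by
  rw [Real.rpow_mul (by norm_num)]
  norm_num

theorem truncKernel_zero (hα : 0 < α) {z : Rd d} (hz : z ≠ 0) :
    truncKernel (α / 2) 0 z = ENNReal.ofReal (rieszKernel (((d : ℝ) + α) / 2) z) := by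
  have hd : (0 : ℝ) ≤ d := d.cast_nonneg
  rw [truncKernel, lintegral_rpow_mul_gaussKernel (by linarith) hz]
  congr 2
  ring

/-- With `truncKernel_zero` this is subordination: away from 0 the kernel `𝒜(d, α)|z|^{-d-α}` equals
`(α/2)/Γ(1-α/2)` times `∫ t^{-1-α/2} g_t(z) dt`. -/
theorem fracConst_div_rpow (hα : 0 < α) (hα2 : α < 2) (z : Rd d) :
    fracConst d α / ‖z‖ ^ ((d : ℝ) + α) = α / 2 / Real.Gamma (1 - α / 2) *
      rieszKernel (((d : ℝ) + α) / 2) z := by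
  have hG : Real.Gamma (1 - α / 2) ≠ 0 := (Real.Gamma_pos_of_pos (by linarith)).ne'
  have hpi := Real.pi_pos
  rw [rieszKernel_eq, four_rpow, show 2 * (((d : ℝ) + α) / 2) = d + α by ring,
    Real.rpow_neg (norm_nonneg _), ← div_eq_mul_inv, ← mul_div_assoc, fracConst,
    Real.mul_rpow (by norm_num) hpi.le, four_rpow, show 2 * (-(d : ℝ) / 2) = -d by ring,
    Real.rpow_add two_pos, Real.rpow_sub two_pos, neg_div, Real.rpow_neg hpi.le,
    Real.rpow_neg zero_le_two, Real.rpow_one]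
  congr 1
  have h1 : Real.pi ^ ((d : ℝ) / 2) ≠ 0 := by positivity
  have h2 : (2 : ℝ) ^ (d : ℝ) ≠ 0 := by positivity
  have h3 : (2 : ℝ) ^ α ≠ 0 := by positivity
  field_simp

/-- The case `a = α/2`, `b = (d+α)/4` of the limiting defect. Here `b - a = (d-α)/4 = q`, and the
denominator of the beta function is `Γ(q+1) = q Γ(q)`. -/
theorem beta_const (hα : 0 < α) (hα2 : α < 2) (hαd : α < d) :
    α / 2 / Real.Gamma (1 - α / 2) * ((((d : ℝ) + α) / 4 - α / 2) / (α / 2) *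
      ProbabilityTheory.beta (1 - α / 2) (((d : ℝ) + α) / 4)) =
    Real.Gamma (((d : ℝ) + α) / 4) / Real.Gamma (((d : ℝ) - α) / 4) := by
  have h1 : Real.Gamma (1 - α / 2) ≠ 0 := (Real.Gamma_pos_of_pos (by linarith)).ne'
  have h2 : Real.Gamma (((d : ℝ) - α) / 4) ≠ 0 := (Real.Gamma_pos_of_pos (by linarith)).ne'
  have h3 : ((d : ℝ) - α) / 4 ≠ 0 := by linarith
  rw [ProbabilityTheory.beta, show 1 - α / 2 + ((d : ℝ) + α) / 4 = ((d : ℝ) - α) / 4 + 1 by ring,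
    Real.Gamma_add_one h3, show ((d : ℝ) + α) / 4 - α / 2 = ((d : ℝ) - α) / 4 by ring]
  generalize ((d : ℝ) - α) / 4 = q at *
  generalize Real.Gamma (1 - α / 2) = G at *
  field_simp

/-- The ground state `|x|^{-(d-α)/2}`, up to a constant. -/
def groundState (α : ℝ) : Rd d → ℝ := rieszKernel (((d : ℝ) - α) / 4)

theorem rieszKernel_div (hα : 0 < α) (hαd : α < d) {x : Rd d} (hx : x ≠ 0) :
    rieszKernel (((d : ℝ) + α) / 4) x / groundState α x *
      (Real.Gamma (((d : ℝ) + α) / 4) / Real.Gamma (((d : ℝ) - α) / 4)) =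
    hardyPotential α (hardyConst d α) x := by
  have hd : (0 : ℝ) < d := hα.trans hαd
  have h1 : Real.Gamma (((d : ℝ) - α) / 4) ≠ 0 := (Real.Gamma_pos_of_pos (by linarith)).ne'
  have hx' : 0 < ‖x‖ := norm_pos_iff.2 hx
  have hpi := Real.pi_pos
  rw [groundState, rieszKernel_eq, rieszKernel_eq, hardyPotential, hardyConst, four_rpow,
    four_rpow, show 2 * (((d : ℝ) + α) / 4) = 2 * (((d : ℝ) - α) / 4) + α by ring,
    Real.rpow_add two_pos, neg_add, Real.rpow_add hx', Real.rpow_neg hx'.le α]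
  have h2 : (4 * Real.pi) ^ (-(d : ℝ) / 2) ≠ 0 := by positivity
  have h3 : (2 : ℝ) ^ (2 * (((d : ℝ) - α) / 4)) ≠ 0 := by positivity
  have h4 : ‖x‖ ^ (-(2 * (((d : ℝ) - α) / 4))) ≠ 0 := by positivity
  have h5 : ‖x‖ ^ α ≠ 0 := by positivity
  field_simp

/-- The energy of the ground state representation. -/
def groundEnergy (α : ℝ) (f : Rd d → ℝ) : ENNReal :=
  ENNReal.ofReal (fracConst d α / 2) * ∫⁻ z : Rd d × Rd d,
    ENNReal.ofReal (groundState α z.1 * groundState α z.2 *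
      (f z.1 / groundState α z.1 - f z.2 / groundState α z.2) ^ 2 /
        ‖z.1 - z.2‖ ^ ((d : ℝ) + α))

theorem groundState_pos (hαd : α < d) {x : Rd d} (hx : x ≠ 0) : 0 < groundState α x :=
  rieszKernel_pos (by linarith) hx

theorem measurable_groundState : Measurable (groundState α : Rd d → ℝ) :=
  measurable_rieszKernel _

/-- Fatou's lemma. At the critical constant this is the only semicontinuity left for proving
closability. -/
theorem groundEnergy_le_liminf {f : ℕ → Rd d → ℝ} {g : Rd d → ℝ}
    (hf : ∀ n, AEStronglyMeasurable (f n) volume)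
    (hlim : ∀ᵐ x, Tendsto (fun n => f n x) atTop (𝓝 (g x))) :
    groundEnergy α g ≤ liminf (fun n => groundEnergy α (f n)) atTop := by
  have hh1 : Measurable fun z : Rd d × Rd d => groundState α z.1 :=
    measurable_groundState.comp measurable_fst
  have hh2 : Measurable fun z : Rd d × Rd d => groundState α z.2 :=
    measurable_groundState.comp measurable_snd
  have hz : Measurable fun z : Rd d × Rd d => ‖z.1 - z.2‖ ^ ((d : ℝ) + α) := by fun_prop
  set G : (Rd d → ℝ) → Rd d × Rd d → ENNReal := fun f z =>
    ENNReal.ofReal (groundState α z.1 * groundState α z.2 *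
      (f z.1 / groundState α z.1 - f z.2 / groundState α z.2) ^ 2 /
        ‖z.1 - z.2‖ ^ ((d : ℝ) + α)) with hG
  have hGm : ∀ n, AEMeasurable (G (f n)) volume := fun n =>
    (((hh1.aemeasurable.mul hh2.aemeasurable).mul
      ((((hf n).aemeasurable.comp_quasiMeasurePreserving
        Measure.quasiMeasurePreserving_fst).div hh1.aemeasurable).sub
      (((hf n).aemeasurable.comp_quasiMeasurePreserving
        Measure.quasiMeasurePreserving_snd).div hh2.aemeasurable) |>.pow_const 2)).div
          hz.aemeasurable).ennreal_ofReal
  have h1 : ∫⁻ z, G g z ≤ liminf (fun n => ∫⁻ z, G (f n) z) atTop := by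
    calc _ = ∫⁻ z, liminf (fun n => G (f n) z) atTop := by
          refine lintegral_congr_ae ?_
          filter_upwards [ae_comp_fst hlim, ae_comp_snd hlim] with z h1 h2
          refine ((ENNReal.continuous_ofReal.tendsto _).comp ?_).liminf_eq.symm
          exact (((((h1.div_const _).sub (h2.div_const _)).pow 2).const_mul _).div_const _)
      _ ≤ _ := lintegral_liminf_le' hGm
  simp only [groundEnergy]
  refine (mul_le_mul_right h1 _).trans (le_of_eq ?_)
  exact (Monotone.map_liminf_of_continuousAt (f := fun y => ENNReal.ofReal (fracConst d α / 2) * y)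
    (fun _ _ h => mul_le_mul_right h _) _
    (ENNReal.continuous_const_mul ENNReal.ofReal_ne_top).continuousAt
    (by isBoundedDefault) (by isBoundedDefault))

/-- The two kernels agree only off the diagonal, where `truncKernel_zero` applies; on it, `w = 0`
makes both integrands vanish. -/
theorem ofReal_fracConst_mul_lintegral (hα : 0 < α) (hα2 : α < 2) {w : Rd d × Rd d → ℝ}
    (hw : ∀ z : Rd d × Rd d, z.1 = z.2 → w z = 0) :
    ENNReal.ofReal (fracConst d α / 2) *
      ∫⁻ z : Rd d × Rd d, ENNReal.ofReal (w z / ‖z.1 - z.2‖ ^ ((d : ℝ) + α)) =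
    ENNReal.ofReal (α / 2 / Real.Gamma (1 - α / 2) / 2) *
      ∫⁻ z : Rd d × Rd d, truncKernel (α / 2) 0 (z.1 - z.2) * ENNReal.ofReal (w z) := by
  have hG : 0 < Real.Gamma (1 - α / 2) := Real.Gamma_pos_of_pos (by linarith)
  have hc := fracConst_pos (d := d) hα hα2
  have hd : (0 : ℝ) ≤ d := d.cast_nonneg
  rw [← lintegral_const_mul' _ _ ENNReal.ofReal_ne_top,
    ← lintegral_const_mul' _ _ ENNReal.ofReal_ne_top]
  refine lintegral_congr fun z => ?_
  by_cases hz : z.1 = z.2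
  · simp [hw z hz]
  · have h0 := rieszKernel_nonneg (q := ((d : ℝ) + α) / 2) (by linarith) (z.1 - z.2)
    rw [truncKernel_zero hα (sub_ne_zero.2 hz), ← ENNReal.ofReal_mul (by positivity),
      ← ENNReal.ofReal_mul h0, ← ENNReal.ofReal_mul (by positivity)]
    congr 1
    calc fracConst d α / 2 * (w z / ‖z.1 - z.2‖ ^ ((d : ℝ) + α))
        = fracConst d α / ‖z.1 - z.2‖ ^ ((d : ℝ) + α) * w z / 2 := by ring
      _ = _ := by rw [fracConst_div_rpow hα hα2]; ring

/-- The ground state representation of the fractional energy. -/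
theorem fracEnergy_eq_groundEnergy_add (hα : 0 < α) (hα2 : α < 2) (hαd : α < d)
    {f : Rd d → ℝ} (hf : MemFracSobolev α f) : fracEnergy α f = groundEnergy α f +
      ∫⁻ x, ENNReal.ofReal (f x ^ 2 * hardyPotential α (hardyConst d α) x) := by
  have hd : (0 : ℝ) < d := hα.trans hαd
  have hd' : 0 < d := by exact_mod_cast hd
  have : Nontrivial (Rd d) := by
    have : Nonempty (Fin d) := ⟨⟨0, hd'⟩⟩
    infer_instance
  have hne : ∀ᵐ y : Rd d, y ≠ 0 := (measure_eq_zero_iff_ae_notMem.1 (measure_singleton 0))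
  have hG : 0 < Real.Gamma (1 - α / 2) := Real.Gamma_pos_of_pos (by linarith)
  -- The exponent `q = (d - α) / 4` belongs to the ground state `|x|^{-(d-α)/2}`, and `b = d/2 - q`
  -- is its exponent in time. With it the limiting defect divided by `h` is a multiple of `|x|^{-α}`
  -- with the critical constant.
  set a := α / 2 with ha
  set b := ((d : ℝ) + α) / 4 with hb
  set q := ((d : ℝ) - α) / 4 with hq
  have ha0 : 0 < a := by positivity
  have ha1 : a < 1 := by linarith
  have hab : a < b := by linarith
  have hq0 : 0 < q := by linarith
  have hbq : q = (d : ℝ) / 2 - b := by rw [hq, hb]; ring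
  have hbd : b - a < (d : ℝ) / 2 := by linarith
  have hbq2 : (d : ℝ) / 2 - (b - a) = b := by rw [hb, ha]; ring
  -- The full kernel has infinite mass, so the representation is applied to the kernel with times `t
  -- > δ n` and the cutoff is removed afterwards.
  set δ : ℕ → ℝ := fun n => 1 / ((n : ℝ) + 1)
  have hδ : ∀ n, 0 < δ n := fun n => Nat.one_div_pos_of_nat
  have hδa : Antitone δ := fun m n h => Nat.one_div_le_one_div h
  have hδl : Tendsto δ atTop (𝓝 0) := tendsto_one_div_add_atTop_nhds_zero_nat
  set h : Rd d → ℝ := groundState α with hh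
  have hhm : Measurable h := measurable_groundState
  have hhpos : ∀ᵐ x, 0 < h x := by
    filter_upwards [hne] with x hx using groundState_pos hαd hx
  have hfm : AEMeasurable f volume := hf.1.1.aemeasurable
  have hf1 : AEMeasurable (fun z : Rd d × Rd d => f z.1) volume :=
    hfm.comp_quasiMeasurePreserving Measure.quasiMeasurePreserving_fst
  have hf2 : AEMeasurable (fun z : Rd d × Rd d => f z.2) volume :=
    hfm.comp_quasiMeasurePreserving Measure.quasiMeasurePreserving_snd
  have hh1 : Measurable fun z : Rd d × Rd d => h z.1 := hhm.comp measurable_fst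
  have hh2 : Measurable fun z : Rd d × Rd d => h z.2 := hhm.comp measurable_snd
  have hkm : ∀ n, Measurable fun z : Rd d × Rd d => truncKernel a (δ n) (z.1 - z.2) := fun n =>
    (measurable_truncKernel a (δ n)).comp (measurable_fst.sub measurable_snd)
  have hlim : ∀ w : Rd d × Rd d → ℝ, AEMeasurable w volume →
      Tendsto (fun n => ∫⁻ z : Rd d × Rd d, truncKernel a (δ n) (z.1 - z.2) *
        ENNReal.ofReal (w z)) atTop (𝓝 (∫⁻ z : Rd d × Rd d, truncKernel a 0 (z.1 - z.2) *
        ENNReal.ofReal (w z))) := by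
    intro w hw
    refine lintegral_tendsto_of_tendsto_of_monotone
      (fun n => (hkm n).aemeasurable.mul hw.ennreal_ofReal) ?_ ?_
    · exact Eventually.of_forall fun z m n hmn =>
        mul_le_mul_left ((tendsto_truncKernel hδ hδa hδl (z.1 - z.2)).1 hmn) _
    · exact Eventually.of_forall fun z => ENNReal.Tendsto.mul_const
        (tendsto_truncKernel hδ hδa hδl (z.1 - z.2)).2 (Or.inr ENNReal.ofReal_ne_top)
  set X : Rd d × Rd d → ℝ := fun z => (f z.1 - f z.2) ^ 2 with hX
  set N : Rd d × Rd d → ℝ := fun z => h z.1 * h z.2 * (f z.1 / h z.1 - f z.2 / h z.2) ^ 2 with hN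
  have hXl := hlim X ((hf1.sub hf2).pow_const 2)
  have hNl := hlim N ((hh1.aemeasurable.mul hh2.aemeasurable).mul
    (((hf1.div hh1.aemeasurable).sub (hf2.div hh2.aemeasurable)).pow_const 2))
  set R : ℕ → ENNReal := fun n => ∫⁻ x, ENNReal.ofReal (f x ^ 2 / h x) * kernelDefect a b (δ n) x
  have heq : ∀ n, ∫⁻ z : Rd d × Rd d, truncKernel a (δ n) (z.1 - z.2) * ENNReal.ofReal (X z) =
      (∫⁻ z : Rd d × Rd d, truncKernel a (δ n) (z.1 - z.2) * ENNReal.ofReal (N z)) +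
        2 * R n := by
    intro n
    refine lintegral_kernel_sq_sub_eq (measurable_truncKernel a (δ n)) (truncKernel_neg _) ?_ hhm
      hhpos ?_ hf.1
    · rw [lintegral_truncKernel ha0 (hδ n)]
      exact ENNReal.ofReal_ne_top
    · filter_upwards [hne] with x hx
      exact lintegral_truncKernel_mul_add_kernelDefect (hδ n) hd' ha0 hab hq0 hbq hx
  have hE : fracEnergy α f = ENNReal.ofReal (a / Real.Gamma (1 - a) / 2) *
      ∫⁻ z : Rd d × Rd d, truncKernel a 0 (z.1 - z.2) * ENNReal.ofReal (X z) :=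
    ofReal_fracConst_mul_lintegral hα hα2 (w := X) fun z hz => by simp [hX, hz]
  have hE' : groundEnergy α f = ENNReal.ofReal (a / Real.Gamma (1 - a) / 2) *
      ∫⁻ z : Rd d × Rd d, truncKernel a 0 (z.1 - z.2) * ENNReal.ofReal (N z) :=
    ofReal_fracConst_mul_lintegral hα hα2 (w := N) fun z hz => by simp [hN, hz]
  set XI := ∫⁻ z : Rd d × Rd d, truncKernel a 0 (z.1 - z.2) * ENNReal.ofReal (X z)
  set NI := ∫⁻ z : Rd d × Rd d, truncKernel a 0 (z.1 - z.2) * ENNReal.ofReal (N z)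
  have hC0 : 0 < a / Real.Gamma (1 - a) / 2 := by positivity
  have hXI : XI ≠ ⊤ := by
    intro hcon
    have := hf.2
    rw [hE, hcon, ENNReal.mul_top (ENNReal.ofReal_pos.2 hC0).ne'] at this
    exact this.ne rfl
  have hRX : ∀ n, R n ≤ XI := by
    intro n
    calc R n ≤ 2 * R n := by rw [two_mul]; exact le_self_add
      _ ≤ ∫⁻ z : Rd d × Rd d, truncKernel a (δ n) (z.1 - z.2) * ENNReal.ofReal (X z) := by
          rw [heq n]; exact le_add_self
      _ ≤ XI := by
          refine lintegral_mono fun z => mul_le_mul_left ?_ _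
          exact lintegral_mono_set (Ioi_subset_Ioi (hδ n).le)
  set κ : ℝ := (b - a) / a * ProbabilityTheory.beta (1 - a) b with hκ
  have hκ0 : 0 < κ := by
    have := ProbabilityTheory.beta_pos (sub_pos.2 ha1) (ha0.trans hab)
    have := sub_pos.2 hab
    positivity
  set w : Rd d → ℝ := rieszKernel b with hw
  have hDl : ∀ x : Rd d, x ≠ 0 → Tendsto (fun n => kernelDefect a b (δ n) x) atTop
      (𝓝 (ENNReal.ofReal (w x) * ENNReal.ofReal κ)) := by
    intro x hx
    have := tendsto_kernelDefect ha0 ha1 hab hδ hδa hδl hbd hx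
    rwa [hbq2] at this
  have hwm : AEMeasurable (fun x => ENNReal.ofReal (f x ^ 2 / h x)) volume :=
    ((hfm.pow_const 2).div hhm.aemeasurable).ennreal_ofReal
  have hRm : ∀ n, AEMeasurable (fun x => ENNReal.ofReal (f x ^ 2 / h x) *
      kernelDefect a b (δ n) x) volume := fun n =>
    hwm.mul (measurable_kernelDefect (δ n)).aemeasurable
  have hpt : ∀ᵐ x, Tendsto (fun n => ENNReal.ofReal (f x ^ 2 / h x) * kernelDefect a b (δ n) x)
      atTop (𝓝 (ENNReal.ofReal (f x ^ 2 / h x) * (ENNReal.ofReal (w x) * ENNReal.ofReal κ))) := by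
    filter_upwards [hne] with x hx
    exact ENNReal.Tendsto.const_mul (hDl x hx) (Or.inr ENNReal.ofReal_ne_top)
  set RI := ∫⁻ x, ENNReal.ofReal (f x ^ 2 / h x) * (ENNReal.ofReal (w x) * ENNReal.ofReal κ)
  -- Fatou's lemma comes before the limit of `R`: it shows that the integral of `f² w / h` is
  -- finite, and a multiple of this integrand is the dominating function for `hRl`.
  have hRI : RI ≤ XI := by
    calc RI = ∫⁻ x, liminf (fun n => ENNReal.ofReal (f x ^ 2 / h x) *
          kernelDefect a b (δ n) x) atTop := by
          refine lintegral_congr_ae ?_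
          filter_upwards [hpt] with x hx using hx.liminf_eq.symm
      _ ≤ liminf R atTop := lintegral_liminf_le' hRm
      _ ≤ XI := by
          refine (liminf_le_liminf (Eventually.of_forall hRX)).trans ?_
          rw [liminf_const]
  have hfin : ∫⁻ x, ENNReal.ofReal (f x ^ 2 / h x) * ENNReal.ofReal (w x) ≠ ⊤ := by
    intro hcon
    apply ne_top_of_le_ne_top hXI hRI
    simp only [RI, ← mul_assoc]
    rw [lintegral_mul_const' _ _ ENNReal.ofReal_ne_top, hcon,
      ENNReal.top_mul (ENNReal.ofReal_pos.2 hκ0).ne']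
  have hRl : Tendsto R atTop (𝓝 RI) := by
    refine tendsto_lintegral_of_dominated_convergence' (fun x => ENNReal.ofReal (f x ^ 2 / h x) *
      (ENNReal.ofReal (w x) * (ENNReal.ofReal (max 1 b / a) +
        ENNReal.ofReal ((b - a) / a) * ENNReal.ofReal (ProbabilityTheory.beta (1 - a) b))))
      hRm ?_ ?_ hpt
    · intro n
      filter_upwards [hne] with x hx
      have := kernelDefect_le ha0 ha1 hab (hδ n) hbd hx
      rw [hbq2] at this
      exact mul_le_mul_right this _
    · simp only [← mul_assoc]
      rw [lintegral_mul_const' _ _ (by finiteness)]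
      finiteness
  have hfinal : XI = NI + 2 * RI :=
    tendsto_nhds_unique hXl ((hNl.add (ENNReal.Tendsto.const_mul hRl
      (Or.inr (by finiteness)))).congr fun n => (heq n).symm)
  rw [hE, hE', hfinal, mul_add, ← mul_assoc]
  congr 1
  have e2 : ENNReal.ofReal (a / Real.Gamma (1 - a) / 2) * 2 =
      ENNReal.ofReal (a / Real.Gamma (1 - a)) := by
    nth_rw 1 [← ENNReal.ofReal_ofNat 2]
    rw [← ENNReal.ofReal_mul hC0.le, div_mul_cancel₀ _ two_ne_zero]
  rw [e2, ← lintegral_const_mul' _ _ ENNReal.ofReal_ne_top]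
  refine lintegral_congr_ae ?_
  filter_upwards [hne, hhpos] with x hx hx2
  have hw0 : 0 ≤ w x := rieszKernel_nonneg (ha0.trans hab) x
  rw [← ENNReal.ofReal_mul hw0, ← ENNReal.ofReal_mul (by positivity),
    ← ENNReal.ofReal_mul (by positivity)]
  congr 1
  rw [← rieszKernel_div hα hαd hx, ← beta_const hα hα2 hαd]
  rw [← ha, ← hb, ← hκ, ← hw, ← hh]
  ring

end Hardy

end

noncomputable section

/-! ### Extension by zero from `L²(Ω)` to the whole space. -/

section ZeroExtension

variable {d : ℕ} {α : ℝ} {Ω : Set (Rd d)}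

theorem indicator_ae_eq (hΩ : MeasurableSet Ω) {f g : Rd d → ℝ}
    (h : f =ᵐ[volume.restrict Ω] g) : Ω.indicator f =ᵐ[volume] Ω.indicator g := by
  rw [Filter.EventuallyEq, ae_restrict_iff' hΩ] at h
  filter_upwards [h] with x hx
  by_cases hx' : x ∈ Ω
  · rw [indicator_of_mem hx', indicator_of_mem hx', hx hx']
  · rw [indicator_of_notMem hx', indicator_of_notMem hx']

theorem zeroExt_add (hΩ : MeasurableSet Ω) (f g : L2 Ω) :
    zeroExt Ω (f + g) =ᵐ[volume] zeroExt Ω f + zeroExt Ω g := by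
  rw [zeroExt, zeroExt, zeroExt, ← indicator_add']
  exact indicator_ae_eq hΩ (Lp.coeFn_add f g)

theorem zeroExt_sub (hΩ : MeasurableSet Ω) (f g : L2 Ω) :
    zeroExt Ω (f - g) =ᵐ[volume] zeroExt Ω f - zeroExt Ω g := by
  rw [zeroExt, zeroExt, zeroExt, ← indicator_sub']
  exact indicator_ae_eq hΩ (Lp.coeFn_sub f g)

theorem zeroExt_smul (hΩ : MeasurableSet Ω) (r : ℝ) (f : L2 Ω) :
    zeroExt Ω (r • f) =ᵐ[volume] r • zeroExt Ω f := by
  exact (indicator_ae_eq hΩ (Lp.coeFn_smul r f)).trans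
    (indicator_const_smul Ω r f).eventuallyEq

theorem memLp_zeroExt (hΩ : MeasurableSet Ω) (f : L2 Ω) : MemLp (zeroExt Ω f) 2 volume :=
  (memLp_indicator_iff_restrict hΩ).2 (Lp.memLp f)

theorem lintegral_zeroExt_mul (hΩ : MeasurableSet Ω) (f : L2 Ω) (W : Rd d → ℝ) :
    ∫⁻ x, ENNReal.ofReal (zeroExt Ω f x ^ 2 * W x) =
      ∫⁻ x in Ω, ENNReal.ofReal (f x ^ 2 * W x) := by
  rw [← lintegral_indicator hΩ]
  refine lintegral_congr fun x => ?_
  by_cases hx : x ∈ Ω <;> simp [zeroExt, hx]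

theorem L2_inner_eq (f g : L2 Ω) : inner ℝ f g = ∫ x in Ω, f x * g x := by
  rw [L2.inner_def]
  refine integral_congr_ae (Eventually.of_forall fun x => ?_)
  simp [mul_comm]

theorem integrable_L2_mul (f g : L2 Ω) :
    Integrable (fun x => f x * g x) (volume.restrict Ω) :=
  (Lp.memLp f).integrable_mul (Lp.memLp g)

theorem lintegral_L2_sq (f : L2 Ω) :
    ∫⁻ x in Ω, ENNReal.ofReal (f x ^ 2) = ENNReal.ofReal (‖f‖ ^ 2) := by
  rw [← real_inner_self_eq_norm_sq, L2_inner_eq, ofReal_integral_eq_lintegral_ofReal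
    (integrable_L2_mul f f) (Eventually.of_forall fun x => mul_self_nonneg _)]
  simp only [sq]

theorem lintegral_zeroExt_sq (hΩ : MeasurableSet Ω) (f : L2 Ω) :
    ∫⁻ x, ENNReal.ofReal (zeroExt Ω f x ^ 2) = ENNReal.ofReal (‖f‖ ^ 2) := by
  have := lintegral_zeroExt_mul hΩ f fun _ => 1
  simpa only [mul_one, lintegral_L2_sq] using this

/-- Convergence in `L²` implies almost everywhere convergence along a subsequence. -/
theorem exists_subseq_ae_tendsto {X : Type*} [MeasurableSpace X] {μ : Measure X}
    {f : ℕ → Lp ℝ 2 μ} {g : Lp ℝ 2 μ} (h : Tendsto f atTop (𝓝 g)) :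
    ∃ φ : ℕ → ℕ, StrictMono φ ∧ ∀ᵐ x ∂μ, Tendsto (fun n => f (φ n) x) atTop (𝓝 (g x)) :=
  (tendstoInMeasure_of_tendsto_Lp h).exists_seq_tendsto_ae

theorem ae_tendsto_zeroExt (hΩ : MeasurableSet Ω) {f : ℕ → L2 Ω} {g : L2 Ω}
    (h : ∀ᵐ x ∂volume.restrict Ω, Tendsto (fun n => f n x) atTop (𝓝 (g x))) :
    ∀ᵐ x, Tendsto (fun n => zeroExt Ω (f n) x) atTop (𝓝 (zeroExt Ω g x)) := by
  rw [ae_restrict_iff' hΩ] at h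
  filter_upwards [h] with x hx
  by_cases hx' : x ∈ Ω
  · simpa [zeroExt, hx'] using hx hx'
  · simp [zeroExt, hx']

end ZeroExtension

/-! ### The forms `ℰ_Ω - W` for potentials below the critical Hardy potential. -/

section PerturbedForms

variable {d : ℕ} {α : ℝ} {Ω : Set (Rd d)}

/-- Nonnegative potentials dominated by the critical Hardy potential. -/
structure IsHardyBounded (α : ℝ) (W : Rd d → ℝ) : Prop where
  measurable : Measurable W
  nonneg : ∀ x, 0 ≤ W x
  le : ∀ x, W x ≤ hardyPotential α (hardyConst d α) x

theorem hardyConst_pos (hα : 0 < α) (hαd : α < d) : 0 < hardyConst d α := by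
  have h1 := Real.Gamma_pos_of_pos (s := ((d : ℝ) + α) / 4) (by positivity)
  have h2 := Real.Gamma_pos_of_pos (s := ((d : ℝ) - α) / 4) (by linarith)
  unfold hardyConst
  positivity

theorem measurable_hardyPotential (c : ℝ) : Measurable (hardyPotential α c : Rd d → ℝ) := by
  unfold hardyPotential
  fun_prop

theorem hardyPotential_nonneg {c : ℝ} (hc : 0 ≤ c) (x : Rd d) : 0 ≤ hardyPotential α c x := by
  unfold hardyPotential
  positivity

theorem hardyPotential_mono {c c' : ℝ} (h : c ≤ c') (x : Rd d) :
    hardyPotential α c x ≤ hardyPotential α c' x := by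
  unfold hardyPotential
  gcongr

theorem isHardyBounded_hardyPotential {c : ℝ} (hc : 0 ≤ c) (hc' : c ≤ hardyConst d α) :
    IsHardyBounded α (hardyPotential α c : Rd d → ℝ) :=
  ⟨measurable_hardyPotential c, hardyPotential_nonneg hc, hardyPotential_mono hc'⟩

theorem isHardyBounded_min {c : ℝ} (hc : 0 ≤ c) (hc' : c ≤ hardyConst d α) (k : ℕ) :
    IsHardyBounded α (fun x : Rd d => min (hardyPotential α c x) k) :=
  ⟨(measurable_hardyPotential c).min measurable_const,
    fun x => le_min (hardyPotential_nonneg hc x) k.cast_nonneg,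
    fun x => (min_le_left _ _).trans (hardyPotential_mono hc' x)⟩

theorem isHardyBounded_zero (hα : 0 < α) (hαd : α < d) :
    IsHardyBounded α (fun _ : Rd d => 0) :=
  ⟨measurable_const, fun _ => le_rfl, hardyPotential_nonneg (hardyConst_pos hα hαd).le⟩

variable {W : Rd d → ℝ} (hα : 0 < α) (hα2 : α < 2) (hαd : α < d) (hΩ : MeasurableSet Ω)
  (hW : IsHardyBounded α W)
include hα hα2 hαd hΩ hW

/-- Hardy's inequality: the ground energy in `fracEnergy_eq_groundEnergy_add` is dropped. -/
theorem IsHardyBounded.lintegral_le {f : L2 Ω} (hf : MemFracSobolev α (zeroExt Ω f)) :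
    ∫⁻ x in Ω, ENNReal.ofReal (f x ^ 2 * W x) ≤ fracEnergy α (zeroExt Ω f) := by
  rw [fracEnergy_eq_groundEnergy_add hα hα2 hαd hf, ← lintegral_zeroExt_mul hΩ]
  refine le_add_left (lintegral_mono fun x => ENNReal.ofReal_le_ofReal ?_)
  exact mul_le_mul_of_nonneg_left (hW.le x) (sq_nonneg _)

theorem IsHardyBounded.integrable_sq {f : L2 Ω} (hf : MemFracSobolev α (zeroExt Ω f)) :
    Integrable (fun x => f x ^ 2 * W x) (volume.restrict Ω) := by
  have hm := hW.measurable.aestronglyMeasurable (μ := volume.restrict Ω)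
  refine ⟨((Lp.aestronglyMeasurable f).pow 2).mul hm, ?_⟩
  rw [hasFiniteIntegral_iff_ofReal
    (Eventually.of_forall fun x => mul_nonneg (sq_nonneg _) (hW.nonneg x))]
  exact (hW.lintegral_le hα hα2 hαd hΩ hf).trans_lt hf.2

theorem IsHardyBounded.integrable_mul {f g : L2 Ω} (hf : MemFracSobolev α (zeroExt Ω f))
    (hg : MemFracSobolev α (zeroExt Ω g)) :
    Integrable (fun x => f x * g x * W x) (volume.restrict Ω) := by
  have hm := hW.measurable.aestronglyMeasurable (μ := volume.restrict Ω)
  refine Integrable.mono' ((hW.integrable_sq hα hα2 hαd hΩ hf).add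
    (hW.integrable_sq hα hα2 hαd hΩ hg))
    (((Lp.aestronglyMeasurable f).mul (Lp.aestronglyMeasurable g)).mul hm) ?_
  refine Eventually.of_forall fun x => ?_
  rw [Real.norm_eq_abs, abs_mul, abs_of_nonneg (hW.nonneg x), Pi.add_apply, ← add_mul]
  refine mul_le_mul_of_nonneg_right ?_ (hW.nonneg x)
  rw [abs_mul]
  nlinarith [sq_nonneg (|f x| - |g x|), sq_abs (f x), sq_abs (g x), sq_nonneg (|f x|),
    sq_nonneg (|g x|)]

theorem IsHardyBounded.ofReal_val_add {f : L2 Ω} (hf : MemFracSobolev α (zeroExt Ω f)) :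
    0 ≤ (perturbedForm α Ω W).val f f ∧
    ENNReal.ofReal ((perturbedForm α Ω W).val f f) + ∫⁻ x in Ω, ENNReal.ofReal (f x ^ 2 * W x) =
      fracEnergy α (zeroExt Ω f) := by
  have h1 := hW.lintegral_le hα hα2 hαd hΩ hf
  have h2 := ofReal_integral_eq_lintegral_ofReal (hW.integrable_sq hα hα2 hαd hΩ hf)
    (Eventually.of_forall fun x => mul_nonneg (sq_nonneg _) (hW.nonneg x))
  have h3 := ofReal_fracForm_self hα hα2 hf
  have h4 : (perturbedForm α Ω W).val f f =
      fracForm α (zeroExt Ω f) (zeroExt Ω f) - ∫ x in Ω, f x ^ 2 * W x := by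
    simp only [perturbedForm, sq]
  have h5 : 0 ≤ ∫ x in Ω, f x ^ 2 * W x :=
    integral_nonneg fun x => mul_nonneg (sq_nonneg _) (hW.nonneg x)
  rw [← h2, ← h3, ENNReal.ofReal_le_ofReal_iff (fracForm_self_nonneg hα hα2 _)] at h1
  have h6 : 0 ≤ (perturbedForm α Ω W).val f f := by rw [h4]; linarith
  refine ⟨h6, ?_⟩
  rw [← h2, ← h3, ← ENNReal.ofReal_add h6 h5, h4, sub_add_cancel]

theorem perturbedForm_isNonneg : (perturbedForm α Ω W).IsNonneg where
  zero_mem := by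
    have h0 : MemFracSobolevZero α Ω (0 : Rd d → ℝ) := by
      refine memFracSobolevZero_of_contDiff hα hα2 (by exact_mod_cast hα.trans hαd)
        contDiff_const (f := fun _ => 0) ?_ ?_
      · exact HasCompactSupport.zero
      · rw [show (fun _ : Rd d => (0 : ℝ)) = 0 from rfl, tsupport_zero]
        exact empty_subset _
    refine h0.congr ?_
    have := indicator_ae_eq hΩ (Lp.coeFn_zero ℝ 2 (volume.restrict Ω))
    rw [indicator_zero'] at this
    exact this.symm
  add_mem f hf g hg := (hf.add hα hα2 hg).congr (zeroExt_add hΩ f g).symm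
  smul_mem r f hf := (hf.smul hα hα2 r).congr (zeroExt_smul hΩ r f).symm
  add_left f hf g hg h hh := by
    simp only [perturbedForm]
    have e : ∫ x in Ω, (f + g : L2 Ω) x * h x * W x =
        (∫ x in Ω, f x * h x * W x) + ∫ x in Ω, g x * h x * W x := by
      rw [← integral_add (hW.integrable_mul hα hα2 hαd hΩ hf.1 hh.1)
        (hW.integrable_mul hα hα2 hαd hΩ hg.1 hh.1)]
      refine integral_congr_ae ?_
      filter_upwards [Lp.coeFn_add f g] with x hx
      rw [hx, Pi.add_apply]
      ring
    rw [fracForm_congr (zeroExt_add hΩ f g) EventuallyEq.rfl,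
      fracForm_add_left hα hα2 hf.1 hg.1 hh.1, e]
    ring
  smul_left r f hf g hg := by
    simp only [perturbedForm]
    have e : ∫ x in Ω, (r • f : L2 Ω) x * g x * W x = r * ∫ x in Ω, f x * g x * W x := by
      rw [← integral_const_mul]
      refine integral_congr_ae ?_
      filter_upwards [Lp.coeFn_smul r f] with x hx
      rw [hx, Pi.smul_apply, smul_eq_mul]
      ring
    rw [fracForm_congr (zeroExt_smul hΩ r f) EventuallyEq.rfl, fracForm_smul_left, e]
    ring
  symm f hf g hg := by
    simp only [perturbedForm]
    rw [fracForm_comm]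
    simp only [mul_comm]
  nonneg f hf := (hW.ofReal_val_add hα hα2 hαd hΩ hf.1).1

-- The domain does not depend on `W`, and it contains the smooth functions with compact support in
-- `Ω`; an element of `L²(Ω)` orthogonal to all of these is zero.
omit hW in
theorem dense_perturbedForm_dom (hΩo : IsOpen Ω) (W : Rd d → ℝ) :
    Dense (perturbedForm α Ω W).dom := by
  have hq := perturbedForm_isNonneg hα hα2 hαd hΩ (isHardyBounded_zero hα hαd)
  have h : hq.submodule.topologicalClosure = ⊤ := by
    rw [Submodule.topologicalClosure_eq_top_iff, Submodule.eq_bot_iff]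
    intro g hg
    have h0 : ∀ᵐ x, x ∈ Ω → zeroExt Ω g x = 0 := by
      refine hΩo.ae_eq_zero_of_integral_contDiff_smul_eq_zero ?_ fun φ hφ hφc hφs => ?_
      · exact ((memLp_zeroExt hΩ g).locallyIntegrable (by norm_num)).locallyIntegrableOn Ω
      · have hm : MemLp φ 2 (volume.restrict Ω) :=
          (hφ.continuous.memLp_of_hasCompactSupport hφc).restrict Ω
        have e : zeroExt Ω hm.toLp =ᵐ[volume] φ := by
          refine (indicator_ae_eq hΩ hm.coeFn_toLp).trans ?_
          rw [indicator_eq_self.2 ((subset_tsupport φ).trans hφs)]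
        have hmem : hm.toLp ∈ hq.submodule :=
          (memFracSobolevZero_of_contDiff hα hα2 (by exact_mod_cast hα.trans hαd)
            (hφ.of_le (by exact_mod_cast le_top)) hφc hφs).congr e.symm
        have h1 := (Submodule.mem_orthogonal _ _).1 hg _ hmem
        rw [L2_inner_eq, ← integral_indicator hΩ] at h1
        rw [← h1]
        refine integral_congr_ae ?_
        filter_upwards [e] with x hx
        by_cases hx' : x ∈ Ω
        · simp only [zeroExt, indicator_of_mem hx', smul_eq_mul] at hx ⊢
          rw [hx]
        · simp [zeroExt, hx']
    refine Lp.ext ?_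
    have h2 : ∀ᵐ x ∂volume.restrict Ω, g x = 0 := by
      rw [ae_restrict_iff' hΩ]
      filter_upwards [h0] with x hx hx'
      simpa [zeroExt, hx'] using hx hx'
    filter_upwards [h2, Lp.coeFn_zero ℝ 2 (volume.restrict Ω)] with x hx hx'
    rw [hx, hx', Pi.zero_apply]
  exact Submodule.dense_iff_topologicalClosure_eq_top.2 h

end PerturbedForms

end

noncomputable section

/-! ### Closedness for bounded potentials and closability for the Hardy potential. -/

section Closedness

variable {d : ℕ} {α : ℝ} {Ω : Set (Rd d)}

theorem mul_le_liminf_mul {a c : ENNReal} {u : ℕ → ENNReal} (hc : c ≠ ⊤)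
    (h : a ≤ liminf u atTop) : c * a ≤ liminf (fun n => c * u n) atTop :=
  (mul_le_mul_right h _).trans (le_of_eq
    (Monotone.map_liminf_of_continuousAt (f := fun y => c * y)
      (fun _ _ h => mul_le_mul_right h _) _ (ENNReal.continuous_const_mul hc).continuousAt
      (by isBoundedDefault) (by isBoundedDefault)))

theorem HForm.Approximates.subseq {H : Type*} [NormedAddCommGroup H] {q : HForm H} {s : ℕ → H}
    {f : H} (h : q.Approximates s f) {φ : ℕ → ℕ} (hφ : Tendsto φ atTop atTop) :
    q.Approximates (s ∘ φ) f :=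
  ⟨fun n => h.1 _, h.2.1.comp hφ, h.2.2.comp ((hφ.comp tendsto_fst).prodMk (hφ.comp tendsto_snd)
    |>.mono_left (by rw [prod_atTop_atTop_eq]) |>.mono_right (by rw [prod_atTop_atTop_eq]))⟩

theorem HForm.Approximates.exists_forall_lt {H : Type*} [NormedAddCommGroup H] {q : HForm H}
    {s : ℕ → H} {f : H} (h : q.Approximates s f) {ε : ℝ} (hε : 0 < ε) :
    ∃ N, ∀ m ≥ N, ∀ n ≥ N, q.val (s m - s n) (s m - s n) < ε := by
  obtain ⟨⟨a, b⟩, hab⟩ := eventually_atTop.1 (h.2.2.eventually (gt_mem_nhds hε))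
  exact ⟨max a b, fun m hm n hn => hab (m, n)
    ⟨(le_max_left _ _).trans hm, (le_max_right _ _).trans hn⟩⟩

variable {W : Rd d → ℝ} (hα : 0 < α) (hα2 : α < 2) (hαd : α < d) (hΩ : MeasurableSet Ω)
  (hW : IsHardyBounded α W)
include hα hα2 hαd hΩ hW

/-- For bounded `W` the form controls the Sobolev norm up to the `L²` norm, so closedness reduces to
the completeness of `W_0(Ω)`. -/
theorem sobolevSq_le_val {K : ℝ} (hK : ∀ x, W x ≤ K) {f : L2 Ω}
    (hf : f ∈ (perturbedForm α Ω W).dom) : sobolevSq α (zeroExt Ω f) ≤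
      ENNReal.ofReal ((perturbedForm α Ω W).val f f) + ENNReal.ofReal ((K + 1) * ‖f‖ ^ 2) := by
  have hK0 : 0 ≤ K := (hW.nonneg 0).trans (hK 0)
  rw [sobolevSq, ← (hW.ofReal_val_add hα hα2 hαd hΩ hf.1).2, add_assoc, lintegral_zeroExt_sq hΩ,
    add_one_mul, ENNReal.ofReal_add (by positivity) (by positivity)]
  gcongr
  rw [ENNReal.ofReal_mul hK0, ← lintegral_L2_sq, ← lintegral_const_mul' _ _ ENNReal.ofReal_ne_top]
  refine lintegral_mono fun x => ?_
  dsimp only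
  rw [← ENNReal.ofReal_mul hK0, mul_comm]
  exact ENNReal.ofReal_le_ofReal (mul_le_mul_of_nonneg_right (hK x) (sq_nonneg _))

theorem val_le_sobolevSq {f : L2 Ω} (hf : f ∈ (perturbedForm α Ω W).dom) :
    ENNReal.ofReal ((perturbedForm α Ω W).val f f) ≤ sobolevSq α (zeroExt Ω f) := by
  rw [sobolevSq, ← (hW.ofReal_val_add hα hα2 hαd hΩ hf.1).2, add_assoc]
  exact le_self_add

theorem perturbedForm_isClosed {K : ℝ} (hK : ∀ x, W x ≤ K) :
    (perturbedForm α Ω W).IsClosed := by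
  have hq := perturbedForm_isNonneg hα hα2 hαd hΩ hW
  have hK0 : 0 ≤ K := (hW.nonneg 0).trans (hK 0)
  have hsub : ∀ f ∈ (perturbedForm α Ω W).dom, ∀ g ∈ (perturbedForm α Ω W).dom,
      f - g ∈ (perturbedForm α Ω W).dom := fun f hf g hg => hq.submodule.sub_mem hf hg
  have key : ∀ s f, (perturbedForm α Ω W).Approximates s f → f ∈ (perturbedForm α Ω W).dom ∧
      ∃ φ : ℕ → ℕ, Tendsto (fun n => (perturbedForm α Ω W).val (s (φ n) - f) (s (φ n) - f))
        atTop (𝓝 0) := by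
    intro s f hs
    obtain ⟨φ, hφ, hae⟩ := exists_subseq_ae_tendsto hs.2.1
    have hs' := hs.subseq hφ.tendsto_atTop
    have hsd : ∀ n, s n ∈ (perturbedForm α Ω W).dom := hs.1
    obtain ⟨h1, h2⟩ := MemFracSobolevZero.of_cauchy hα hα2 (f := fun n => zeroExt Ω (s (φ n)))
      (g := zeroExt Ω f) (fun n => hsd (φ n)) (fun ε hε => by
        obtain ⟨η, hη, hηε⟩ := ENNReal.lt_iff_exists_nnreal_btwn.1 hε
        have hη' : (0 : ℝ) < η := by exact_mod_cast hη
        -- One half of the tolerance `η` pays for the form term of `sobolevSq_le_val`, the other for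
        -- `(K + 1)‖·‖²`.
        obtain ⟨N₁, hN₁⟩ := hs'.exists_forall_lt (half_pos hη')
        have hc := hs'.2.1.cauchySeq
        obtain ⟨N₂, hN₂⟩ := Metric.cauchySeq_iff.1 hc (√(η / 2 / (K + 1))) (by positivity)
        refine ⟨max N₁ N₂, fun m hm n hn => ?_⟩
        rw [sobolevSq_congr (zeroExt_sub hΩ (s (φ m)) (s (φ n))).symm]
        refine (sobolevSq_le_val hα hα2 hαd hΩ hW hK
          (hsub _ (hsd (φ m)) _ (hsd (φ n)))).trans (le_trans ?_ hηε.le)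
        have h1 := hN₁ m ((le_max_left _ _).trans hm) n ((le_max_left _ _).trans hn)
        have h2 := hN₂ m ((le_max_right _ _).trans hm) n ((le_max_right _ _).trans hn)
        simp only [Function.comp] at h1 h2
        rw [dist_eq_norm] at h2
        have h3 : ‖s (φ m) - s (φ n)‖ ^ 2 ≤ η / 2 / (K + 1) := by
          rw [← Real.sq_sqrt (show (0 : ℝ) ≤ η / 2 / (K + 1) by positivity)]
          exact pow_le_pow_left₀ (norm_nonneg _) h2.le 2
        rw [le_div_iff₀ (by positivity)] at h3
        rw [← ENNReal.ofReal_add (hq.nonneg _ (hsub _ (hsd _) _ (hsd _))) (by positivity),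
          ← ENNReal.ofReal_coe_nnreal]
        exact ENNReal.ofReal_le_ofReal (by linarith)) (ae_tendsto_zeroExt hΩ hae)
    refine ⟨h1, φ, ?_⟩
    have hd : ∀ n, s (φ n) - f ∈ (perturbedForm α Ω W).dom := fun n => hsub _ (hsd _) _ h1
    have h3 : Tendsto (fun n => ENNReal.ofReal
        ((perturbedForm α Ω W).val (s (φ n) - f) (s (φ n) - f))) atTop (𝓝 0) := by
      refine tendsto_of_tendsto_of_tendsto_of_le_of_le tendsto_const_nhds h2
        (fun _ => zero_le) fun n => ?_
      refine (val_le_sobolevSq hα hα2 hαd hΩ hW (hd n)).trans (le_of_eq ?_)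
      exact sobolevSq_congr (zeroExt_sub hΩ _ _)
    have h4 := (ENNReal.tendsto_toReal ENNReal.zero_ne_top).comp h3
    refine h4.congr fun n => ?_
    exact ENNReal.toReal_ofReal (hq.nonneg _ (hd n))
  intro s f hs
  -- `key` yields convergence only along a subsequence chosen for a.e. convergence. As it applies to
  -- every subsequence of `s`, the whole sequence converges.
  refine ⟨(key s f hs).1, tendsto_of_subseq_tendsto fun ns hns => ?_⟩
  exact (key _ f (hs.subseq hns)).2

-- With `θ = c / c*`, `ℰ - V_c = (1-θ) ℰ + θ (ℰ - V_{c*})`, and `ℰ - V_{c*}` is the ground energy.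
-- At `θ = 1` the energy term is absent, which is why the form may fail to be closed there.
omit hW in
theorem ofReal_hardyForm_val {c : ℝ} (hc : 0 ≤ c) (hc' : c ≤ hardyConst d α) {f : L2 Ω}
    (hf : MemFracSobolev α (zeroExt Ω f)) : ENNReal.ofReal ((hardyForm α Ω c).val f f) =
      ENNReal.ofReal (1 - c / hardyConst d α) * fracEnergy α (zeroExt Ω f) +
        ENNReal.ofReal (c / hardyConst d α) * groundEnergy α (zeroExt Ω f) := by
  have hC := hardyConst_pos hα hαd
  have hW := isHardyBounded_hardyPotential hc hc'
  have h1 := (hW.ofReal_val_add hα hα2 hαd hΩ hf).2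
  have h2 := fracEnergy_eq_groundEnergy_add hα hα2 hαd hf
  set θ := c / hardyConst d α with hθ
  have hθ0 : 0 ≤ θ := by positivity
  have hθ1 : θ ≤ 1 := (div_le_one hC).2 hc'
  have e : ∫⁻ x in Ω, ENNReal.ofReal (f x ^ 2 * hardyPotential α c x) = ENNReal.ofReal θ *
      ∫⁻ x, ENNReal.ofReal (zeroExt Ω f x ^ 2 * hardyPotential α (hardyConst d α) x) := by
    rw [lintegral_zeroExt_mul hΩ, ← lintegral_const_mul' _ _ ENNReal.ofReal_ne_top]
    refine lintegral_congr fun x => ?_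
    rw [← ENNReal.ofReal_mul hθ0]
    congr 1
    rw [hθ, hardyPotential, hardyPotential]
    field_simp
  have hfin : ENNReal.ofReal θ * ∫⁻ x, ENNReal.ofReal (zeroExt Ω f x ^ 2 *
      hardyPotential α (hardyConst d α) x) ≠ ⊤ := by
    refine ENNReal.mul_ne_top ENNReal.ofReal_ne_top (ne_top_of_le_ne_top hf.2.ne ?_)
    rw [h2]
    exact le_add_self
  rw [e] at h1
  refine (ENNReal.add_left_inj hfin).1 ?_
  rw [hardyForm, h1, add_assoc, ← mul_add, ← h2, ← add_mul,
    ← ENNReal.ofReal_add (by linarith) hθ0, sub_add_cancel, ENNReal.ofReal_one, one_mul]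

-- Both terms of `ofReal_hardyForm_val` are lower semicontinuous under a.e. convergence. Along a
-- subsequence `s (φ j) → 0` a.e., so `q[s n]` is at most the liminf over `j` of `q[s n - s (φ j)]`,
-- which is small for large `n` by the Cauchy property.
omit hW in
theorem hardyForm_isClosable {c : ℝ} (hc : 0 ≤ c) (hc' : c ≤ hardyConst d α) :
    (hardyForm α Ω c).IsClosable := by
  have hq : (hardyForm α Ω c).IsNonneg :=
    perturbedForm_isNonneg hα hα2 hαd hΩ (isHardyBounded_hardyPotential hc hc')
  intro s hs
  have hsd : ∀ n, s n ∈ (hardyForm α Ω c).dom := hs.1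
  have hsub : ∀ m n, s m - s n ∈ (hardyForm α Ω c).dom := fun m n =>
    hq.submodule.sub_mem (hsd m) (hsd n)
  obtain ⟨φ, hφ, hae⟩ := exists_subseq_ae_tendsto hs.2.1
  have hae0 : ∀ᵐ x ∂volume.restrict Ω, Tendsto (fun n => s (φ n) x) atTop (𝓝 0) := by
    filter_upwards [hae, Lp.coeFn_zero ℝ 2 (volume.restrict Ω)] with x hx hx'
    rwa [hx'] at hx
  rw [Metric.tendsto_atTop]
  intro ε hε
  obtain ⟨N, hN⟩ := hs.exists_forall_lt (half_pos hε)
  refine ⟨N, fun n hn => ?_⟩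
  have hlim : ∀ᵐ x, Tendsto (fun j => zeroExt Ω (s n - s (φ j)) x) atTop
      (𝓝 (zeroExt Ω (s n) x)) := by
    refine ae_tendsto_zeroExt hΩ ?_
    have h1 : ∀ᵐ x ∂volume.restrict Ω, ∀ j, (s n - s (φ j) : L2 Ω) x = s n x - s (φ j) x :=
      ae_all_iff.2 fun j => Lp.coeFn_sub _ _
    filter_upwards [h1, hae0] with x hx1 hx2
    simp only [hx1]
    simpa using hx2.const_sub (s n x)
  have hm : ∀ j, AEStronglyMeasurable (zeroExt Ω (s n - s (φ j))) volume := fun j =>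
    (memLp_zeroExt hΩ _).1
  have h1 : ENNReal.ofReal ((hardyForm α Ω c).val (s n) (s n)) ≤ ENNReal.ofReal (ε / 2) := by
    rw [ofReal_hardyForm_val hα hα2 hαd hΩ hc hc' (hsd n).1]
    refine (add_le_add (mul_le_liminf_mul ENNReal.ofReal_ne_top (fracEnergy_le_liminf hm hlim))
      (mul_le_liminf_mul ENNReal.ofReal_ne_top (groundEnergy_le_liminf hm hlim))).trans ?_
    refine liminf_add_liminf_le ?_
    filter_upwards [hφ.tendsto_atTop.eventually_ge_atTop N] with j hj
    rw [← ofReal_hardyForm_val hα hα2 hαd hΩ hc hc' (hsub _ _).1]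
    exact ENNReal.ofReal_le_ofReal (hN n hn _ hj).le
  rw [ENNReal.ofReal_le_ofReal_iff (by positivity)] at h1
  rw [dist_zero_right, Real.norm_of_nonneg (hq.nonneg _ (hsd n))]
  linarith

end Closedness

end

noncomputable section

/-! ### Positivity preservation and the Markov property of the semigroups. -/

section Lattice

variable {X : Type*} [MeasurableSpace X] {μ : Measure X}

/-- Positivity preserving operators. -/
def IsPositive (T : Lp ℝ 2 μ →L[ℝ] Lp ℝ 2 μ) : Prop := ∀ f, 0 ≤ f → 0 ≤ T f

theorem IsPositive.mono {T : Lp ℝ 2 μ →L[ℝ] Lp ℝ 2 μ} (hT : IsPositive T) {f g : Lp ℝ 2 μ}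
    (h : f ≤ g) : T f ≤ T g := by
  have := hT (g - f) (sub_nonneg.2 h)
  rwa [map_sub, sub_nonneg] at this

theorem IsPositive.pow {T : Lp ℝ 2 μ →L[ℝ] Lp ℝ 2 μ} (hT : IsPositive T) (n : ℕ) :
    IsPositive (T ^ n) := by
  induction n with
  | zero => exact fun f hf => hf
  | succ k ih => rw [pow_succ]; exact fun f hf => ih _ (hT f hf)

theorem ae_le_of_tendsto {f : ℕ → Lp ℝ 2 μ} {g : Lp ℝ 2 μ} (h : Tendsto f atTop (𝓝 g)) {M : ℝ}
    (hM : ∀ n, ∀ᵐ x ∂μ, f n x ≤ M) : ∀ᵐ x ∂μ, g x ≤ M := by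
  obtain ⟨φ, -, hae⟩ := exists_subseq_ae_tendsto h
  filter_upwards [hae, ae_all_iff.2 fun n => hM (φ n)] with x hx hx'
  exact le_of_tendsto' hx hx'

theorem nonneg_iff_ae {f : Lp ℝ 2 μ} : 0 ≤ f ↔ ∀ᵐ x ∂μ, 0 ≤ f x :=
  (Lp.coeFn_nonneg f).symm

theorem IsNormalContraction.coeFn_toLp {φ : ℝ → ℝ} (hφ : IsNormalContraction φ) (f : Lp ℝ 2 μ) :
    ⇑((hφ.memLp (Lp.memLp f)).toLp (fun x => φ (f x))) =ᵐ[μ] fun x => φ (f x) :=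
  MemLp.coeFn_toLp _

end Lattice

section Markov

variable {d : ℕ} {α : ℝ} {Ω : Set (Rd d)}

theorem isNormalContraction_min_zero : IsNormalContraction fun x => min x 0 where
  zero := min_self 0
  le a b := by simpa using abs_min_sub_min_le_max a 0 b 0

theorem isNormalContraction_max_sub {M : ℝ} (hM : 0 ≤ M) :
    IsNormalContraction fun x => max (x - M) 0 where
  zero := by simpa using hM
  le a b := by simpa using abs_max_sub_max_le_max (a - M) 0 (b - M) 0

variable (hα : 0 < α) (hα2 : α < 2) (hαd : α < d) (hΩ : MeasurableSet Ω)

-- Because `φ 0 = 0`, composing with `φ` commutes with the extension by zero.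
include hα hα2 hΩ in
theorem IsNormalContraction.toLp_mem {φ : ℝ → ℝ} (hφ : IsNormalContraction φ) (hmono : Monotone φ)
    {W : Rd d → ℝ} {u : L2 Ω} (hu : u ∈ (perturbedForm α Ω W).dom) :
    (hφ.memLp (Lp.memLp u)).toLp (fun x => φ (u x)) ∈ (perturbedForm α Ω W).dom ∧
    fracForm α (zeroExt Ω ((hφ.memLp (Lp.memLp u)).toLp (fun x => φ (u x))))
      (zeroExt Ω ((hφ.memLp (Lp.memLp u)).toLp (fun x => φ (u x)))) ≤
    fracForm α (zeroExt Ω u) (zeroExt Ω ((hφ.memLp (Lp.memLp u)).toLp (fun x => φ (u x)))) := by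
  have e : zeroExt Ω ((hφ.memLp (Lp.memLp u)).toLp (fun x => φ (u x))) =ᵐ[volume]
      fun x => φ (zeroExt Ω u x) := by
    refine (indicator_ae_eq hΩ (hφ.coeFn_toLp u)).trans (Eventually.of_forall fun x => ?_)
    by_cases hx : x ∈ Ω <;> simp [zeroExt, hx, hφ.zero]
  refine ⟨MemFracSobolevZero.congr (hu.comp hφ) e.symm, ?_⟩
  rw [fracForm_congr e e, fracForm_congr EventuallyEq.rfl e]
  exact fracForm_contraction_le hα hα2 hφ hmono hu.1

-- Test the equation `ε L u = f - u` with `v = min u 0`. The form side is at least `q[v] ≥ 0`, since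
-- `u v W = v² W` and the energy part only decreases when `u` is replaced by `v`. The other side is
-- `ε⁻¹ (⟨f, v⟩ - ‖v‖²)` with `⟨f, v⟩ ≤ 0`, so `v = 0`.
include hα hα2 hαd hΩ in
theorem nonneg_of_opGraph {W : Rd d → ℝ} (hW : IsHardyBounded α W) {ε : ℝ} (hε : 0 < ε)
    {f u : L2 Ω} (hf : 0 ≤ f) (hu : (perturbedForm α Ω W).opGraph u (ε⁻¹ • (f - u))) : 0 ≤ u := by
  have hφ := isNormalContraction_min_zero
  obtain ⟨hv, hle⟩ := hφ.toLp_mem hα hα2 hΩ (fun a b h => min_le_min_right 0 h) hu.1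
  set v : L2 Ω := (hφ.memLp (Lp.memLp u)).toLp (fun x => min (u x) 0)
  have hvu : ∀ᵐ x ∂volume.restrict Ω, v x = min (u x) 0 := hφ.coeFn_toLp u
  have h1 := hu.2 v hv
  have h2 := (hW.ofReal_val_add hα hα2 hαd hΩ hv.1).1
  have eW : ∫ x in Ω, u x * v x * W x = ∫ x in Ω, v x * v x * W x := by
    refine integral_congr_ae ?_
    filter_upwards [hvu] with x hx
    rw [hx]
    rcases le_total (u x) 0 with h | h
    · rw [min_eq_left h]
    · rw [min_eq_right h]; ring
  have e2 : inner ℝ u v = ‖v‖ ^ 2 := by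
    rw [← real_inner_self_eq_norm_sq, L2_inner_eq, L2_inner_eq]
    refine integral_congr_ae ?_
    filter_upwards [hvu] with x hx
    rw [hx]
    rcases le_total (u x) 0 with h | h
    · rw [min_eq_left h]
    · rw [min_eq_right h]; ring
  have e3 : inner ℝ f v ≤ 0 := by
    rw [L2_inner_eq]
    refine integral_nonpos_of_ae ?_
    filter_upwards [hvu, nonneg_iff_ae.1 hf] with x hx hx'
    rw [hx]
    exact mul_nonpos_of_nonneg_of_nonpos hx' (min_le_right _ _)
  rw [real_inner_smul_left, inner_sub_left, e2] at h1
  simp only [perturbedForm] at h1 h2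
  rw [eW] at h1
  have h3 : ‖v‖ ^ 2 ≤ 0 := by
    have h4 : 0 ≤ ε⁻¹ * (inner ℝ f v - ‖v‖ ^ 2) := by rw [← h1]; linarith
    have h5 := nonneg_of_mul_nonneg_right h4 (inv_pos.2 hε)
    linarith
  have hv0 : v = 0 := by
    rw [← norm_eq_zero]
    exact pow_eq_zero_iff two_ne_zero |>.1 (le_antisymm h3 (sq_nonneg _))
  rw [nonneg_iff_ae]
  filter_upwards [hvu, (Lp.ext_iff.1 hv0), Lp.coeFn_zero ℝ 2 (volume.restrict Ω)] with x hx hx2 hx3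
  rw [hx, hx3, Pi.zero_apply] at hx2
  exact hx2 ▸ min_le_left _ _

-- Test with `v = (u - M)⁺`, on whose support `f - u ≤ -v`. A positive potential would contribute
-- `-∫ u v W` with the wrong sign, so this is confined to `W = 0`.
include hα hα2 hΩ in
theorem le_of_opGraph {ε : ℝ} (hε : 0 < ε) {M : ℝ} (hM : 0 ≤ M) {f u : L2 Ω}
    (hf : ∀ᵐ x ∂volume.restrict Ω, f x ≤ M)
    (hu : (dirichletForm α Ω).opGraph u (ε⁻¹ • (f - u))) :
    ∀ᵐ x ∂volume.restrict Ω, u x ≤ M := by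
  have hφ := isNormalContraction_max_sub hM
  obtain ⟨hv, hle⟩ := hφ.toLp_mem hα hα2 hΩ
    (fun a b h => max_le_max_right 0 (sub_le_sub_right h M)) hu.1
  set v : L2 Ω := (hφ.memLp (Lp.memLp u)).toLp (fun x => max (u x - M) 0)
  have hvu : ∀ᵐ x ∂volume.restrict Ω, v x = max (u x - M) 0 := hφ.coeFn_toLp u
  have h1 := hu.2 v hv
  have h2 := fracForm_self_nonneg hα hα2 (zeroExt Ω v)
  have e3 : inner ℝ (f - u) v ≤ -‖v‖ ^ 2 := by
    rw [← real_inner_self_eq_norm_sq, ← inner_neg_left, L2_inner_eq, L2_inner_eq]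
    refine integral_mono_ae (integrable_L2_mul _ _) (integrable_L2_mul _ _) ?_
    filter_upwards [hvu, hf, Lp.coeFn_sub f u, Lp.coeFn_neg v] with x hx hx' hs hn
    rw [hs, hn, Pi.neg_apply, Pi.sub_apply]
    rcases le_total (u x - M) 0 with h | h
    · rw [hx, max_eq_right h]; simp
    · rw [hx, max_eq_left h]; nlinarith
  rw [real_inner_smul_left] at h1
  simp only [dirichletForm, perturbedForm, mul_zero, integral_zero, sub_zero] at h1
  have h3 : ‖v‖ ^ 2 ≤ 0 := by
    have h4 : 0 ≤ ε⁻¹ * inner ℝ (f - u) v := by rw [← h1]; linarith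
    have h5 := nonneg_of_mul_nonneg_right h4 (inv_pos.2 hε)
    linarith
  have hv0 : v = 0 := by
    rw [← norm_eq_zero]
    exact pow_eq_zero_iff two_ne_zero |>.1 (le_antisymm h3 (sq_nonneg _))
  filter_upwards [hvu, (Lp.ext_iff.1 hv0), Lp.coeFn_zero ℝ 2 (volume.restrict Ω)] with x hx hx2 hx3
  rw [hx, hx3, Pi.zero_apply] at hx2
  linarith [le_max_left (u x - M) 0]

-- The exponential formula passes positivity from the resolvents to the semigroup, the positive cone
-- being closed.
include hα hα2 hαd hΩ in
theorem isPositive_expSg {W : Rd d → ℝ} (hW : IsHardyBounded α W) {B : L2 Ω →L[ℝ] L2 Ω}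
    (hB : IsResolventOf B (perturbedForm α Ω W).opGraph) (t : ℝ) : IsPositive (expSg B t) := by
  rcases le_or_gt t 0 with ht | ht
  · rw [expSg, if_pos ht]
    exact fun f hf => hf
  · intro f hf
    refine ge_of_tendsto' (hB.tendsto_resolventSg_pow ht f) fun n => ?_
    have hε : 0 < t / ((n : ℝ) + 1) := by positivity
    have hpos : IsPositive (resolventSg B (t / ((n : ℝ) + 1))) := fun g hg =>
      nonneg_of_opGraph hα hα2 hαd hΩ hW hε hg (hB.graph_resolventSg hε g)
    exact hpos.pow (n + 1) f hf

include hα hα2 hΩ in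
theorem expSg_le_of_le {B : L2 Ω →L[ℝ] L2 Ω}
    (hB : IsResolventOf B (dirichletForm α Ω).opGraph) (t : ℝ) {M : ℝ} (hM : 0 ≤ M) {f : L2 Ω}
    (hf : ∀ᵐ x ∂volume.restrict Ω, f x ≤ M) :
    ∀ᵐ x ∂volume.restrict Ω, expSg B t f x ≤ M := by
  rcases le_or_gt t 0 with ht | ht
  · rw [expSg, if_pos ht]
    exact hf
  · refine ae_le_of_tendsto (hB.tendsto_resolventSg_pow ht f) fun n => ?_
    have hε : 0 < t / ((n : ℝ) + 1) := by positivity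
    have hone : ∀ g : L2 Ω, (∀ᵐ x ∂volume.restrict Ω, g x ≤ M) →
        ∀ᵐ x ∂volume.restrict Ω, resolventSg B (t / ((n : ℝ) + 1)) g x ≤ M := fun g hg =>
      le_of_opGraph hα hα2 hΩ hε hM hg (hB.graph_resolventSg hε g)
    have hpow : ∀ m : ℕ, ∀ᵐ x ∂volume.restrict Ω,
        (resolventSg B (t / ((n : ℝ) + 1)) ^ m) f x ≤ M := by
      intro m
      induction m with
      | zero => exact hf
      | succ k ih => rw [pow_succ']; exact hone _ ih
    exact hpow (n + 1)

end Markov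

end

noncomputable section

/-! ### Bounds between `L¹`, `L²` and `L^∞` by duality. -/

section Duality

variable {X : Type*} [MeasurableSpace X] {μ : Measure X}

/-- The indicator function of a set of finite measure, in `L²`. -/
abbrev indL2 {A : Set X} (hA : MeasurableSet A) (hμA : μ A ≠ ⊤) : Lp ℝ 2 μ :=
  indicatorConstLp 2 hA hμA 1

theorem indL2_nonneg {A : Set X} (hA : MeasurableSet A) (hμA : μ A ≠ ⊤) : 0 ≤ indL2 hA hμA := by
  rw [nonneg_iff_ae]
  filter_upwards [indicatorConstLp_coeFn (p := 2) (hs := hA) (hμs := hμA) (c := (1 : ℝ))] with x hx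
  rw [hx]
  exact indicator_nonneg (fun _ _ => zero_le_one) x

theorem indL2_le_one {A : Set X} (hA : MeasurableSet A) (hμA : μ A ≠ ⊤) :
    ∀ᵐ x ∂μ, indL2 hA hμA x ≤ 1 := by
  filter_upwards [indicatorConstLp_coeFn (p := 2) (hs := hA) (hμs := hμA) (c := (1 : ℝ))] with x hx
  rw [hx]
  exact indicator_le' (fun _ _ => le_rfl) (fun _ _ => zero_le_one) x

theorem lintegral_indL2 {A : Set X} (hA : MeasurableSet A) (hμA : μ A ≠ ⊤) :
    ∫⁻ x, ENNReal.ofReal (indL2 hA hμA x) ∂μ = μ A := by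
  rw [← lintegral_indicator_one hA]
  refine lintegral_congr_ae ?_
  filter_upwards [indicatorConstLp_coeFn (p := 2) (hs := hA) (hμs := hμA) (c := (1 : ℝ))] with x hx
  rw [hx]
  by_cases h : x ∈ A <;> simp [h]

theorem ofReal_inner_eq_lintegral {f g : Lp ℝ 2 μ} (hf : 0 ≤ f) (hg : 0 ≤ g) :
    ENNReal.ofReal (inner ℝ f g) = ∫⁻ x, ENNReal.ofReal (f x * g x) ∂μ := by
  have e : inner ℝ f g = ∫ x, f x * g x ∂μ := by
    rw [L2.inner_def]
    exact integral_congr_ae (Eventually.of_forall fun x => by simp [mul_comm])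
  rw [e]
  refine ofReal_integral_eq_lintegral_ofReal ((Lp.memLp f).integrable_mul (Lp.memLp g)) ?_
  filter_upwards [nonneg_iff_ae.1 hf, nonneg_iff_ae.1 hg] with x h1 h2 using mul_nonneg h1 h2

theorem ofReal_inner_indL2 {A : Set X} (hA : MeasurableSet A) (hμA : μ A ≠ ⊤) {f : Lp ℝ 2 μ}
    (hf : 0 ≤ f) :
    ENNReal.ofReal (inner ℝ (indL2 hA hμA) f) = ∫⁻ x in A, ENNReal.ofReal (f x) ∂μ := by
  rw [ofReal_inner_eq_lintegral (indL2_nonneg hA hμA) hf, ← lintegral_indicator hA]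
  refine lintegral_congr_ae ?_
  filter_upwards [indicatorConstLp_coeFn (p := 2) (hs := hA) (hμs := hμA) (c := (1 : ℝ))] with x hx
  rw [hx]
  by_cases h : x ∈ A <;> simp [h]

variable [SigmaFinite μ] {T : Lp ℝ 2 μ →L[ℝ] Lp ℝ 2 μ}

/-- Dual to the contraction property on `L^∞`: test `T f` against the indicator of a set of finite
measure and move `T` onto the indicator. -/
theorem IsPositive.lintegral_le (hT : IsPositive T)
    (hsymm : ∀ f g, inner ℝ (T f) g = inner ℝ f (T g))
    (hM : ∀ f : Lp ℝ 2 μ, (∀ᵐ x ∂μ, f x ≤ 1) → ∀ᵐ x ∂μ, T f x ≤ 1) {f : Lp ℝ 2 μ} (hf : 0 ≤ f) :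
    ∫⁻ x, ENNReal.ofReal (T f x) ∂μ ≤ ∫⁻ x, ENNReal.ofReal (f x) ∂μ := by
  refine lintegral_le_of_forall_fin_meas_le _ fun A hA hμA => ?_
  have h0 := indL2_nonneg hA hμA
  rw [← ofReal_inner_indL2 hA hμA (hT f hf), ← hsymm, ofReal_inner_eq_lintegral (hT _ h0) hf]
  refine lintegral_mono_ae ?_
  filter_upwards [hM _ (indL2_le_one hA hμA), nonneg_iff_ae.1 hf] with x h1 h2
  exact ENNReal.ofReal_le_ofReal (mul_le_of_le_one_left h2 h1)

/-- A bound from `L¹` to `L²` dualises to one from `L²` to `L^∞` with the same constant. Averages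
over sets of finite measure bound `T g` pointwise for `g ≥ 0`; general `g` is dominated by `|g|`. -/
theorem IsPositive.ae_le_of_norm_le (hT : IsPositive T)
    (hsymm : ∀ f g, inner ℝ (T f) g = inner ℝ f (T g)) {K : ℝ} (hK : 0 ≤ K)
    (h : ∀ f : Lp ℝ 2 μ, 0 ≤ f →
      ENNReal.ofReal ‖T f‖ ≤ ENNReal.ofReal K * ∫⁻ x, ENNReal.ofReal (f x) ∂μ)
    (g : Lp ℝ 2 μ) : ∀ᵐ x ∂μ, |T g x| ≤ K * ‖g‖ := by
  have key : ∀ g : Lp ℝ 2 μ, 0 ≤ g → ∀ᵐ x ∂μ, T g x ≤ K * ‖g‖ := by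
    intro g hg
    have h1 : (fun x => ENNReal.ofReal (T g x)) ≤ᵐ[μ] fun _ => ENNReal.ofReal (K * ‖g‖) := by
      refine ae_le_of_forall_setLIntegral_le_of_sigmaFinite₀
        (Lp.aestronglyMeasurable _).aemeasurable.ennreal_ofReal fun A hA hμA => ?_
      rw [← ofReal_inner_indL2 hA hμA.ne (hT g hg), ← hsymm, setLIntegral_const]
      calc ENNReal.ofReal (inner ℝ (T (indL2 hA hμA.ne)) g)
          ≤ ENNReal.ofReal (‖T (indL2 hA hμA.ne)‖ * ‖g‖) :=
            ENNReal.ofReal_le_ofReal (real_inner_le_norm _ _)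
        _ = ENNReal.ofReal ‖T (indL2 hA hμA.ne)‖ * ENNReal.ofReal ‖g‖ :=
            ENNReal.ofReal_mul (norm_nonneg _)
        _ ≤ ENNReal.ofReal K * μ A * ENNReal.ofReal ‖g‖ := by
            have := h _ (indL2_nonneg hA hμA.ne)
            rw [lintegral_indL2] at this
            exact mul_le_mul_left this _
        _ = ENNReal.ofReal (K * ‖g‖) * μ A := by
            rw [ENNReal.ofReal_mul hK]; ring
    filter_upwards [h1] with x hx
    exact (ENNReal.ofReal_le_ofReal_iff (by positivity)).1 hx
  have h1 := hT.mono (le_abs_self g)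
  have h2 := hT.mono (neg_le_abs g)
  rw [map_neg] at h2
  filter_upwards [key _ (abs_nonneg g), (Lp.coeFn_le _ _).2 h1, (Lp.coeFn_le _ _).2 h2,
    Lp.coeFn_neg (T g)] with x a1 a2 a3 a4
  rw [norm_abs_eq_norm] at a1
  rw [a4, Pi.neg_apply] at a3
  exact abs_le.2 ⟨by linarith, a2.trans a1⟩

end Duality

/-! ### Ultracontractivity of the Dirichlet semigroup from the Nash-type inequality. -/

section Ultracontractivity

variable {d : ℕ} {α : ℝ} {Ω : Set (Rd d)}

theorem exists_nash (hα : 0 < α) (hα2 : α < 2) (hαd : α < d) (hΩ : MeasurableSet Ω) :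
    ∃ C₁ C₂ : ℝ, 0 < C₁ ∧ 0 < C₂ ∧ ∀ v ∈ (dirichletForm α Ω).dom, ∀ m : ℝ, 0 ≤ m →
      ∫⁻ x in Ω, ENNReal.ofReal |v x| ≤ ENNReal.ofReal m → ∀ r : ℝ, 0 < r →
        ‖v‖ ^ 2 ≤ C₁ * r ^ α * (dirichletForm α Ω).val v v + C₂ * r ^ (-(d : ℝ)) * m ^ 2 := by
  have hC := fracConst_pos (d := d) hα hα2
  set ω := (volume (Metric.ball (0 : Rd d) 1)).toReal
  have hω : 0 < ω := ENNReal.toReal_pos (Metric.measure_ball_pos _ _ one_pos).ne'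
    measure_ball_lt_top.ne
  refine ⟨1 / (fracConst d α * ω), 1 / ω, by positivity, by positivity,
    fun v hv m hm hvm r hr => ?_⟩
  have h1 := lintegral_sq_le_nash hα (memLp_zeroExt hΩ v).1 hr
  obtain ⟨hq, hE⟩ := (isHardyBounded_zero hα hαd).ofReal_val_add hα hα2 hαd hΩ hv.1
  simp only [mul_zero, ENNReal.ofReal_zero, lintegral_zero, add_zero] at hE
  change 0 ≤ (dirichletForm α Ω).val v v at hq
  change ENNReal.ofReal ((dirichletForm α Ω).val v v) = _ at hE
  set q := (dirichletForm α Ω).val v v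
  rw [fracEnergy_eq] at hE
  have hX : ∫⁻ z, ENNReal.ofReal (diffQuot α (zeroExt Ω v) z ^ 2) =
      ENNReal.ofReal (2 / fracConst d α * q) := by
    rw [ENNReal.ofReal_mul (by positivity), hE, ← mul_assoc, ← ENNReal.ofReal_mul (by positivity)]
    rw [show 2 / fracConst d α * (fracConst d α / 2) = 1 by field_simp, ENNReal.ofReal_one, one_mul]
  have hL : ∫⁻ x, ENNReal.ofReal |zeroExt Ω v x| ≤ ENNReal.ofReal m := by
    refine le_trans (le_of_eq ?_) hvm
    rw [← lintegral_indicator hΩ]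
    refine lintegral_congr fun x => ?_
    by_cases hx : x ∈ Ω <;> simp [zeroExt, hx]
  have hball : volume (Metric.ball (0 : Rd d) r) = ENNReal.ofReal (r ^ (d : ℝ) * ω) := by
    rw [Measure.addHaar_ball_of_pos _ _ hr, finrank_euclideanSpace_fin, Real.rpow_natCast,
      ENNReal.ofReal_mul (by positivity), ENNReal.ofReal_toReal measure_ball_lt_top.ne]
  have h2 : ENNReal.ofReal (2 * (r ^ (d : ℝ) * ω * ‖v‖ ^ 2)) ≤
      ENNReal.ofReal (r ^ ((d : ℝ) + α) * (2 / fracConst d α * q) + 2 * m ^ 2) := by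
    rw [ENNReal.ofReal_mul zero_le_two, ENNReal.ofReal_mul (by positivity), ENNReal.ofReal_add
      (by positivity) (by positivity),
      ENNReal.ofReal_mul (p := r ^ ((d : ℝ) + α)) (by positivity),
      ENNReal.ofReal_mul zero_le_two, ENNReal.ofReal_pow hm, ENNReal.ofReal_ofNat, ← hX, ← hball,
      ← lintegral_zeroExt_sq hΩ]
    refine h1.trans ?_
    gcongr
  rw [ENNReal.ofReal_le_ofReal_iff (by positivity)] at h2
  have hrd : 0 < r ^ (d : ℝ) := by positivity
  rw [Real.rpow_add hr] at h2
  rw [Real.rpow_neg hr.le]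
  have h3 : ‖v‖ ^ 2 = 2 * (r ^ (d : ℝ) * ω * ‖v‖ ^ 2) / (2 * r ^ (d : ℝ) * ω) := by
    field_simp
  rw [h3, div_le_iff₀ (by positivity)]
  refine h2.trans (le_of_eq ?_)
  field_simp

/-- The form value is `⟨L e^{-sL} f, e^{-sL} f⟩`; half of the time is spent on `‖L e^{-(s/2)L}‖ ≤
2/s`, the other half remains on `f`. -/
theorem norm_expSg_sq_le {H : Type*} [NormedAddCommGroup H] [InnerProductSpace ℝ H]
    [CompleteSpace H] {B : H →L[ℝ] H} {q : HForm H} (hB : IsResolventOf B q.opGraph) {s : ℝ}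
    (hs : 0 < s) (f : H) :
    q.val (expSg B s f) (expSg B s f) ≤ 2 / s * ‖expSg B (s / 2) f‖ ^ 2 := by
  have hs2 := half_pos hs
  have hg := hB.graph_expSg hs f
  have e : genExpSg B s = genExpSg B (s / 2) * expSg B (s / 2) := by
    rw [genExpSg, genExpSg, expSg_of_pos B hs2, ← hB.pos.opFun_mul (isC0_mul_exp hs2)
      (isC0_exp hs2)]
    refine opFun_congr fun l _ => ?_
    rw [mul_assoc, ← Real.exp_add]
    congr 2
    ring
  have h1 : ‖genExpSg B s f‖ ≤ 2 / s * ‖expSg B (s / 2) f‖ := by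
    rw [e, mul_apply_eq_comp]
    refine (ContinuousLinearMap.le_of_opNorm_le _ (hB.pos.norm_genExpSg_le hs2) _).trans
      (le_of_eq ?_)
    field_simp
  have h2 : ‖expSg B s f‖ ≤ ‖expSg B (s / 2) f‖ := by
    nth_rw 1 [show s = s / 2 + s / 2 by ring]
    rw [hB.pos.expSg_add hs2.le hs2.le]
    exact hB.pos.norm_expSg_apply_le _ _
  rw [hg.2 _ hg.1]
  calc _ ≤ ‖genExpSg B s f‖ * ‖expSg B s f‖ := real_inner_le_norm _ _
    _ ≤ (2 / s * ‖expSg B (s / 2) f‖) * ‖expSg B (s / 2) f‖ := by gcongr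
    _ = _ := by ring

/-- The Nash inequality at `e^{-sL} f` with `r^α = η s` bounds `‖e^{-sL} f‖²` by a multiple of
`‖e^{-(s/2)L} f‖²` plus a constant times `m² s^{-p}`, where `p = d/α` and the `L¹` contraction
supplies `m`. The choice of `η` makes the multiple `2^{-p}/2`: the factor `2^{-p}` undoes the growth
of `s^{-p}` under `s ↦ s/2`, and the factor `1/2` removes `‖f‖²` after infinitely many halvings. -/
theorem exists_norm_expSg_le (hα : 0 < α) (hα2 : α < 2) (hαd : α < d) (hΩ : MeasurableSet Ω)
    {B : L2 Ω →L[ℝ] L2 Ω} (hB : IsResolventOf B (dirichletForm α Ω).opGraph) {t : ℝ}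
    (ht : 0 < t) : ∃ K : ℝ, 0 ≤ K ∧ ∀ f : L2 Ω, 0 ≤ f →
      ENNReal.ofReal ‖expSg B t f‖ ≤ ENNReal.ofReal K * ∫⁻ x in Ω, ENNReal.ofReal (f x) := by
  obtain ⟨C₁, C₂, hC₁, hC₂, hnash⟩ := exists_nash hα hα2 hαd hΩ
  have hpos := isPositive_expSg hα hα2 hαd hΩ (isHardyBounded_zero hα hαd) hB
  set p : ℝ := d / α
  have hp : 0 < p := by have : (0 : ℝ) < d := hα.trans hαd; positivity
  set η : ℝ := (2 : ℝ) ^ (-p) / 4 / C₁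
  have hη : 0 < η := by positivity
  set K2 : ℝ := 2 * C₂ * η ^ (-p) with hK2
  refine ⟨√(K2 * t ^ (-p)) + 1, by positivity, fun f hf => ?_⟩
  by_cases htop : ∫⁻ x in Ω, ENNReal.ofReal (f x) = ⊤
  · rw [htop, ENNReal.mul_top (by simp; positivity)]
    exact le_top
  set m := (∫⁻ x in Ω, ENNReal.ofReal (f x)).toReal
  have hm : 0 ≤ m := ENNReal.toReal_nonneg
  have hmf : ∫⁻ x in Ω, ENNReal.ofReal (f x) = ENNReal.ofReal m := (ENNReal.ofReal_toReal htop).symm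
  have step : ∀ s : ℝ, 0 < s → ‖expSg B s f‖ ^ 2 ≤
      1 / 2 * 2 ^ (-p) * ‖expSg B (s / 2) f‖ ^ 2 + K2 * m ^ 2 / 2 * s ^ (-p) := by
    intro s hs
    have hmem := (hB.graph_expSg hs f).1
    have hr : 0 < (η * s) ^ (1 / α) := by positivity
    have hL1 : ∫⁻ x in Ω, ENNReal.ofReal |expSg B s f x| ≤ ENNReal.ofReal m := by
      rw [← hmf]
      refine le_trans (le_of_eq ?_) ((hpos s).lintegral_le (hB.pos.inner_expSg s)
        (fun g hg => expSg_le_of_le hα hα2 hΩ hB s zero_le_one hg) hf)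
      refine lintegral_congr_ae ?_
      filter_upwards [nonneg_iff_ae.1 (hpos s f hf)] with x hx
      rw [abs_of_nonneg hx]
    have h1 := hnash _ hmem m hm hL1 _ hr
    have h2 := norm_expSg_sq_le hB hs f
    rw [← Real.rpow_mul (by positivity), ← Real.rpow_mul (by positivity), one_div_mul_cancel hα.ne',
      Real.rpow_one, show 1 / α * -(d : ℝ) = -p by simp only [p]; ring,
      Real.mul_rpow hη.le hs.le] at h1
    calc _ ≤ _ := h1
      _ ≤ C₁ * (η * s) * (2 / s * ‖expSg B (s / 2) f‖ ^ 2) +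
          C₂ * (η ^ (-p) * s ^ (-p)) * m ^ 2 := by gcongr
      _ = _ := by
          rw [hK2]
          simp only [η]
          field_simp
          ring
  have hind : ∀ n : ℕ, ∀ s : ℝ, 0 < s → ‖expSg B s f‖ ^ 2 ≤
      (1 / 2) ^ n * ‖f‖ ^ 2 + K2 * m ^ 2 * s ^ (-p) := by
    intro n
    induction n with
    | zero =>
      intro s hs
      have := hB.pos.norm_expSg_apply_le s f
      have h2 : 0 ≤ K2 * m ^ 2 * s ^ (-p) := by positivity
      rw [pow_zero, one_mul]
      nlinarith [norm_nonneg (expSg B s f)]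
    | succ n ih =>
      intro s hs
      have h1 := ih (s / 2) (half_pos hs)
      have h2 : (2 : ℝ) ^ (-p) ≤ 1 := Real.rpow_le_one_of_one_le_of_nonpos one_le_two (by linarith)
      have h3 : (2 : ℝ) ^ (-p) * (s / 2) ^ (-p) = s ^ (-p) := by
        rw [← Real.mul_rpow zero_le_two (by positivity)]
        congr 1
        ring
      calc _ ≤ _ := step s hs
        _ ≤ 1 / 2 * 2 ^ (-p) * ((1 / 2) ^ n * ‖f‖ ^ 2 + K2 * m ^ 2 * (s / 2) ^ (-p)) +
            K2 * m ^ 2 / 2 * s ^ (-p) := by gcongr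
        _ = 2 ^ (-p) * (1 / 2 * ((1 / 2) ^ n * ‖f‖ ^ 2)) + 1 / 2 * (K2 * m ^ 2) *
            (2 ^ (-p) * (s / 2) ^ (-p)) + K2 * m ^ 2 / 2 * s ^ (-p) := by ring
        _ ≤ 1 * (1 / 2 * ((1 / 2) ^ n * ‖f‖ ^ 2)) + 1 / 2 * (K2 * m ^ 2) *
            (2 ^ (-p) * (s / 2) ^ (-p)) + K2 * m ^ 2 / 2 * s ^ (-p) := by gcongr
        _ = _ := by rw [h3]; ring
  have hfin : ‖expSg B t f‖ ^ 2 ≤ K2 * m ^ 2 * t ^ (-p) := by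
    have h1 : Tendsto (fun n : ℕ => (1 / 2 : ℝ) ^ n * ‖f‖ ^ 2 + K2 * m ^ 2 * t ^ (-p)) atTop
        (𝓝 (0 * ‖f‖ ^ 2 + K2 * m ^ 2 * t ^ (-p))) :=
      ((tendsto_pow_atTop_nhds_zero_of_lt_one (by norm_num) (by norm_num)).mul_const _).add_const _
    rw [zero_mul, zero_add] at h1
    exact ge_of_tendsto' h1 fun n => hind n t ht
  rw [hmf, ← ENNReal.ofReal_mul (by positivity)]
  refine ENNReal.ofReal_le_ofReal ?_
  have h4 : ‖expSg B t f‖ ≤ √(K2 * t ^ (-p)) * m := by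
    rw [← Real.sqrt_sq hm, ← Real.sqrt_mul (by positivity)]
    exact Real.le_sqrt_of_sq_le (hfin.trans (le_of_eq (by ring)))
  linarith

theorem exists_abs_expSg_le (hα : 0 < α) (hα2 : α < 2) (hαd : α < d) (hΩ : MeasurableSet Ω)
    {B : L2 Ω →L[ℝ] L2 Ω} (hB : IsResolventOf B (dirichletForm α Ω).opGraph) {t : ℝ}
    (ht : 0 < t) : ∃ K : ℝ, 0 ≤ K ∧ ∀ f : L2 Ω, ∀ᵐ x ∂volume.restrict Ω,
      |expSg B t f x| ≤ K * ‖f‖ := by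
  obtain ⟨K, hK, h⟩ := exists_norm_expSg_le hα hα2 hαd hΩ hB ht
  exact ⟨K, hK, (isPositive_expSg hα hα2 hαd hΩ (isHardyBounded_zero hα hαd) hB t).ae_le_of_norm_le
    (hB.pos.inner_expSg t) hK h⟩

end Ultracontractivity

end

noncomputable section

/-! ### Orthonormal bases indexed by the natural numbers. -/

section CountableBasis

variable {H : Type*} [NormedAddCommGroup H] [InnerProductSpace ℝ H]

/-- A sequence that consists of an orthonormal basis and of zeros. -/
structure IsBasisSeq (e : ℕ → H) : Prop where
  hasSum : ∀ f, HasSum (fun n => inner ℝ (e n) f • e n) f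
  norm_sq_le : ∀ (s : Finset ℕ) (a : ℕ → ℝ), ‖∑ n ∈ s, a n • e n‖ ^ 2 ≤ ∑ n ∈ s, a n ^ 2

/-- Distinct vectors of an orthonormal basis are at distance more than 1, so separability makes the
basis countable. Filling up with zeros treats finite and infinite dimension alike. -/
theorem exists_isBasisSeq [CompleteSpace H] [SecondCountableTopology H] :
    ∃ e : ℕ → H, IsBasisSeq e := by
  obtain ⟨w, b, hb⟩ := exists_hilbertBasis ℝ H
  have hdist : ∀ i j : w, i ≠ j → 1 < ‖b i - b j‖ := by
    intro i j hij
    have h := norm_sub_sq_real (b i) (b j)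
    rw [b.orthonormal.2 hij, b.orthonormal.1 i, b.orthonormal.1 j] at h
    nlinarith [norm_nonneg (b i - b j)]
  have hc : Countable w := by
    refine Pairwise.countable_of_isOpen_disjoint (s := fun i : w => Metric.ball (b i) (1 / 2))
      (fun i j hij => ?_) (fun i => Metric.isOpen_ball) fun i => ⟨b i, by simp⟩
    refine Metric.ball_disjoint_ball ?_
    rw [dist_eq_norm]
    linarith [hdist i j hij]
  have : Encodable w := Encodable.ofCountable w
  have hinj : Function.Injective (Encodable.encode : w → ℕ) := Encodable.encode_injective
  set e : ℕ → H := Function.extend Encodable.encode b 0 with he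
  have he1 : ∀ i : w, e (Encodable.encode i) = b i := fun i => hinj.extend_apply _ _ _
  have he0 : ∀ n, (¬∃ i : w, Encodable.encode i = n) → e n = 0 := fun n hn =>
    Function.extend_apply' _ _ _ hn
  have horth : ∀ m n, m ≠ n → inner ℝ (e m) (e n) = 0 := by
    intro m n hmn
    by_cases hm : ∃ i : w, Encodable.encode i = m
    · by_cases hn : ∃ i : w, Encodable.encode i = n
      · obtain ⟨i, rfl⟩ := hm
        obtain ⟨j, rfl⟩ := hn
        rw [he1, he1]
        exact b.orthonormal.2 fun h => hmn (by rw [h])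
      · rw [he0 n hn, inner_zero_right]
    · rw [he0 m hm, inner_zero_left]
  have hnorm : ∀ n, ‖e n‖ ≤ 1 := by
    intro n
    by_cases hn : ∃ i : w, Encodable.encode i = n
    · obtain ⟨i, rfl⟩ := hn
      rw [he1, b.orthonormal.1]
    · rw [he0 n hn, norm_zero]
      exact zero_le_one
  refine ⟨e, fun f => ?_, fun s a => ?_⟩
  · have h := b.hasSum_repr f
    rw [← hasSum_extend_zero hinj] at h
    convert h using 1
    funext n
    by_cases hn : ∃ i : w, Encodable.encode i = n
    · obtain ⟨i, rfl⟩ := hn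
      rw [hinj.extend_apply, he1, b.repr_apply_apply]
    · rw [Function.extend_apply' _ _ _ hn, he0 n hn, smul_zero, Pi.zero_apply]
  · induction s using Finset.induction_on with
    | empty => simp
    | insert m s hm ih =>
      rw [Finset.sum_insert hm, Finset.sum_insert hm, norm_add_sq_real, inner_sum]
      have h0 : ∑ n ∈ s, inner ℝ (a m • e m) (a n • e n) = 0 := by
        refine Finset.sum_eq_zero fun n hn => ?_
        rw [real_inner_smul_left, real_inner_smul_right, horth m n fun h => hm (h ▸ hn)]
        simp
      have h1 : ‖a m • e m‖ ^ 2 ≤ a m ^ 2 := by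
        rw [norm_smul, mul_pow, Real.norm_eq_abs, sq_abs]
        exact mul_le_of_le_one_right (sq_nonneg _) (pow_le_one₀ (norm_nonneg _) (hnorm m))
      rw [h0]
      linarith

theorem IsBasisSeq.summable [CompleteSpace H] {e : ℕ → H} (he : IsBasisSeq e) {a : ℕ → ℝ}
    (ha : Summable fun n => a n ^ 2) : Summable fun n => a n • e n := by
  rw [summable_iff_vanishing_norm]
  intro ε hε
  obtain ⟨s, hs⟩ := summable_iff_vanishing_norm.1 ha (ε ^ 2) (by positivity)
  refine ⟨s, fun t ht => ?_⟩
  have h1 := hs t ht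
  rw [Real.norm_of_nonneg (Finset.sum_nonneg fun n _ => sq_nonneg _)] at h1
  exact lt_of_pow_lt_pow_left₀ 2 hε.le ((he.norm_sq_le t a).trans_lt h1)

end CountableBasis

/-! ### Jointly measurable versions of curves in `L²`. -/

section Versions

variable {X : Type*} [MeasurableSpace X] {μ : Measure X}

theorem coeFn_sum_smul (s : Finset ℕ) (a : ℕ → ℝ) (f : ℕ → Lp ℝ 2 μ) :
    ∀ᵐ x ∂μ, (∑ n ∈ s, a n • f n : Lp ℝ 2 μ) x = ∑ n ∈ s, a n * f n x := by
  induction s using Finset.induction_on with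
  | empty =>
    filter_upwards [Lp.coeFn_zero ℝ 2 μ] with x hx
    rw [Finset.sum_empty, Finset.sum_empty]
    exact hx
  | insert m s hm ih =>
    rw [Finset.sum_insert hm]
    filter_upwards [ih, Lp.coeFn_add (a m • f m) (∑ n ∈ s, a n • f n),
      Lp.coeFn_smul (a m) (f m)] with x h1 h2 h3
    rw [h2, Pi.add_apply, h1, h3, Finset.sum_insert hm, Pi.smul_apply, smul_eq_mul]

/-- The sum of the `|f_n - g|²` is integrable, hence finite a.e., so its terms tend to 0 a.e.; no
subsequence is needed. -/
theorem ae_tendsto_of_summable_norm_sq {f : ℕ → Lp ℝ 2 μ} {g : Lp ℝ 2 μ}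
    (h : Summable fun n => ‖f n - g‖ ^ 2) :
    ∀ᵐ x ∂μ, Tendsto (fun n => f n x) atTop (𝓝 (g x)) := by
  have hn : ∀ n, ∫⁻ x, ENNReal.ofReal ((f n x - g x) ^ 2) ∂μ = ENNReal.ofReal (‖f n - g‖ ^ 2) := by
    intro n
    rw [← real_inner_self_eq_norm_sq, L2.inner_def, ← ofReal_integral_eq_lintegral_ofReal]
    · congr 1
      refine integral_congr_ae ?_
      filter_upwards [Lp.coeFn_sub (f n) g] with x hx
      rw [hx]
      simp [sq]
    · exact ((Lp.memLp (f n)).sub (Lp.memLp g)).integrable_sq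
    · exact Eventually.of_forall fun x => sq_nonneg _
  have hm : ∀ n, AEMeasurable (fun x => ENNReal.ofReal ((f n x - g x) ^ 2)) μ := fun n =>
    (((Lp.aestronglyMeasurable (f n)).aemeasurable.sub
      (Lp.aestronglyMeasurable g).aemeasurable).pow_const 2).ennreal_ofReal
  have hfin : ∫⁻ x, ∑' n, ENNReal.ofReal ((f n x - g x) ^ 2) ∂μ ≠ ⊤ := by
    rw [lintegral_tsum hm]
    simp only [hn]
    exact h.tsum_ofReal_ne_top
  filter_upwards [ae_lt_top' (AEMeasurable.tsum hm) hfin] with x hx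
  have h1 := ENNReal.tendsto_atTop_zero_of_tsum_ne_top hx.ne
  have h2 := (ENNReal.tendsto_toReal ENNReal.zero_ne_top).comp h1
  simp only [Function.comp_def, ENNReal.toReal_ofReal (sq_nonneg _), ENNReal.toReal_zero] at h2
  have h3 := h2.sqrt
  simp only [Real.sqrt_sq_eq_abs, Real.sqrt_zero] at h3
  have h4 := (tendsto_zero_iff_abs_tendsto_zero _).2 h3
  simpa using h4.add_const (g x)

/-- A curve in `L²` that is locally Lipschitz on `(0, ∞)` has a jointly measurable version. -/
theorem exists_measurable_version {F : ℝ → Lp ℝ 2 μ} {C : ℝ}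
    (hF : ∀ s t, 0 < s → s ≤ t → ‖F t - F s‖ ≤ C * ((t - s) / s)) :
    ∃ v : ℝ × X → ℝ, Measurable v ∧ ∀ t, 0 < t → ∀ᵐ x ∂μ, v (t, x) = F t x := by
  -- Time is rounded up to the dyadic grid of mesh `2^{-j}`, so that `V j` uses countably many times
  -- and is jointly measurable. The `+ 1` keeps the grid point at or above `t > 0`, where the
  -- Lipschitz bound with base point `t` applies and gives errors with summable squares.
  set τ : ℕ → ℕ → ℝ := fun j n => ((n : ℝ) + 1) / 2 ^ j
  set V : ℕ → ℝ × X → ℝ := fun j z => F (τ j ⌊2 ^ j * z.1⌋₊) z.2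
  have hV : ∀ j, Measurable (V j) := by
    intro j
    have h1 : Measurable fun z : ℕ × X => F (τ j z.1) z.2 :=
      measurable_from_prod_countable_right
        fun n => (Lp.stronglyMeasurable (F (τ j n))).measurable
    exact h1.comp (f := fun z : ℝ × X => (⌊2 ^ j * z.1⌋₊, z.2))
      ((Nat.measurable_floor.comp (measurable_fst.const_mul _)).prodMk measurable_snd)
  refine ⟨fun z => limsup (fun j => V j z) atTop, Measurable.limsup hV, fun t ht => ?_⟩
  have hlow : ∀ j, t ≤ τ j ⌊2 ^ j * t⌋₊ := by
    intro j
    rw [le_div_iff₀ (by positivity), mul_comm]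
    exact (Nat.lt_floor_add_one _).le
  have hup : ∀ j, τ j ⌊2 ^ j * t⌋₊ - t ≤ (1 / 2) ^ j := by
    intro j
    have h1 : (⌊2 ^ j * t⌋₊ : ℝ) ≤ 2 ^ j * t := Nat.floor_le (by positivity)
    rw [sub_le_iff_le_add, div_le_iff₀ (by positivity), add_mul, ← mul_pow]
    norm_num
    linarith
  have hsum : Summable fun j => ‖F (τ j ⌊2 ^ j * t⌋₊) - F t‖ ^ 2 := by
    refine Summable.of_nonneg_of_le (fun _ => sq_nonneg _) (fun j => ?_)
      (f := fun j : ℕ => (|C| / t) ^ 2 * (1 / 4) ^ j)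
      ((summable_geometric_of_lt_one (by norm_num) (by norm_num)).mul_left _)
    have h1 := hF t _ ht (hlow j)
    have h2 : ‖F (τ j ⌊2 ^ j * t⌋₊) - F t‖ ≤ |C| / t * (1 / 2) ^ j := by
      refine h1.trans ?_
      rw [div_mul_eq_mul_div, ← mul_div_assoc]
      gcongr ?_ / t
      exact mul_le_mul (le_abs_self C) (hup j) (sub_nonneg.2 (hlow j)) (abs_nonneg _)
    calc _ ≤ (|C| / t * (1 / 2) ^ j) ^ 2 := pow_le_pow_left₀ (norm_nonneg _) h2 2
      _ = _ := by rw [mul_pow, ← pow_mul, mul_comm j, pow_mul]; norm_num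
  filter_upwards [ae_tendsto_of_summable_norm_sq hsum] with x hx
  exact hx.limsup_eq

end Versions

/-! ### Integral kernels of operators bounded from `L²` to `L^∞`. -/

section Kernel

variable {X : Type*} [MeasurableSpace X] {μ : Measure X} {S : Lp ℝ 2 μ →L[ℝ] Lp ℝ 2 μ} {K : ℝ}
  {e : ℕ → Lp ℝ 2 μ} {v : ℕ → X → ℝ}

/-- The exceptional set of `|S f x| ≤ K ‖f‖` depends on `f`, so the bound is used for rational
combinations of the `e n` only and extended to real coefficients by density. Taking `v n x`
themselves as coefficients gives the claim. -/
theorem ae_sum_sq_le (hK : 0 ≤ K) (hS : ∀ f : Lp ℝ 2 μ, ∀ᵐ x ∂μ, |S f x| ≤ K * ‖f‖)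
    (he : IsBasisSeq e) (hv : ∀ n, ∀ᵐ x ∂μ, v n x = S (e n) x) :
    ∀ᵐ x ∂μ, ∀ N, ∑ n ∈ Finset.range N, v n x ^ 2 ≤ K ^ 2 := by
  rw [ae_all_iff]
  intro N
  have h1 : ∀ᵐ x ∂μ, ∀ a : Fin N → ℚ,
      |∑ i, (a i : ℝ) * v i x| ≤ K * √(∑ i, (a i : ℝ) ^ 2) := by
    rw [ae_all_iff]
    intro a
    set b : ℕ → ℝ := fun n => if h : n < N then (a ⟨n, h⟩ : ℝ) else 0
    have hb : ∀ i : Fin N, b i = a i := fun i => by simp [b]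
    have h2 := hS (∑ n ∈ Finset.range N, b n • e n)
    simp only [map_sum, map_smul] at h2
    filter_upwards [h2, coeFn_sum_smul (Finset.range N) b (fun n => S (e n)),
      ae_all_iff.2 hv] with x h3 h4 h5
    rw [h4] at h3
    have e1 : ∑ i : Fin N, (a i : ℝ) * v i x = ∑ n ∈ Finset.range N, b n * S (e n) x := by
      rw [Finset.sum_range]
      exact Finset.sum_congr rfl fun i _ => by rw [hb, h5]
    have e2 : ∑ i : Fin N, (a i : ℝ) ^ 2 = ∑ n ∈ Finset.range N, b n ^ 2 := by
      rw [Finset.sum_range]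
      exact Finset.sum_congr rfl fun i _ => by rw [hb]
    rw [e1, e2]
    refine h3.trans (mul_le_mul_of_nonneg_left ?_ hK)
    exact Real.le_sqrt_of_sq_le (he.norm_sq_le _ _)
  filter_upwards [h1] with x hx
  have hd : DenseRange (fun (a : Fin N → ℚ) i => (a i : ℝ)) :=
    DenseRange.piMap fun _ => Rat.denseRange_cast
  have h2 : ∀ a : Fin N → ℝ, |∑ i, a i * v i x| ≤ K * √(∑ i, a i ^ 2) := fun a =>
    hd.induction_on (p := fun a => |∑ i, a i * v i x| ≤ K * √(∑ i, a i ^ 2)) a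
      (isClosed_le (by fun_prop) (by fun_prop)) hx
  have h3 := h2 fun i => v i x
  rw [Finset.sum_range]
  set Q := ∑ i : Fin N, v i x ^ 2 with hQ
  have hQ0 : 0 ≤ Q := Finset.sum_nonneg fun _ _ => sq_nonneg _
  have e1 : ∑ i : Fin N, v i x * v i x = Q := by simp only [hQ, sq]
  rw [e1, abs_of_nonneg hQ0] at h3
  have h4 : √Q * √Q ≤ K * √Q := by rwa [Real.mul_self_sqrt hQ0]
  have h5 : √Q ≤ K := by
    rcases (Real.sqrt_nonneg Q).eq_or_lt with h | h
    · rwa [← h]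
    · exact le_of_mul_le_mul_right h4 h
  exact Real.sqrt_le_iff.1 h5 |>.2

/-- The kernel `∑ v_n(x) v_n(y)`. -/
def sumKernel (v : ℕ → X → ℝ) (x y : X) : ℝ :=
  limsup (fun N => ∑ n ∈ Finset.range N, v n x * v n y) atTop

omit [MeasurableSpace X] in
theorem sumKernel_comm (x y : X) : sumKernel v x y = sumKernel v y x := by
  simp only [sumKernel, mul_comm]

/-- The kernel sections are elements of the range of `S`. -/
theorem ae_exists_sumKernel (hK : 0 ≤ K)
    (hS : ∀ f : Lp ℝ 2 μ, ∀ᵐ x ∂μ, |S f x| ≤ K * ‖f‖) (he : IsBasisSeq e)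
    (hv : ∀ n, ∀ᵐ x ∂μ, v n x = S (e n) x) :
    ∀ᵐ x ∂μ, ∃ k : Lp ℝ 2 μ, (∀ᵐ y ∂μ, sumKernel v x y = S k y) ∧
      ∀ g, Tendsto (fun N => ∑ n ∈ Finset.range N, v n x * inner ℝ (e n) g) atTop
        (𝓝 (inner ℝ k g)) := by
  have hsq := ae_sum_sq_le hK hS he hv
  have hsum : ∀ᵐ x ∂μ, Summable fun n => v n x ^ 2 := by
    filter_upwards [hsq] with x hx
    exact summable_of_sum_range_le (fun _ => sq_nonneg _) hx
  filter_upwards [hsum] with x hx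
  set a : ℕ → ℝ := fun n => v n x
  have hk := (he.summable hx).hasSum.tendsto_sum_nat
  set k := ∑' n, a n • e n
  refine ⟨k, ?_, fun g => ?_⟩
  · have h1 : Tendsto (fun N => S (∑ n ∈ Finset.range N, a n • e n)) atTop (𝓝 (S k)) :=
      (S.continuous.tendsto k).comp hk
    obtain ⟨φ, hφ, hae⟩ := exists_subseq_ae_tendsto h1
    have h2 : ∀ᵐ y ∂μ, ∀ N, S (∑ n ∈ Finset.range N, a n • e n) y =
        ∑ n ∈ Finset.range N, a n * S (e n) y := by
      rw [ae_all_iff]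
      intro N
      simp only [map_sum, map_smul]
      exact coeFn_sum_smul _ _ _
    filter_upwards [hsum, hae, h2, ae_all_iff.2 hv] with y hy h3 h4 h5
    have h6 : Summable fun n => v n x * v n y := by
      refine Summable.of_norm_bounded (hx.add hy) fun n => ?_
      rw [Real.norm_eq_abs, abs_le]
      constructor <;> nlinarith [sq_nonneg (v n x + v n y), sq_nonneg (v n x - v n y),
        sq_nonneg (v n x), sq_nonneg (v n y)]
    have h7 := h6.hasSum.tendsto_sum_nat
    rw [sumKernel, h7.limsup_eq]
    refine tendsto_nhds_unique (h7.comp hφ.tendsto_atTop) (h3.congr fun N => ?_)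
    rw [h4]
    exact Finset.sum_congr rfl fun n _ => by rw [h5]
  · have h1 : Tendsto (fun N => inner ℝ (∑ n ∈ Finset.range N, a n • e n) g) atTop
        (𝓝 (inner ℝ k g)) := hk.inner tendsto_const_nhds
    refine h1.congr fun N => ?_
    rw [sum_inner]
    exact Finset.sum_congr rfl fun n _ => by rw [real_inner_smul_left]

/-- The vector `k` of `ae_exists_sumKernel` represents evaluation of `S h` at `x`. The null set
depends on `h` but not on `k`. -/
theorem ae_tendsto_expansion (he : IsBasisSeq e)
    (hv : ∀ n, ∀ᵐ x ∂μ, v n x = S (e n) x) (h : Lp ℝ 2 μ) :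
    ∀ᵐ x ∂μ, ∀ k : Lp ℝ 2 μ, (∀ g, Tendsto (fun N => ∑ n ∈ Finset.range N,
      v n x * inner ℝ (e n) g) atTop (𝓝 (inner ℝ k g))) → inner ℝ k h = S h x := by
  have h1 : Tendsto (fun N => S (∑ n ∈ Finset.range N, inner ℝ (e n) h • e n)) atTop (𝓝 (S h)) :=
    (S.continuous.tendsto h).comp (he.hasSum h).tendsto_sum_nat
  obtain ⟨φ, hφ, hae⟩ := exists_subseq_ae_tendsto h1
  have h2 : ∀ᵐ y ∂μ, ∀ N, S (∑ n ∈ Finset.range N, inner ℝ (e n) h • e n) y =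
      ∑ n ∈ Finset.range N, inner ℝ (e n) h * S (e n) y := by
    rw [ae_all_iff]
    intro N
    simp only [map_sum, map_smul]
    exact coeFn_sum_smul _ _ _
  filter_upwards [hae, h2, ae_all_iff.2 hv] with x h3 h4 h5 k hk
  refine tendsto_nhds_unique ((hk h).comp hφ.tendsto_atTop) (h3.congr fun N => ?_)
  rw [h4]
  exact Finset.sum_congr rfl fun n _ => by rw [h5, mul_comm]

theorem nonneg_of_inner_nonneg [SigmaFinite μ] {h : Lp ℝ 2 μ}
    (hh : ∀ f : Lp ℝ 2 μ, 0 ≤ f → 0 ≤ inner ℝ h f) : 0 ≤ h := by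
  rw [nonneg_iff_ae]
  refine ae_nonneg_of_forall_setIntegral_nonneg_of_sigmaFinite (fun A hA hμA => ?_)
    fun A hA hμA => ?_
  · have : IsFiniteMeasure (μ.restrict A) := ⟨by simpa using hμA⟩
    exact ((Lp.memLp h).restrict A).integrable (by norm_num)
  · have h1 := hh _ (indL2_nonneg hA hμA.ne)
    rwa [real_inner_comm, L2.inner_indicatorConstLp_one] at h1

/-- For a.e. `x`, `(S S f)(x) = ⟨k, S f⟩ = ⟨S k, f⟩`, and `S k` is the section `sumKernel v x`. Its
positivity is tested on a countable dense set of nonnegative functions, which leaves a single null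
set of `x`; hence `max 0` changes nothing almost everywhere. -/
theorem sumKernel_spec [SigmaFinite μ] [SecondCountableTopology (Lp ℝ 2 μ)] (hK : 0 ≤ K)
    (hS : ∀ f : Lp ℝ 2 μ, ∀ᵐ x ∂μ, |S f x| ≤ K * ‖f‖)
    (hsymm : ∀ f g, inner ℝ (S f) g = inner ℝ f (S g)) (hpos : IsPositive S)
    (he : IsBasisSeq e) (hv : ∀ n, ∀ᵐ x ∂μ, v n x = S (e n) x) (f : Lp ℝ 2 μ) :
    ∀ᵐ x ∂μ, Integrable (fun y => max 0 (sumKernel v x y) * f y) μ ∧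
      S (S f) x = ∫ y, max 0 (sumKernel v x y) * f y ∂μ := by
  obtain ⟨D, hD, hDd⟩ := TopologicalSpace.exists_countable_dense {f : Lp ℝ 2 μ // 0 ≤ f}
  have : Countable D := hD.to_subtype
  have hpD : ∀ᵐ x ∂μ, ∀ g : D, 0 ≤ S (S g.1.1) x := by
    rw [ae_all_iff]
    exact fun g => nonneg_iff_ae.1 (hpos _ (hpos _ g.1.2))
  have hexD : ∀ᵐ x ∂μ, ∀ g : D, ∀ k : Lp ℝ 2 μ, (∀ h, Tendsto (fun N => ∑ n ∈ Finset.range N,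
      v n x * inner ℝ (e n) h) atTop (𝓝 (inner ℝ k h))) → inner ℝ k (S g.1.1) = S (S g.1.1) x := by
    rw [ae_all_iff]
    exact fun g => ae_tendsto_expansion he hv _
  filter_upwards [ae_exists_sumKernel hK hS he hv, ae_tendsto_expansion he hv (S f),
    hpD, hexD] with x ⟨k, hk1, hk2⟩ h1 h2 h3
  have hSk : 0 ≤ S k := by
    refine nonneg_of_inner_nonneg fun g hg => ?_
    have hcl : IsClosed {g : {f : Lp ℝ 2 μ // 0 ≤ f} | 0 ≤ inner ℝ (S k) g.1} :=
      isClosed_le continuous_const (continuous_const.inner continuous_subtype_val)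
    have hsub : D ⊆ {g : {f : Lp ℝ 2 μ // 0 ≤ f} | 0 ≤ inner ℝ (S k) g.1} := by
      intro g hgD
      have h4 := h3 ⟨g, hgD⟩ k hk2
      have h5 := h2 ⟨g, hgD⟩
      rw [← h4, ← hsymm] at h5
      exact h5
    exact hcl.closure_subset_iff.2 hsub (hDd ⟨g, hg⟩)
  have he1 : (fun y => max 0 (sumKernel v x y) * f y) =ᵐ[μ] fun y => S k y * f y := by
    filter_upwards [hk1, nonneg_iff_ae.1 hSk] with y h4 h5
    rw [h4, max_eq_right h5]
  refine ⟨((Lp.memLp (S k)).integrable_mul (Lp.memLp f)).congr he1.symm, ?_⟩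
  rw [integral_congr_ae he1, ← h1 k hk2, ← hsymm, L2.inner_def]
  exact integral_congr_ae (Eventually.of_forall fun y => by simp [mul_comm])

end Kernel

/-! ### Existence of the heat kernel. -/

section HeatKernel

variable {d : ℕ} {α : ℝ} {Ω : Set (Rd d)}

theorem norm_expSg_sub_apply_le {H : Type*} [NormedAddCommGroup H] [InnerProductSpace ℝ H]
    [CompleteSpace H] {B : H →L[ℝ] H} (hB : IsPosContraction B) (f : H) {s t : ℝ} (hs : 0 < s)
    (hst : s ≤ t) : ‖expSg B t f - expSg B s f‖ ≤ ‖f‖ * ((t - s) / s) := by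
  have h := hB.norm_expSg_sub_le (hs.trans_le hst) hs
  rw [min_eq_right hst, abs_of_nonneg (sub_nonneg.2 hst)] at h
  have h2 := ContinuousLinearMap.le_of_opNorm_le _ h f
  rw [sub_apply] at h2
  rw [mul_comm]
  exact h2

/-- `sumKernel_spec` is applied to `S = e^{-(t/2)L_0}`, so that `S S = e^{-tL_0}`. The versions `V
n` give measurability in `(t, x, y)`, while `max 0` and the symmetric series give sign and symmetry
at every point. -/
theorem exists_isHeatKernel (hα : 0 < α) (hα2 : α < 2) (hαd : α < d) (hΩ : MeasurableSet Ω)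
    {B : L2 Ω →L[ℝ] L2 Ω} (hB : IsResolventOf B (dirichletForm α Ω).opGraph)
    {T : ℝ → L2 Ω →L[ℝ] L2 Ω} (hT : ∀ t, 0 ≤ t → T t = expSg B t) :
    ∃ p, IsHeatKernel Ω T p := by
  have : Fact ((2 : ENNReal) ≠ ⊤) := ⟨by norm_num⟩
  obtain ⟨e, he⟩ := exists_isBasisSeq (H := L2 Ω)
  choose V hVm hV using fun n => exists_measurable_version (F := fun t => expSg B t (e n))
    (fun s t hs hst => norm_expSg_sub_apply_le hB.pos (e n) hs hst)
  refine ⟨fun t x y => max 0 (sumKernel (fun n x => V n (t / 2, x)) x y), ?_, ?_, ?_, ?_⟩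
  · refine measurable_const.max (Measurable.limsup fun N => ?_)
    refine Finset.measurable_sum _ fun n _ => ?_
    exact ((hVm n).comp (f := fun z : ℝ × Rd d × Rd d => (z.1 / 2, z.2.1)) (by fun_prop)).mul
      ((hVm n).comp (f := fun z : ℝ × Rd d × Rd d => (z.1 / 2, z.2.2)) (by fun_prop))
  · exact fun t _ x _ y _ => le_max_left _ _
  · intro t _ x _ y _
    rw [sumKernel_comm]
  · intro t ht f
    have ht2 := half_pos ht
    obtain ⟨K, hK, hS⟩ := exists_abs_expSg_le hα hα2 hαd hΩ hB ht2
    have e1 : T t = expSg B (t / 2) * expSg B (t / 2) := by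
      rw [hT t ht.le, ← hB.pos.expSg_add ht2.le ht2.le, add_halves]
    rw [e1]
    exact sumKernel_spec hK hS (hB.pos.inner_expSg _)
      (isPositive_expSg hα hα2 hαd hΩ (isHardyBounded_zero hα hαd) hB _) he
      (fun n => hV n _ ht2) f

end HeatKernel

end

noncomputable section

/-! ### Comparison of the semigroups of two potentials. -/

section Comparison

variable {d : ℕ} {α : ℝ} {Ω : Set (Rd d)}

variable (hα : 0 < α) (hα2 : α < 2) (hαd : α < d) (hΩ : MeasurableSet Ω)
  {W W' : Rd d → ℝ} (hW : IsHardyBounded α W) (hW' : IsHardyBounded α W')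
  (hle : ∀ x, W x ≤ W' x) {B B' : L2 Ω →L[ℝ] L2 Ω}
  (hB : IsResolventOf B (perturbedForm α Ω W).opGraph)
  (hB' : IsResolventOf B' (perturbedForm α Ω W').opGraph)
  {f g : L2 Ω} (hf : 0 ≤ f) (hg : 0 ≤ g) {t : ℝ} (ht : 0 ≤ t)

include hα hα2 hαd hΩ hW hW' hle hB hB' hf hg ht

/-- Duhamel's principle for two perturbations, tested against `g`. -/
theorem ofReal_inner_expSg_sub :
    0 ≤ inner ℝ g (expSg B' t f) - inner ℝ g (expSg B t f) ∧
    ENNReal.ofReal (inner ℝ g (expSg B' t f) - inner ℝ g (expSg B t f)) =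
      ∫⁻ s in Ioo 0 t, ∫⁻ x in Ω,
        ENNReal.ofReal (expSg B (t - s) g x * expSg B' s f x * (W' x - W x)) := by
  have hpos := isPositive_expSg hα hα2 hαd hΩ hW hB
  have hpos' := isPositive_expSg hα hα2 hαd hΩ hW' hB'
  set φ : ℝ → ℝ := fun s => inner ℝ (expSg B (t - s) g) (expSg B' s f)
  set D : ℝ → ℝ := fun s => ∫ x in Ω, expSg B (t - s) g x * expSg B' s f x * (W' x - W x)
  have hcont : ContinuousOn φ (Icc 0 t) := by
    refine ContinuousOn.inner (𝕜 := ℝ) ?_ ((hB'.continuousOn_expSg f).mono Icc_subset_Ici_self)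
    exact (hB.continuousOn_expSg g).comp (f := fun s => t - s) (by fun_prop)
      fun s hs => sub_nonneg.2 hs.2
  have hnn : ∀ s, ∀ᵐ x ∂volume.restrict Ω,
      0 ≤ expSg B (t - s) g x * expSg B' s f x * (W' x - W x) := by
    intro s
    filter_upwards [nonneg_iff_ae.1 (hpos (t - s) g hg), nonneg_iff_ae.1 (hpos' s f hf)]
      with x h1 h2 using mul_nonneg (mul_nonneg h1 h2) (sub_nonneg.2 (hle x))
  have hmem : ∀ s ∈ Ioo 0 t, expSg B (t - s) g ∈ (perturbedForm α Ω W).dom ∧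
      expSg B' s f ∈ (perturbedForm α Ω W').dom := fun s hs =>
    ⟨(hB.graph_expSg (sub_pos.2 hs.2) g).1, (hB'.graph_expSg hs.1 f).1⟩
  have hint : ∀ s ∈ Ioo 0 t, Integrable
      (fun x => expSg B (t - s) g x * expSg B' s f x * (W' x - W x)) (volume.restrict Ω) := by
    intro s hs
    obtain ⟨h1, h2⟩ := hmem s hs
    simp only [mul_sub]
    exact (hW'.integrable_mul hα hα2 hαd hΩ h1.1 h2.1).sub
      (hW.integrable_mul hα hα2 hαd hΩ h1.1 h2.1)
  -- The derivative is the difference of the two forms at the same pair of vectors. They share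
  -- domain and energy part, so only the potentials remain.
  have hderiv : ∀ s ∈ Ioo 0 t, HasDerivAt φ (D s) s := by
    intro s hs
    obtain ⟨h1, h2⟩ := hmem s hs
    have d1 : HasDerivAt (fun s => expSg B (t - s) g) (genExpSg B (t - s) g) s := by
      have := (hB.pos.hasDerivAt_expSg_apply (sub_pos.2 hs.2) g).scomp s
        ((hasDerivAt_id s).const_sub t)
      simpa [Function.comp_def] using this
    have d2 := hB'.pos.hasDerivAt_expSg_apply hs.1 f
    refine (d1.inner ℝ d2).congr_deriv ?_
    have e1 := (hB.graph_expSg (sub_pos.2 hs.2) g).2 (expSg B' s f) h2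
    have e2 := (hB'.graph_expSg hs.1 f).2 (expSg B (t - s) g) h1
    rw [inner_neg_right, real_inner_comm (genExpSg B' s f), ← e1, ← e2]
    simp only [perturbedForm, D]
    rw [fracForm_comm (zeroExt Ω (expSg B' s f)), ← sub_eq_neg_add, sub_sub_sub_cancel_left,
      ← integral_sub (hW'.integrable_mul hα hα2 hαd hΩ h2.1 h1.1)
        (hW.integrable_mul hα hα2 hαd hΩ h1.1 h2.1)]
    refine integral_congr_ae (Eventually.of_forall fun x => ?_)
    ring
  have hD : ∀ s, 0 ≤ D s := fun s => integral_nonneg_of_ae (hnn s)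
  -- At the ends of the interval only continuity of `φ` is known; the sign of the derivative makes
  -- it integrable nevertheless.
  have hDint : IntegrableOn D (Ioc 0 t) :=
    intervalIntegral.integrableOn_deriv_of_nonneg hcont hderiv fun s _ => hD s
  have key := intervalIntegral.integral_eq_sub_of_hasDerivAt_of_le ht hcont hderiv
    ((intervalIntegrable_iff_integrableOn_Ioc_of_le ht).2 hDint)
  have e0 : φ t - φ 0 = inner ℝ g (expSg B' t f) - inner ℝ g (expSg B t f) := by
    simp only [φ, sub_self, sub_zero, expSg_zero]
    rw [hB.pos.inner_expSg]
    rfl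
  rw [e0, intervalIntegral.integral_of_le ht, integral_Ioc_eq_integral_Ioo] at key
  rw [← key]
  refine ⟨integral_nonneg hD, ?_⟩
  rw [ofReal_integral_eq_lintegral_ofReal
    (hDint.mono_set Ioo_subset_Ioc_self) (Eventually.of_forall hD)]
  refine setLIntegral_congr_fun measurableSet_Ioo fun s hs => ?_
  exact ofReal_integral_eq_lintegral_ofReal (hint s hs) (hnn s)

omit hg in
theorem expSg_le_expSg : expSg B t f ≤ expSg B' t f := by
  rw [← sub_nonneg]
  refine nonneg_of_inner_nonneg fun g hg => ?_
  rw [real_inner_comm, inner_sub_right]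
  exact (ofReal_inner_expSg_sub hα hα2 hαd hΩ hW hW' hle hB hB' hf hg ht).1

end Comparison

end

noncomputable section

/-! ### From the tested to the pointwise Duhamel formula. -/

section Duhamel

variable {d : ℕ} {Ω : Set (Rd d)} {T : ℝ → L2 Ω →L[ℝ] L2 Ω} {p : ℝ → Rd d → Rd d → ℝ}

theorem IsHeatKernel.ofReal_apply_indL2 (hp : IsHeatKernel Ω T p) (hΩ : MeasurableSet Ω) {t : ℝ}
    (ht : 0 < t) {A : Set (Rd d)} (hA : MeasurableSet A) (hμA : volume.restrict Ω A ≠ ⊤) :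
    ∀ᵐ y ∂volume.restrict Ω, ENNReal.ofReal (T t (indL2 hA hμA) y) =
      ∫⁻ x in A, ENNReal.ofReal (p t x y) ∂volume.restrict Ω := by
  filter_upwards [hp.repr t ht (indL2 hA hμA), ae_restrict_mem hΩ] with y hy hyΩ
  rw [hy.2, ofReal_integral_eq_lintegral_ofReal hy.1, ← lintegral_indicator hA]
  · refine lintegral_congr_ae ?_
    filter_upwards [indicatorConstLp_coeFn (p := 2) (hs := hA) (hμs := hμA) (c := (1 : ℝ)),
      ae_restrict_mem hΩ] with x hx hxΩ
    rw [hx, hp.symm t ht y hyΩ x hxΩ]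
    by_cases h : x ∈ A <;> simp [h]
  · filter_upwards [nonneg_iff_ae.1 (indL2_nonneg hA hμA), ae_restrict_mem hΩ] with x hx hxΩ
    exact mul_nonneg (hp.nonneg t ht y hyΩ x hxΩ) hx

variable {t : ℝ} {u : ℝ → L2 Ω} {v : ℝ × Rd d → ℝ} {V : Rd d → ℝ} {h : L2 Ω}

/-- The pointwise form of a tested Duhamel formula. -/
theorem IsHeatKernel.ofReal_eq_lintegral (hp : IsHeatKernel Ω T p) (hΩ : MeasurableSet Ω)
    (hv : Measurable v) (hvu : ∀ s, 0 < s → ∀ᵐ x ∂volume.restrict Ω, v (s, x) = u s x)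
    (hVm : Measurable V) (hT : ∀ s, 0 < s → IsPositive (T s))
    (hh : 0 ≤ h) (htest : ∀ g : L2 Ω, 0 ≤ g → ENNReal.ofReal (inner ℝ g h) =
      ∫⁻ s in Ioo 0 t, ∫⁻ x in Ω, ENNReal.ofReal (T (t - s) g x * u s x * V x)) :
    ∀ᵐ x ∂volume.restrict Ω, ENNReal.ofReal (h x) =
      ∫⁻ s in Ioo 0 t, ∫⁻ y in Ω,
        ENNReal.ofReal (p (t - s) x y) * ENNReal.ofReal (v (s, y) * V y) := by
  set k : ℝ × Rd d × Rd d → ENNReal := fun z =>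
    ENNReal.ofReal (p (t - z.1) z.2.1 z.2.2) * ENNReal.ofReal (v (z.1, z.2.2) * V z.2.2)
  have hk : Measurable k := by
    have h1 : Measurable fun z : ℝ × Rd d × Rd d => p (t - z.1) z.2.1 z.2.2 :=
      hp.measurable.comp (f := fun z : ℝ × Rd d × Rd d => (t - z.1, z.2.1, z.2.2)) (by fun_prop)
    have h2 : Measurable fun z : ℝ × Rd d × Rd d => v (z.1, z.2.2) :=
      hv.comp (f := fun z : ℝ × Rd d × Rd d => (z.1, z.2.2)) (by fun_prop)
    have h3 : Measurable fun z : ℝ × Rd d × Rd d => V z.2.2 :=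
      hVm.comp (f := fun z : ℝ × Rd d × Rd d => z.2.2) (by fun_prop)
    exact h1.ennreal_ofReal.mul (h2.mul h3).ennreal_ofReal
  have hJ : Measurable fun z : ℝ × Rd d => ∫⁻ y in Ω, k (z.1, z.2, y) :=
    Measurable.lintegral_prod_right' (f := fun w : (ℝ × Rd d) × Rd d => k (w.1.1, w.1.2, w.2))
      (hk.comp (by fun_prop))
  -- Both sides are compared on sets `A` of finite measure by testing with their indicators.
  -- Symmetry of `p` writes `T (t - s)` of the indicator as an integral of `p` over `A`, and
  -- Tonelli's theorem exchanges the integrals; it needs the jointly measurable version `v` of `u`.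
  refine ae_eq_of_forall_setLIntegral_eq_of_sigmaFinite₀
    (Lp.aestronglyMeasurable h).aemeasurable.ennreal_ofReal
    (Measurable.lintegral_prod_right' (f := fun w : Rd d × ℝ => ∫⁻ y in Ω, k (w.2, w.1, y))
      (hJ.comp measurable_swap)).aemeasurable fun A hA hμA => ?_
  rw [← ofReal_inner_indL2 hA hμA.ne hh, htest _ (indL2_nonneg hA hμA.ne)]
  calc ∫⁻ s in Ioo 0 t, ∫⁻ x in Ω,
        ENNReal.ofReal (T (t - s) (indL2 hA hμA.ne) x * u s x * V x)
      = ∫⁻ s in Ioo 0 t, ∫⁻ x in A, (∫⁻ y in Ω, k (s, x, y)) ∂volume.restrict Ω := by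
        refine setLIntegral_congr_fun measurableSet_Ioo fun s hs => ?_
        rw [lintegral_lintegral_swap (f := fun x y => k (s, x, y)) (hk.comp
          (f := fun w : Rd d × Rd d => (s, w.1, w.2)) (by fun_prop)).aemeasurable]
        refine lintegral_congr_ae ?_
        filter_upwards [hp.ofReal_apply_indL2 hΩ (sub_pos.2 hs.2) hA hμA.ne, hvu s hs.1,
          nonneg_iff_ae.1 (hT (t - s) (sub_pos.2 hs.2) _ (indL2_nonneg hA hμA.ne))] with y h1 h2 h3
        rw [mul_assoc, ENNReal.ofReal_mul h3, h1, ← h2, ← lintegral_mul_const]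
        exact (hp.measurable.comp (f := fun x : Rd d => (t - s, x, y))
          (by fun_prop)).ennreal_ofReal
    _ = ∫⁻ x in A, (∫⁻ s in Ioo 0 t, ∫⁻ y in Ω, k (s, x, y)) ∂volume.restrict Ω :=
        lintegral_lintegral_swap (f := fun s x => ∫⁻ y in Ω, k (s, x, y)) hJ.aemeasurable

/-- The integrand is nonnegative and `h x` is a finite number, so finiteness of the Tonelli integral
at `x` yields all the integrability claims. -/
theorem IsHeatKernel.duhamel_of_lintegral (hp : IsHeatKernel Ω T p) (hΩ : MeasurableSet Ω)
    (ht : 0 ≤ t) (hv : Measurable v)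
    (hvu : ∀ s, 0 < s → ∀ᵐ x ∂volume.restrict Ω, v (s, x) = u s x) (hu : ∀ s, 0 < s → 0 ≤ u s)
    (hVm : Measurable V) (hV : ∀ x, 0 ≤ V x) {x : Rd d} (hx : x ∈ Ω) (hhx : 0 ≤ h x)
    (hI : ENNReal.ofReal (h x) = ∫⁻ s in Ioo 0 t, ∫⁻ y in Ω,
        ENNReal.ofReal (p (t - s) x y) * ENNReal.ofReal (v (s, y) * V y)) :
    (∀ᵐ s ∂volume.restrict (Ioo 0 t),
      IntegrableOn (fun y => p (t - s) x y * u s y * V y) Ω) ∧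
    IntervalIntegrable (fun s => ∫ y in Ω, p (t - s) x y * u s y * V y) volume 0 t ∧
    h x = ∫ s in (0 : ℝ)..t, ∫ y in Ω, p (t - s) x y * u s y * V y := by
  set J : ℝ → ENNReal := fun s => ∫⁻ y in Ω,
    ENNReal.ofReal (p (t - s) x y) * ENNReal.ofReal (v (s, y) * V y) with hJdef
  have hJ : Measurable J := by
    have h1 : Measurable fun z : ℝ × Rd d => p (t - z.1) x z.2 :=
      hp.measurable.comp (f := fun z : ℝ × Rd d => (t - z.1, x, z.2)) (by fun_prop)
    exact Measurable.lintegral_prod_right' (h1.ennreal_ofReal.mul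
      (hv.mul (hVm.comp measurable_snd)).ennreal_ofReal)
  have hfin : ∫⁻ s in Ioo 0 t, J s ≠ ⊤ := hI ▸ ENNReal.ofReal_ne_top
  have hnn : ∀ s ∈ Ioo 0 t, ∀ᵐ y ∂volume.restrict Ω, 0 ≤ p (t - s) x y * u s y * V y := by
    intro s hs
    filter_upwards [nonneg_iff_ae.1 (hu s hs.1), ae_restrict_mem hΩ] with y h1 h2
    exact mul_nonneg (mul_nonneg (hp.nonneg _ (sub_pos.2 hs.2) x hx y h2) h1) (hV y)
  have hm : ∀ s, AEStronglyMeasurable (fun y => p (t - s) x y * u s y * V y)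
      (volume.restrict Ω) := fun s =>
    (((hp.measurable.comp (f := fun y : Rd d => (t - s, x, y))
      (by fun_prop)).aestronglyMeasurable).mul (Lp.aestronglyMeasurable (u s))).mul
      hVm.aestronglyMeasurable
  have hJs : ∀ s ∈ Ioo 0 t,
      ∫⁻ y in Ω, ENNReal.ofReal (p (t - s) x y * u s y * V y) = J s := by
    intro s hs
    refine lintegral_congr_ae ?_
    filter_upwards [hvu s hs.1, ae_restrict_mem hΩ] with y h1 h2
    rw [mul_assoc, ENNReal.ofReal_mul (hp.nonneg _ (sub_pos.2 hs.2) x hx y h2), h1]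
  have hint : ∀ s ∈ Ioo 0 t, ∫ y in Ω, p (t - s) x y * u s y * V y = (J s).toReal := by
    intro s hs
    rw [integral_eq_lintegral_of_nonneg_ae (hnn s hs) (hm s), hJs s hs]
  have hlt := ae_lt_top hJ hfin
  have hJi : IntegrableOn (fun s => (J s).toReal) (Ioo 0 t) :=
    integrable_toReal_of_lintegral_ne_top hJ.aemeasurable hfin
  refine ⟨?_, ?_, ?_⟩
  · filter_upwards [hlt, ae_restrict_mem measurableSet_Ioo] with s h1 hs
    refine ⟨hm s, ?_⟩
    rw [hasFiniteIntegral_iff_ofReal (hnn s hs), hJs s hs]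
    exact h1
  · rw [intervalIntegrable_iff_integrableOn_Ioo_of_le ht]
    exact hJi.congr_fun (fun s hs => (hint s hs).symm) measurableSet_Ioo
  · rw [intervalIntegral.integral_of_le ht, integral_Ioc_eq_integral_Ioo,
      setIntegral_congr_fun measurableSet_Ioo hint, integral_toReal hJ.aemeasurable hlt, ← hI,
      ENNReal.toReal_ofReal hhx]

end Duhamel

end

/-! ### The limit of the truncated problems. -/

noncomputable section

/-- Convergence in `L²` gives a.e. convergence only along a subsequence; pointwise monotonicity
extends it to the whole sequence. -/
theorem ae_monotone_and_tendsto {X : Type*} [MeasurableSpace X] {μ : Measure X}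
    {h : ℕ → Lp ℝ 2 μ} {g : Lp ℝ 2 μ} (hm : ∀ k, h k ≤ h (k + 1))
    (hl : Tendsto h atTop (𝓝 g)) :
    ∀ᵐ x ∂μ, Monotone (fun k => h k x) ∧ Tendsto (fun k => h k x) atTop (𝓝 (g x)) := by
  obtain ⟨φ, hφ, hae⟩ := exists_subseq_ae_tendsto hl
  filter_upwards [hae, ae_all_iff.2 fun k => Lp.coeFn_le (h k) (h (k + 1)) |>.2 (hm k)]
    with x h1 h2
  have hmono : Monotone fun k => h k x := monotone_nat_of_le_succ h2
  exact ⟨hmono, (tendsto_iff_tendsto_subseq_of_monotone hmono hφ.tendsto_atTop).2 h1⟩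

section Limit

variable {d : ℕ} {α : ℝ} {Ω : Set (Rd d)}

variable (hα : 0 < α) (hα2 : α < 2) (hαd : α < d) (hΩ : MeasurableSet Ω)
  {c : ℝ} (hc : 0 ≤ c) (hc' : c ≤ hardyConst d α)

include hα hα2 hαd hΩ hc hc'

theorem tendsto_truncatedForm_val {f : L2 Ω} (hf : f ∈ (hardyForm α Ω c).dom) :
    Tendsto (fun k => (truncatedForm α Ω c k).val f f) atTop
      (𝓝 ((hardyForm α Ω c).val f f)) := by
  refine tendsto_const_nhds.sub (tendsto_integral_of_dominated_convergence
    (fun x => f x ^ 2 * hardyPotential α c x)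
    (fun k => (((isHardyBounded_min hc hc' k).integrable_mul hα hα2 hαd hΩ hf.1 hf.1).1))
    ((isHardyBounded_hardyPotential hc hc').integrable_sq hα hα2 hαd hΩ hf.1) (fun k => ?_) ?_)
  · refine Eventually.of_forall fun x => ?_
    rw [Real.norm_of_nonneg (mul_nonneg (mul_self_nonneg _)
      ((isHardyBounded_min hc hc' k).nonneg x)), ← sq]
    exact mul_le_mul_of_nonneg_left (min_le_left _ _) (sq_nonneg _)
  · refine Eventually.of_forall fun x => ?_
    refine tendsto_const_nhds.mul (tendsto_const_nhds.congr' ?_)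
    filter_upwards [eventually_ge_atTop ⌈hardyPotential α c x⌉₊] with k hk
    exact (min_eq_left (Nat.ceil_le.1 hk)).symm

theorem truncatedForm_val_ge (k : ℕ) {f : L2 Ω} (hf : f ∈ (hardyForm α Ω c).dom) :
    (hardyForm α Ω c).val f f ≤ (truncatedForm α Ω c k).val f f := by
  refine sub_le_sub_left (integral_mono
    ((isHardyBounded_min hc hc' k).integrable_mul hα hα2 hαd hΩ hf.1 hf.1)
    ((isHardyBounded_hardyPotential hc hc').integrable_mul hα hα2 hαd hΩ hf.1 hf.1) fun x => ?_) _
  exact mul_le_mul_of_nonneg_left (min_le_left _ _) (mul_self_nonneg _)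

/-- The operators of the truncated forms converge to the operator of the Hardy form in the strong
resolvent sense. -/
theorem tendsto_resolvent_truncatedForm (hΩo : IsOpen Ω) (f : L2 Ω) :
    Tendsto (fun k => FormSpace.resolvent (perturbedForm_isNonneg hα hα2 hαd hΩ
      (isHardyBounded_min hc hc' k)) f) atTop
      (𝓝 (FormSpace.resolvent (perturbedForm_isNonneg hα hα2 hαd hΩ
        (isHardyBounded_hardyPotential hc hc')) f)) :=
  FormSpace.tendsto_resolvent _ _
    (fun k => perturbedForm_isClosed hα hα2 hαd hΩ (isHardyBounded_min hc hc' k)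
      fun _ => min_le_right _ (k : ℝ))
    (fun _ => dense_perturbedForm_dom hα hα2 hαd hΩ hΩo _) (fun _ => rfl)
    (fun k _ hv => truncatedForm_val_ge hα hα2 hαd hΩ hc hc' k hv)
    (fun _ hv => tendsto_truncatedForm_val hα hα2 hαd hΩ hc hc' hv) f

variable {B₀ B : L2 Ω →L[ℝ] L2 Ω} {Bn : ℕ → L2 Ω →L[ℝ] L2 Ω}
  (hBn : ∀ k, IsResolventOf (Bn k) (truncatedForm α Ω c k).opGraph) (hB : IsPosContraction B)
  (hlim : ∀ f, Tendsto (fun k => Bn k f) atTop (𝓝 (B f))) {u₀ : L2 Ω} (hu₀ : 0 ≤ u₀)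

include hBn hu₀ in
theorem expSg_truncated_nonneg (k : ℕ) (t : ℝ) : 0 ≤ expSg (Bn k) t u₀ :=
  isPositive_expSg hα hα2 hαd hΩ (isHardyBounded_min hc hc' k) (hBn k) t u₀ hu₀

include hBn hB hlim hu₀ in
theorem ae_monotone_tendsto_expSg {t : ℝ} (ht : 0 ≤ t) : ∀ᵐ x ∂volume.restrict Ω,
    0 ≤ expSg B t u₀ x ∧ Monotone (fun k => expSg (Bn k) t u₀ x) ∧
      Tendsto (fun k => expSg (Bn k) t u₀ x) atTop (𝓝 (expSg B t u₀ x)) := by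
  have hmono : ∀ k, expSg (Bn k) t u₀ ≤ expSg (Bn (k + 1)) t u₀ := fun k =>
    expSg_le_expSg hα hα2 hαd hΩ (isHardyBounded_min hc hc' k) (isHardyBounded_min hc hc' (k + 1))
      (fun x => min_le_min_left _ (by push_cast; linarith)) (hBn k) (hBn (k + 1)) hu₀ ht
  filter_upwards [ae_monotone_and_tendsto hmono
    (tendsto_expSg_apply (fun k => (hBn k).pos) hB hlim t u₀),
    ae_all_iff.2 fun k => nonneg_iff_ae.1
      (expSg_truncated_nonneg hα hα2 hαd hΩ hc hc' hBn hu₀ k t)] with x h1 h2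
  exact ⟨ge_of_tendsto' h1.2 h2, h1⟩

include hBn hB hlim hu₀ in
/-- Duhamel's principle for the Hardy potential, tested against `g`. -/
theorem ofReal_inner_expSg_sub_dirichlet (hB₀ : IsResolventOf B₀ (dirichletForm α Ω).opGraph)
    {t : ℝ} (ht : 0 ≤ t) {g : L2 Ω} (hg : 0 ≤ g) :
    0 ≤ inner ℝ g (expSg B t u₀ - expSg B₀ t u₀) ∧
    ENNReal.ofReal (inner ℝ g (expSg B t u₀ - expSg B₀ t u₀)) =
      ∫⁻ s in Ioo 0 t, ∫⁻ x in Ω, ENNReal.ofReal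
        (expSg B₀ (t - s) g x * expSg B s u₀ x * hardyPotential α c x) := by
  have hpos₀ := isPositive_expSg hα hα2 hαd hΩ (isHardyBounded_zero hα hαd) hB₀
  have hk := fun k => ofReal_inner_expSg_sub hα hα2 hαd hΩ (isHardyBounded_zero hα hαd)
    (isHardyBounded_min hc hc' k) (isHardyBounded_min hc hc' k).nonneg hB₀ (hBn k) hu₀ hg ht
  simp only [← inner_sub_right, sub_zero] at hk
  have hl : Tendsto (fun k => inner ℝ g (expSg (Bn k) t u₀ - expSg B₀ t u₀)) atTop
      (𝓝 (inner ℝ g (expSg B t u₀ - expSg B₀ t u₀))) :=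
    tendsto_const_nhds.inner
      ((tendsto_expSg_apply (fun k => (hBn k).pos) hB hlim t u₀).sub_const _)
  refine ⟨ge_of_tendsto' hl fun k => (hk k).1, ?_⟩
  refine tendsto_nhds_unique (ENNReal.tendsto_ofReal hl) ?_
  simp only [fun k => (hk k).2]
  -- Jointly measurable versions are needed only to see that the inner integral is measurable in
  -- `s`.
  obtain ⟨w, hwm, hw⟩ := exists_measurable_version (F := fun t => expSg B₀ t g)
    (fun s t hs hst => norm_expSg_sub_apply_le hB₀.pos g hs hst)
  choose v hvm hv using fun k => exists_measurable_version (F := fun t => expSg (Bn k) t u₀)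
    (fun s t hs hst => norm_expSg_sub_apply_le (hBn k).pos u₀ hs hst)
  have hae : ∀ s ∈ Ioo 0 t, ∀ᵐ x ∂volume.restrict Ω,
      0 ≤ expSg B₀ (t - s) g x ∧ (∀ k, 0 ≤ expSg (Bn k) s u₀ x) ∧
        Monotone (fun k => expSg (Bn k) s u₀ x) ∧
        Tendsto (fun k => expSg (Bn k) s u₀ x) atTop (𝓝 (expSg B s u₀ x)) := by
    intro s hs
    filter_upwards [nonneg_iff_ae.1 (hpos₀ (t - s) g hg), ae_all_iff.2 fun k => nonneg_iff_ae.1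
      (expSg_truncated_nonneg hα hα2 hαd hΩ hc hc' hBn hu₀ k s),
      ae_monotone_tendsto_expSg hα hα2 hαd hΩ hc hc' hBn hB hlim hu₀ hs.1.le] with x h1 h2 h3
    exact ⟨h1, h2, h3.2⟩
  have hmin : ∀ x : Rd d, Monotone fun k : ℕ => min (hardyPotential α c x) (k : ℝ) :=
    fun x i j hij => min_le_min_left _ (Nat.cast_le.2 hij)
  have hinner_mono : ∀ s ∈ Ioo 0 t, ∀ᵐ x ∂volume.restrict Ω, Monotone fun k : ℕ =>
      ENNReal.ofReal (expSg B₀ (t - s) g x * expSg (Bn k) s u₀ x *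
        min (hardyPotential α c x) k) := by
    intro s hs
    filter_upwards [hae s hs] with x ⟨h1, h2, h3, _⟩ i j hij
    refine ENNReal.ofReal_le_ofReal (mul_le_mul (mul_le_mul_of_nonneg_left (h3 hij) h1)
      (hmin x hij) (le_min (hardyPotential_nonneg hc x) i.cast_nonneg) (mul_nonneg h1 (h2 j)))
  -- Monotone convergence in `s`, and inside it in `x`: both the truncated solutions and the
  -- truncated potentials increase with `k`.
  refine lintegral_tendsto_of_tendsto_of_monotone (fun k => ?_) ?_ ?_
  · have hm : Measurable fun s : ℝ => ∫⁻ x in Ω, ENNReal.ofReal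
        (w (t - s, x) * v k (s, x) * min (hardyPotential α c x) k) := by
      refine Measurable.lintegral_prod_right' (f := fun z : ℝ × Rd d => ENNReal.ofReal
        (w (t - z.1, z.2) * v k z * min (hardyPotential α c z.2) k)) ?_
      exact (((hwm.comp (f := fun z : ℝ × Rd d => (t - z.1, z.2)) (by fun_prop)).mul
        (hvm k)).mul ((isHardyBounded_min hc hc' k).measurable.comp
          measurable_snd)).ennreal_ofReal
    refine hm.aemeasurable.congr ?_
    filter_upwards [ae_restrict_mem measurableSet_Ioo] with s hs
    refine lintegral_congr_ae ?_
    filter_upwards [hw _ (sub_pos.2 hs.2), hv k _ hs.1] with x h1 h2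
    rw [h1, h2]
  · filter_upwards [ae_restrict_mem measurableSet_Ioo] with s hs i j hij
    refine lintegral_mono_ae ?_
    filter_upwards [hinner_mono s hs] with x hx using hx hij
  · filter_upwards [ae_restrict_mem measurableSet_Ioo] with s hs
    refine lintegral_tendsto_of_tendsto_of_monotone (fun k => ?_) (hinner_mono s hs) ?_
    · exact (((Lp.aestronglyMeasurable _).aemeasurable.mul
        (Lp.aestronglyMeasurable _).aemeasurable).mul
        (isHardyBounded_min hc hc' k).measurable.aemeasurable).ennreal_ofReal
    · filter_upwards [hae s hs] with x ⟨_, _, _, h4⟩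
      refine ENNReal.tendsto_ofReal ((tendsto_const_nhds.mul h4).mul
        (tendsto_const_nhds.congr' ?_))
      filter_upwards [eventually_ge_atTop ⌈hardyPotential α c x⌉₊] with k hk
      exact (min_eq_left (Nat.ceil_le.1 hk)).symm

end Limit

end

/-! ### The main theorem. -/

theorem mainTheorem6 {d : ℕ} {α : ℝ} (hα : 0 < α) (hα2 : α < 2) (hαd : α < d)
    {Ω : Set (Rd d)} (hΩ : IsOpen Ω) (h0 : (0 : Rd d) ∈ Ω)
    {c : ℝ} (hc : 0 < c) (hc' : c ≤ hardyConst d α) :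
    -- the forms, semigroups and the heat kernel in the claim are well defined
    (hardyForm α Ω c).IsClosable ∧
    IsSemigroupOf (closedHardyForm α Ω c).semigroup (closedHardyForm α Ω c).opGraph ∧
    (∀ k : ℕ, IsSemigroupOf (truncatedForm α Ω c k).semigroup (truncatedForm α Ω c k).opGraph) ∧
    IsSemigroupOf (dirichletForm α Ω).semigroup (dirichletForm α Ω).opGraph ∧
    (∃ p, IsHeatKernel Ω (dirichletForm α Ω).semigroup p) ∧
    -- the claim, for every nonnegative initial value
    ∀ u₀ : L2 Ω, (∀ᵐ x ∂volume.restrict Ω, 0 ≤ u₀ x) →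
      IsMinimalSolution α Ω c u₀ (fun t => (closedHardyForm α Ω c).semigroup t u₀) ∧
      (∀ t : ℝ, 0 < t → (closedHardyForm α Ω c).semigroup t u₀ ∈ (closedHardyForm α Ω c).opDom) ∧
      ContinuousOn (fun t => (closedHardyForm α Ω c).semigroup t u₀) (Ici 0) ∧
      ContDiffOn ℝ 1 (fun t => (closedHardyForm α Ω c).semigroup t u₀) (Ioi 0) ∧
      (∀ p, IsHeatKernel Ω (dirichletForm α Ω).semigroup p →
        DuhamelFormula α Ω (hardyPotential α c) p u₀
          (fun t => (closedHardyForm α Ω c).semigroup t u₀)) := by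
  
  have hΩm := hΩ.measurableSet
  have hV := isHardyBounded_hardyPotential hc.le hc'
  have hmin := isHardyBounded_min (d := d) hc.le hc'
  have hzero := isHardyBounded_zero hα hαd
  have hcl := hardyForm_isClosable hα hα2 hαd hΩm hc.le hc'
  have hdense := dense_perturbedForm_dom hα hα2 hαd hΩm hΩ
  -- Only the unbounded potential goes through the closure; the truncated and Dirichlet forms have
  -- bounded potentials and are closed already.
  have hB : IsResolventOf _ (closedHardyForm α Ω c).opGraph :=
    FormSpace.isResolventOf (perturbedForm_isNonneg hα hα2 hαd hΩm hV) hcl (hdense _)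
  have hBn : ∀ k, IsResolventOf _ (truncatedForm α Ω c k).opGraph := fun k =>
    (perturbedForm_isNonneg hα hα2 hαd hΩm (hmin k)).isResolventOf_of_isClosed
      (perturbedForm_isClosed hα hα2 hαd hΩm (hmin k) fun _ => min_le_right _ (k : ℝ)) (hdense _)
  have hB₀ : IsResolventOf _ (dirichletForm α Ω).opGraph :=
    (perturbedForm_isNonneg hα hα2 hαd hΩm hzero).isResolventOf_of_isClosed
      (perturbedForm_isClosed hα hα2 hαd hΩm hzero fun _ => le_refl (0 : ℝ)) (hdense _)
  have hlim := tendsto_resolvent_truncatedForm hα hα2 hαd hΩm hc.le hc' hΩ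
  refine ⟨hcl, HForm.isSemigroupOf_semigroup hB, fun k => HForm.isSemigroupOf_semigroup (hBn k),
    HForm.isSemigroupOf_semigroup hB₀, exists_isHeatKernel hα hα2 hαd hΩm hB₀
      fun t ht => HForm.semigroup_eq_expSg hB₀ ht, fun u₀ hu₀ => ?_⟩
  have hu : ∀ t, 0 ≤ t → (closedHardyForm α Ω c).semigroup t u₀ = expSg _ t u₀ := fun t ht => by
    rw [HForm.semigroup_eq_expSg hB ht]
  replace hu₀ : 0 ≤ u₀ := nonneg_iff_ae.2 hu₀
  have hmain := fun t (ht : 0 ≤ t) =>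
    ae_monotone_tendsto_expSg hα hα2 hαd hΩm hc.le hc' hBn hB.pos hlim hu₀ ht
  refine ⟨fun t ht => ?_, fun t ht => ?_, ?_, ?_, fun p hp t ht => ?_⟩
  · simp only [truncatedSolution, hu t ht, fun k => HForm.semigroup_eq_expSg (hBn k) ht]
    exact hmain t ht
  · rw [hu t ht.le]
    exact ⟨_, hB.graph_expSg ht u₀⟩
  · exact (hB.continuousOn_expSg u₀).congr hu
  · exact (hB.pos.contDiffOn_expSg_apply u₀).congr fun t ht => hu t (le_of_lt ht)
  · obtain ⟨v, hvm, hv⟩ := exists_measurable_version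
      (fun s t hs hst => norm_expSg_sub_apply_le hB.pos u₀ hs hst)
    have hnn : ∀ s, 0 < s → 0 ≤ (closedHardyForm α Ω c).semigroup s u₀ := fun s hs => by
      rw [hu s hs.le, nonneg_iff_ae]
      filter_upwards [hmain s hs.le] with x hx using hx.1
    have hvu : ∀ s, 0 < s → ∀ᵐ x ∂volume.restrict Ω,
        v (s, x) = (closedHardyForm α Ω c).semigroup s u₀ x := fun s hs => by
      rw [hu s hs.le]
      exact hv s hs
    have htest := fun (g : L2 Ω) (hg : 0 ≤ g) =>
      ofReal_inner_expSg_sub_dirichlet hα hα2 hαd hΩm hc.le hc' hBn hB.pos hlim hu₀ hB₀ ht.le hg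
    have hT : ∀ s, 0 < s → (dirichletForm α Ω).semigroup s = expSg _ s := fun s hs =>
      HForm.semigroup_eq_expSg hB₀ hs.le
    simp only [← hu t ht.le, ← hT t ht] at htest
    -- This difference is the function `h` that the pointwise formula identifies with the Duhamel
    -- integral; its sign follows from testing with all `g ≥ 0`.
    have hh : 0 ≤ (closedHardyForm α Ω c).semigroup t u₀ - (dirichletForm α Ω).semigroup t u₀ :=
      nonneg_of_inner_nonneg fun g hg => by
        rw [real_inner_comm]
        exact (htest g hg).1
    filter_upwards [hp.ofReal_eq_lintegral hΩm hvm hvu hV.measurable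
      (fun s hs => hT s hs ▸ isPositive_expSg hα hα2 hαd hΩm hzero hB₀ s) hh
      (fun g hg => (htest g hg).2.trans (setLIntegral_congr_fun measurableSet_Ioo fun s hs => by
        simp only [hT _ (sub_pos.2 hs.2), hu s hs.1.le])),
      nonneg_iff_ae.1 hh, ae_restrict_mem hΩm, Lp.coeFn_sub
        ((closedHardyForm α Ω c).semigroup t u₀) ((dirichletForm α Ω).semigroup t u₀)]
      with x hI hhx hx hsub
    obtain ⟨h1, h2, h3⟩ := hp.duhamel_of_lintegral hΩm ht.le hvm hvu hnn hV.measurable hV.nonneg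
      hx hhx hI
    rw [hsub, Pi.sub_apply, sub_eq_iff_eq_add'] at h3
    exact ⟨h1, h2, h3⟩
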